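/- **Setting.** Let $d\ge 0$ and $m\ge 3$ be integers, $\delta\in(0,1]$, $K\ge1$, $\tau_0>0$, $c_0>0$, and $h_0,T\in(0,\infty)$; put $H_T=[0,T]\times\mathbb R^d$. Let $\mathfrak B^m$ be the set of bounded Borel functions $\psi$ on $H_T$, continuous in $x$ for each $t$, whose generalized derivatives $D^\alpha\psi$ in $x$, $|\alpha|\le m$, are bounded on $H_T$, and let $\|\psi\|_m=\sup_{H_T}\big(\sum_{|\alpha|\le m}|D^\alpha\psi|^2\big)^{1/2}$ (essential supremum in $x$); the same notation is used for functions of $x$ only. Let $\Lambda_1\subset\mathbb R^d\setminus\{0\}$ be finite, let $\tau_\lambda\ge0$ for $\lambda\in\Lambda_1$, and put $|\Lambda_1|^2=\sum_{\lambda\in\Lambda_1}|\lambda|^2$, $\|\Lambda_1\|^2=\sum_{\lambda\in\Lambda_1}|\tau_\lambda\lambda|^2$. Let $q_\lambda\ge0$, $p_\lambda$ ($\lambda\in\Lambda_1$), $c$, $f$ be functions on $H_T$ and $g$ a function on $\mathbb R^d$. With $\delta_{h,\lambda}\varphi(x)=h^{-1}(\varphi(x+h\lambda)-\varphi(x))$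 set $$L_h\varphi=\tfrac1h\sum_{\lambda\in\Lambda_1}q_\lambda\delta_{h,\lambda}\varphi+\sum_{\lambda\in\Lambda_1}p_\lambda\delta_{h,\lambda}\varphi-c\varphi,\qquad \chi_{h,\lambda}=q_\lambda+hp_\lambda,$$ $$\mathcal L\varphi=\tfrac12\sum_{\lambda\in\Lambda_1}\sum_{i,j}q_\lambda\lambda_i\lambda_jD_iD_j\varphi+\sum_{\lambda\in\Lambda_1}\sum_ip_\lambda\lambda_iD_i\varphi-c\varphi .$$ Let $\Lambda$ be the disjoint union of $\Lambda_1$ and a set $\{\ell^1,\dots,\ell^d\}$ of $d$ labels, and for $h>0$ put $T_{h,\lambda}\varphi(x)=\varphi(x+h\lambda)$, $\bar\delta_{h,\lambda}=\tau_\lambda h^{-1}(T_{h,\lambda}-1)$ for $\lambda\in\Lambda_1$, and $T_{h,\ell^i}=1$, $\bar\delta_{h,\ell^i}=\tau_0D_i$; for $\lambda=(\lambda^1,\lambda^2)\in\Lambda^2$ put $T_{h,\lambda}=T_{h,\lambda^1}T_{h,\lambda^2}$, $\bar\delta_{h,\lambda}=\bar\delta_{h,\lambda^1}\bar\delta_{h,\lambda^2}$.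 For $\mu\in\Lambda\cup\Lambda^2$ let $$Q_{h,\mu}\varphi=\tfrac1h\sum_{\lambda\in\Lambda_1}(\bar\delta_{h,\mu}q_\lambda)\delta_{h,\lambda}\varphi,\qquad L^0_{h,\mu}\varphi=Q_{h,\mu}\varphi+\sum_{\lambda\in\Lambda_1}(\bar\delta_{h,\mu}p_\lambda)\delta_{h,\lambda}\varphi,$$ $$A_h(\varphi)=2\sum_{\lambda\in\Lambda}(\bar\delta_{h,\lambda}\varphi)L^0_{h,\lambda}T_{h,\lambda}\varphi,\qquad \mathcal Q_h(\varphi)=\sum_{\lambda\in\Lambda_1}\chi_{h,\lambda}(\delta_{h,\lambda}\varphi)^2 .$$ Let $\mathfrak K$ be the set of families, indexed by $t\in[0,T]$, of linear operators $\mathcal K=\mathcal K(t)$ on the bounded Borel functions on $\mathbb R^d$ that preserve nonnegativity and satisfy $\mathcal K1\le1$. **Assumptions.** 1. $p_\lambda,q_\lambda,c,f,g\in\mathfrak B^m$, and for $k=0,\dots,m$, with constants $M_k$, $\sup_{H_T}\big(\sum_{\lambda\in\Lambda_1}(|D^kq_\lambda|^2+|D^kp_\lambda|^2)+|D^kc|^2\big)\le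 M_k^2$, where $|D^k\psi|^2=\sum_{|\alpha|=k}|D^\alpha\psi|^2$. 2. $\chi_{h,\lambda}\ge0$ on $H_T$ for all $h\in(0,h_0]$, $\lambda\in\Lambda_1$. 3. $\sum_{\lambda\in\Lambda_1}\lambda q_\lambda=0$ on $H_T$. 4. $c\ge c_0$ on $H_T$. 5. For every $h\in(0,h_0]$ there is $\mathcal K_h\in\mathfrak K$ such that on $H_T$, for all smooth $\varphi$ on $\mathbb R^d$ bounded with all their derivatives, $$mA_h(\varphi)\le(1-\delta)\sum_{\lambda\in\Lambda}\mathcal Q_h(\bar\delta_{h,\lambda}\varphi)+K\mathcal Q_h(\varphi)+2(1-\delta)c\,\mathcal K_h\Big(\sum_{\lambda\in\Lambda}|\bar\delta_{h,\lambda}\varphi|^2\Big).$$ 6. For every $h\in(0,h_0]$ and $n=1,\dots,m$ there is $\mathcal K_h=\mathcal K_{h,n}\in\mathfrak K$ such that on $H_T$, for all such $\varphi$, $$n\sum_{\nu\in\Lambda}A_h(\bar\delta_{h,\nu}\varphi)+n(n-1)\sum_{\lambda\in\Lambda^2}(\bar\delta_{h,\lambda}\varphi)Q_{h,\lambda}T_{h,\lambda}\varphi\le(1-\delta)\sum_{\lambda\in\Lambda^2}\mathcal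 Q_h(\bar\delta_{h,\lambda}\varphi)+K\sum_{\lambda\in\Lambda}\mathcal Q_h(\bar\delta_{h,\lambda}\varphi)$$ $$\qquad+2(1-\delta)c\,\mathcal K_h\Big(\sum_{\lambda\in\Lambda^2}|\bar\delta_{h,\lambda}\varphi|^2\Big)+K\mathcal K_h\Big(\sum_{\lambda\in\Lambda}|\bar\delta_{h,\lambda}\varphi|^2\Big).$$ **Solutions.** For each $h\in(0,h_0]$ there is a unique bounded Borel solution $u_h$ on $H_T$ of $u(t,x)=g(x)+\int_0^t(L_hu+f)(s,x)\,ds$. There is a unique bounded continuous $u^{(0)}\in\mathfrak B^2$ satisfying $u(t,\cdot)=g+\int_0^t(\mathcal Lu+f)(s,\cdot)\,ds$ for all $t\in[0,T]$ in the sense of generalized functions on $\mathbb R^d$ (i.e. after integration against any $\phi\in C_0^\infty(\mathbb R^d)$). For $k\ge0$ let $\bar u_h=\sum_{j=0}^kb_ju_{2^{-j}h}$ with $(b_0,\dots,b_k)=(1,0,\dots,0)V^{-1}$, $V^{ij}=2^{-(i-1)(j-1)}$, $i,j=1,\dots,k+1$. For odd $k$ let $\tilde k=\frac{k-1}2$ and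 $\tilde u_h=\sum_{j=0}^{\tilde k}\tilde b_ju_{2^{-j}h}$ with $(\tilde b_0,\dots,\tilde b_{\tilde k})=(1,0,\dots,0)\tilde V^{-1}$, $\tilde V^{ij}=4^{-(i-1)(j-1)}$, $i,j=1,\dots,\tilde k+1$. Condition (S) means: $\Lambda_1=-\Lambda_1$ and $q_\lambda=q_{-\lambda}$ for all $\lambda\in\Lambda_1$. **Corollary 10.25.11.08.** There is a constant $N$ depending only on $d,m,\delta,K,\tau_0,c_0,|\Lambda_1|,\|\Lambda_1\|,M_0,\dots,M_m$ (in particular not on $T$, $h_0$ or $h$) with the following property. Let Assumptions 1–6 hold, and let $k,l\ge0$ be integers such that one of the following is met: (i) $m\ge3k+3+l$; (ii) $m\ge2k+3+l$ and (S) holds; (iii) $k$ is odd, $m\ge2k+2+l$, (S) holds and $p_{-\lambda}=-p_\lambda$ for all $\lambda\in\Lambda_1$. Then $u_h(t,\cdot)$ and $u^{(0)}(t,\cdot)$ are $l$ times continuously differentiable for all $t\in[0,T]$, $h\in(0,h_0]$, and for every multi-index $\alpha$ with $|\alpha|\le l$ and every $h\in(0,h_0]$ $$\sup_{H_T}|D^\alpha\bar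 u_h-D^\alpha u^{(0)}|\le Nh^{k+1}(\|f\|_m+\|g\|_m);$$ if (iii) is met, then also $$\sup_{H_T}|D^\alpha\tilde u_h-D^\alpha u^{(0)}|\le Nh^{k+1}(\|f\|_m+\|g\|_m).$$ -/

import Mathlib

open MeasureTheory Set
open scoped ContDiff

namespace Richardson

/-- The Euclidean space `ℝ^d`. -/
abbrev Eu (d : ℕ) : Type := EuclideanSpace ℝ (Fin d)

/-! ### Derivatives, test functions and the spaces `𝔅^m` -/

/-- The partial derivative `D_i φ`. -/
noncomputable def pd {d : ℕ} (i : Fin d) (φ : Eu d → ℝ) : Eu d → ℝ :=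
  fun x => lineDeriv ℝ φ x (EuclideanSpace.single i (1 : ℝ))

/-- The (classical) derivative `D^α φ = D_1^{α_1} ⋯ D_d^{α_d} φ` for a multi-index `α`. -/
noncomputable def mderiv {d : ℕ} (α : Fin d → ℕ) (φ : Eu d → ℝ) : Eu d → ℝ :=
  (List.finRange d).foldr (fun i ψ => (pd i)^[α i] ψ) φ

/-- The length `|α| = ∑ α_i` of a multi-index. -/
def order {d : ℕ} (α : Fin d → ℕ) : ℕ := ∑ i, α i

/-- The finite set of multi-indices of length exactly `k`. -/
def multiIndices (d k : ℕ) : Finset (Fin d → ℕ) :=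
  Finset.piAntidiag (Finset.univ : Finset (Fin d)) k

/-- `w` is the generalized derivative `D^α v` on `ℝ^d`. -/
def IsWeakDeriv {d : ℕ} (α : Fin d → ℕ) (v w : Eu d → ℝ) : Prop :=
  LocallyIntegrable v ∧ LocallyIntegrable w ∧
    ∀ η : Eu d → ℝ, ContDiff ℝ ∞ η → HasCompactSupport η →
      ∫ x, v x * mderiv α η x = (-1) ^ order α * ∫ x, w x * η x

open Classical in
/-- A representative of the generalized derivative `D^α v` (unique up to a null set);
zero if there is none. -/
noncomputable def weakDeriv {d : ℕ} (α : Fin d → ℕ) (v : Eu d → ℝ) : Eu d → ℝ :=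
  if h : ∃ w, IsWeakDeriv α v w then h.choose else 0

/-- `|D^k v|^2 = ∑_{|α| = k} |D^α v|^2` with generalized derivatives. -/
noncomputable def weakSq {d : ℕ} (k : ℕ) (v : Eu d → ℝ) (x : Eu d) : ℝ :=
  ∑ α ∈ multiIndices d k, weakDeriv α v x ^ 2

/-- The space `𝔅^m_T`: bounded Borel functions `ψ(t,x)` on `H_T = [0,T] × ℝ^d`, continuous in `x`
for each `t`, whose generalized `x`-derivatives of order at most `m` are bounded on `H_T`. -/
structure InB {d : ℕ} (T : ℝ) (m : ℕ) (ψ : ℝ → Eu d → ℝ) : Prop where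
  measurable : Measurable fun z : Icc (0 : ℝ) T × Eu d => ψ z.1 z.2
  bounded : ∃ C : ℝ, ∀ t ∈ Icc 0 T, ∀ x, |ψ t x| ≤ C
  continuous : ∀ t ∈ Icc 0 T, Continuous (ψ t)
  derivs : ∃ C : ℝ, ∀ t ∈ Icc 0 T, ∀ α : Fin d → ℕ, order α ≤ m →
    (∃ w, IsWeakDeriv α (ψ t) w) ∧ ∀ᵐ x, |weakDeriv α (ψ t) x| ≤ C

/-- The norm `‖ψ‖_m = (sup_{H_T} ∑_{|α| ≤ m} |D^α ψ|^2)^{1/2}` on `𝔅^m_T`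
(the supremum in `x` being essential, since `D^α ψ` is a generalized derivative). -/
noncomputable def normB {d : ℕ} (T : ℝ) (m : ℕ) (ψ : ℝ → Eu d → ℝ) : ℝ :=
  sInf {C : ℝ | 0 ≤ C ∧ ∀ t ∈ Icc 0 T, ∀ᵐ x,
    ∑ k ∈ Finset.range (m + 1), weakSq k (ψ t) x ≤ C ^ 2}

/-! ### The operators -/

/-- The data of the operators `L_h` and `𝓛`: the finite set `Λ₁ ⊆ ℝ^d` and the coefficients
`q_λ(t,x)`, `p_λ(t,x)` (only the values for `λ ∈ Λ₁` matter) and `c(t,x)`. -/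
structure Coeffs (d : ℕ) where
  Λ₁ : Finset (Eu d)
  q : Eu d → ℝ → Eu d → ℝ
  p : Eu d → ℝ → Eu d → ℝ
  c : ℝ → Eu d → ℝ

/-- `δ_{h,λ} φ(x) = (φ(x + hλ) - φ(x)) / h`. -/
noncomputable def fdiff {d : ℕ} (h : ℝ) (lam : Eu d) (φ : Eu d → ℝ) : Eu d → ℝ :=
  fun x => (1 / h) * (φ (x + h • lam) - φ x)

/-- The finite difference operator
`L_h φ = h⁻¹ ∑ q_λ δ_{h,λ} φ + ∑ p_λ δ_{h,λ} φ - c φ` at time `t`. -/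
noncomputable def Coeffs.Lh {d : ℕ} (co : Coeffs d) (h t : ℝ) (φ : Eu d → ℝ) (x : Eu d) : ℝ :=
  (1 / h) * ∑ lam ∈ co.Λ₁, co.q lam t x * fdiff h lam φ x
    + ∑ lam ∈ co.Λ₁, co.p lam t x * fdiff h lam φ x - co.c t x * φ x

/-- `𝓛 φ = ½ ∑_λ ∑_{i,j} q_λ λ_i λ_j D_i D_j φ + ∑_λ ∑_i p_λ λ_i D_i φ - c φ` at time `t`,
with generalized derivatives. -/
noncomputable def Coeffs.calL {d : ℕ} (co : Coeffs d) (t : ℝ) (φ : Eu d → ℝ) (x : Eu d) : ℝ :=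
  (1 / 2) * ∑ lam ∈ co.Λ₁, ∑ i, ∑ j,
      co.q lam t x * lam i * lam j * weakDeriv (Pi.single i 1 + Pi.single j 1) φ x
    + ∑ lam ∈ co.Λ₁, ∑ i, co.p lam t x * lam i * weakDeriv (Pi.single i 1) φ x
    - co.c t x * φ x

/-- `u` is a bounded (Borel) solution on `H_T` of the scheme
`u(t,x) = g(x) + ∫_0^t (L_h u(s,x) + f(s,x)) ds`. -/
structure IsSchemeSol {d : ℕ} (co : Coeffs d) (T h : ℝ) (f : ℝ → Eu d → ℝ) (g : Eu d → ℝ)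
    (u : ℝ → Eu d → ℝ) : Prop where
  measurable : Measurable fun z : Icc (0 : ℝ) T × Eu d => u z.1 z.2
  bounded : ∃ C : ℝ, ∀ t ∈ Icc 0 T, ∀ x, |u t x| ≤ C
  eqn : ∀ t ∈ Icc 0 T, ∀ x, u t x = g x + ∫ s in (0 : ℝ)..t, (co.Lh h s (u s) x + f s x)

/-- `u` is a solution of `∂u/∂t = 𝓛 u + f`, `u(0,·) = g` on `H_T`: a bounded continuous function
of class `𝔅^2_T` satisfying the integrated equation in the sense of generalized functions. -/
structure IsPDESol {d : ℕ} (co : Coeffs d) (T : ℝ) (f : ℝ → Eu d → ℝ) (g : Eu d → ℝ)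
    (u : ℝ → Eu d → ℝ) : Prop where
  continuous : ContinuousOn (fun z : ℝ × Eu d => u z.1 z.2) (Icc 0 T ×ˢ univ)
  inB : InB T 2 u
  eqn : ∀ t ∈ Icc 0 T, ∀ η : Eu d → ℝ, ContDiff ℝ ∞ η → HasCompactSupport η →
    ∫ x, η x * u t x = (∫ x, η x * g x)
      + ∫ s in (0 : ℝ)..t, ∫ x, η x * (co.calL s (u s) x + f s x)

/-! ### The structural assumptions on the scheme -/

/-- Bounded Borel functions on `ℝ^d`. -/
def IsBoundedBorel {d : ℕ} (φ : Eu d → ℝ) : Prop :=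
  Measurable φ ∧ ∃ C : ℝ, ∀ x, |φ x| ≤ C

/-- The class `𝔎`: linear operators on the bounded Borel functions that preserve the cone of
nonnegative functions and satisfy `𝒦 1 ≤ 1` (hence bounded, with `|𝒦 φ| ≤ sup |φ|`). -/
structure IsSubMarkov {d : ℕ} (𝒦 : (Eu d → ℝ) → Eu d → ℝ) : Prop where
  maps : ∀ φ, IsBoundedBorel φ → IsBoundedBorel (𝒦 φ)
  map_add : ∀ φ ψ, IsBoundedBorel φ → IsBoundedBorel ψ → 𝒦 (φ + ψ) = 𝒦 φ + 𝒦 ψ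
  map_smul : ∀ (a : ℝ) (φ), IsBoundedBorel φ → 𝒦 (a • φ) = a • 𝒦 φ
  nonneg : ∀ φ, IsBoundedBorel φ → (∀ x, 0 ≤ φ x) → ∀ x, 0 ≤ 𝒦 φ x
  one_le : ∀ x, 𝒦 (fun _ => 1) x ≤ 1

/-- Smooth functions that are bounded together with all their derivatives. -/
def IsSmoothBounded {d : ℕ} (φ : Eu d → ℝ) : Prop :=
  ContDiff ℝ ∞ φ ∧ ∀ n : ℕ, ∃ C : ℝ, ∀ x, ‖iteratedFDeriv ℝ n φ x‖ ≤ C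

/-- The index set `Λ = Λ₁ ∪ Λ₂`; the `d` labels `ℓ^1, …, ℓ^d` forming `Λ₂` are `Fin d`. -/
abbrev Coeffs.Idx {d : ℕ} (co : Coeffs d) : Type := {lam : Eu d // lam ∈ co.Λ₁} ⊕ Fin d

/-- `T_{h,λ} φ(x) = φ(x + hλ)` for `λ ∈ Λ₁`, and the identity for `λ ∈ Λ₂`. -/
noncomputable def Coeffs.shift {d : ℕ} (co : Coeffs d) (h : ℝ) :
    co.Idx → (Eu d → ℝ) → Eu d → ℝ
  | Sum.inl lam, φ => fun x => φ (x + h • lam.1)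
  | Sum.inr _, φ => φ

/-- `δ̄_{h,λ} = τ_λ h⁻¹ (T_{h,λ} - 1)` for `λ ∈ Λ₁`, and `δ̄_{h,ℓ^i} = τ₀ D_i`. -/
noncomputable def Coeffs.dbar {d : ℕ} (co : Coeffs d) (τ : Eu d → ℝ) (τ₀ h : ℝ) :
    co.Idx → (Eu d → ℝ) → Eu d → ℝ
  | Sum.inl lam, φ => fun x => τ lam.1 * (1 / h) * (φ (x + h • lam.1) - φ x)
  | Sum.inr i, φ => fun x => τ₀ * pd i φ x

/-- `Q_{h,μ} φ = h⁻¹ ∑_{λ ∈ Λ₁} (δ̄_{h,μ} q_λ) δ_{h,λ} φ`, where `dμ` is `δ̄_{h,μ}`. -/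
noncomputable def Coeffs.Qop {d : ℕ} (co : Coeffs d) (h t : ℝ)
    (dμ : (Eu d → ℝ) → Eu d → ℝ) (φ : Eu d → ℝ) (x : Eu d) : ℝ :=
  (1 / h) * ∑ lam ∈ co.Λ₁, dμ (co.q lam t) x * fdiff h lam φ x

/-- `L⁰_{h,μ} φ = Q_{h,μ} φ + ∑_{λ ∈ Λ₁} (δ̄_{h,μ} p_λ) δ_{h,λ} φ`, where `dμ` is `δ̄_{h,μ}`. -/
noncomputable def Coeffs.L0op {d : ℕ} (co : Coeffs d) (h t : ℝ)
    (dμ : (Eu d → ℝ) → Eu d → ℝ) (φ : Eu d → ℝ) (x : Eu d) : ℝ :=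
  co.Qop h t dμ φ x + ∑ lam ∈ co.Λ₁, dμ (co.p lam t) x * fdiff h lam φ x

/-- `A_h(φ) = 2 ∑_{λ ∈ Λ} (δ̄_{h,λ} φ) L⁰_{h,λ} T_{h,λ} φ`. -/
noncomputable def Coeffs.Aop {d : ℕ} (co : Coeffs d) (τ : Eu d → ℝ) (τ₀ h t : ℝ)
    (φ : Eu d → ℝ) (x : Eu d) : ℝ :=
  2 * ∑ μ : co.Idx, co.dbar τ τ₀ h μ φ x *
    co.L0op h t (co.dbar τ τ₀ h μ) (co.shift h μ φ) x

/-- `𝒬_h(φ) = ∑_{λ ∈ Λ₁} χ_{h,λ} (δ_{h,λ} φ)^2` with `χ_{h,λ} = q_λ + h p_λ`. -/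
noncomputable def Coeffs.quad {d : ℕ} (co : Coeffs d) (h t : ℝ)
    (φ : Eu d → ℝ) (x : Eu d) : ℝ :=
  ∑ lam ∈ co.Λ₁, (co.q lam t x + h * co.p lam t x) * fdiff h lam φ x ^ 2

/-- The functions `p_λ, q_λ, c` belong to `𝔅^m_T` and
`∑_λ (|D^k q_λ|^2 + |D^k p_λ|^2) + |D^k c|^2 ≤ M_k^2` on `H_T` for `k = 0, …, m`. -/
def Coeffs.Smooth {d : ℕ} (co : Coeffs d) (T : ℝ) (m : ℕ) (M : Fin (m + 1) → ℝ) : Prop :=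
  (∀ lam ∈ co.Λ₁, InB T m (co.q lam) ∧ InB T m (co.p lam)) ∧ InB T m co.c ∧
  ∀ k : Fin (m + 1), ∀ t ∈ Icc 0 T, ∀ᵐ x,
    ∑ lam ∈ co.Λ₁, (weakSq k (co.q lam t) x + weakSq k (co.p lam t) x)
      + weakSq k (co.c t) x ≤ M k ^ 2

/-- First structural inequality: for any `h ∈ (0,h₀]` there is `𝒦_h = 𝒦_h(t) ∈ 𝔎` with
`m A_h(φ) ≤ (1-δ) ∑_Λ 𝒬_h(δ̄_{h,λ}φ) + K 𝒬_h(φ) + 2(1-δ) c 𝒦_h(∑_Λ |δ̄_{h,λ}φ|^2)`. -/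
def Coeffs.Structural1 {d : ℕ} (co : Coeffs d) (τ : Eu d → ℝ) (τ₀ δ K h₀ T : ℝ) (m : ℕ) :
    Prop :=
  ∀ h ∈ Ioc 0 h₀, ∃ 𝒦 : ℝ → (Eu d → ℝ) → Eu d → ℝ, (∀ t ∈ Icc 0 T, IsSubMarkov (𝒦 t)) ∧
    ∀ t ∈ Icc 0 T, ∀ φ : Eu d → ℝ, IsSmoothBounded φ → ∀ x,
      (m : ℝ) * co.Aop τ τ₀ h t φ x ≤
        (1 - δ) * ∑ μ : co.Idx, co.quad h t (co.dbar τ τ₀ h μ φ) x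
        + K * co.quad h t φ x
        + 2 * (1 - δ) * co.c t x * 𝒦 t (fun y => ∑ μ : co.Idx, |co.dbar τ τ₀ h μ φ y| ^ 2) x

/-- Second structural inequality: for any `h ∈ (0,h₀]` and `n = 1, …, m` there is
`𝒦_h = 𝒦_h(t) ∈ 𝔎` with
`n ∑_Λ A_h(δ̄_{h,ν}φ) + n(n-1) ∑_{Λ²} (δ̄_{h,λ}φ) Q_{h,λ} T_{h,λ}φ
  ≤ (1-δ) ∑_{Λ²} 𝒬_h(δ̄_{h,λ}φ) + K ∑_Λ 𝒬_h(δ̄_{h,λ}φ)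
    + 2(1-δ) c 𝒦_h(∑_{Λ²} |δ̄_{h,λ}φ|^2) + K 𝒦_h(∑_Λ |δ̄_{h,λ}φ|^2)`. -/
def Coeffs.Structural2 {d : ℕ} (co : Coeffs d) (τ : Eu d → ℝ) (τ₀ δ K h₀ T : ℝ) (m : ℕ) :
    Prop :=
  ∀ h ∈ Ioc 0 h₀, ∀ n ∈ Finset.Icc 1 m,
    ∃ 𝒦 : ℝ → (Eu d → ℝ) → Eu d → ℝ, (∀ t ∈ Icc 0 T, IsSubMarkov (𝒦 t)) ∧
    ∀ t ∈ Icc 0 T, ∀ φ : Eu d → ℝ, IsSmoothBounded φ → ∀ x,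
      (n : ℝ) * ∑ ν : co.Idx, co.Aop τ τ₀ h t (co.dbar τ τ₀ h ν φ) x
        + (n : ℝ) * ((n : ℝ) - 1) * ∑ μ : co.Idx, ∑ ν : co.Idx,
            co.dbar τ τ₀ h μ (co.dbar τ τ₀ h ν φ) x *
            co.Qop h t (fun ψ => co.dbar τ τ₀ h μ (co.dbar τ τ₀ h ν ψ))
              (co.shift h μ (co.shift h ν φ)) x ≤
        (1 - δ) * ∑ μ : co.Idx, ∑ ν : co.Idx,
            co.quad h t (co.dbar τ τ₀ h μ (co.dbar τ τ₀ h ν φ)) x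
        + K * ∑ μ : co.Idx, co.quad h t (co.dbar τ τ₀ h μ φ) x
        + 2 * (1 - δ) * co.c t x * 𝒦 t (fun y => ∑ μ : co.Idx, ∑ ν : co.Idx,
            |co.dbar τ τ₀ h μ (co.dbar τ τ₀ h ν φ) y| ^ 2) x
        + K * 𝒦 t (fun y => ∑ μ : co.Idx, |co.dbar τ τ₀ h μ φ y| ^ 2) x

/-- All the assumptions on the coefficients of the scheme. -/
structure Coeffs.Admissible {d : ℕ} (co : Coeffs d) (τ : Eu d → ℝ) (τ₀ δ K c₀ h₀ T : ℝ)
    (m : ℕ) (M : Fin (m + 1) → ℝ) : Prop where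
  zero_notMem : (0 : Eu d) ∉ co.Λ₁
  q_nonneg : ∀ lam ∈ co.Λ₁, ∀ t ∈ Icc 0 T, ∀ x, 0 ≤ co.q lam t x
  tau_nonneg : ∀ lam ∈ co.Λ₁, 0 ≤ τ lam
  smooth : co.Smooth T m M
  chi_nonneg : ∀ t ∈ Icc 0 T, ∀ x, ∀ h ∈ Ioc 0 h₀, ∀ lam ∈ co.Λ₁,
    0 ≤ co.q lam t x + h * co.p lam t x
  balanced : ∀ t ∈ Icc 0 T, ∀ x, ∑ lam ∈ co.Λ₁, co.q lam t x • lam = 0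
  c_lower : ∀ t ∈ Icc 0 T, ∀ x, c₀ ≤ co.c t x
  structural1 : co.Structural1 τ τ₀ δ K h₀ T m
  structural2 : co.Structural2 τ τ₀ δ K h₀ T m

/-- The symmetry condition (S): `Λ₁ = -Λ₁` and `q_λ = q_{-λ}`. -/
def Coeffs.Symmetric {d : ℕ} (co : Coeffs d) (T : ℝ) : Prop :=
  ∀ lam ∈ co.Λ₁, -lam ∈ co.Λ₁ ∧ ∀ t ∈ Icc 0 T, ∀ x, co.q (-lam) t x = co.q lam t x

/-- The antisymmetry condition `p_{-λ} = -p_λ`. -/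
def Coeffs.Antisymmetric {d : ℕ} (co : Coeffs d) (T : ℝ) : Prop :=
  ∀ lam ∈ co.Λ₁, ∀ t ∈ Icc 0 T, ∀ x, co.p (-lam) t x = -co.p lam t x

/-- Case (i): `m ≥ 3k + 3 + l`. -/
def CaseI (m k l : ℕ) : Prop := 3 * k + 3 + l ≤ m

/-- Case (ii): `m ≥ 2k + 3 + l` and (S) holds. -/
def CaseII {d : ℕ} (co : Coeffs d) (T : ℝ) (m k l : ℕ) : Prop :=
  2 * k + 3 + l ≤ m ∧ co.Symmetric T

/-- Case (iii): `k` is odd, `m ≥ 2k + 2 + l`, (S) holds and `p_{-λ} = -p_λ`. -/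
def CaseIII {d : ℕ} (co : Coeffs d) (T : ℝ) (m k l : ℕ) : Prop :=
  Odd k ∧ 2 * k + 2 + l ≤ m ∧ co.Symmetric T ∧ co.Antisymmetric T

/-! ### The Richardson combinations -/

/-- The matrix with entries `a^{-(i-1)(j-1)}`, `i, j = 1, …, n + 1`
(with indices starting from `0` in the code). -/
noncomputable def vander (a : ℝ) (n : ℕ) : Matrix (Fin (n + 1)) (Fin (n + 1)) ℝ :=
  Matrix.of fun i j => (a ^ ((i : ℕ) * (j : ℕ)))⁻¹

/-- The weights `(b_0, …, b_n) = (1, 0, …, 0) V⁻¹` for `V` the matrix `vander a n`. -/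
noncomputable def weights (a : ℝ) (n : ℕ) : Fin (n + 1) → ℝ :=
  Matrix.vecMul (Pi.single 0 1) (vander a n)⁻¹

/-- `ū_h = ∑_{j=0}^k b_j u_{2^{-j} h}`, where `u h` is the solution of the scheme of step `h`. -/
noncomputable def ubar {d : ℕ} (k : ℕ) (u : ℝ → ℝ → Eu d → ℝ) (h t : ℝ) : Eu d → ℝ :=
  fun x => ∑ j : Fin (k + 1), weights 2 k j * u (h / 2 ^ (j : ℕ)) t x

/-- `ũ_h = ∑_{j=0}^{(k-1)/2} b̃_j u_{2^{-j} h}` (used for odd `k`). -/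
noncomputable def utilde {d : ℕ} (k : ℕ) (u : ℝ → ℝ → Eu d → ℝ) (h t : ℝ) : Eu d → ℝ :=
  fun x => ∑ j : Fin ((k - 1) / 2 + 1), weights 4 ((k - 1) / 2) j * u (h / 2 ^ (j : ℕ)) t x

end Richardson

/-! Extrapolation works as soon as `u_h = ∑_{j ≤ k} h^j v_j + O(h^{k+1})` in `C^l` with `v_j`
independent of `h`: the weights solve a Vandermonde system that keeps `v_0` and annihilates the
powers `h, …, h^k`. If `q` is symmetric and `p` antisymmetric, the odd coefficients vanish and half
as many steps suffice (`sum_weights`, `Good.combination`, `Good.richardson`).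

Formally `L_h = ∑ h^i 𝓛_i` by Taylor's formula, where `∑ λ q_λ = 0` removes the singular term, so
`v_j` should solve the limiting equation with free term `∑_{i<j} 𝓛_{j-i} v_i`. To avoid solving
degenerate equations, the `v_j` are taken to be solutions of the scheme itself with an auxiliary
step `h'`. The remainder `u_h - ∑ h^j v_j` then solves the scheme of step `h` with free term
`O(h^{k+1}) + O(h')` (`Good.expansion`), and `h' → 0` in the end.

The analytic core is `Good.apriori`: derivatives of order `n ≤ m` of solutions are bounded by those
of the data, uniformly in `h` and `T`. This is Bernstein's method. Let `W_n` be the sum of `|δ̄_l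
u|²` over words `l` of length `n`. In the Leibniz expansion of `2 ∑ δ̄_l u · δ̄_l(L_h u)`, the terms
with undifferentiated coefficients give a jump operator applied to `W_n`, minus a dissipation `Z_n`,
minus `2cW_n`. The first differences of `q` and `p` and the second differences of `q` are absorbed
by the structural inequalities, and everything else involves derivatives of `u` of order below `n`
(`Good.bernstein`). A weighted sum of `W_0, …, W_n` makes the dissipations telescope, and the
maximum principle with `c ≥ c₀ > 0` gives `sup W_n ≤ (1 - δ/2) sup W_n + lower order`, without any
growth in time (`Good.next_level`).

For coefficients in `𝔅^m` all of this is applied to mollified coefficients. The structural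
inequalities survive mollification: replace `𝒦` by an upper bound, apply the inequality at `z` to
the translate `φ(· + x - z)`, and average over `z`; every factor containing `φ` is then independent
of `z`, and the coefficients enter linearly (`Coeffs.Red1.mollify`, `Coeffs.Red2.mollify`). Removing
the mollification gives the solutions `u_h` (`Problem.exists_schemeSol`); the case `k = l = 0` shows
that they are Cauchy as `h → 0`, and their limit `v` solves the limiting equation
(`Problem.exists_limit`, `Problem.isPDESol`).

Uniqueness for the limiting equation also comes from the scheme. Any solution, mollified at scale
`ε`, satisfies the scheme up to `O(ε) + O_ε(h)`, so it is close to `u_h` and hence to `v`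
(`Problem.pdeSol_unique`). -/

namespace Richardson

/-! ### Partial derivatives of smooth functions -/

/-- The iterated partial derivative along a list of coordinates. -/
noncomputable def pdl {d : ℕ} (I : List (Fin d)) (φ : Eu d → ℝ) : Eu d → ℝ := I.foldr pd φ

/-- All iterated partial derivatives of order at most `n` are bounded by `C`. -/
def Bd {d : ℕ} (n : ℕ) (C : ℝ) (φ : Eu d → ℝ) : Prop :=
  ∀ I : List (Fin d), I.length ≤ n → ∀ x, |pdl I φ x| ≤ C

/-- A family of smooth functions all of whose derivatives are bounded uniformly in the family. -/
structure USmooth {d : ℕ} {S : Type*} (ψ : S → Eu d → ℝ) : Prop where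
  smooth : ∀ t, ContDiff ℝ ∞ (ψ t)
  bdd : ∀ n, ∃ C, ∀ t, Bd n C (ψ t)

/-- Smooth functions with bounded derivatives. -/
def Smb {d : ℕ} (φ : Eu d → ℝ) : Prop := USmooth fun _ : Unit => φ

section pd
variable {d : ℕ} {φ ψ : Eu d → ℝ} {i j : Fin d} {x : Eu d}

lemma pd_apply (hφ : DifferentiableAt ℝ φ x) :
    pd i φ x = fderiv ℝ φ x (EuclideanSpace.single i 1) := hφ.lineDeriv_eq_fderiv

lemma pd_eq (hφ : Differentiable ℝ φ) :
    pd i φ = fun x => fderiv ℝ φ x (EuclideanSpace.single i 1) :=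
  funext fun _ => pd_apply (hφ _)

lemma smooth_differentiable (hφ : ContDiff ℝ ∞ φ) : Differentiable ℝ φ :=
  hφ.differentiable (by simp)

lemma contDiff_pd {n : ℕ∞} (hφ : ContDiff ℝ (n + 1 : ℕ∞) φ) : ContDiff ℝ n (pd i φ) := by
  rw [pd_eq (hφ.differentiable (by simp))]
  exact (hφ.fderiv_right (m := n) (by simp)).clm_apply contDiff_const

lemma smooth_pd (hφ : ContDiff ℝ ∞ φ) : ContDiff ℝ ∞ (pd i φ) := contDiff_pd (n := ⊤) hφ

lemma smooth_pdl (hφ : ContDiff ℝ ∞ φ) (I : List (Fin d)) : ContDiff ℝ ∞ (pdl I φ) := by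
  induction I with
  | nil => exact hφ
  | cons i I ih => exact smooth_pd ih

lemma pd_add (hφ : Differentiable ℝ φ) (hψ : Differentiable ℝ ψ) :
    pd i (fun x => φ x + ψ x) = fun x => pd i φ x + pd i ψ x := by
  funext x
  rw [pd_apply (hφ.fun_add hψ x), pd_apply (hφ x), pd_apply (hψ x)]
  rw [fderiv_fun_add (hφ x) (hψ x)]; rfl

lemma pd_const_mul (a : ℝ) (hφ : Differentiable ℝ φ) :
    pd i (fun x => a * φ x) = fun x => a * pd i φ x := by
  funext x
  rw [pd_apply ((hφ x).const_mul a), pd_apply (hφ x), fderiv_const_mul (hφ x)]; rfl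

lemma pd_mul (hφ : Differentiable ℝ φ) (hψ : Differentiable ℝ ψ) :
    pd i (fun x => φ x * ψ x) = fun x => φ x * pd i ψ x + pd i φ x * ψ x := by
  funext x
  rw [pd_apply ((hφ x).fun_mul (hψ x)), pd_apply (hφ x), pd_apply (hψ x), fderiv_fun_mul (hφ x) (hψ x)]
  simp [mul_comm]

lemma pd_const (a : ℝ) : pd i (fun _ : Eu d => a) = fun _ => 0 := by
  funext x
  rw [pd_apply (differentiableAt_const a)]; simp

lemma pd_sum {κ : Type*} (s : Finset κ) (f : κ → Eu d → ℝ) (hf : ∀ k ∈ s, Differentiable ℝ (f k)) :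
    pd i (fun x => ∑ k ∈ s, f k x) = fun x => ∑ k ∈ s, pd i (f k) x := by
  funext x
  rw [pd_apply (DifferentiableAt.fun_sum fun k hk => hf k hk x),
    fderiv_fun_sum fun k hk => hf k hk x]
  simp only [FunLike.coe_sum, Finset.sum_apply]
  exact Finset.sum_congr rfl fun k hk => (pd_apply (hf k hk x)).symm

lemma pd_comp_add (v : Eu d) : pd i (fun x => φ (x + v)) = fun x => pd i φ (x + v) := by
  funext x
  simp only [pd, lineDeriv]
  congr 1; funext t; congr 1; abel

lemma pd_comm (hφ : ContDiff ℝ ∞ φ) : pd i (pd j φ) = pd j (pd i φ) := by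
  funext x
  have hd := smooth_differentiable hφ
  have h2 : DifferentiableAt ℝ (fderiv ℝ φ) x :=
    ((hφ.fderiv_right (m := ∞) (by simp)).differentiable (by simp)) x
  rw [pd_apply (smooth_differentiable (smooth_pd hφ) x),
    pd_apply (smooth_differentiable (smooth_pd hφ) x), pd_eq hd, pd_eq hd,
    fderiv_clm_apply h2 (differentiableAt_const _), fderiv_clm_apply h2 (differentiableAt_const _)]
  have := second_derivative_symmetric (𝕜 := ℝ) (fun y => (hd y).hasFDerivAt) h2.hasFDerivAt
    (EuclideanSpace.single i (1:ℝ)) (EuclideanSpace.single j (1:ℝ))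
  simpa using this

@[simp] lemma pdl_nil : pdl [] φ = φ := rfl
@[simp] lemma pdl_cons (I : List (Fin d)) : pdl (i :: I) φ = pd i (pdl I φ) := rfl
lemma pdl_append (I J : List (Fin d)) : pdl (I ++ J) φ = pdl I (pdl J φ) := by
  simp [pdl, List.foldr_append]
lemma pdl_concat (I : List (Fin d)) : pdl (I ++ [i]) φ = pdl I (pd i φ) := by
  rw [pdl_append]; rfl

lemma pdl_pd (hφ : ContDiff ℝ ∞ φ) (I : List (Fin d)) : pdl I (pd i φ) = pd i (pdl I φ) := by
  induction I with
  | nil => rfl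
  | cons k I ih => rw [pdl_cons, ih, pd_comm (smooth_pdl hφ I)]; rfl

lemma pdl_perm (hφ : ContDiff ℝ ∞ φ) {I J : List (Fin d)} (h : I.Perm J) : pdl I φ = pdl J φ := by
  induction h with
  | nil => rfl
  | cons k _ ih => rw [pdl_cons, ih]; rfl
  | swap k l I => simp only [pdl_cons]; rw [pd_comm (smooth_pdl hφ I)]
  | trans _ _ h1 h2 => exact h1.trans h2

lemma pdl_add (hφ : ContDiff ℝ ∞ φ) (hψ : ContDiff ℝ ∞ ψ) (I : List (Fin d)) :
    pdl I (fun x => φ x + ψ x) = fun x => pdl I φ x + pdl I ψ x := by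
  induction I with
  | nil => rfl
  | cons k I ih => rw [pdl_cons, ih, pd_add (smooth_differentiable (smooth_pdl hφ I))
      (smooth_differentiable (smooth_pdl hψ I))]; rfl

lemma pdl_const_mul (a : ℝ) (hφ : ContDiff ℝ ∞ φ) (I : List (Fin d)) :
    pdl I (fun x => a * φ x) = fun x => a * pdl I φ x := by
  induction I with
  | nil => rfl
  | cons k I ih => rw [pdl_cons, ih, pd_const_mul a (smooth_differentiable (smooth_pdl hφ I))]; rfl

lemma pdl_sub (hφ : ContDiff ℝ ∞ φ) (hψ : ContDiff ℝ ∞ ψ) (I : List (Fin d)) :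
    pdl I (fun x => φ x - ψ x) = fun x => pdl I φ x - pdl I ψ x := by
  have := pdl_add hφ (contDiff_const.mul hψ : ContDiff ℝ ∞ fun x => (-1 : ℝ) * ψ x) I
  rw [pdl_const_mul (-1) hψ] at this
  simpa [sub_eq_add_neg] using this

lemma pdl_sum {κ : Type*} (s : Finset κ) (f : κ → Eu d → ℝ) (hf : ∀ k ∈ s, ContDiff ℝ ∞ (f k))
    (I : List (Fin d)) :
    pdl I (fun x => ∑ k ∈ s, f k x) = fun x => ∑ k ∈ s, pdl I (f k) x := by
  induction I with
  | nil => rfl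
  | cons k I ih =>
    rw [pdl_cons, ih, pd_sum s _ fun k hk => smooth_differentiable (smooth_pdl (hf k hk) I)]; rfl

lemma pdl_comp_add (v : Eu d) (I : List (Fin d)) :
    pdl I (fun x => φ (x + v)) = fun x => pdl I φ (x + v) := by
  induction I with
  | nil => rfl
  | cons k I ih => rw [pdl_cons, ih, pd_comp_add]; rfl

lemma smooth_comp_add (hφ : ContDiff ℝ ∞ φ) (v : Eu d) : ContDiff ℝ ∞ (fun x => φ (x + v)) :=
  hφ.comp (contDiff_id.add contDiff_const)

lemma pdl_zero (I : List (Fin d)) : pdl I (fun _ : Eu d => (0 : ℝ)) = fun _ => 0 := by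
  induction I with
  | nil => rfl
  | cons k I ih => rw [pdl_cons, ih, pd_const]

lemma fderiv_eq_sum (v : Eu d) (hφ : DifferentiableAt ℝ φ x) :
    fderiv ℝ φ x v = ∑ i, v i * pd i φ x := by
  conv_lhs => rw [← (EuclideanSpace.basisFun (Fin d) ℝ).sum_repr v]
  simp [map_sum, pd_apply hφ]

lemma abs_coord_le (v : Eu d) (i : Fin d) : |v i| ≤ ‖v‖ := by
  simpa using PiLp.norm_apply_le v i

lemma norm_fderiv_le {C : ℝ} (hφ : DifferentiableAt ℝ φ x) (hC : ∀ i, |pd i φ x| ≤ C) (v : Eu d) :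
    |fderiv ℝ φ x v| ≤ d * C * ‖v‖ := by
  rw [fderiv_eq_sum v hφ]
  calc |∑ i, v i * pd i φ x| ≤ ∑ i, |v i * pd i φ x| := Finset.abs_sum_le_sum_abs _ _
    _ ≤ ∑ _i : Fin d, ‖v‖ * C := Finset.sum_le_sum fun i _ => by
        rw [abs_mul]
        exact mul_le_mul (abs_coord_le v i) (hC i) (abs_nonneg _) (norm_nonneg _)
    _ = d * C * ‖v‖ := by simp; ring

lemma abs_sub_le_of_pd {C : ℝ} (hφ : Differentiable ℝ φ) (hC : ∀ i x, |pd i φ x| ≤ C)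
    (x y : Eu d) : |φ y - φ x| ≤ d * C * ‖y - x‖ := by
  rcases Nat.eq_zero_or_pos d with rfl | hd
  · have : y = x := Subsingleton.elim _ _
    simp [this]
  have hC0 : 0 ≤ C := (abs_nonneg _).trans (hC ⟨0, hd⟩ x)
  have := Convex.norm_image_sub_le_of_norm_fderiv_le (𝕜 := ℝ) (f := φ) (s := univ)
    (C := d * C) (fun z _ => hφ z) (fun z _ => ContinuousLinearMap.opNorm_le_bound _
      (by positivity) fun v => norm_fderiv_le (hφ z) (fun i => hC i z) v) convex_univ
    (mem_univ x) (mem_univ y)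
  simpa using this

lemma contDiff_succ_of_pd {n : ℕ} (hφ : Differentiable ℝ φ) (h : ∀ i, ContDiff ℝ n (pd i φ)) :
    ContDiff ℝ (n + 1 : ℕ) φ := by
  have : fderiv ℝ φ = fun x => ∑ i, pd i φ x • (EuclideanSpace.proj i : Eu d →L[ℝ] ℝ) := by
    funext x; ext v
    rw [fderiv_eq_sum v (hφ x)]
    simp [mul_comm]
  rw [show ((n + 1 : ℕ) : ℕ∞ω) = (n : ℕ∞ω) + 1 by simp, contDiff_succ_iff_fderiv]
  refine ⟨hφ, by simp, ?_⟩
  rw [this]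
  exact ContDiff.sum fun i _ => (h i).smul contDiff_const

end pd
end Richardson

namespace Richardson

/-! ### Calculus of uniform derivative bounds. -/

section Bd
variable {d n : ℕ} {φ ψ : Eu d → ℝ} {C A B : ℝ}

lemma Bd.nonneg (h : Bd n C φ) : 0 ≤ C := (abs_nonneg _).trans (h [] (by simp) 0)

lemma Bd.mono {n' : ℕ} {C' : ℝ} (h : Bd n C φ) (hn : n' ≤ n) (hC : C ≤ C') : Bd n' C' φ :=
  fun I hI x => (h I (hI.trans hn) x).trans hC

lemma Bd.abs_le (h : Bd n C φ) (x : Eu d) : |φ x| ≤ C := h [] (by simp) x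

lemma bd_zero : Bd 0 C φ ↔ ∀ x, |φ x| ≤ C := by
  refine ⟨fun h => h.abs_le, fun h I hI x => ?_⟩
  rw [List.length_eq_zero_iff.1 (Nat.le_zero.1 hI)]; exact h x

lemma bd_succ : Bd (n + 1) C φ ↔ (∀ x, |φ x| ≤ C) ∧ ∀ i, Bd n C (pd i φ) := by
  refine ⟨fun h => ⟨h.abs_le, fun i I hI x => ?_⟩, fun h I hI x => ?_⟩
  · rw [← pdl_concat]; exact h _ (by simpa using hI) x
  · rcases List.eq_nil_or_concat I with rfl | ⟨J, i, rfl⟩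
    · exact h.1 x
    · rw [List.concat_eq_append, pdl_concat]; exact h.2 i J (by simpa using hI) x

lemma Bd.pdl {k : ℕ} (h : Bd k C φ) (I : List (Fin d)) (hk : n + I.length ≤ k) :
    Bd n C (pdl I φ) := fun J hJ x => by
  rw [← pdl_append]; exact h _ (by rw [List.length_append]; lia) x

lemma Bd.pd {k : ℕ} (h : Bd k C φ) (i : Fin d) (hk : n + 1 ≤ k) : Bd n C (pd i φ) :=
  h.pdl [i] hk

lemma Bd.add (hf : ContDiff ℝ ∞ φ) (hg : ContDiff ℝ ∞ ψ) (h : Bd n A φ) (h' : Bd n B ψ) :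
    Bd n (A + B) fun x => φ x + ψ x := fun I hI x => by
  rw [pdl_add hf hg]; exact (abs_add_le _ _).trans (add_le_add (h I hI x) (h' I hI x))

lemma Bd.sub (hf : ContDiff ℝ ∞ φ) (hg : ContDiff ℝ ∞ ψ) (h : Bd n A φ) (h' : Bd n B ψ) :
    Bd n (A + B) fun x => φ x - ψ x := fun I hI x => by
  rw [pdl_sub hf hg]; exact (abs_sub _ _).trans (add_le_add (h I hI x) (h' I hI x))

lemma Bd.const_mul (a : ℝ) (hf : ContDiff ℝ ∞ φ) (h : Bd n A φ) :
    Bd n (|a| * A) fun x => a * φ x := fun I hI x => by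
  rw [pdl_const_mul a hf, abs_mul]; exact mul_le_mul_of_nonneg_left (h I hI x) (abs_nonneg _)

lemma Bd.sum {κ : Type*} (s : Finset κ) {f : κ → Eu d → ℝ} {b : κ → ℝ}
    (hf : ∀ k ∈ s, ContDiff ℝ ∞ (f k)) (h : ∀ k ∈ s, Bd n (b k) (f k)) :
    Bd n (∑ k ∈ s, b k) fun x => ∑ k ∈ s, f k x := fun I hI x => by
  rw [pdl_sum s f hf]
  exact (Finset.abs_sum_le_sum_abs _ _).trans (Finset.sum_le_sum fun k hk => h k hk I hI x)

lemma Bd.comp_add (h : Bd n A φ) (v : Eu d) : Bd n A fun x => φ (x + v) := fun I hI x => by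
  rw [pdl_comp_add]; exact h I hI _

lemma Bd.mul (hf : ContDiff ℝ ∞ φ) (hg : ContDiff ℝ ∞ ψ) (h : Bd n A φ) (h' : Bd n B ψ) :
    Bd n (2 ^ n * (A * B)) fun x => φ x * ψ x := by
  induction n generalizing φ ψ with
  | zero =>
    rw [bd_zero] at *
    intro x
    rw [abs_mul, pow_zero, one_mul]
    exact mul_le_mul (h x) (h' x) (abs_nonneg _) ((abs_nonneg _).trans (h x))
  | succ n ih =>
    have hAB : 0 ≤ A * B := mul_nonneg h.nonneg h'.nonneg
    rw [bd_succ]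
    refine ⟨fun x => ?_, fun i => ?_⟩
    · rw [abs_mul]
      refine (mul_le_mul (h.abs_le x) (h'.abs_le x) (abs_nonneg _) h.nonneg).trans ?_
      exact le_mul_of_one_le_left hAB (one_le_pow₀ (by norm_num))
    · rw [pd_mul (smooth_differentiable hf) (smooth_differentiable hg)]
      have h1 := ih hf (smooth_pd hg) (h.mono (by lia) le_rfl) (h'.pd i le_rfl)
      have h2 := ih (smooth_pd hf) hg (h.pd i le_rfl) (h'.mono (by lia) le_rfl)
      refine (h1.add (hf.mul (smooth_pd hg)) ((smooth_pd hf).mul hg) h2).mono le_rfl ?_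
      rw [pow_succ]; linarith

/-- A Leibniz estimate for `∑ f_k g_k` under an `ℓ²` bound on the `f_k`. -/
lemma bd_sum_mul {κ : Type*} (s : Finset κ) {f g : κ → Eu d → ℝ} {b : κ → ℝ}
    (hfs : ∀ k ∈ s, ContDiff ℝ ∞ (f k)) (hgs : ∀ k ∈ s, ContDiff ℝ ∞ (g k)) (hA : 0 ≤ A)
    (hB : 0 ≤ B)
    (hf : ∀ I : List (Fin d), I.length ≤ n → ∀ x, ∑ k ∈ s, Richardson.pdl I (f k) x ^ 2 ≤ A ^ 2)
    (hg : ∀ k ∈ s, Bd n (b k) (g k)) (hb : ∑ k ∈ s, b k ^ 2 ≤ B ^ 2) :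
    Bd n (2 ^ n * (A * B)) fun x => ∑ k ∈ s, f k x * g k x := by
  have key : ∀ (f g : κ → Eu d → ℝ), (∀ x, ∑ k ∈ s, f k x ^ 2 ≤ A ^ 2) →
      (∀ k ∈ s, ∀ x, |g k x| ≤ b k) → ∀ x, |∑ k ∈ s, f k x * g k x| ≤ A * B := by
    intro f g hf hg x
    apply abs_le_of_sq_le_sq _ (mul_nonneg hA hB)
    refine (Finset.sum_mul_sq_le_sq_mul_sq s _ _).trans ?_
    rw [mul_pow]
    refine mul_le_mul (hf x) ((Finset.sum_le_sum fun k hk => ?_).trans hb)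
      (Finset.sum_nonneg fun _ _ => sq_nonneg _) (sq_nonneg _)
    exact sq_le_sq' (by linarith [(abs_le.1 (hg k hk x)).1]) (abs_le.1 (hg k hk x)).2
  induction n generalizing f g with
  | zero =>
    rw [bd_zero, pow_zero, one_mul]
    exact key f g (fun x => hf [] (by simp) x) fun k hk x => (hg k hk).abs_le x
  | succ n ih =>
    have hAB : 0 ≤ A * B := mul_nonneg hA hB
    rw [bd_succ]
    refine ⟨fun x => (key f g (fun x => hf [] (by simp) x) (fun k hk x => (hg k hk).abs_le x) x).trans
      (le_mul_of_one_le_left hAB (one_le_pow₀ (by norm_num))), fun i => ?_⟩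
    have h1 := ih hfs (fun k hk => smooth_pd (i := i) (hgs k hk))
      (fun I hI => hf I (by lia)) (fun k hk => (hg k hk).pd i le_rfl)
    have h2 := ih (fun k hk => smooth_pd (i := i) (hfs k hk)) hgs
      (fun I hI x => by
        simp_rw [← pdl_concat]; exact hf _ (by simpa using hI) x)
      (fun k hk => (hg k hk).mono (by lia) le_rfl)
    have e : pd i (fun x => ∑ k ∈ s, f k x * g k x) = fun x =>
        (∑ k ∈ s, f k x * pd i (g k) x) + ∑ k ∈ s, pd i (f k) x * g k x := by
      rw [pd_sum s _ fun k hk => smooth_differentiable ((hfs k hk).mul (hgs k hk))]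
      funext x
      rw [← Finset.sum_add_distrib]
      refine Finset.sum_congr rfl fun k hk => ?_
      -- Each derivative splits the sum in two, which accounts for the factor `2 ^ n`. The
      -- Cauchy-Schwarz bound is applied only at the end, so the number of summands never enters.
      rw [pd_mul (smooth_differentiable (hfs k hk)) (smooth_differentiable (hgs k hk))]
    rw [e]
    refine (h1.add (ContDiff.sum fun k hk => (hfs k hk).mul (smooth_pd (hgs k hk)))
      (ContDiff.sum fun k hk => (smooth_pd (hfs k hk)).mul (hgs k hk)) h2).mono le_rfl ?_
    rw [pow_succ]; linarith

/-! ### Finite differences and directional derivatives -/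

lemma smooth_fdiff (hφ : ContDiff ℝ ∞ φ) (h : ℝ) (v : Eu d) : ContDiff ℝ ∞ (fdiff h v φ) :=
  contDiff_const.mul ((smooth_comp_add hφ _).sub hφ)

lemma pdl_fdiff (hφ : ContDiff ℝ ∞ φ) (h : ℝ) (v : Eu d) (I : List (Fin d)) :
    Richardson.pdl I (fdiff h v φ) = fdiff h v (Richardson.pdl I φ) := by
  unfold fdiff
  rw [pdl_const_mul _ ((smooth_comp_add hφ _).sub hφ), pdl_sub (smooth_comp_add hφ _) hφ,
    pdl_comp_add]

lemma abs_fdiff_le {h : ℝ} (hh : 0 < h) (v : Eu d) (hφ : Differentiable ℝ φ)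
    (hC : ∀ i x, |Richardson.pd i φ x| ≤ C) (x : Eu d) : |fdiff h v φ x| ≤ d * ‖v‖ * C := by
  have := abs_sub_le_of_pd hφ hC x (x + h • v)
  unfold fdiff
  rw [abs_mul, abs_of_pos (by positivity)]
  rw [add_sub_cancel_left, norm_smul, Real.norm_eq_abs, abs_of_pos hh] at this
  rw [div_mul_eq_mul_div, one_mul, div_le_iff₀ hh]
  linarith

/-- The derivative in the direction `v`. -/
noncomputable def dd (v : Eu d) (φ : Eu d → ℝ) : Eu d → ℝ := fun x => ∑ i, v i * Richardson.pd i φ x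

lemma smooth_dd (v : Eu d) (hφ : ContDiff ℝ ∞ φ) : ContDiff ℝ ∞ (dd v φ) :=
  ContDiff.sum fun _ _ => contDiff_const.mul (smooth_pd hφ)

lemma smooth_dd_iter (v : Eu d) (hφ : ContDiff ℝ ∞ φ) (k : ℕ) : ContDiff ℝ ∞ ((dd v)^[k] φ) := by
  induction k generalizing φ with
  | zero => exact hφ
  | succ k ih => exact ih (smooth_dd v hφ)

lemma pdl_dd (v : Eu d) (hφ : ContDiff ℝ ∞ φ) (I : List (Fin d)) :
    Richardson.pdl I (dd v φ) = dd v (Richardson.pdl I φ) := by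
  unfold dd
  rw [pdl_sum _ _ fun i _ => contDiff_const.mul (smooth_pd hφ)]
  simp_rw [pdl_const_mul _ (smooth_pd hφ), pdl_pd hφ]

lemma Bd.dd (v : Eu d) (hφ : ContDiff ℝ ∞ φ) (hb : Bd (n + 1) C φ) :
    Bd n (d * ‖v‖ * C) (dd v φ) := fun I hI x => by
  rw [pdl_dd v hφ]
  refine (Finset.abs_sum_le_sum_abs _ _).trans ?_
  calc _ ≤ ∑ _i : Fin d, ‖v‖ * C := Finset.sum_le_sum fun i _ => by
        rw [abs_mul]
        exact mul_le_mul (abs_coord_le v i) (hb (i :: I) (by simpa using hI) x) (abs_nonneg _)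
          (norm_nonneg _)
    _ = _ := by simp; ring

lemma Bd.dd_iter (v : Eu d) (hφ : ContDiff ℝ ∞ φ) (k : ℕ) (hb : Bd (n + k) C φ) :
    Bd n ((d * ‖v‖) ^ k * C) ((Richardson.dd v)^[k] φ) := by
  induction k generalizing φ C with
  | zero => simpa using hb
  | succ k ih =>
    have := ih (smooth_dd v hφ) (Bd.dd v hφ (n := n + k) hb)
    rw [Function.iterate_succ_apply]
    refine this.mono le_rfl (le_of_eq ?_)
    rw [pow_succ]; ring

lemma pdl_dd_iter (v : Eu d) (hφ : ContDiff ℝ ∞ φ) (I : List (Fin d)) (k : ℕ) :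
    Richardson.pdl I ((dd v)^[k] φ) = (dd v)^[k] (Richardson.pdl I φ) := by
  induction k generalizing φ with
  | zero => rfl
  | succ k ih => rw [Function.iterate_succ_apply, ih (smooth_dd v hφ), pdl_dd v hφ]; rfl

lemma hasDerivAt_line (v x : Eu d) (hφ : Differentiable ℝ φ) (t : ℝ) :
    HasDerivAt (fun t : ℝ => φ (x + t • v)) (dd v φ (x + t • v)) t := by
  have h1 : HasDerivAt (fun t : ℝ => x + t • v) v t := by
    simpa using ((hasDerivAt_id t).smul_const v).const_add x
  have := (hφ (x + t • v)).hasFDerivAt.comp_hasDerivAt t h1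
  rwa [fderiv_eq_sum v (hφ _)] at this

/-- The remainder in Taylor's formula of order `r` in the direction `v`. -/
noncomputable def taylorRem (h : ℝ) (v : Eu d) (r : ℕ) (φ : Eu d → ℝ) : Eu d → ℝ := fun x =>
  φ (x + h • v) - ∑ i ∈ Finset.range r, h ^ i / i.factorial * (dd v)^[i] φ x

/-- The derivative in `h` of the remainder of order `r + 1` of `φ` is the remainder of order `r` of
the directional derivative of `φ`. Induction and the mean value inequality give the bound, without
the factor `1 / r!`, which is not needed. -/
lemma abs_taylorRem_le {h : ℝ} (hh : 0 ≤ h) (v : Eu d) (r : ℕ) (hφ : ContDiff ℝ ∞ φ)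
    (hC : ∀ x, |(dd v)^[r] φ x| ≤ C) (x : Eu d) : |taylorRem h v r φ x| ≤ h ^ r * C := by
  induction r generalizing φ h with
  | zero => simpa [taylorRem] using hC (x + h • v)
  | succ r ih =>
    have hd : ∀ t : ℝ, HasDerivAt (fun t => taylorRem t v (r + 1) φ x)
        (taylorRem t v r (dd v φ) x) t := by
      intro t
      unfold taylorRem
      refine (hasDerivAt_line v x (smooth_differentiable hφ) t).sub ?_
      simp_rw [Finset.sum_range_succ' _ r]
      have : HasDerivAt (fun t : ℝ => ∑ i ∈ Finset.range r,
          t ^ (i + 1) / (i + 1).factorial * (dd v)^[i + 1] φ x)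
          (∑ i ∈ Finset.range r, t ^ i / i.factorial * (dd v)^[i] (dd v φ) x) t := by
        apply HasDerivAt.fun_sum
        intro i _
        have := (((hasDerivAt_pow (i + 1) t).div_const ((i + 1).factorial : ℝ)).mul_const
          ((dd v)^[i + 1] φ x))
        refine this.congr_deriv ?_
        rw [Function.iterate_succ_apply, Nat.factorial_succ]
        push_cast
        have : (i.factorial : ℝ) ≠ 0 := by positivity
        field_simp
      simpa using this.add_const (φ x)
    have h0 : taylorRem 0 v (r + 1) φ x = 0 := by
      simp [taylorRem, Finset.sum_range_succ']
    have := norm_image_sub_le_of_norm_deriv_le_segment' (a := 0) (b := h) (C := h ^ r * C)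
      (f := fun t => taylorRem t v (r + 1) φ x) (fun t _ => (hd t).hasDerivWithinAt)
      (fun t ht => ?_) h ⟨hh, le_rfl⟩
    · simp only [h0, sub_zero, Real.norm_eq_abs] at this
      rw [pow_succ]; linarith
    · refine (ih ht.1 (smooth_dd v hφ) hC).trans ?_
      exact mul_le_mul_of_nonneg_right (pow_le_pow_left₀ ht.1 ht.2.le r)
        ((abs_nonneg _).trans (hC x))

lemma smooth_taylorRem (h : ℝ) (v : Eu d) (r : ℕ) (hφ : ContDiff ℝ ∞ φ) :
    ContDiff ℝ ∞ (taylorRem h v r φ) :=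
  (smooth_comp_add hφ _).sub
    (ContDiff.sum fun i _ => contDiff_const.mul (smooth_dd_iter v hφ i))

lemma Bd.taylorRem {h : ℝ} (hh : 0 ≤ h) (v : Eu d) (r : ℕ) (hφ : ContDiff ℝ ∞ φ)
    (hb : Bd (n + r) C φ) : Bd n (h ^ r * ((d * ‖v‖) ^ r * C)) (taylorRem h v r φ) := by
  intro I hI x
  have e : Richardson.pdl I (Richardson.taylorRem h v r φ) =
      Richardson.taylorRem h v r (Richardson.pdl I φ) := by
    unfold Richardson.taylorRem
    rw [pdl_sub (smooth_comp_add hφ _)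
      (ContDiff.sum fun i _ => contDiff_const.mul (smooth_dd_iter v hφ i)), pdl_comp_add,
      pdl_sum _ _ fun i _ => contDiff_const.mul (smooth_dd_iter v hφ i)]
    simp_rw [pdl_const_mul _ (smooth_dd_iter v hφ _), pdl_dd_iter v hφ]
  rw [e]
  refine abs_taylorRem_le hh v r (smooth_pdl hφ I) (fun y => ?_) x
  exact (Bd.dd_iter v (smooth_pdl hφ I) r (n := 0) (hb.pdl I (by lia))).abs_le y

/-- Landau-Kolmogorov interpolation from Taylor's formula of order two with step `ε`. It upgrades
uniform convergence of functions to uniform convergence of derivatives. -/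
lemma pd_interp (hφ : ContDiff ℝ ∞ φ) {i : Fin d} (hA : ∀ x, |φ x| ≤ A)
    (hB : ∀ x, |Richardson.pd i (Richardson.pd i φ) x| ≤ B) {ε : ℝ} (hε : 0 < ε) (x : Eu d) :
    |Richardson.pd i φ x| ≤ 2 * A / ε + ε * B := by
  have e : ∀ ψ : Eu d → ℝ, dd (EuclideanSpace.single i 1) ψ = Richardson.pd i ψ := by
    intro ψ; funext y
    simp [dd]
  have h2 := abs_taylorRem_le hε.le (EuclideanSpace.single i (1:ℝ)) 2 hφ (C := B)
    (fun y => by simpa [e] using hB y) x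
  simp only [taylorRem, Finset.sum_range_succ, Finset.range_zero, Finset.sum_empty, e,
    Function.iterate_succ_apply, Function.iterate_zero, id, pow_zero, Nat.factorial, pow_one] at h2
  have h3 := hA (x + ε • EuclideanSpace.single i (1:ℝ))
  have h4 := hA x
  have : |ε * Richardson.pd i φ x| ≤ 2 * A + ε ^ 2 * B := by
    norm_num at h2
    rw [abs_le] at *
    constructor <;> linarith
  rw [abs_mul, abs_of_pos hε] at this
  have h5 : 2 * A / ε + ε * B = (2 * A + ε ^ 2 * B) / ε := by field_simp
  rw [h5, le_div_iff₀ hε]; linarith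

end Bd
end Richardson

namespace Richardson

/-! ### Uniform limits of smooth functions. -/

section Limits
open Filter Topology
variable {d : ℕ}

/-- If the partial derivatives up to order `n` of a sequence of smooth functions are uniformly
Cauchy, then the limit is of class `C^n` and the partial derivatives converge. -/
theorem contDiff_of_uniformCauchy (n : ℕ) : ∀ (f : ℕ → Eu d → ℝ) (φ : Eu d → ℝ),
    (∀ j, ContDiff ℝ ∞ (f j)) →
    (∀ I : List (Fin d), I.length ≤ n → UniformCauchySeqOn (fun j => pdl I (f j)) atTop univ) →
    (∀ x, Tendsto (fun j => f j x) atTop (𝓝 (φ x))) →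
    ContDiff ℝ n φ ∧ ∀ I : List (Fin d), I.length ≤ n →
      TendstoUniformly (fun j => pdl I (f j)) (pdl I φ) atTop := by
  induction n with
  | zero =>
    intro f φ hf hC hl
    have hu : TendstoUniformly f φ atTop := by
      rw [← tendstoUniformlyOn_univ]
      exact (hC [] (by simp)).tendstoUniformlyOn_of_tendsto fun x _ => hl x
    refine ⟨?_, fun I hI => ?_⟩
    · rw [Nat.cast_zero, contDiff_zero]
      exact hu.continuous (Eventually.of_forall fun j => (hf j).continuous).frequently
    · rw [List.length_eq_zero_iff.1 (Nat.le_zero.1 hI)]; exact hu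
  | succ n ih =>
    intro f φ hf hC hl
    have hu : TendstoUniformly f φ atTop := by
      rw [← tendstoUniformlyOn_univ]
      exact (hC [] (by simp)).tendstoUniformlyOn_of_tendsto fun x _ => hl x
    have hex : ∀ i : Fin d, ∀ x, ∃ y, Tendsto (fun j => pd i (f j) x) atTop (𝓝 y) := fun i x =>
      cauchySeq_tendsto_of_complete ((hC [i] (by simp)).cauchySeq (mem_univ x))
    choose ψ hψ using hex
    have hψu : ∀ i, TendstoUniformly (fun j => pd i (f j)) (ψ i) atTop := fun i => by
      rw [← tendstoUniformlyOn_univ]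
      exact (hC [i] (by simp)).tendstoUniformlyOn_of_tendsto fun x _ => hψ i x
    -- The linear map from vectors of partial derivatives to Fréchet derivatives is uniformly
    -- continuous, so uniform convergence of the partials carries over to the full derivative.
    let L : (Fin d → ℝ) →ₗ[ℝ] (Eu d →L[ℝ] ℝ) :=
      { toFun := fun c => ∑ i, c i • (EuclideanSpace.proj i : Eu d →L[ℝ] ℝ)
        map_add' := fun a b => by simp [add_smul, Finset.sum_add_distrib]
        map_smul' := fun a b => by simp [Finset.smul_sum, smul_smul] }
    have hL : UniformContinuous L.toContinuousLinearMap :=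
      ContinuousLinearMap.uniformContinuous _
    have hpi : TendstoUniformly (fun j x i => pd i (f j) x) (fun x i => ψ i x) atTop := by
      rw [Metric.tendstoUniformly_iff]
      intro ε hε
      have : ∀ᶠ j in atTop, ∀ i, ∀ x, dist (ψ i x) (pd i (f j) x) < ε :=
        eventually_all.2 fun i => Metric.tendstoUniformly_iff.1 (hψu i) ε hε
      filter_upwards [this] with j hj x
      exact (dist_pi_lt_iff hε).2 fun i => hj i x
    have hLu := hL.comp_tendstoUniformly hpi
    have hfd : ∀ j x, HasFDerivAt (f j) (L.toContinuousLinearMap fun i => pd i (f j) x) x := by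
      intro j x
      have hd := smooth_differentiable (hf j) x
      convert hd.hasFDerivAt using 1
      ext v
      rw [fderiv_eq_sum v hd]
      simp [L, mul_comm]
    have hφd := hasFDerivAt_of_tendstoUniformly hLu hfd hl
    have hφD : Differentiable ℝ φ := fun x => (hφd x).differentiableAt
    have hpdφ : ∀ i, pd i φ = ψ i := by
      intro i; funext x
      rw [pd_apply (hφD x), (hφd x).fderiv]
      simp [L]
    have hih : ∀ i, _ := fun i => ih (fun j => pd i (f j)) (ψ i) (fun j => smooth_pd (hf j))
      (fun I hI => by simp_rw [← pdl_concat]; exact hC _ (by simpa using hI)) (hψ i)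
    refine ⟨contDiff_succ_of_pd hφD fun i => by rw [hpdφ i]; exact (hih i).1, fun I hI => ?_⟩
    rcases List.eq_nil_or_concat I with rfl | ⟨J, i, rfl⟩
    · exact hu
    · rw [List.concat_eq_append] at hI ⊢
      simp_rw [pdl_concat, hpdφ]
      exact (hih i).2 J (by simpa using hI)

/-- Uniformly Cauchy sequences with bounded higher derivatives have uniformly Cauchy derivatives. -/
lemma uniformCauchy_pdl {n : ℕ} {C : ℝ} {f : ℕ → Eu d → ℝ} (hf : ∀ j, ContDiff ℝ ∞ (f j))
    (hb : ∀ j, Bd (n + 1) C (f j)) (hc : UniformCauchySeqOn f atTop univ)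
    (I : List (Fin d)) (hI : I.length ≤ n) :
    UniformCauchySeqOn (fun j => pdl I (f j)) atTop univ := by
  induction I with
  | nil => exact hc
  | cons i I ih =>
    have hC0 : 0 ≤ C := (hb 0).nonneg
    have ih := ih (by simp at hI; lia)
    rw [Metric.uniformCauchySeqOn_iff] at ih ⊢
    intro ε hε
    -- With interpolation step `η`, the second-derivative term is at most `2Cη ≤ ε/2`, and accuracy
    -- `ηε/8` of the functions contributes `ε/4`.
    set η := ε / (4 * (C + 1)) with hη
    have hη0 : 0 < η := by positivity
    obtain ⟨N, hN⟩ := ih (η * ε / 8) (by positivity)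
    refine ⟨N, fun j hj k hk x _ => ?_⟩
    have e : ∀ J, pdl J (fun x => f j x - f k x) = fun x => pdl J (f j) x - pdl J (f k) x :=
      pdl_sub (hf j) (hf k)
    have := pd_interp (φ := pdl I (fun x => f j x - f k x)) (A := η * ε / 8) (B := 2 * C) (i := i)
      (smooth_pdl ((hf j).sub (hf k)) I) (fun y => ?_) (fun y => ?_) hη0 x
    · rw [← pdl_cons, e] at this
      rw [Real.dist_eq]
      refine this.trans_lt ?_
      have h1 : 2 * (η * ε / 8) / η = ε / 4 := by field_simp; norm_num
      have h2 : η * (2 * C) ≤ ε / 2 := by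
        rw [hη, div_mul_eq_mul_div, div_le_div_iff₀ (by positivity) (by norm_num)]
        nlinarith
      rw [h1]; linarith
    · rw [e]; exact (hN j hj k hk y (mem_univ y)).le
    · rw [← pdl_cons, ← pdl_cons, e]
      have hl : (i :: i :: I).length ≤ n + 1 := by simpa using hI
      refine (abs_sub _ _).trans ?_
      linarith [hb j _ hl y, hb k _ hl y]

/-- Limits of uniformly convergent smooth functions with bounded derivatives. -/
theorem contDiff_of_bd {n : ℕ} {C : ℝ} {f : ℕ → Eu d → ℝ} {φ : Eu d → ℝ}
    (hf : ∀ j, ContDiff ℝ ∞ (f j)) (hb : ∀ j, Bd (n + 1) C (f j))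
    (hu : TendstoUniformly f φ atTop) :
    ContDiff ℝ n φ ∧ ∀ I : List (Fin d), I.length ≤ n →
      TendstoUniformly (fun j => pdl I (f j)) (pdl I φ) atTop :=
  contDiff_of_uniformCauchy n f φ hf (fun I hI => uniformCauchy_pdl hf hb
    (tendstoUniformlyOn_univ.2 hu).uniformCauchySeqOn I hI) fun x => hu.tendsto_at x

end Limits

/-! ### Closure properties of uniformly smooth families. -/

section USmooth
variable {d : ℕ} {S : Type*} {φ ψ : S → Eu d → ℝ}

lemma USmooth.add (hφ : USmooth φ) (hψ : USmooth ψ) : USmooth fun t x => φ t x + ψ t x :=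
  ⟨fun t => (hφ.smooth t).add (hψ.smooth t), fun n => by
    obtain ⟨A, hA⟩ := hφ.bdd n
    obtain ⟨B, hB⟩ := hψ.bdd n
    exact ⟨A + B, fun t => (hA t).add (hφ.smooth t) (hψ.smooth t) (hB t)⟩⟩

lemma USmooth.mul (hφ : USmooth φ) (hψ : USmooth ψ) : USmooth fun t x => φ t x * ψ t x :=
  ⟨fun t => (hφ.smooth t).mul (hψ.smooth t), fun n => by
    obtain ⟨A, hA⟩ := hφ.bdd n
    obtain ⟨B, hB⟩ := hψ.bdd n
    exact ⟨_, fun t => (hA t).mul (hφ.smooth t) (hψ.smooth t) (hB t)⟩⟩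

lemma USmooth.const_mul (a : ℝ) (hφ : USmooth φ) : USmooth fun t x => a * φ t x :=
  ⟨fun t => contDiff_const.mul (hφ.smooth t), fun n => by
    obtain ⟨A, hA⟩ := hφ.bdd n
    exact ⟨_, fun t => (hA t).const_mul a (hφ.smooth t)⟩⟩

lemma USmooth.sub (hφ : USmooth φ) (hψ : USmooth ψ) : USmooth fun t x => φ t x - ψ t x := by
  simpa [sub_eq_add_neg] using hφ.add (hψ.const_mul (-1))

lemma USmooth.pd (hφ : USmooth φ) (i : Fin d) : USmooth fun t => pd i (φ t) :=
  ⟨fun t => smooth_pd (hφ.smooth t), fun n => by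
    obtain ⟨A, hA⟩ := hφ.bdd (n + 1)
    exact ⟨A, fun t => (hA t).pd i le_rfl⟩⟩

lemma USmooth.comp_add (hφ : USmooth φ) (v : Eu d) : USmooth fun t x => φ t (x + v) :=
  ⟨fun t => smooth_comp_add (hφ.smooth t) v, fun n => by
    obtain ⟨A, hA⟩ := hφ.bdd n
    exact ⟨A, fun t => (hA t).comp_add v⟩⟩

lemma USmooth.zero : USmooth fun (_ : S) (_ : Eu d) => (0 : ℝ) :=
  ⟨fun _ => contDiff_const, fun _ => ⟨0, fun _ I _ x => by rw [pdl_zero]; simp⟩⟩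

lemma USmooth.sum {κ : Type*} (s : Finset κ) {f : κ → S → Eu d → ℝ}
    (hf : ∀ k ∈ s, USmooth (f k)) : USmooth fun t x => ∑ k ∈ s, f k t x := by
  classical
  induction s using Finset.induction_on with
  | empty => simpa using USmooth.zero
  | insert a s ha ih =>
    simp_rw [Finset.sum_insert ha]
    exact (hf a (by simp)).add (ih fun k hk => hf k (by simp [hk]))

lemma USmooth.smb (hφ : USmooth φ) (t : S) : Smb (φ t) :=
  ⟨fun _ => hφ.smooth t, fun n => (hφ.bdd n).imp fun _ h _ => h t⟩

lemma USmooth.bounded (hφ : USmooth φ) : ∃ C, ∀ t x, |φ t x| ≤ C :=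
  (hφ.bdd 0).imp fun _ h t => (h t).abs_le

lemma Smb.smooth {φ : Eu d → ℝ} (h : Smb φ) : ContDiff ℝ ∞ φ := USmooth.smooth h ()

lemma Smb.const {φ : Eu d → ℝ} (h : Smb φ) : USmooth fun _ : S => φ :=
  ⟨fun _ => h.smooth, fun n => (h.bdd n).imp fun _ h _ => h ()⟩

end USmooth

/-! ### Time dependent families -/

/-- Functions of `(t, x)`, measurable in `t`, smooth in `x` with bounded derivatives. -/
structure SB {d : ℕ} (ψ : ℝ → Eu d → ℝ) : Prop where
  usmooth : USmooth ψ
  meas : ∀ x, Measurable fun t => ψ t x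

section SB
open Filter Topology
variable {d : ℕ} {φ ψ : ℝ → Eu d → ℝ}

lemma SB.add (hφ : SB φ) (hψ : SB ψ) : SB fun t x => φ t x + ψ t x :=
  ⟨hφ.usmooth.add hψ.usmooth, fun x => (hφ.meas x).add (hψ.meas x)⟩
lemma SB.sub (hφ : SB φ) (hψ : SB ψ) : SB fun t x => φ t x - ψ t x :=
  ⟨hφ.usmooth.sub hψ.usmooth, fun x => (hφ.meas x).sub (hψ.meas x)⟩
lemma SB.mul (hφ : SB φ) (hψ : SB ψ) : SB fun t x => φ t x * ψ t x :=
  ⟨hφ.usmooth.mul hψ.usmooth, fun x => (hφ.meas x).mul (hψ.meas x)⟩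
lemma SB.const_mul (a : ℝ) (hφ : SB φ) : SB fun t x => a * φ t x :=
  ⟨hφ.usmooth.const_mul a, fun x => (hφ.meas x).const_mul a⟩
lemma SB.comp_add (hφ : SB φ) (v : Eu d) : SB fun t x => φ t (x + v) :=
  ⟨hφ.usmooth.comp_add v, fun _ => hφ.meas _⟩
lemma SB.fdiff (hφ : SB φ) (h : ℝ) (v : Eu d) : SB fun t => fdiff h v (φ t) :=
  ((hφ.comp_add (h • v)).sub hφ).const_mul (1 / h)
lemma SB.zero : SB fun (_ : ℝ) (_ : Eu d) => (0 : ℝ) := ⟨USmooth.zero, fun _ => measurable_const⟩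
lemma SB.sum {κ : Type*} (s : Finset κ) {f : κ → ℝ → Eu d → ℝ}
    (hf : ∀ k ∈ s, SB (f k)) : SB fun t x => ∑ k ∈ s, f k t x :=
  ⟨USmooth.sum s fun k hk => (hf k hk).usmooth,
    fun x => Finset.measurable_sum s fun k hk => (hf k hk).meas x⟩
lemma SB.const {φ : Eu d → ℝ} (h : Smb φ) : SB fun _ => φ :=
  ⟨h.const, fun _ => measurable_const⟩

/-- Partial derivatives are limits of difference quotients. -/
lemma tendsto_quotient_pd {φ : Eu d → ℝ} (hφ : Differentiable ℝ φ) (i : Fin d) (x : Eu d) :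
    Tendsto (fun k : ℕ => Richardson.fdiff (1 / ((k : ℝ) + 1)) (EuclideanSpace.single i 1) φ x) atTop
      (𝓝 (pd i φ x)) := by
  have h := (hφ x).hasFDerivAt.hasLineDerivAt (EuclideanSpace.single i (1:ℝ))
  have h2 := h.tendsto_slope_zero
  rw [← pd_apply (hφ x)] at h2
  have h3 : Tendsto (fun k : ℕ => 1 / ((k : ℝ) + 1)) atTop (𝓝[≠] 0) :=
    tendsto_nhdsWithin_iff.2 ⟨tendsto_one_div_add_atTop_nhds_zero_nat,
      Eventually.of_forall fun k => by simp; positivity⟩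
  refine (h2.comp h3).congr fun k => ?_
  simp [Richardson.fdiff]

/-- Measurability in `t` is the only point: a partial derivative is a limit of difference quotients
along a fixed sequence of increments. -/
lemma SB.pd (hφ : SB φ) (i : Fin d) : SB fun t => pd i (φ t) :=
  ⟨hφ.usmooth.pd i, fun x => measurable_of_tendsto_metrizable
    (fun k => (hφ.fdiff (1 / ((k : ℝ) + 1)) (EuclideanSpace.single i 1)).meas x)
    (tendsto_pi_nhds.2 fun t =>
      tendsto_quotient_pd (smooth_differentiable (hφ.usmooth.smooth t)) i x)⟩

lemma SB.pdl (hφ : SB φ) (I : List (Fin d)) : SB fun t => pdl I (φ t) := by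
  induction I with
  | nil => exact hφ
  | cons i I ih => exact ih.pd i

lemma SB.dd (hφ : SB φ) (v : Eu d) : SB fun t => dd v (φ t) :=
  SB.sum _ fun i _ => (hφ.pd i).const_mul (v i)

lemma SB.dd_iter (hφ : SB φ) (v : Eu d) (k : ℕ) :
    SB fun t => (Richardson.dd v)^[k] (φ t) := by
  induction k generalizing φ with
  | zero => exact hφ
  | succ k ih => exact ih (hφ.dd v)

lemma SB.comp_measurable (hφ : SB φ) {θ : ℝ → ℝ} (hθ : Measurable θ) : SB fun t => φ (θ t) :=
  ⟨⟨fun _ => hφ.usmooth.smooth _, fun n => (hφ.usmooth.bdd n).imp fun _ h _ => h _⟩,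
    fun x => (hφ.meas x).comp hθ⟩

lemma intervalIntegrable_of_bdd {f : ℝ → ℝ} (hf : Measurable f) {C : ℝ} (hC : ∀ t, |f t| ≤ C)
    (a b : ℝ) : IntervalIntegrable f volume a b := by
  refine (intervalIntegrable_const (c := C)).mono_fun hf.aestronglyMeasurable ?_
  exact Eventually.of_forall fun t => by
    simpa using (hC t).trans (le_abs_self C)

lemma SB.intervalIntegrable (hφ : SB φ) (x : Eu d) (a b : ℝ) :
    IntervalIntegrable (fun t => φ t x) volume a b := by
  obtain ⟨C, hC⟩ := hφ.usmooth.bounded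
  exact intervalIntegrable_of_bdd (hφ.meas x) (fun t => hC t x) a b

lemma SB.hasFDerivAt_integral (hφ : SB φ) (a b : ℝ) (x : Eu d) :
    HasFDerivAt (fun x => ∫ s in a..b, φ s x)
      (∑ i, (∫ s in a..b, Richardson.pd i (φ s) x) •
        (EuclideanSpace.proj i : Eu d →L[ℝ] ℝ)) x := by
  obtain ⟨C, hC⟩ := hφ.usmooth.bdd 1
  have hF : ∀ s y, HasFDerivAt (φ s)
      (∑ i, Richardson.pd i (φ s) y • (EuclideanSpace.proj i : Eu d →L[ℝ] ℝ)) y := by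
    intro s y
    have hd := smooth_differentiable (hφ.usmooth.smooth s) y
    convert hd.hasFDerivAt using 1
    ext v
    rw [fderiv_eq_sum v hd]
    simp [mul_comm]
  have hm : ∀ y, Measurable fun s => ∑ i, Richardson.pd i (φ s) y •
      (EuclideanSpace.proj i : Eu d →L[ℝ] ℝ) := fun y =>
    Finset.measurable_sum _ fun i _ => ((hφ.pd i).meas y).smul_const _
  have := intervalIntegral.hasFDerivAt_integral_of_dominated_of_fderiv_le (μ := volume)
    (F := fun y s => φ s y) (a := a) (b := b) (bound := fun _ => d * C) (x₀ := x) univ_mem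
    (Eventually.of_forall fun y => (hφ.meas y).aestronglyMeasurable)
    (hφ.intervalIntegrable x a b) ((hm x).aestronglyMeasurable)
    (Eventually.of_forall fun s _ y _ => ?_) (intervalIntegrable_const)
    (Eventually.of_forall fun s _ y _ => hF s y)
  · rw [intervalIntegral.integral_finsetSum] at this
    · simpa only [intervalIntegral.integral_smul_const] using this
    · intro i _
      have h := (hφ.pd i).intervalIntegrable x a b
      exact ⟨h.1.smul_const _, h.2.smul_const _⟩
  · have hC0 := (hC 0).nonneg
    refine ContinuousLinearMap.opNorm_le_bound _ (by positivity) fun v => ?_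
    rw [← (hF s y).fderiv]
    exact norm_fderiv_le (hF s y).differentiableAt (fun i => hC s [i] (by simp) y) v

lemma SB.pd_integral (hφ : SB φ) (a b : ℝ) (i : Fin d) :
    Richardson.pd i (fun x => ∫ s in a..b, φ s x) =
      fun x => ∫ s in a..b, Richardson.pd i (φ s) x := by
  funext x
  rw [pd_apply (hφ.hasFDerivAt_integral a b x).differentiableAt,
    (hφ.hasFDerivAt_integral a b x).fderiv]
  simp

lemma SB.pdl_integral (hφ : SB φ) (a b : ℝ) (I : List (Fin d)) :
    Richardson.pdl I (fun x => ∫ s in a..b, φ s x) =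
      fun x => ∫ s in a..b, Richardson.pdl I (φ s) x := by
  induction I with
  | nil => rfl
  | cons i I ih => rw [pdl_cons, ih, (hφ.pdl I).pd_integral]; rfl

lemma SB.contDiff_integral (hφ : SB φ) (a b : ℝ) : ContDiff ℝ ∞ (fun x => ∫ s in a..b, φ s x) := by
  rw [contDiff_infty]
  intro n
  induction n generalizing φ with
  | zero =>
    rw [Nat.cast_zero, contDiff_zero]
    exact continuous_iff_continuousAt.2 fun x => (hφ.hasFDerivAt_integral a b x).continuousAt
  | succ n ih =>
    refine contDiff_succ_of_pd (fun x => (hφ.hasFDerivAt_integral a b x).differentiableAt)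
      fun i => ?_
    rw [hφ.pd_integral]
    exact ih (hφ.pd i)

/-- Projection of the time axis onto `[0, T]`. -/
noncomputable def clamp (T t : ℝ) : ℝ := max 0 (min t T)

lemma clamp_mem {T : ℝ} (hT : 0 ≤ T) (t : ℝ) : clamp T t ∈ Icc 0 T :=
  ⟨le_max_left _ _, max_le hT (min_le_right _ _)⟩
lemma clamp_eq {T t : ℝ} (ht : t ∈ Icc 0 T) : clamp T t = t := by
  rw [clamp, min_eq_left ht.2, max_eq_right ht.1]
lemma continuous_clamp (T : ℝ) : Continuous (clamp T) :=
  continuous_const.max (continuous_id.min continuous_const)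

lemma Bd.integral {n : ℕ} {C : ℝ} (hφ : SB φ) (hC : ∀ t, Bd n C (φ t)) {t : ℝ} (ht : 0 ≤ t) :
    Bd n (t * C) (fun x => ∫ s in 0..t, φ s x) := by
  intro I hI x
  rw [hφ.pdl_integral, ← Real.norm_eq_abs]
  refine (intervalIntegral.norm_integral_le_of_norm_le_const (C := C)
    fun s _ => hC s I hI x).trans (le_of_eq ?_)
  rw [sub_zero, abs_of_nonneg ht, mul_comm]

lemma SB.integral_clamp (hφ : SB φ) {T : ℝ} (hT : 0 ≤ T) :
    SB fun t x => ∫ s in 0..clamp T t, φ s x := by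
  refine ⟨⟨fun t => hφ.contDiff_integral _ _, fun n => ?_⟩, fun x => ?_⟩
  · obtain ⟨C, hC⟩ := hφ.usmooth.bdd n
    refine ⟨T * C, fun t => (Bd.integral hφ hC (clamp_mem hT t).1).mono le_rfl ?_⟩
    exact mul_le_mul_of_nonneg_right (clamp_mem hT t).2 (hC 0).nonneg
  · exact ((intervalIntegral.continuous_primitive (hφ.intervalIntegrable x) 0).comp
      (continuous_clamp T)).measurable

end SB
end Richardson

namespace Richardson

/-! ### Product rule and maximum principle in integrated form. -/

section Time
open Filter Topology

/-- The product rule for indefinite integrals. -/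
lemma mul_eq_integral {a b α β : ℝ → ℝ} {T : ℝ} (hT : 0 ≤ T)
    (hα : IntervalIntegrable α volume 0 T) (hβ : IntervalIntegrable β volume 0 T)
    (ha : ∀ t ∈ Icc 0 T, a t = a 0 + ∫ s in 0..t, α s)
    (hb : ∀ t ∈ Icc 0 T, b t = b 0 + ∫ s in 0..t, β s) :
    IntervalIntegrable (fun s => α s * b s + a s * β s) volume 0 T ∧
      a T * b T = a 0 * b 0 + ∫ s in 0..T, (α s * b s + a s * β s) := by
  have hu : uIcc 0 T = Icc 0 T := uIcc_of_le hT
  have h0 : (0 : ℝ) ∈ uIcc 0 T := left_mem_uIcc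
  have key : ∀ (c γ : ℝ → ℝ), IntervalIntegrable γ volume 0 T →
      (∀ t ∈ Icc 0 T, c t = c 0 + ∫ s in 0..t, γ s) →
      AbsolutelyContinuousOnInterval (fun t => c 0 + ∫ s in 0..t, γ s) 0 T ∧
      (∀ᵐ x, x ∈ uIcc 0 T → deriv (fun t => c 0 + ∫ s in 0..t, γ s) x = γ x) := by
    intro c γ hγ hc
    refine ⟨?_, ?_⟩
    · have h1 := hγ.absolutelyContinuousOnInterval_intervalIntegral h0
      have h2 : AbsolutelyContinuousOnInterval (fun _ : ℝ => c 0) 0 T :=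
        (LipschitzWith.const (c 0)).lipschitzOnWith.absolutelyContinuousOnInterval
      exact h2.fun_add h1
    · filter_upwards [hγ.ae_hasDerivAt_integral] with x hx hxu
      exact ((hx hxu 0 h0).const_add (c 0)).deriv
  obtain ⟨hA, hA'⟩ := key a α hα ha
  obtain ⟨hB, hB'⟩ := key b β hβ hb
  have hac : ContinuousOn a (uIcc 0 T) := hA.continuousOn.congr fun t ht => ha t (hu ▸ ht)
  have hbc : ContinuousOn b (uIcc 0 T) := hB.continuousOn.congr fun t ht => hb t (hu ▸ ht)
  refine ⟨(hα.mul_continuousOn hbc).add (hβ.continuousOn_mul hac), ?_⟩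
  -- The densities are only integrable, so `a` and `b` are merely absolutely continuous and their
  -- derivatives exist only almost everywhere.
  have h := hA.integral_deriv_mul_eq_sub hB
  have hTm : T ∈ Icc 0 T := ⟨hT, le_rfl⟩
  simp only [← ha T hTm, ← hb T hTm, intervalIntegral.integral_same, add_zero] at h
  rw [sub_eq_iff_eq_add'.1 h.symm]
  congr 1
  apply intervalIntegral.integral_congr_ae
  filter_upwards [hA', hB'] with x hx hx' hxu
  have hxm := uIoc_subset_uIcc hxu
  rw [hx hxm, hx' hxm, ← ha x (hu ▸ hxm), ← hb x (hu ▸ hxm)]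

/-- The maximum principle for an integral inequality with nonlocal jump terms. -/
theorem nonpos_of_jump_inequality {X ι : Type*} (s : Finset ι) {a : ι → ℝ → X → ℝ} (y : ι → X → X)
    {c V w : ℝ → X → ℝ} {T κ A : ℝ}
    (ha : ∀ i ∈ s, ∀ t ∈ Icc 0 T, ∀ x, 0 ≤ a i t x) (hc : ∀ t ∈ Icc 0 T, ∀ x, 0 ≤ c t x)
    (hκ : ∀ t ∈ Icc 0 T, ∀ x, ∑ i ∈ s, a i t x + c t x ≤ κ)
    (hA : ∀ t ∈ Icc 0 T, ∀ x, V t x ≤ A)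
    (hw : ∀ x, IntervalIntegrable (fun t => w t x) volume 0 T)
    (hV : ∀ t ∈ Icc 0 T, ∀ x, V t x = V 0 x + ∫ r in 0..t, w r x)
    (h0 : ∀ x, V 0 x ≤ 0)
    (hle : ∀ t ∈ Icc 0 T, ∀ x, w t x ≤ ∑ i ∈ s, a i t x * (V t (y i x) - V t x) - c t x * V t x) :
    ∀ t ∈ Icc 0 T, ∀ x, V t x ≤ 0 := by
  intro t₀ ht₀ x₀
  have hT : 0 ≤ T := ht₀.1.trans ht₀.2
  have hκ0 : 0 ≤ κ := (add_nonneg (Finset.sum_nonneg fun i hi => ha i hi t₀ ht₀ x₀)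
    (hc t₀ ht₀ x₀)).trans (hκ t₀ ht₀ x₀)
  set A' := |A| * Real.exp (κ * T) with hA'
  have hA'0 : 0 ≤ A' := by positivity
  -- The factor `exp (κ t)` makes the coefficient `κ - ∑ a - c` of `V t x` nonnegative, so an upper
  -- bound `E` on the weighted function bounds its time derivative by `κ E`. Each iteration
  -- integrates once more, producing `(κ t) ^ n / n!`, which tends to zero.
  have claim : ∀ n : ℕ, ∀ t ∈ Icc 0 T, ∀ x,
      Real.exp (κ * t) * V t x ≤ A' * (κ * t) ^ n / n.factorial := by
    intro n
    induction n with
    | zero =>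
      intro t ht x
      simp only [pow_zero, mul_one, Nat.factorial_zero, Nat.cast_one, div_one]
      rw [hA', mul_comm]
      have h1 : V t x ≤ |A| := (hA t ht x).trans (le_abs_self A)
      have h2 : Real.exp (κ * t) ≤ Real.exp (κ * T) :=
        Real.exp_le_exp.2 (mul_le_mul_of_nonneg_left ht.2 hκ0)
      exact (mul_le_mul_of_nonneg_right h1 (Real.exp_pos _).le).trans
        (mul_le_mul_of_nonneg_left h2 (abs_nonneg _))
    | succ n ih =>
      intro t ht x
      have hsub : Icc 0 t ⊆ Icc 0 T := Icc_subset_Icc_right ht.2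
      have hexp : ∀ r ∈ Icc 0 t, Real.exp (κ * r) = Real.exp (κ * 0) +
          ∫ s in 0..r, κ * Real.exp (κ * s) := by
        intro r _
        rw [intervalIntegral.integral_eq_sub_of_hasDerivAt (f := fun s => Real.exp (κ * s))]
        · ring
        · intro z _
          have := ((hasDerivAt_id z).const_mul κ).exp
          simpa [mul_comm] using this
        · exact Continuous.intervalIntegrable (by fun_prop) _ _
      have hwt : IntervalIntegrable (fun t => w t x) volume 0 t :=
        (hw x).mono_set (by
          rw [uIcc_of_le ht.1, uIcc_of_le hT]; exact hsub)
      obtain ⟨hint, heq⟩ := mul_eq_integral (a := fun r => Real.exp (κ * r)) (b := fun r => V r x)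
        ht.1 (Continuous.intervalIntegrable (by fun_prop) _ _) hwt hexp
        (fun r hr => hV r (hsub hr) x)
      rw [heq]
      have hi0 : ∫ r in 0..t, A' * κ * (κ * r) ^ n / n.factorial =
          A' * (κ * t) ^ (n + 1) / (n + 1).factorial := by
        simp_rw [mul_pow, ← mul_assoc, mul_div_right_comm _ _ (n.factorial : ℝ)]
        rw [intervalIntegral.integral_const_mul, integral_pow, Nat.factorial_succ]
        push_cast
        have : (n.factorial : ℝ) ≠ 0 := by positivity
        field_simp
        ring
      rw [← hi0]
      have hfirst : Real.exp (κ * 0) * V 0 x ≤ 0 := by simpa using h0 x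
      refine (add_le_of_nonpos_left hfirst).trans ?_
      refine intervalIntegral.integral_mono_on ht.1 hint
        (Continuous.intervalIntegrable (by fun_prop) _ _) fun r hr => ?_
      have hr' := hsub hr
      set E := A' * (κ * r) ^ n / n.factorial with hE
      have hE0 : 0 ≤ E := by
        have : 0 ≤ κ * r := mul_nonneg hκ0 hr.1
        positivity
      have e1 : κ * Real.exp (κ * r) * V r x + Real.exp (κ * r) * w r x ≤
          ∑ i ∈ s, a i r x * (Real.exp (κ * r) * V r (y i x)) +
            (κ - ∑ i ∈ s, a i r x - c r x) * (Real.exp (κ * r) * V r x) := by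
        have := mul_le_mul_of_nonneg_left (hle r hr' x) (Real.exp_pos (κ * r)).le
        have e2 : ∑ i ∈ s, a i r x * (Real.exp (κ * r) * V r (y i x)) +
            (κ - ∑ i ∈ s, a i r x - c r x) * (Real.exp (κ * r) * V r x) =
            κ * Real.exp (κ * r) * V r x + Real.exp (κ * r) *
            (∑ i ∈ s, a i r x * (V r (y i x) - V r x) - c r x * V r x) := by
          have h1 : ∑ i ∈ s, a i r x * (V r (y i x) - V r x) =
              ∑ i ∈ s, a i r x * V r (y i x) - (∑ i ∈ s, a i r x) * V r x := by
            rw [Finset.sum_mul, ← Finset.sum_sub_distrib]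
            exact Finset.sum_congr rfl fun i _ => by ring
          have h2 : ∑ i ∈ s, a i r x * (Real.exp (κ * r) * V r (y i x)) =
              Real.exp (κ * r) * ∑ i ∈ s, a i r x * V r (y i x) := by
            rw [Finset.mul_sum]
            exact Finset.sum_congr rfl fun i _ => by ring
          rw [h1, h2]; ring
        rw [e2]; linarith
      refine e1.trans ?_
      have e3 : ∑ i ∈ s, a i r x * (Real.exp (κ * r) * V r (y i x)) ≤ ∑ i ∈ s, a i r x * E :=
        Finset.sum_le_sum fun i hi => mul_le_mul_of_nonneg_left (ih r hr' _) (ha i hi r hr' x)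
      have hk := hκ r hr' x
      have hcc := hc r hr' x
      have e4 : (κ - ∑ i ∈ s, a i r x - c r x) * (Real.exp (κ * r) * V r x) ≤
          (κ - ∑ i ∈ s, a i r x - c r x) * E :=
        mul_le_mul_of_nonneg_left (ih r hr' x) (by linarith)
      rw [← Finset.sum_mul] at e3
      have e5 : A' * κ * (κ * r) ^ n / n.factorial = κ * E := by rw [hE]; ring
      rw [e5]
      nlinarith [mul_nonneg hcc hE0]
  have hlim : Tendsto (fun n : ℕ => A' * ((κ * t₀) ^ n / n.factorial)) atTop (𝓝 (A' * 0)) :=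
    (FloorSemiring.tendsto_pow_div_factorial_atTop (κ * t₀)).const_mul A'
  rw [mul_zero] at hlim
  have := ge_of_tendsto hlim (Eventually.of_forall fun n => by
    have := claim n t₀ ht₀ x₀
    rwa [mul_div_assoc] at this)
  exact nonpos_of_mul_nonpos_right this (Real.exp_pos _)

end Time
end Richardson

namespace Richardson

/-! ### Sums over words -/

/-- The sum of `F` over all words of length `n`. -/
def lsum {ι : Type*} [Fintype ι] : ℕ → (List ι → ℝ) → ℝ
  | 0, F => F []
  | n + 1, F => ∑ μ : ι, lsum n fun l => F (μ :: l)

section lsum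
variable {ι : Type*} [Fintype ι]

lemma lsum_zero (F : List ι → ℝ) : lsum 0 F = F [] := rfl
lemma lsum_succ (n : ℕ) (F : List ι → ℝ) : lsum (n + 1) F = ∑ μ : ι, lsum n fun l => F (μ :: l) :=
  rfl

lemma lsum_mono {n : ℕ} {F G : List ι → ℝ} (h : ∀ l, l.length = n → F l ≤ G l) :
    lsum n F ≤ lsum n G := by
  induction n generalizing F G with
  | zero => exact h [] rfl
  | succ n ih => exact Finset.sum_le_sum fun μ _ => ih fun l hl => h _ (by simp [hl])

lemma lsum_congr {n : ℕ} {F G : List ι → ℝ} (h : ∀ l, l.length = n → F l = G l) :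
    lsum n F = lsum n G :=
  le_antisymm (lsum_mono fun l hl => (h l hl).le) (lsum_mono fun l hl => (h l hl).ge)

lemma lsum_add (n : ℕ) (F G : List ι → ℝ) :
    lsum n (fun l => F l + G l) = lsum n F + lsum n G := by
  induction n generalizing F G with
  | zero => rfl
  | succ n ih => simp_rw [lsum_succ, ih, Finset.sum_add_distrib]

lemma lsum_mul_left (n : ℕ) (a : ℝ) (F : List ι → ℝ) :
    lsum n (fun l => a * F l) = a * lsum n F := by
  induction n generalizing F with
  | zero => rfl
  | succ n ih => simp_rw [lsum_succ, ih, Finset.mul_sum]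

lemma lsum_sub (n : ℕ) (F G : List ι → ℝ) :
    lsum n (fun l => F l - G l) = lsum n F - lsum n G := by
  have := lsum_add n F fun l => (-1) * G l
  rw [lsum_mul_left] at this
  simpa [sub_eq_add_neg] using this

lemma lsum_zero_fun (n : ℕ) : lsum n (fun _ : List ι => (0 : ℝ)) = 0 := by
  simpa using lsum_mul_left n 0 fun _ : List ι => (0 : ℝ)

lemma lsum_nonneg {n : ℕ} {F : List ι → ℝ} (h : ∀ l, l.length = n → 0 ≤ F l) : 0 ≤ lsum n F := by
  rw [← lsum_zero_fun (ι := ι) n]; exact lsum_mono h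

lemma lsum_sum {κ : Type*} (s : Finset κ) (n : ℕ) (F : κ → List ι → ℝ) :
    lsum n (fun l => ∑ k ∈ s, F k l) = ∑ k ∈ s, lsum n (F k) := by
  induction n generalizing F with
  | zero => rfl
  | succ n ih => simp_rw [lsum_succ, ih]; exact Finset.sum_comm

lemma lsum_append (s r : ℕ) (F : List ι → ℝ) :
    lsum s (fun σ => lsum r fun ν => F (σ ++ ν)) = lsum (s + r) F := by
  induction s generalizing F with
  | zero => rw [Nat.zero_add]; rfl
  | succ s ih => rw [Nat.succ_add]; exact Finset.sum_congr rfl fun μ _ => ih fun l => F (μ :: l)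

lemma le_lsum {n : ℕ} {F : List ι → ℝ} (h : ∀ l, l.length = n → 0 ≤ F l) (l : List ι)
    (hl : l.length = n) : F l ≤ lsum n F := by
  induction n generalizing F l with
  | zero => rw [List.length_eq_zero_iff.1 hl]; exact le_rfl
  | succ n ih =>
    obtain ⟨μ, l, rfl⟩ := List.exists_cons_of_length_eq_add_one hl
    refine (ih (F := fun l => F (μ :: l)) (fun l hl => h _ (by simp [hl])) l
      (by simpa using hl)).trans ?_
    exact Finset.single_le_sum (f := fun μ => lsum n fun l => F (μ :: l))
      (fun ν _ => lsum_nonneg fun l hl => h _ (by simp [hl])) (Finset.mem_univ μ)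

lemma lsum_eq_sum (n : ℕ) (F : List ι → ℝ) : lsum n F = ∑ v : Fin n → ι, F (List.ofFn v) := by
  induction n generalizing F with
  | zero => simp [lsum_zero]
  | succ n ih =>
    simp_rw [lsum_succ, ih]
    rw [← Fintype.sum_prod_type' fun (μ : ι) (v : Fin n → ι) => F (μ :: List.ofFn v)]
    refine Fintype.sum_equiv (Fin.consEquiv fun _ => ι) _ _ fun p => ?_
    simp [Fin.consEquiv, List.ofFn_succ]

/-- Words factor letter by letter. This turns a sum over words of length `n` into a power, so that
only `∑ w²`, and not the size of the alphabet, enters the constants. -/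
lemma lsum_prod_pow (n : ℕ) (w : ι → ℝ) :
    lsum n (fun l => (l.map w).prod ^ 2) = (∑ μ, w μ ^ 2) ^ n := by
  induction n with
  | zero => simp [lsum_zero]
  | succ n ih =>
    simp_rw [lsum_succ, List.map_cons, List.prod_cons, mul_pow, lsum_mul_left, ih, pow_succ,
      ← Finset.sum_mul]
    ring

end lsum

/-! ### The operators `δ̄` and `T` -/

section Ops
variable {d : ℕ} {co : Coeffs d} {τ : Eu d → ℝ} {τ₀ h : ℝ} {φ ψ : Eu d → ℝ}

lemma smooth_dbar (hφ : ContDiff ℝ ∞ φ) (μ : co.Idx) : ContDiff ℝ ∞ (co.dbar τ τ₀ h μ φ) := by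
  rcases μ with l | i
  · exact contDiff_const.mul ((smooth_comp_add hφ _).sub hφ)
  · exact contDiff_const.mul (smooth_pd hφ)

lemma smooth_shift (hφ : ContDiff ℝ ∞ φ) (μ : co.Idx) : ContDiff ℝ ∞ (co.shift h μ φ) := by
  rcases μ with l | i
  · exact smooth_comp_add hφ _
  · exact hφ

lemma dbar_mul (hφ : ContDiff ℝ ∞ φ) (hψ : ContDiff ℝ ∞ ψ) (μ : co.Idx) :
    co.dbar τ τ₀ h μ (fun x => φ x * ψ x) = fun x =>
      φ x * co.dbar τ τ₀ h μ ψ x + co.dbar τ τ₀ h μ φ x * co.shift h μ ψ x := by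
  rcases μ with l | i
  · funext x; simp only [Coeffs.dbar, Coeffs.shift]; ring
  · simp only [Coeffs.dbar, Coeffs.shift]
    rw [pd_mul (smooth_differentiable hφ) (smooth_differentiable hψ)]
    funext x; ring

lemma dbar_add (hφ : Differentiable ℝ φ) (hψ : Differentiable ℝ ψ) (μ : co.Idx) :
    co.dbar τ τ₀ h μ (fun x => φ x + ψ x) = fun x =>
      co.dbar τ τ₀ h μ φ x + co.dbar τ τ₀ h μ ψ x := by
  rcases μ with l | i
  · funext x; simp only [Coeffs.dbar]; ring
  · simp only [Coeffs.dbar]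
    rw [pd_add hφ hψ]
    funext x; ring

lemma dbar_const_mul (a : ℝ) (hφ : Differentiable ℝ φ) (μ : co.Idx) :
    co.dbar τ τ₀ h μ (fun x => a * φ x) = fun x => a * co.dbar τ τ₀ h μ φ x := by
  rcases μ with l | i
  · funext x; simp only [Coeffs.dbar]; ring
  · simp only [Coeffs.dbar]
    rw [pd_const_mul a hφ]
    funext x; ring

lemma dbar_comp_add (v : Eu d) (μ : co.Idx) :
    co.dbar τ τ₀ h μ (fun x => φ (x + v)) = fun x => co.dbar τ τ₀ h μ φ (x + v) := by
  rcases μ with l | i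
  · funext x; simp only [Coeffs.dbar, add_right_comm]
  · simp only [Coeffs.dbar]; rw [pd_comp_add]

lemma shift_dbar (μ ν : co.Idx) :
    co.shift h μ (co.dbar τ τ₀ h ν φ) = co.dbar τ τ₀ h ν (co.shift h μ φ) := by
  rcases μ with l | i
  · exact (dbar_comp_add _ ν).symm
  · rfl

lemma shift_comm (μ ν : co.Idx) :
    co.shift h μ (co.shift h ν φ) = co.shift h ν (co.shift h μ φ) := by
  rcases μ with l | i <;> rcases ν with k | j <;> simp only [Coeffs.shift, add_right_comm]

lemma fdiff_comp_add (v w : Eu d) :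
    fdiff h v (fun x => φ (x + w)) = fun x => fdiff h v φ (x + w) := by
  funext x; simp only [fdiff, add_right_comm]

lemma dbar_sub (hφ : Differentiable ℝ φ) (hψ : Differentiable ℝ ψ) (μ : co.Idx) :
    co.dbar τ τ₀ h μ (fun x => φ x - ψ x) = fun x =>
      co.dbar τ τ₀ h μ φ x - co.dbar τ τ₀ h μ ψ x := by
  have := dbar_add (co := co) (τ := τ) (τ₀ := τ₀) (h := h) hφ (hψ.const_mul (-1)) μ
  rw [dbar_const_mul (-1) hψ] at this
  simpa [sub_eq_add_neg] using this

lemma dbar_fdiff (hφ : ContDiff ℝ ∞ φ) (v : Eu d) (μ : co.Idx) :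
    co.dbar τ τ₀ h μ (fdiff h v φ) = fdiff h v (co.dbar τ τ₀ h μ φ) := by
  unfold fdiff
  rw [dbar_const_mul _ (smooth_differentiable ((smooth_comp_add hφ _).sub hφ)),
    dbar_sub (smooth_differentiable (smooth_comp_add hφ _)) (smooth_differentiable hφ),
    dbar_comp_add]

lemma shift_fdiff (v : Eu d) (μ : co.Idx) :
    co.shift h μ (fdiff h v φ) = fdiff h v (co.shift h μ φ) := by
  rcases μ with l | i
  · exact (fdiff_comp_add _ _).symm
  · rfl

lemma pdl_dbar (hφ : ContDiff ℝ ∞ φ) (I : List (Fin d)) (μ : co.Idx) :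
    pdl I (co.dbar τ τ₀ h μ φ) = co.dbar τ τ₀ h μ (pdl I φ) := by
  rcases μ with l | i
  · simp only [Coeffs.dbar]
    rw [pdl_const_mul _ ((smooth_comp_add hφ _).sub hφ), pdl_sub (smooth_comp_add hφ _) hφ,
      pdl_comp_add]
  · simp only [Coeffs.dbar]
    rw [pdl_const_mul _ (smooth_pd hφ), pdl_pd hφ]

lemma pdl_shift (I : List (Fin d)) (μ : co.Idx) :
    pdl I (co.shift h μ φ) = co.shift h μ (pdl I φ) := by
  rcases μ with l | i
  · exact pdl_comp_add _ I
  · rfl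

lemma dbar_comm (hφ : ContDiff ℝ ∞ φ) (μ ν : co.Idx) :
    co.dbar τ τ₀ h μ (co.dbar τ τ₀ h ν φ) = co.dbar τ τ₀ h ν (co.dbar τ τ₀ h μ φ) := by
  rcases ν with k | j
  · change co.dbar τ τ₀ h μ (fun x => τ k.1 * (1 / h) * (φ (x + h • k.1) - φ x)) = _
    rw [dbar_const_mul _ (smooth_differentiable ((smooth_comp_add hφ _).sub hφ)),
      dbar_sub (smooth_differentiable (smooth_comp_add hφ _)) (smooth_differentiable hφ),
      dbar_comp_add]
    rfl
  · change co.dbar τ τ₀ h μ (fun x => τ₀ * pd j φ x) = fun x => τ₀ * pd j (co.dbar τ τ₀ h μ φ) x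
    rw [dbar_const_mul _ (smooth_differentiable (smooth_pd hφ))]
    have := pdl_dbar (co := co) (τ := τ) (τ₀ := τ₀) (h := h) hφ [j] μ
    simp only [pdl_cons, pdl_nil] at this
    rw [this]

variable (co τ τ₀ h) in
/-- The composition of the operators `δ̄_μ` along a word. -/
noncomputable def dl (l : List co.Idx) (φ : Eu d → ℝ) : Eu d → ℝ := l.foldr (co.dbar τ τ₀ h) φ

variable (co h) in
/-- The composition of the shifts `T_μ` along a word. -/
noncomputable def tl (l : List co.Idx) (φ : Eu d → ℝ) : Eu d → ℝ := l.foldr (co.shift h) φ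

lemma smooth_dl (hφ : ContDiff ℝ ∞ φ) (l : List co.Idx) : ContDiff ℝ ∞ (dl co τ τ₀ h l φ) := by
  induction l with
  | nil => exact hφ
  | cons μ l ih => exact smooth_dbar ih μ

lemma smooth_tl (hφ : ContDiff ℝ ∞ φ) (l : List co.Idx) : ContDiff ℝ ∞ (tl co h l φ) := by
  induction l with
  | nil => exact hφ
  | cons μ l ih => exact smooth_shift ih μ

@[simp] lemma dl_nil : dl co τ τ₀ h [] φ = φ := rfl
@[simp] lemma dl_cons (μ : co.Idx) (l : List co.Idx) :
    dl co τ τ₀ h (μ :: l) φ = co.dbar τ τ₀ h μ (dl co τ τ₀ h l φ) := rfl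
@[simp] lemma tl_nil : tl co h [] φ = φ := rfl
@[simp] lemma tl_cons (μ : co.Idx) (l : List co.Idx) :
    tl co h (μ :: l) φ = co.shift h μ (tl co h l φ) := rfl

lemma dl_dbar (hφ : ContDiff ℝ ∞ φ) (μ : co.Idx) (l : List co.Idx) :
    dl co τ τ₀ h l (co.dbar τ τ₀ h μ φ) = co.dbar τ τ₀ h μ (dl co τ τ₀ h l φ) := by
  induction l with
  | nil => rfl
  | cons ν l ih => rw [dl_cons, ih, dbar_comm (smooth_dl hφ l)]; rfl

lemma dl_shift (μ : co.Idx) (l : List co.Idx) :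
    dl co τ τ₀ h l (co.shift h μ φ) = co.shift h μ (dl co τ τ₀ h l φ) := by
  induction l with
  | nil => rfl
  | cons ν l ih => rw [dl_cons, ih, ← shift_dbar]; rfl

lemma tl_shift (μ : co.Idx) (l : List co.Idx) :
    tl co h l (co.shift h μ φ) = co.shift h μ (tl co h l φ) := by
  induction l with
  | nil => rfl
  | cons ν l ih => rw [tl_cons, ih, shift_comm]; rfl

lemma dl_fdiff (hφ : ContDiff ℝ ∞ φ) (v : Eu d) (l : List co.Idx) :
    dl co τ τ₀ h l (fdiff h v φ) = fdiff h v (dl co τ τ₀ h l φ) := by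
  induction l with
  | nil => rfl
  | cons ν l ih => rw [dl_cons, ih, dbar_fdiff (smooth_dl hφ l)]; rfl

lemma tl_fdiff (v : Eu d) (l : List co.Idx) :
    tl co h l (fdiff h v φ) = fdiff h v (tl co h l φ) := by
  induction l with
  | nil => rfl
  | cons ν l ih => rw [tl_cons, ih, shift_fdiff]; rfl

lemma dl_perm (hφ : ContDiff ℝ ∞ φ) {l k : List co.Idx} (hp : l.Perm k) :
    dl co τ τ₀ h l φ = dl co τ τ₀ h k φ := by
  induction hp with
  | nil => rfl
  | cons _ _ ih => rw [dl_cons, ih]; rfl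
  | swap _ _ l => simp only [dl_cons]; rw [dbar_comm (smooth_dl hφ l)]
  | trans _ _ h1 h2 => exact h1.trans h2

lemma dl_add (hφ : ContDiff ℝ ∞ φ) (hψ : ContDiff ℝ ∞ ψ) (l : List co.Idx) :
    dl co τ τ₀ h l (fun x => φ x + ψ x) = fun x => dl co τ τ₀ h l φ x + dl co τ τ₀ h l ψ x := by
  induction l with
  | nil => rfl
  | cons ν l ih => rw [dl_cons, ih, dbar_add (smooth_differentiable (smooth_dl hφ l))
      (smooth_differentiable (smooth_dl hψ l))]; rfl

lemma dl_const_mul (a : ℝ) (hφ : ContDiff ℝ ∞ φ) (l : List co.Idx) :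
    dl co τ τ₀ h l (fun x => a * φ x) = fun x => a * dl co τ τ₀ h l φ x := by
  induction l with
  | nil => rfl
  | cons ν l ih => rw [dl_cons, ih, dbar_const_mul a (smooth_differentiable (smooth_dl hφ l))]; rfl

lemma dl_sub (hφ : ContDiff ℝ ∞ φ) (hψ : ContDiff ℝ ∞ ψ) (l : List co.Idx) :
    dl co τ τ₀ h l (fun x => φ x - ψ x) = fun x => dl co τ τ₀ h l φ x - dl co τ τ₀ h l ψ x := by
  have := dl_add (τ := τ) (τ₀ := τ₀) (h := h) hφ (contDiff_const.mul hψ : ContDiff ℝ ∞ fun x => (-1 : ℝ) * ψ x) l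
  rw [dl_const_mul (-1) hψ] at this
  simpa [sub_eq_add_neg] using this

lemma dl_zero (l : List co.Idx) : dl co τ τ₀ h l (fun _ => 0) = fun _ => 0 := by
  have := dl_const_mul (co := co) (τ := τ) (τ₀ := τ₀) (h := h) (φ := fun _ => 0) 0 contDiff_const l
  simpa using this

lemma dl_sum {κ : Type*} (s : Finset κ) (f : κ → Eu d → ℝ) (hf : ∀ k ∈ s, ContDiff ℝ ∞ (f k))
    (l : List co.Idx) :
    dl co τ τ₀ h l (fun x => ∑ k ∈ s, f k x) = fun x => ∑ k ∈ s, dl co τ τ₀ h l (f k) x := by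
  classical
  induction s using Finset.induction_on with
  | empty => simpa using dl_zero l
  | insert a s ha ih =>
    simp_rw [Finset.sum_insert ha]
    rw [dl_add (hf a (by simp)) (ContDiff.sum fun k hk => hf k (by simp [hk])),
      ih fun k hk => hf k (by simp [hk])]

/-- The Leibniz rule for `δ̄` along words, summed against a symmetric weight. -/
theorem lsum_dl_mul (n : ℕ) : ∀ (X : List co.Idx → ℝ) (a b : Eu d → ℝ),
    (∀ l k, l.Perm k → X l = X k) → ContDiff ℝ ∞ a → ContDiff ℝ ∞ b → ∀ x,
    lsum n (fun l => X l * dl co τ τ₀ h l (fun y => a y * b y) x) =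
      ∑ ij ∈ Finset.HasAntidiagonal.antidiagonal n, (n.choose ij.1 : ℝ) *
        lsum ij.1 fun σ => lsum ij.2 fun ν =>
          X (σ ++ ν) * (dl co τ τ₀ h σ a x * tl co h σ (dl co τ τ₀ h ν b) x) := by
  induction n with
  | zero => intro X a b _ _ _ x; simp [lsum_zero]
  | succ n ih =>
    intro X a b hX ha hb x
    rw [Finset.sum_antidiagonal_choose_succ_mul (fun s r => lsum s fun σ => lsum r fun ν =>
          X (σ ++ ν) * (dl co τ τ₀ h σ a x * tl co h σ (dl co τ τ₀ h ν b) x)) n, lsum_succ]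
    have e : ∀ (μ : co.Idx) (l : List co.Idx), X (μ :: l) *
        dl co τ τ₀ h (μ :: l) (fun y => a y * b y) x =
        X (μ :: l) * dl co τ τ₀ h l (fun y => a y * co.dbar τ τ₀ h μ b y) x +
        X (μ :: l) * dl co τ τ₀ h l (fun y => co.dbar τ τ₀ h μ a y * co.shift h μ b y) x := by
      intro μ l
      rw [dl_cons, ← dl_dbar (ha.mul hb), dbar_mul ha hb,
        dl_add (ha.mul (smooth_dbar hb μ)) ((smooth_dbar ha μ).mul (smooth_shift hb μ)), mul_add]
    have hX' : ∀ μ l k, List.Perm l k → X (μ :: l) = X (μ :: k) := fun μ l k hp =>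
      hX _ _ (hp.cons μ)
    simp_rw [e, lsum_add]
    rw [Finset.sum_add_distrib]
    congr 1
    · rw [Finset.sum_congr rfl fun μ _ => ih (fun l => X (μ :: l)) a (co.dbar τ τ₀ h μ b) (hX' μ)
        ha (smooth_dbar hb μ) x, Finset.sum_comm]
      refine Finset.sum_congr rfl fun ij _ => ?_
      rw [← Finset.mul_sum, ← lsum_sum]
      congr 1
      refine lsum_congr fun σ _ => ?_
      rw [lsum_succ]
      refine Finset.sum_congr rfl fun μ _ => lsum_congr fun ν _ => ?_
      -- The symmetry of the weight moves the letter `μ` from the front of the word to the place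
      -- between `σ` and `ν`; without it no binomial coefficients would arise.
      rw [dl_dbar hb, dl_cons, hX _ _ (List.perm_middle (a := μ) (l₁ := σ) (l₂ := ν)).symm]
    · rw [Finset.sum_congr rfl fun μ _ => ih (fun l => X (μ :: l)) (co.dbar τ τ₀ h μ a)
        (co.shift h μ b) (hX' μ) (smooth_dbar ha μ) (smooth_shift hb μ) x, Finset.sum_comm]
      refine Finset.sum_congr rfl fun ij hij => ?_
      rw [← Finset.mul_sum, lsum_succ, Nat.choose_symm_of_eq_add
        (Finset.HasAntidiagonal.mem_antidiagonal.1 hij).symm]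
      congr 1
      refine Finset.sum_congr rfl fun μ _ => lsum_congr fun σ _ => lsum_congr fun ν _ => ?_
      rw [dl_dbar ha, dl_cons, dl_shift, tl_shift, tl_cons]
      rfl

end Ops
end Richardson

namespace Richardson

/-! ### The reduced structural inequalities and the smooth setting -/

/-- The parameters on which the constants may depend (besides the dimension). -/
structure Prm where
  m : ℕ
  δ : ℝ
  K : ℝ
  τ₀ : ℝ
  c₀ : ℝ
  L : ℝ
  Lτ : ℝ
  M : ℝ

section Defs
variable {d : ℕ}

/-- First structural inequality with the operator `𝒦` replaced by an upper bound. -/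
def Coeffs.Red1 (co : Coeffs d) (τ : Eu d → ℝ) (τ₀ δ K : ℝ) (m : ℕ) (h t : ℝ) : Prop :=
  ∀ φ : Eu d → ℝ, Smb φ → ∀ B, (∀ y, ∑ μ : co.Idx, co.dbar τ τ₀ h μ φ y ^ 2 ≤ B) → ∀ x,
    (m : ℝ) * co.Aop τ τ₀ h t φ x ≤
      (1 - δ) * ∑ μ : co.Idx, co.quad h t (co.dbar τ τ₀ h μ φ) x
      + K * co.quad h t φ x + 2 * (1 - δ) * co.c t x * B

/-- Second structural inequality for finite families of functions, with the operator `𝒦` replaced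
by upper bounds. -/
def Coeffs.Red2 (co : Coeffs d) (τ : Eu d → ℝ) (τ₀ δ K : ℝ) (n : ℕ) (h t : ℝ) : Prop :=
  ∀ (κ : Type) [Fintype κ] (φ : κ → Eu d → ℝ), (∀ k, Smb (φ k)) → ∀ B₂ B₁,
    (∀ y, ∑ k, ∑ μ : co.Idx, ∑ ν : co.Idx,
      co.dbar τ τ₀ h μ (co.dbar τ τ₀ h ν (φ k)) y ^ 2 ≤ B₂) →
    (∀ y, ∑ k, ∑ μ : co.Idx, co.dbar τ τ₀ h μ (φ k) y ^ 2 ≤ B₁) → ∀ x,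
      (n : ℝ) * ∑ k, ∑ ν : co.Idx, co.Aop τ τ₀ h t (co.dbar τ τ₀ h ν (φ k)) x
        + (n : ℝ) * ((n : ℝ) - 1) * ∑ k, ∑ μ : co.Idx, ∑ ν : co.Idx,
            co.dbar τ τ₀ h μ (co.dbar τ τ₀ h ν (φ k)) x *
            co.Qop h t (fun ψ => co.dbar τ τ₀ h μ (co.dbar τ τ₀ h ν ψ))
              (co.shift h μ (co.shift h ν (φ k))) x ≤
        (1 - δ) * ∑ k, ∑ μ : co.Idx, ∑ ν : co.Idx,
            co.quad h t (co.dbar τ τ₀ h μ (co.dbar τ τ₀ h ν (φ k))) x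
        + K * ∑ k, ∑ μ : co.Idx, co.quad h t (co.dbar τ τ₀ h μ (φ k)) x
        + 2 * (1 - δ) * co.c t x * B₂ + K * B₁

/-- Coefficients that are smooth in `x` and satisfy all assumptions for all times. -/
structure Good (P : Prm) (h₀ : ℝ) (co : Coeffs d) (τ : Eu d → ℝ) : Prop where
  δ_pos : 0 < P.δ
  δ_le : P.δ ≤ 1
  K_one : 1 ≤ P.K
  τ₀_pos : 0 < P.τ₀
  c₀_pos : 0 < P.c₀
  L_nonneg : 0 ≤ P.L
  M_nonneg : 0 ≤ P.M
  m_pos : 0 < P.m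
  q_sb : ∀ lam ∈ co.Λ₁, SB (co.q lam)
  p_sb : ∀ lam ∈ co.Λ₁, SB (co.p lam)
  c_sb : SB co.c
  q_bd : ∀ I : List (Fin d), I.length ≤ P.m → ∀ t x,
    ∑ lam ∈ co.Λ₁, pdl I (co.q lam t) x ^ 2 ≤ P.M ^ 2
  p_bd : ∀ I : List (Fin d), I.length ≤ P.m → ∀ t x,
    ∑ lam ∈ co.Λ₁, pdl I (co.p lam t) x ^ 2 ≤ P.M ^ 2
  c_bd : ∀ t, Bd P.m P.M (co.c t)
  chi_nonneg : ∀ h ∈ Ioc 0 h₀, ∀ lam ∈ co.Λ₁, ∀ t x, 0 ≤ co.q lam t x + h * co.p lam t x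
  balanced : ∀ t x, ∑ lam ∈ co.Λ₁, co.q lam t x • lam = 0
  c_lower : ∀ t x, P.c₀ ≤ co.c t x
  L_le : ∑ lam ∈ co.Λ₁, ‖lam‖ ^ 2 ≤ P.L ^ 2
  Lτ_le : ∑ lam ∈ co.Λ₁, ‖τ lam • lam‖ ^ 2 ≤ P.Lτ ^ 2
  red1 : ∀ h ∈ Ioc 0 h₀, ∀ t, co.Red1 τ P.τ₀ P.δ P.K P.m h t
  red2 : ∀ h ∈ Ioc 0 h₀, ∀ n ∈ Finset.Icc 1 P.m, ∀ t, co.Red2 τ P.τ₀ P.δ P.K n h t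

/-- All partial derivatives of order exactly `j` are bounded by `C`. -/
def Lv (j : ℕ) (C : ℝ) (φ : Eu d → ℝ) : Prop :=
  ∀ I : List (Fin d), I.length = j → ∀ x, |pdl I φ x| ≤ C

/-- The weight of `δ̄_μ` as a first order operator. -/
noncomputable def Coeffs.wt (co : Coeffs d) (τ : Eu d → ℝ) (τ₀ : ℝ) : co.Idx → ℝ
  | Sum.inl l => d * ‖τ l.1 • l.1‖
  | Sum.inr _ => τ₀

/-- The jump part of the scheme. -/
noncomputable def Coeffs.jump (co : Coeffs d) (h t : ℝ) (φ : Eu d → ℝ) (x : Eu d) : ℝ :=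
  ∑ lam ∈ co.Λ₁, (co.q lam t x + h * co.p lam t x) / h ^ 2 * (φ (x + h • lam) - φ x)

/-- `W_n = ∑_{|l| = n} |δ̄_l φ|²`. -/
noncomputable def Coeffs.W (co : Coeffs d) (τ : Eu d → ℝ) (τ₀ h : ℝ) (n : ℕ) (φ : Eu d → ℝ)
    (x : Eu d) : ℝ := lsum n fun l => dl co τ τ₀ h l φ x ^ 2

/-- `Z_n = ∑_{|l| = n} 𝒬_h(δ̄_l φ)`. -/
noncomputable def Coeffs.Z (co : Coeffs d) (τ : Eu d → ℝ) (τ₀ h t : ℝ) (n : ℕ) (φ : Eu d → ℝ)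
    (x : Eu d) : ℝ := lsum n fun l => co.quad h t (dl co τ τ₀ h l φ) x

end Defs

/-! ### Words of differences as operators of order equal to their length. -/

section Levels
variable {d : ℕ} {co : Coeffs d} {τ : Eu d → ℝ} {τ₀ h : ℝ} {φ ψ : Eu d → ℝ} {C : ℝ} {j : ℕ}

lemma wt_nonneg (hτ₀ : 0 ≤ τ₀) (μ : co.Idx) : 0 ≤ co.wt τ τ₀ μ := by
  rcases μ with l | i
  · simp only [Coeffs.wt]; positivity
  · exact hτ₀

lemma wt_prod_nonneg (hτ₀ : 0 ≤ τ₀) (l : List co.Idx) : 0 ≤ (l.map (co.wt τ τ₀)).prod :=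
  List.prod_nonneg fun a ha => by
    obtain ⟨μ, _, rfl⟩ := List.mem_map.1 ha
    exact wt_nonneg hτ₀ μ

lemma sum_wt_sq : ∑ μ, co.wt τ τ₀ μ ^ 2 = d ^ 2 * ∑ lam ∈ co.Λ₁, ‖τ lam • lam‖ ^ 2 + d * τ₀ ^ 2 := by
  rw [Fintype.sum_sum_type]
  simp only [Coeffs.wt, mul_pow, ← Finset.mul_sum]
  rw [Finset.sum_coe_sort co.Λ₁ fun l => ‖τ l • l‖ ^ 2]
  simp

lemma Lv.fdiff (hh : 0 < h) (v : Eu d) (hφ : ContDiff ℝ ∞ φ) (hb : Lv (j + 1) C φ) :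
    Lv j (d * ‖v‖ * C) (fdiff h v φ) := fun I hI x => by
  rw [pdl_fdiff hφ]
  exact abs_fdiff_le hh v (smooth_differentiable (smooth_pdl hφ I))
    (fun i y => hb (i :: I) (by simpa using hI) y) x

lemma Lv.dd (v : Eu d) (hφ : ContDiff ℝ ∞ φ) (hb : Lv (j + 1) C φ) :
    Lv j (d * ‖v‖ * C) (dd v φ) := fun I hI x => by
  rw [pdl_dd v hφ]
  refine (Finset.abs_sum_le_sum_abs _ _).trans ?_
  calc _ ≤ ∑ _i : Fin d, ‖v‖ * C := Finset.sum_le_sum fun i _ => by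
        rw [abs_mul]
        exact mul_le_mul (abs_coord_le v i) (hb (i :: I) (by simpa using hI) x) (abs_nonneg _)
          (norm_nonneg _)
    _ = _ := by simp; ring

/-- By the mean value inequality a difference quotient costs one derivative, with a factor
independent of `h`. This is the sense in which all the `δ̄_μ` are first-order operators. -/
lemma Lv.dbar (hh : 0 < h) (hτ₀ : 0 ≤ τ₀) (hφ : ContDiff ℝ ∞ φ) (μ : co.Idx)
    (hb : Lv (j + 1) C φ) : Lv j (co.wt τ τ₀ μ * C) (co.dbar τ τ₀ h μ φ) := fun I hI x => by
  rcases μ with l | i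
  · rw [pdl_dbar hφ]
    have h1 := hb.fdiff hh l.1 hφ I hI x
    rw [pdl_fdiff hφ] at h1
    have e : co.dbar τ τ₀ h (Sum.inl l) (pdl I φ) x =
        τ l.1 * Richardson.fdiff h l.1 (pdl I φ) x := by
      simp only [Coeffs.dbar, Richardson.fdiff]; ring
    rw [e, abs_mul]
    refine (mul_le_mul_of_nonneg_left h1 (abs_nonneg _)).trans (le_of_eq ?_)
    simp only [Coeffs.wt, norm_smul, Real.norm_eq_abs]; ring
  · rw [pdl_dbar hφ]
    simp only [Coeffs.dbar, Coeffs.wt, abs_mul, abs_of_nonneg hτ₀]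
    exact mul_le_mul_of_nonneg_left (hb (i :: I) (by simpa using hI) x) hτ₀

lemma Lv.dl (hh : 0 < h) (hτ₀ : 0 ≤ τ₀) (hφ : ContDiff ℝ ∞ φ) (l : List co.Idx)
    (hb : Lv (j + l.length) C φ) :
    Lv j ((l.map (co.wt τ τ₀)).prod * C) (dl co τ τ₀ h l φ) := by
  induction l generalizing j with
  | nil => simpa using hb
  | cons μ l ih =>
    have := (ih (j := j + 1) (by rwa [add_assoc, add_comm 1])).dbar (τ := τ) hh hτ₀ (smooth_dl hφ l) μ
    simpa [mul_assoc] using this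

lemma Lv.tl (l : List co.Idx) (hb : Lv j C φ) : Lv j C (tl co h l φ) := by
  induction l with
  | nil => exact hb
  | cons μ l ih =>
    intro I hI x
    rw [tl_cons, pdl_shift]
    rcases μ with k | i
    · exact ih I hI _
    · exact ih I hI x

lemma Lv.abs_le (hb : Lv 0 C φ) (x : Eu d) : |φ x| ≤ C := hb [] rfl x

lemma tl_const_mul (a : ℝ) (l : List co.Idx) :
    tl co h l (fun x => a * φ x) = fun x => a * tl co h l φ x := by
  induction l with
  | nil => rfl
  | cons μ l ih =>
    rw [tl_cons, ih]
    rcases μ with k | i <;> rfl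

/-- The labels `ℓ^i` are what makes a bound on the differences control genuine derivatives, at the
price of a power of `τ₀`. -/
lemma dl_labels (hφ : ContDiff ℝ ∞ φ) (I : List (Fin d)) :
    dl co τ τ₀ h (I.map Sum.inr) φ = fun x => τ₀ ^ I.length * pdl I φ x := by
  induction I with
  | nil => simp
  | cons i I ih =>
    rw [List.map_cons, dl_cons, ih]
    simp only [Coeffs.dbar]
    rw [pd_const_mul _ (smooth_differentiable (smooth_pdl hφ I))]
    funext x
    rw [List.length_cons, pow_succ, pdl_cons]; ring

lemma abs_pdl_le_W (hτ₀ : 0 < τ₀) (hφ : ContDiff ℝ ∞ φ) (I : List (Fin d)) (x : Eu d) :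
    |pdl I φ x| ≤ Real.sqrt (co.W τ τ₀ h I.length φ x) / τ₀ ^ I.length := by
  rw [le_div_iff₀ (by positivity)]
  apply Real.le_sqrt_of_sq_le
  have := le_lsum (F := fun l => dl co τ τ₀ h l φ x ^ 2) (n := I.length)
    (fun l _ => sq_nonneg _) (I.map Sum.inr) (by simp)
  rw [dl_labels hφ] at this
  refine le_trans (le_of_eq ?_) this
  rw [mul_pow, mul_pow, sq_abs]; ring

lemma W_le (hh : 0 < h) (hτ₀ : 0 ≤ τ₀) (hφ : ContDiff ℝ ∞ φ) (hb : Lv j C φ) (x : Eu d) :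
    co.W τ τ₀ h j φ x ≤ (∑ μ, co.wt τ τ₀ μ ^ 2) ^ j * C ^ 2 := by
  rw [← lsum_prod_pow, mul_comm, ← lsum_mul_left]
  refine lsum_mono fun l hl => ?_
  have h1 := ((show Lv (0 + l.length) C φ by rwa [zero_add, hl]).dl (co := co) (τ := τ)
    hh hτ₀ hφ l).abs_le x
  rw [← sq_abs, mul_comm, ← mul_pow]
  exact pow_le_pow_left₀ (abs_nonneg _) h1 2

end Levels

/-! ### Leibniz expansion of differences of the scheme operator. -/

section Bernstein
variable {d : ℕ} {co : Coeffs d} {τ : Eu d → ℝ} {h h₀ t : ℝ} {φ : Eu d → ℝ} {P : Prm}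

lemma Good.wt_le (hG : Good P h₀ co τ) :
    ∑ μ, co.wt τ P.τ₀ μ ^ 2 ≤ d ^ 2 * P.Lτ ^ 2 + d * P.τ₀ ^ 2 := by
  rw [sum_wt_sq]
  have := mul_le_mul_of_nonneg_left hG.Lτ_le (sq_nonneg (d : ℝ))
  linarith

/-- The numbers `b k` are constants, so the sum is `δ̄_σ` of the single function `∑ b_k f_k`.
Cauchy-Schwarz is applied to the derivatives of that function, which keeps the cardinality of `s`
out of the constant. -/
lemma abs_sum_dl_le {f : Eu d → Eu d → ℝ} {s : Finset (Eu d)} {M β τ₀ : ℝ} (hh : 0 < h)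
    (hτ₀ : 0 ≤ τ₀) (hβ : 0 ≤ β) (hM : 0 ≤ M) (hf : ∀ k ∈ s, ContDiff ℝ ∞ (f k)) (σ : List co.Idx)
    (hfb : ∀ I : List (Fin d), I.length = σ.length → ∀ x, ∑ k ∈ s, pdl I (f k) x ^ 2 ≤ M ^ 2)
    {b : Eu d → ℝ} (hb : ∑ k ∈ s, b k ^ 2 ≤ β ^ 2) (x : Eu d) :
    |∑ k ∈ s, dl co τ τ₀ h σ (f k) x * b k| ≤ (σ.map (co.wt τ τ₀)).prod * (M * β) := by
  have e : ∑ k ∈ s, dl co τ τ₀ h σ (f k) x * b k =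
      dl co τ τ₀ h σ (fun y => ∑ k ∈ s, b k * f k y) x := by
    rw [dl_sum s _ fun k hk => contDiff_const.mul (hf k hk)]
    refine Finset.sum_congr rfl fun k hk => ?_
    rw [dl_const_mul _ (hf k hk), mul_comm]
  rw [e]
  have hs : ContDiff ℝ ∞ (fun y => ∑ k ∈ s, b k * f k y) :=
    ContDiff.sum fun k hk => contDiff_const.mul (hf k hk)
  refine (Lv.dl (j := 0) hh hτ₀ hs σ fun I hI y => ?_).abs_le x
  rw [pdl_sum s _ fun k hk => contDiff_const.mul (hf k hk)]
  have e2 : ∑ k ∈ s, pdl I (fun y => b k * f k y) y = ∑ k ∈ s, pdl I (f k) y * b k :=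
    Finset.sum_congr rfl fun k hk => by rw [pdl_const_mul _ (hf k hk), mul_comm]
  change |∑ k ∈ s, pdl I (fun y => b k * f k y) y| ≤ M * β
  rw [e2]
  apply abs_le_of_sq_le_sq _ (mul_nonneg hM hβ)
  refine (Finset.sum_mul_sq_le_sq_mul_sq s _ _).trans ?_
  rw [mul_pow]
  exact mul_le_mul (hfb I (by simpa using hI) y) hb
    (Finset.sum_nonneg fun _ _ => sq_nonneg _) (sq_nonneg _)

/-- Pointwise `2a(b - a) = (b² - a²) - (b - a)²`. The negative square supplies the dissipation that
absorbs the first-order terms in Bernstein's method. -/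
lemma two_mul_Lh (hh : 0 < h) (x : Eu d) :
    2 * (φ x * co.Lh h t φ x) = co.jump h t (fun y => φ y ^ 2) x - co.quad h t φ x
      - 2 * co.c t x * φ x ^ 2 := by
  have e : ∑ lam ∈ co.Λ₁, (2 * φ x * ((1 / h) * (co.q lam t x * fdiff h lam φ x) +
        co.p lam t x * fdiff h lam φ x)) =
      co.jump h t (fun y => φ y ^ 2) x - co.quad h t φ x := by
    unfold Coeffs.jump Coeffs.quad
    rw [← Finset.sum_sub_distrib]
    refine Finset.sum_congr rfl fun l _ => ?_
    unfold fdiff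
    field_simp
    ring
  rw [← e]
  unfold Coeffs.Lh
  rw [← Finset.mul_sum, Finset.sum_add_distrib, ← Finset.mul_sum]
  ring

/-- The expansion of `δ̄_l (L_h φ)`, summed against a symmetric weight. -/
lemma Good.lsum_dl_Lh (hG : Good P h₀ co τ) (hφ : ContDiff ℝ ∞ φ) (n : ℕ)
    (X : List co.Idx → ℝ) (hX : ∀ l k, l.Perm k → X l = X k) (x : Eu d) :
    lsum n (fun l => X l * dl co τ P.τ₀ h l (co.Lh h t φ) x) =
      ∑ s ∈ Finset.range (n + 1), (n.choose s : ℝ) *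
        lsum s fun σ => lsum (n - s) fun ν => X (σ ++ ν) *
          ((∑ lam ∈ co.Λ₁, dl co τ P.τ₀ h σ (co.q lam t) x *
              ((1 / h) * fdiff h lam (tl co h σ (dl co τ P.τ₀ h ν φ)) x))
            + (∑ lam ∈ co.Λ₁, dl co τ P.τ₀ h σ (co.p lam t) x *
              fdiff h lam (tl co h σ (dl co τ P.τ₀ h ν φ)) x)
            - dl co τ P.τ₀ h σ (co.c t) x * tl co h σ (dl co τ P.τ₀ h ν φ) x) := by
  have hq : ∀ lam ∈ co.Λ₁, ContDiff ℝ ∞ (co.q lam t) := fun l hl => (hG.q_sb l hl).usmooth.smooth t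
  have hp : ∀ lam ∈ co.Λ₁, ContDiff ℝ ∞ (co.p lam t) := fun l hl => (hG.p_sb l hl).usmooth.smooth t
  have hc : ContDiff ℝ ∞ (co.c t) := hG.c_sb.usmooth.smooth t
  have hfd : ∀ lam, ContDiff ℝ ∞ (fun y => (1 / h) * fdiff h lam φ y) := fun l =>
    contDiff_const.mul (smooth_fdiff hφ h l)
  have e : co.Lh h t φ = fun y =>
      ((∑ lam ∈ co.Λ₁, co.q lam t y * ((1 / h) * fdiff h lam φ y)) +
        ∑ lam ∈ co.Λ₁, co.p lam t y * fdiff h lam φ y) - co.c t y * φ y := by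
    funext y; unfold Coeffs.Lh
    rw [Finset.mul_sum]
    congr 2
    exact Finset.sum_congr rfl fun l _ => by ring
  have s1 : ContDiff ℝ ∞ fun y => ∑ lam ∈ co.Λ₁, co.q lam t y * ((1 / h) * fdiff h lam φ y) :=
    ContDiff.sum fun l hl => (hq l hl).mul (hfd l)
  have s2 : ContDiff ℝ ∞ fun y => ∑ lam ∈ co.Λ₁, co.p lam t y * fdiff h lam φ y :=
    ContDiff.sum fun l hl => (hp l hl).mul (smooth_fdiff hφ h l)
  have e2 : ∀ l : List co.Idx, dl co τ P.τ₀ h l (co.Lh h t φ) x =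
      (∑ lam ∈ co.Λ₁, dl co τ P.τ₀ h l (fun y => co.q lam t y * ((1 / h) * fdiff h lam φ y)) x) +
      (∑ lam ∈ co.Λ₁, dl co τ P.τ₀ h l (fun y => co.p lam t y * fdiff h lam φ y) x) -
      dl co τ P.τ₀ h l (fun y => co.c t y * φ y) x := by
    intro l
    rw [e, dl_sub (s1.add s2) (hc.mul hφ), dl_add s1 s2,
      dl_sum _ _ fun k hk => (hq k hk).mul (hfd k),
      dl_sum _ _ fun k hk => (hp k hk).mul (smooth_fdiff hφ h k)]
  simp_rw [e2, mul_sub, mul_add, Finset.mul_sum, lsum_sub, lsum_add, lsum_sum]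
  rw [Finset.sum_congr rfl fun l hl => lsum_dl_mul n X _ _ hX (hq l hl) (hfd l) x,
    Finset.sum_congr rfl fun l hl => lsum_dl_mul n X _ _ hX (hp l hl) (smooth_fdiff hφ h l) x,
    lsum_dl_mul n X _ _ hX hc hφ x, Finset.sum_comm,
    Finset.sum_comm (s := co.Λ₁) (t := Finset.HasAntidiagonal.antidiagonal n),
    ← Finset.sum_add_distrib, ← Finset.sum_sub_distrib,
    Finset.Nat.sum_antidiagonal_eq_sum_range_succ_mk]
  refine Finset.sum_congr rfl fun s _ => ?_
  have e3 : ∀ lam (ν : List co.Idx), dl co τ P.τ₀ h ν (fun y => (1 / h) * fdiff h lam φ y) =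
      fun y => (1 / h) * fdiff h lam (dl co τ P.τ₀ h ν φ) y := fun lam ν => by
    rw [dl_const_mul _ (smooth_fdiff hφ h lam), dl_fdiff hφ]
  simp_rw [e3, dl_fdiff hφ, tl_const_mul, tl_fdiff, ← Finset.mul_sum, mul_sub, mul_add]

end Bernstein
end Richardson

namespace Richardson

/-! ### Smoothness of iterated differences. -/

section Closure
variable {d : ℕ} {S : Type*} {co : Coeffs d} {τ : Eu d → ℝ} {τ₀ h : ℝ}

lemma USmooth.dbar {φ : S → Eu d → ℝ} (hφ : USmooth φ) (μ : co.Idx) :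
    USmooth fun t => co.dbar τ τ₀ h μ (φ t) := by
  rcases μ with l | i
  · exact ((hφ.comp_add _).sub hφ).const_mul _
  · exact (hφ.pd i).const_mul _

lemma USmooth.dl {φ : S → Eu d → ℝ} (hφ : USmooth φ) (l : List co.Idx) :
    USmooth fun t => dl co τ τ₀ h l (φ t) := by
  induction l with
  | nil => exact hφ
  | cons μ l ih => exact ih.dbar μ

lemma Smb.dl {φ : Eu d → ℝ} (hφ : Smb φ) (l : List co.Idx) : Smb (dl co τ τ₀ h l φ) :=
  USmooth.dl hφ l

lemma SB.dbar {φ : ℝ → Eu d → ℝ} (hφ : SB φ) (μ : co.Idx) :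
    SB fun t => co.dbar τ τ₀ h μ (φ t) := by
  rcases μ with l | i
  · exact ((hφ.comp_add _).sub hφ).const_mul _
  · exact (hφ.pd i).const_mul _

lemma SB.dl {φ : ℝ → Eu d → ℝ} (hφ : SB φ) (l : List co.Idx) :
    SB fun t => dl co τ τ₀ h l (φ t) := by
  induction l with
  | nil => exact hφ
  | cons μ l ih => exact ih.dbar μ

end Closure

/-! ### Bernstein's inequality for the sums over words. -/

section Bernstein
variable {d : ℕ} {co : Coeffs d} {τ : Eu d → ℝ} {h h₀ t : ℝ} {φ : Eu d → ℝ} {P : Prm}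

lemma quad_nonneg (hχ : ∀ lam ∈ co.Λ₁, ∀ x, 0 ≤ co.q lam t x + h * co.p lam t x) (x : Eu d) :
    0 ≤ co.quad h t φ x :=
  Finset.sum_nonneg fun l hl => mul_nonneg (hχ l hl x) (sq_nonneg _)

lemma jump_W (n : ℕ) (x : Eu d) {τ₀ : ℝ} : co.jump h t (co.W τ τ₀ h n φ) x =
    lsum n fun l => co.jump h t (fun y => dl co τ τ₀ h l φ y ^ 2) x := by
  unfold Coeffs.jump Coeffs.W
  rw [lsum_sum]
  refine Finset.sum_congr rfl fun k _ => ?_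
  rw [← lsum_sub, ← lsum_mul_left]

/-- The principal part of the expansion of `2 ∑ δ̄_l φ · δ̄_l (L_h φ)`. -/
lemma Good.main_le (hG : Good P h₀ co τ) (hh : h ∈ Ioc 0 h₀) (hφ : Smb φ) (n : ℕ) (hn : n ≤ P.m)
    {B B' : ℝ} (hB : ∀ y, co.W τ P.τ₀ h n φ y ≤ B) (hB'0 : 0 ≤ B')
    (hB' : ∀ k, n = k + 1 → ∀ y, co.W τ P.τ₀ h k φ y ≤ B') (x : Eu d)
    {Y : List co.Idx → List co.Idx → ℝ} {Yq Yp : List co.Idx → List co.Idx → ℝ}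
    (hY : ∀ ν, Y [] ν = co.Lh h t (dl co τ P.τ₀ h ν φ) x)
    (hYq : ∀ σ ν, Yq σ ν = ∑ lam ∈ co.Λ₁, dl co τ P.τ₀ h σ (co.q lam t) x *
              ((1 / h) * fdiff h lam (tl co h σ (dl co τ P.τ₀ h ν φ)) x))
    (hYp : ∀ σ ν, Yp σ ν = ∑ lam ∈ co.Λ₁, dl co τ P.τ₀ h σ (co.p lam t) x *
              fdiff h lam (tl co h σ (dl co τ P.τ₀ h ν φ)) x) :
    2 * ∑ s ∈ Finset.range (n + 1), (n.choose s : ℝ) *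
      lsum s (fun σ => lsum (n - s) fun ν => dl co τ P.τ₀ h (σ ++ ν) φ x *
        (if s = 0 then Y σ ν else if s = 1 then Yq σ ν + Yp σ ν else if s = 2 then Yq σ ν else 0)) ≤
      co.jump h t (co.W τ P.τ₀ h n φ) x - 2 * co.c t x * co.W τ P.τ₀ h n φ x
        - P.δ * co.Z τ P.τ₀ h t n φ x
        + P.K * (if n = 0 then 0 else co.Z τ P.τ₀ h t (n - 1) φ x)
        + 2 * (1 - P.δ) * co.c t x * B + P.K * B' := by
  set m : ℕ → ℝ := fun s => lsum s (fun σ => lsum (n - s) fun ν => dl co τ P.τ₀ h (σ ++ ν) φ x *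
        (if s = 0 then Y σ ν else if s = 1 then Yq σ ν + Yp σ ν else if s = 2 then Yq σ ν else 0))
    with hm
  have hχ : ∀ lam ∈ co.Λ₁, ∀ x, 0 ≤ co.q lam t x + h * co.p lam t x :=
    fun l hl x => hG.chi_nonneg h hh l hl t x
  have hc0 : 0 ≤ co.c t x := hG.c₀_pos.le.trans (hG.c_lower t x)
  have hδ := hG.δ_pos
  have hδ1 := hG.δ_le
  have hK := hG.K_one
  have hB0 : 0 ≤ B := (lsum_nonneg fun l _ => sq_nonneg _).trans (hB x)
  have hZ : ∀ k, 0 ≤ co.Z τ P.τ₀ h t k φ x := fun k => lsum_nonneg fun l _ => quad_nonneg hχ x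
  -- No difference falls on the coefficients: the identity for `2 φ L_h φ` is summed over all words.
  have m0 : 2 * m 0 = co.jump h t (co.W τ P.τ₀ h n φ) x - co.Z τ P.τ₀ h t n φ x
      - 2 * co.c t x * co.W τ P.τ₀ h n φ x := by
    simp only [hm, lsum_zero, List.nil_append, if_true, Nat.sub_zero, hY]
    rw [← lsum_mul_left, jump_W]
    unfold Coeffs.Z Coeffs.W
    rw [← lsum_mul_left n (2 * co.c t x), ← lsum_sub, ← lsum_sub]
    exact lsum_congr fun l _ => two_mul_Lh hh.1 x
  -- One difference falls on `q` or `p`; the sum over this one letter is the form `A_h`.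
  have m1 : ∀ k, n = k + 1 → 2 * m 1 = lsum k fun ν => co.Aop τ P.τ₀ h t (dl co τ P.τ₀ h ν φ) x := by
    intro k hk
    simp only [hm, lsum_succ, lsum_zero]
    rw [← lsum_sum, ← lsum_mul_left]
    simp only [hk, Nat.add_sub_cancel]
    refine lsum_congr fun ν _ => ?_
    unfold Coeffs.Aop
    congr 1
    refine Finset.sum_congr rfl fun μ _ => ?_
    simp only [one_ne_zero, if_false, if_true, hYq, hYp, Coeffs.L0op, Coeffs.Qop,
      List.singleton_append, dl_cons, dl_nil, tl_cons, tl_nil]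
    congr 2
    rw [Finset.mul_sum]
    exact Finset.sum_congr rfl fun l _ => by ring
  have m2 : ∀ k, n = k + 2 → m 2 = lsum k fun ν => ∑ μ : co.Idx, ∑ κ : co.Idx,
      co.dbar τ P.τ₀ h μ (co.dbar τ P.τ₀ h κ (dl co τ P.τ₀ h ν φ)) x *
        co.Qop h t (fun ψ => co.dbar τ P.τ₀ h μ (co.dbar τ P.τ₀ h κ ψ))
          (co.shift h μ (co.shift h κ (dl co τ P.τ₀ h ν φ))) x := by
    intro k hk
    simp only [hm, lsum_succ, lsum_zero]
    simp_rw [← lsum_sum]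
    simp only [hk, Nat.add_sub_cancel]
    refine lsum_congr fun ν _ => ?_
    refine Finset.sum_congr rfl fun μ _ => Finset.sum_congr rfl fun κ _ => ?_
    simp only [OfNat.ofNat_ne_zero, OfNat.ofNat_ne_one, if_false, if_true, hYq, Coeffs.Qop,
      List.cons_append, List.nil_append, dl_cons, dl_nil, tl_cons, tl_nil]
    congr 1
    rw [Finset.mul_sum]
    exact Finset.sum_congr rfl fun l _ => by ring
  rcases n with _ | _ | k
  · simp only [zero_add, Finset.sum_range_one, Nat.choose_self, Nat.cast_one, one_mul, if_true]
    change 2 * m 0 ≤ _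
    rw [m0]
    have h1 := mul_nonneg (mul_nonneg (sub_nonneg.2 hδ1) hc0) hB0
    have h2 := mul_nonneg (zero_le_one.trans hK) hB'0
    have h3 := mul_nonneg (sub_nonneg.2 hδ1) (hZ 0)
    linarith
  · have e : ∑ s ∈ Finset.range (0 + 1 + 1), ((0 + 1).choose s : ℝ) * m s = m 0 + m 1 := by
      simp [Finset.sum_range_succ]
    change 2 * (∑ s ∈ Finset.range (0 + 1 + 1), ((0 + 1).choose s : ℝ) * m s) ≤ _
    rw [e, mul_add, m0, m1 0 rfl, lsum_zero]
    have hr := hG.red1 h hh t φ hφ B (fun y => by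
      simpa [Coeffs.W, lsum_succ, lsum_zero] using hB y) x
    simp only [dl_nil]
    have hZ1 : ∑ μ : co.Idx, co.quad h t (co.dbar τ P.τ₀ h μ φ) x = co.Z τ P.τ₀ h t (0 + 1) φ x := by
      simp [Coeffs.Z, lsum_succ, lsum_zero]
    have hZ0 : co.quad h t φ x = co.Z τ P.τ₀ h t 0 φ x := rfl
    rw [hZ1, hZ0] at hr
    have hm1 : (1 : ℝ) ≤ P.m := by exact_mod_cast hn
    have h1 := mul_nonneg (mul_nonneg (sub_nonneg.2 hδ1) hc0) hB0
    have h2 := mul_nonneg (zero_le_one.trans hK) hB'0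
    have h3 := mul_nonneg (sub_nonneg.2 hδ1) (hZ 1)
    have h4 := mul_nonneg (zero_le_one.trans hK) (hZ 0)
    -- The first structural inequality bounds `m A_h` with `m ≥ 1`. A nonnegative `A_h` is at most
    -- `m A_h`; a negative one is below the right-hand side, which is nonnegative.
    have hA : co.Aop τ P.τ₀ h t φ x ≤ (1 - P.δ) * co.Z τ P.τ₀ h t (0 + 1) φ x
      + P.K * co.Z τ P.τ₀ h t 0 φ x + 2 * (1 - P.δ) * co.c t x * B := by
      rcases le_total 0 (co.Aop τ P.τ₀ h t φ x) with hA | hA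
      · exact (le_mul_of_one_le_left hA hm1).trans hr
      · refine hA.trans ?_
        simp only [zero_add]
        linarith
    simp only [zero_add, one_ne_zero, if_false, Nat.sub_self] at hA ⊢
    linarith
  -- The truncated terms with `s ≥ 3` vanish. The binomials `n` and `n(n-1)/2` reproduce the factors
  -- `n` and `n(n-1)` of the second structural inequality.
  · have e : ∑ s ∈ Finset.range (k + 1 + 1 + 1), ((k + 1 + 1).choose s : ℝ) * m s =
        m 0 + (k + 2) * m 1 + (k + 2) * (k + 1) / 2 * m 2 := by
      rw [Finset.sum_range_succ', Finset.sum_range_succ', Finset.sum_range_succ']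
      have hz : ∀ i, m (i + 1 + 1 + 1) = 0 := by
        intro i
        have h0 : i + 1 + 1 + 1 ≠ 0 := by lia
        have h1 : i + 1 + 1 + 1 ≠ 1 := by lia
        have h2 : i + 1 + 1 + 1 ≠ 2 := by lia
        simp only [hm, h0, h1, h2, if_false, mul_zero, lsum_zero_fun]
      simp only [hz, mul_zero, Finset.sum_const_zero, zero_add, Nat.choose_zero_right,
        Nat.choose_one_right, Nat.cast_choose_two, one_add_one_eq_two]
      push_cast; ring
    change 2 * (∑ s ∈ Finset.range (k + 1 + 1 + 1), ((k + 1 + 1).choose s : ℝ) * m s) ≤ _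
    have hm1 := m1 (k + 1) rfl
    have hm2 := m2 k rfl
    -- Applied to the family of all `δ̄_l φ` with `|l| = k`: adding one or two letters gives the
    -- sums defining `W` and `Z` at levels `k + 1` and `k + 2`.
    have hr := hG.red2 h hh (k + 2) (Finset.mem_Icc.2 ⟨by lia, hn⟩) t (Fin k → co.Idx)
      (fun v => dl co τ P.τ₀ h (List.ofFn v) φ) (fun v => hφ.dl _) B B'
      (fun y => by
        refine le_trans (le_of_eq ?_) (hB y)
        rw [← lsum_eq_sum k fun l => ∑ μ, ∑ ν,
          co.dbar τ P.τ₀ h μ (co.dbar τ P.τ₀ h ν (dl co τ P.τ₀ h l φ)) y ^ 2]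
        simp_rw [lsum_sum]; rfl)
      (fun y => by
        refine le_trans (le_of_eq ?_) (hB' (k + 1) rfl y)
        rw [← lsum_eq_sum k fun l => ∑ μ, co.dbar τ P.τ₀ h μ (dl co τ P.τ₀ h l φ) y ^ 2]
        simp_rw [lsum_sum]; rfl) x
    rw [← lsum_eq_sum k fun l => ∑ ν, co.Aop τ P.τ₀ h t
        (co.dbar τ P.τ₀ h ν (dl co τ P.τ₀ h l φ)) x,
      ← lsum_eq_sum k fun l => ∑ μ, ∑ ν,
          co.quad h t (co.dbar τ P.τ₀ h μ (co.dbar τ P.τ₀ h ν (dl co τ P.τ₀ h l φ))) x,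
      ← lsum_eq_sum k fun l => ∑ μ, co.quad h t (co.dbar τ P.τ₀ h μ (dl co τ P.τ₀ h l φ)) x,
      ← lsum_eq_sum k fun l => ∑ μ : co.Idx, ∑ κ : co.Idx,
      co.dbar τ P.τ₀ h μ (co.dbar τ P.τ₀ h κ (dl co τ P.τ₀ h l φ)) x *
        co.Qop h t (fun ψ => co.dbar τ P.τ₀ h μ (co.dbar τ P.τ₀ h κ ψ))
          (co.shift h μ (co.shift h κ (dl co τ P.τ₀ h l φ))) x, ← hm2] at hr
    have eA : lsum k (fun l => ∑ ν, co.Aop τ P.τ₀ h t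
        (co.dbar τ P.τ₀ h ν (dl co τ P.τ₀ h l φ)) x) = 2 * m 1 := by
      rw [hm1]; simp_rw [lsum_sum]; rfl
    have eZ2 : lsum k (fun l => ∑ μ, ∑ ν,
          co.quad h t (co.dbar τ P.τ₀ h μ (co.dbar τ P.τ₀ h ν (dl co τ P.τ₀ h l φ))) x) =
        co.Z τ P.τ₀ h t (k + 2) φ x := by
      simp_rw [lsum_sum]; rfl
    have eZ1 : lsum k (fun l => ∑ μ, co.quad h t (co.dbar τ P.τ₀ h μ (dl co τ P.τ₀ h l φ)) x) =
        co.Z τ P.τ₀ h t (k + 1) φ x := by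
      simp_rw [lsum_sum]; rfl
    rw [eA, eZ2, eZ1] at hr
    push_cast at hr
    rw [e]
    have hne : ¬ (k + 1 + 1 = 0) := by lia
    simp only [hne, if_false, Nat.add_sub_cancel]
    rw [show k + 1 + 1 = k + 2 from rfl] at *
    have e5 : 2 * (m 0 + (k + 2) * m 1 + (k + 2) * (k + 1) / 2 * m 2) = 2 * m 0 +
      (((k:ℝ) + 2) * (2 * m 1) + (k + 2) * (k + 2 - 1) * m 2) := by ring
    rw [e5, m0]
    linarith

/-- The remaining lower order terms in the expansion of `∑ δ̄_l φ · δ̄_l (L_h φ)`. -/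
lemma Good.rest_le (hG : Good P h₀ co τ) (hh : h ∈ Ioc 0 h₀) (hφ : ContDiff ℝ ∞ φ) {G : ℝ}
    {n : ℕ} (hn : n ≤ P.m) (hG0 : 0 ≤ G) (hLv : ∀ j < n, Lv j G φ) (σ ν : List co.Idx)
    (hl : σ.length + ν.length = n) (x : Eu d) :
    (1 ≤ σ.length → |dl co τ P.τ₀ h σ (co.c t) x * tl co h σ (dl co τ P.τ₀ h ν φ) x| ≤
      ((σ ++ ν).map (co.wt τ P.τ₀)).prod * (P.M * G)) ∧
    (2 ≤ σ.length → |∑ lam ∈ co.Λ₁, dl co τ P.τ₀ h σ (co.p lam t) x *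
        fdiff h lam (tl co h σ (dl co τ P.τ₀ h ν φ)) x| ≤
      ((σ ++ ν).map (co.wt τ P.τ₀)).prod * (P.M * (d * P.L) * G)) ∧
    (3 ≤ σ.length → |∑ lam ∈ co.Λ₁, dl co τ P.τ₀ h σ (co.q lam t) x *
        ((1 / h) * fdiff h lam (tl co h σ (dl co τ P.τ₀ h ν φ)) x)| ≤
      ((σ ++ ν).map (co.wt τ P.τ₀)).prod * (P.M * (d * P.L) ^ 2 * G)) := by
  have hτ₀ := hG.τ₀_pos.le
  have hM := hG.M_nonneg
  have hL := hG.L_nonneg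
  set ψ := tl co h σ (dl co τ P.τ₀ h ν φ) with hψ
  set pν := (ν.map (co.wt τ P.τ₀)).prod with hpν
  set pσ := (σ.map (co.wt τ P.τ₀)).prod with hpσ
  have hpν0 : 0 ≤ pν := wt_prod_nonneg hτ₀ ν
  have hpσ0 : 0 ≤ pσ := wt_prod_nonneg hτ₀ σ
  have hprod : ((σ ++ ν).map (co.wt τ P.τ₀)).prod = pσ * pν := by
    rw [List.map_append, List.prod_append]
  have hψs : ContDiff ℝ ∞ ψ := smooth_tl (smooth_dl hφ ν) σ
  -- The count of orders: the terms with `c`, `p` and `q` cost `0`, `1` and `2` further derivatives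
  -- beyond `|ν|`, hence need `|σ|` at least `1`, `2` and `3` to stay below order `n`.
  have hψL : ∀ j, j + ν.length < n → Lv j (pν * G) ψ := fun j hj =>
    ((hLv _ hj).dl hh.1 hτ₀ hφ ν).tl σ
  rw [hprod]
  refine ⟨fun hs => ?_, fun hs => ?_, fun hs => ?_⟩
  · rw [abs_mul]
    have h1 : |dl co τ P.τ₀ h σ (co.c t) x| ≤ pσ * P.M :=
      (Lv.dl (j := 0) hh.1 hτ₀ (hG.c_sb.usmooth.smooth t) σ
        fun I hI y => hG.c_bd t I (by omega) y).abs_le x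
    have h2 := (hψL 0 (by omega)).abs_le x
    refine (mul_le_mul h1 h2 (abs_nonneg _) (by positivity)).trans (le_of_eq (by ring))
  · refine (abs_sum_dl_le (β := d * P.L * (pν * G)) hh.1 hτ₀ (by positivity) hM
      (fun l hl => (hG.p_sb l hl).usmooth.smooth t) σ
      (fun I hI y => hG.p_bd I (by omega) t y) ?_ x).trans (le_of_eq (by ring))
    have h2 : ∀ lam : Eu d, |fdiff h lam ψ x| ≤ d * ‖lam‖ * (pν * G) := fun lam =>
      ((hψL 1 (by omega)).fdiff (j := 0) hh.1 lam hψs).abs_le x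
    calc ∑ lam ∈ co.Λ₁, fdiff h lam ψ x ^ 2
        ≤ ∑ lam ∈ co.Λ₁, (d * (pν * G)) ^ 2 * ‖lam‖ ^ 2 := Finset.sum_le_sum fun l _ => by
          rw [← sq_abs, ← mul_pow]
          exact pow_le_pow_left₀ (abs_nonneg _) ((h2 l).trans (le_of_eq (by ring))) 2
      _ ≤ (d * (pν * G)) ^ 2 * P.L ^ 2 := by
          rw [← Finset.mul_sum]; exact mul_le_mul_of_nonneg_left hG.L_le (sq_nonneg _)
      _ = _ := by ring
  · have hq := fun l hl => (hG.q_sb l hl).usmooth.smooth t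
    -- The relation `∑ λ q_λ = 0` is linear, hence inherited by `δ̄_σ q_λ`. It cancels the
    -- first-order Taylor terms, and the factor `1 / h²` is then compensated by second-order
    -- remainders.
    have hbal : ∑ lam ∈ co.Λ₁, dl co τ P.τ₀ h σ (co.q lam t) x * dd lam ψ x = 0 := by
      simp only [dd, Finset.mul_sum]
      rw [Finset.sum_comm]
      refine Finset.sum_eq_zero fun i _ => ?_
      have : ∑ lam ∈ co.Λ₁, dl co τ P.τ₀ h σ (co.q lam t) x * (lam i * pd i ψ x) =
          dl co τ P.τ₀ h σ (fun y => ∑ lam ∈ co.Λ₁, lam i * co.q lam t y) x * pd i ψ x := by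
        rw [dl_sum _ _ fun k hk => contDiff_const.mul (hq k hk), Finset.sum_mul]
        refine Finset.sum_congr rfl fun l hl => ?_
        rw [dl_const_mul _ (hq l hl)]; ring
      rw [this]
      have hz : (fun y => ∑ lam ∈ co.Λ₁, lam i * co.q lam t y) = fun _ => 0 := by
        funext y
        have := congrArg (fun v : Eu d => v i) (hG.balanced t y)
        simp only [WithLp.ofLp_sum, Finset.sum_apply] at this
        simpa [mul_comm] using this
      rw [hz, dl_zero, zero_mul]
    have e : ∑ lam ∈ co.Λ₁, dl co τ P.τ₀ h σ (co.q lam t) x * ((1 / h) * fdiff h lam ψ x) =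
        ∑ lam ∈ co.Λ₁, dl co τ P.τ₀ h σ (co.q lam t) x * (taylorRem h lam 2 ψ x / h ^ 2) := by
      have hne := hh.1.ne'
      rw [← sub_zero (∑ lam ∈ co.Λ₁, _ * ((1 / h) * _)), ← mul_zero (1 / h), ← hbal,
        Finset.mul_sum, ← Finset.sum_sub_distrib]
      refine Finset.sum_congr rfl fun l _ => ?_
      simp only [taylorRem, fdiff, Finset.sum_range_succ, Finset.range_zero, Finset.sum_empty,
        Function.iterate_succ_apply, Function.iterate_zero, id, Nat.factorial]
      push_cast
      generalize dl co τ P.τ₀ h σ (co.q l t) x = a, dd l ψ x = b, ψ (x + h • l) = u, ψ x = v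
      have e0 : h * h⁻¹ = 1 := mul_inv_cancel₀ hne
      simp only [div_eq_mul_inv, one_mul, mul_one, pow_zero, pow_one, inv_one, zero_add]
      linear_combination a * b * h⁻¹ * e0
    rw [e]
    refine (abs_sum_dl_le (β := (d * P.L) ^ 2 * (pν * G)) hh.1 hτ₀ (by positivity) hM hq σ
      (fun I hI y => hG.q_bd I (by omega) t y) ?_ x).trans (le_of_eq (by ring))
    have h2 : ∀ lam : Eu d, |taylorRem h lam 2 ψ x / h ^ 2| ≤ (d * ‖lam‖) ^ 2 * (pν * G) := by
      intro lam
      have hdd : ∀ y, |(dd lam)^[2] ψ y| ≤ (d * ‖lam‖) ^ 2 * (pν * G) := fun y => by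
        have := (((hψL 2 (by omega)).dd lam hψs).dd (j := 0) lam (smooth_dd lam hψs)).abs_le y
        exact this.trans (le_of_eq (by ring))
      have := abs_taylorRem_le hh.1.le lam 2 hψs hdd x
      rw [abs_div, abs_of_pos (pow_pos hh.1 2), div_le_iff₀ (pow_pos hh.1 2)]
      linarith
    calc ∑ lam ∈ co.Λ₁, (taylorRem h lam 2 ψ x / h ^ 2) ^ 2
        ≤ ∑ lam ∈ co.Λ₁, (d ^ 2 * (pν * G)) ^ 2 * (‖lam‖ ^ 2) ^ 2 :=
          Finset.sum_le_sum fun l _ => by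
            rw [← sq_abs, ← mul_pow]
            exact pow_le_pow_left₀ (abs_nonneg _) ((h2 l).trans (le_of_eq (by ring))) 2
      _ ≤ (d ^ 2 * (pν * G)) ^ 2 * (P.L ^ 2) ^ 2 := by
          rw [← Finset.mul_sum]
          refine mul_le_mul_of_nonneg_left ?_ (sq_nonneg _)
          refine (Finset.sum_sq_le_sq_sum_of_nonneg fun l _ => sq_nonneg _).trans ?_
          exact pow_le_pow_left₀ (Finset.sum_nonneg fun l _ => sq_nonneg _) hG.L_le 2
      _ = _ := by ring

/-- Pointwise form of Bernstein's estimate. -/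
theorem Good.bernstein (hG : Good P h₀ co τ) (hh : h ∈ Ioc 0 h₀) (hφ : Smb φ) (n : ℕ)
    (hn : n ≤ P.m) {B G η : ℝ} (hB : ∀ y, co.W τ P.τ₀ h n φ y ≤ B) (hG0 : 0 ≤ G)
    (hLv : ∀ j < n, Lv j G φ) (hη : 0 < η) (x : Eu d) :
    2 * lsum n (fun l => dl co τ P.τ₀ h l φ x * dl co τ P.τ₀ h l (co.Lh h t φ) x) ≤
      co.jump h t (co.W τ P.τ₀ h n φ) x - 2 * co.c t x * co.W τ P.τ₀ h n φ x
        - P.δ * co.Z τ P.τ₀ h t n φ x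
        + P.K * (if n = 0 then 0 else co.Z τ P.τ₀ h t (n - 1) φ x)
        + 2 * (1 - P.δ) * co.c t x * B
        + P.K * ((d ^ 2 * P.Lτ ^ 2 + d * P.τ₀ ^ 2) ^ (n - 1) * G ^ 2)
        + 2 ^ n * (η * co.W τ P.τ₀ h n φ x + η⁻¹ * ((d ^ 2 * P.Lτ ^ 2 + d * P.τ₀ ^ 2) ^ n *
          (P.M * (1 + d * P.L + (d * P.L) ^ 2) * G) ^ 2)) := by
  have hτ₀ := hG.τ₀_pos.le
  have hM := hG.M_nonneg
  have hL := hG.L_nonneg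
  have hφs := hφ.smooth
  rw [hG.lsum_dl_Lh hφs n _ (fun l k hp => by rw [dl_perm hφs hp])]
  set w : ℝ := d ^ 2 * P.Lτ ^ 2 + d * P.τ₀ ^ 2 with hw
  have hwle := hG.wt_le
  have hw0 : 0 ≤ ∑ μ, co.wt τ P.τ₀ μ ^ 2 := Finset.sum_nonneg fun _ _ => sq_nonneg _
  set Γ : ℝ := P.M * (1 + d * P.L + (d * P.L) ^ 2) * G with hΓ
  have hΓ0 : 0 ≤ Γ := by positivity
  obtain ⟨Yq, hYq⟩ : ∃ Yq : List co.Idx → List co.Idx → ℝ, ∀ σ ν, Yq σ ν =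
    ∑ lam ∈ co.Λ₁, dl co τ P.τ₀ h σ (co.q lam t) x *
      ((1 / h) * fdiff h lam (tl co h σ (dl co τ P.τ₀ h ν φ)) x) := ⟨_, fun _ _ => rfl⟩
  obtain ⟨Yp, hYp⟩ : ∃ Yp : List co.Idx → List co.Idx → ℝ, ∀ σ ν, Yp σ ν =
    ∑ lam ∈ co.Λ₁, dl co τ P.τ₀ h σ (co.p lam t) x *
      fdiff h lam (tl co h σ (dl co τ P.τ₀ h ν φ)) x := ⟨_, fun _ _ => rfl⟩
  obtain ⟨Yc, hYc⟩ : ∃ Yc : List co.Idx → List co.Idx → ℝ, ∀ σ ν, Yc σ ν =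
    dl co τ P.τ₀ h σ (co.c t) x * tl co h σ (dl co τ P.τ₀ h ν φ) x := ⟨_, fun _ _ => rfl⟩
  -- The part of each term treated by `Good.main_le`; its complement is of lower order in `φ`.
  obtain ⟨Ym, hYm⟩ : ∃ Ym : ℕ → List co.Idx → List co.Idx → ℝ, ∀ s σ ν, Ym s σ ν =
    if s = 0 then Yq σ ν + Yp σ ν - Yc σ ν else if s = 1 then Yq σ ν + Yp σ ν else
      if s = 2 then Yq σ ν else 0 := ⟨_, fun _ _ _ => rfl⟩
  simp_rw [← hYq, ← hYp, ← hYc]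
  have hmain := hG.main_le (t := t) hh hφ n hn hB (B' := w ^ (n - 1) * G ^ 2) (by positivity)
    (fun k hk y => (W_le hh.1 hτ₀ hφs (hLv k (by omega)) y).trans (by
      rw [hk, Nat.add_sub_cancel]
      exact mul_le_mul_of_nonneg_right (pow_le_pow_left₀ hw0 hwle k) (sq_nonneg _))) x
    (Y := fun σ ν => Yq σ ν + Yp σ ν - Yc σ ν) (Yq := Yq) (Yp := Yp)
    (fun ν => by
      simp only [hYq, hYp, hYc, dl_nil, tl_nil, Coeffs.Lh]
      congr 2
      rw [Finset.mul_sum]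
      exact Finset.sum_congr rfl fun l _ => by ring) hYq hYp
  simp_rw [← hYm] at hmain
  have hrest : ∀ s ∈ Finset.range (n + 1), lsum s (fun σ => lsum (n - s) fun ν =>
      dl co τ P.τ₀ h (σ ++ ν) φ x * (Yq σ ν + Yp σ ν - Yc σ ν)) ≤
      lsum s (fun σ => lsum (n - s) fun ν => dl co τ P.τ₀ h (σ ++ ν) φ x * Ym s σ ν) +
      (η * co.W τ P.τ₀ h n φ x + η⁻¹ * (w ^ n * Γ ^ 2)) / 2 := by
    intro s hs
    have hsn : s + (n - s) = n := by have := Finset.mem_range.1 hs; omega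
    have hwn : η⁻¹ * lsum n (fun l : List co.Idx => (l.map (co.wt τ P.τ₀)).prod ^ 2) * Γ ^ 2 ≤
        η⁻¹ * (w ^ n * Γ ^ 2) := by
      rw [lsum_prod_pow, mul_assoc]
      refine mul_le_mul_of_nonneg_left (mul_le_mul_of_nonneg_right
        (pow_le_pow_left₀ hw0 hwle n) (sq_nonneg _)) (inv_nonneg.2 hη.le)
    have hsum : lsum s (fun σ => lsum (n - s) fun ν => (η * dl co τ P.τ₀ h (σ ++ ν) φ x ^ 2 +
        η⁻¹ * Γ ^ 2 * ((σ ++ ν).map (co.wt τ P.τ₀)).prod ^ 2) / 2) =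
        (η * co.W τ P.τ₀ h n φ x +
          η⁻¹ * lsum n (fun l : List co.Idx => (l.map (co.wt τ P.τ₀)).prod ^ 2) * Γ ^ 2) / 2 := by
      rw [lsum_append s (n - s) fun l => (η * dl co τ P.τ₀ h l φ x ^ 2 +
        η⁻¹ * Γ ^ 2 * (l.map (co.wt τ P.τ₀)).prod ^ 2) / 2, hsn]
      simp_rw [div_eq_inv_mul, lsum_mul_left, lsum_add, lsum_mul_left]
      unfold Coeffs.W
      ring
    rw [← sub_le_iff_le_add', ← lsum_sub]
    simp_rw [← lsum_sub, ← mul_sub]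
    refine (lsum_mono fun σ hσ => lsum_mono fun ν hν => ?_).trans
      ((le_of_eq hsum).trans (by linarith))
    obtain ⟨h1, h2, h3⟩ := hG.rest_le (t := t) hh hφs hn hG0 hLv σ ν (by omega) x
    rw [← hYc] at h1; rw [← hYp] at h2; rw [← hYq] at h3
    set Pw := ((σ ++ ν).map (co.wt τ P.τ₀)).prod with hPw
    have hPw0 : 0 ≤ Pw := wt_prod_nonneg hτ₀ _
    have hk1 : 0 ≤ Pw * (P.M * G) := by positivity
    have hk2 : 0 ≤ Pw * (P.M * (d * P.L) * G) := by positivity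
    have hk3 : 0 ≤ Pw * (P.M * (d * P.L) ^ 2 * G) := by positivity
    have hΓe : Pw * Γ = Pw * (P.M * G) + Pw * (P.M * (d * P.L) * G) +
      Pw * (P.M * (d * P.L) ^ 2 * G) := by rw [hΓ]; ring
    have hYle : |Yq σ ν + Yp σ ν - Yc σ ν - Ym s σ ν| ≤ Pw * Γ := by
      rw [hYm, hΓe]
      split_ifs with i0 i1 i2
      · rw [sub_self, abs_zero]; positivity
      · rw [show Yq σ ν + Yp σ ν - Yc σ ν - (Yq σ ν + Yp σ ν) = -Yc σ ν by ring, abs_neg]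
        linarith [h1 (by omega)]
      · have a1 := abs_le.1 (h1 (by omega))
        have a2 := abs_le.1 (h2 (by omega))
        rw [abs_le]; constructor <;> linarith
      · have a1 := abs_le.1 (h1 (by omega))
        have a2 := abs_le.1 (h2 (by omega))
        have a3 := abs_le.1 (h3 (by omega))
        rw [abs_le]; constructor <;> linarith
    set X := dl co τ P.τ₀ h (σ ++ ν) φ x
    set D := Yq σ ν + Yp σ ν - Yc σ ν - Ym s σ ν
    have hD : D ^ 2 ≤ (Pw * Γ) ^ 2 := by
      rw [← sq_abs]; exact pow_le_pow_left₀ (abs_nonneg _) hYle 2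
    -- Young's inequality with a free parameter `η`: the top-order part `η X²` will later be made
    -- small compared with the margin `δ c₀`.
    have hyoung : X * D ≤ (η * X ^ 2 + η⁻¹ * D ^ 2) / 2 := by
      have h0 : η * X ^ 2 + η⁻¹ * D ^ 2 - 2 * (X * D) = η⁻¹ * (η * X - D) ^ 2 := by
        field_simp; ring
      have := mul_nonneg (inv_nonneg.2 hη.le) (sq_nonneg (η * X - D))
      linarith
    have := mul_le_mul_of_nonneg_left hD (inv_nonneg.2 hη.le)
    rw [mul_pow] at this
    linarith
  have hch : ∑ s ∈ Finset.range (n + 1), (n.choose s : ℝ) = 2 ^ n := by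
    exact_mod_cast Nat.sum_range_choose n
  have hfin : ∑ s ∈ Finset.range (n + 1), (n.choose s : ℝ) * lsum s (fun σ => lsum (n - s) fun ν =>
      dl co τ P.τ₀ h (σ ++ ν) φ x * (Yq σ ν + Yp σ ν - Yc σ ν)) ≤
      ∑ s ∈ Finset.range (n + 1), (n.choose s : ℝ) *
        lsum s (fun σ => lsum (n - s) fun ν => dl co τ P.τ₀ h (σ ++ ν) φ x * Ym s σ ν) +
      2 ^ n * ((η * co.W τ P.τ₀ h n φ x + η⁻¹ * (w ^ n * Γ ^ 2)) / 2) := by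
    rw [← hch, Finset.sum_mul, ← Finset.sum_add_distrib]
    refine Finset.sum_le_sum fun s hs => ?_
    rw [← mul_add]
    exact mul_le_mul_of_nonneg_left (hrest s hs) (Nat.cast_nonneg _)
  linarith

end Bernstein
end Richardson

namespace Richardson

/-! ### Stability of the scheme -/

section Stability
variable {d : ℕ} {co : Coeffs d} {h T : ℝ}

lemma Lh_eq_jump (hh : h ≠ 0) (t : ℝ) (φ : Eu d → ℝ) (x : Eu d) :
    co.Lh h t φ x = co.jump h t φ x - co.c t x * φ x := by
  unfold Coeffs.Lh Coeffs.jump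
  rw [Finset.mul_sum, ← Finset.sum_add_distrib]
  congr 1
  refine Finset.sum_congr rfl fun l _ => ?_
  unfold fdiff
  field_simp

/-- Bounds for the coefficients of the scheme, sufficient for the maximum principle. -/
structure Coeffs.Stable (co : Coeffs d) (c₀ h T : ℝ) : Prop where
  chi : ∀ lam ∈ co.Λ₁, ∀ t ∈ Icc 0 T, ∀ x, 0 ≤ co.q lam t x + h * co.p lam t x
  c_lower : ∀ t ∈ Icc 0 T, ∀ x, c₀ ≤ co.c t x
  bdd : ∃ κ : ℝ, ∀ t ∈ Icc 0 T, ∀ x,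
    ∑ lam ∈ co.Λ₁, (co.q lam t x + h * co.p lam t x) / h ^ 2 + co.c t x ≤ κ

/-- One-sided comparison principle for the scheme with zeroth-order coefficient `θ c`. -/
lemma Coeffs.Stable.le_of_inequality {c₀ θ D A : ℝ} (hS : co.Stable c₀ h T) (hc₀ : 0 ≤ c₀)
    (hθ : 0 ≤ θ) {V w : ℝ → Eu d → ℝ}
    (hA : ∀ t ∈ Icc 0 T, ∀ x, V t x ≤ A)
    (hw : ∀ x, IntervalIntegrable (fun t => w t x) volume 0 T)
    (hV : ∀ t ∈ Icc 0 T, ∀ x, V t x = V 0 x + ∫ r in 0..t, w r x)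
    (h0 : ∀ x, V 0 x ≤ D)
    (hle : ∀ t ∈ Icc 0 T, ∀ x, w t x ≤
      co.jump h t (V t) x - θ * co.c t x * V t x + θ * co.c t x * D) :
    ∀ t ∈ Icc 0 T, ∀ x, V t x ≤ D := by
  obtain ⟨κ, hκ⟩ := hS.bdd
  have hc : ∀ t ∈ Icc 0 T, ∀ x, 0 ≤ co.c t x := fun t ht x => hc₀.trans (hS.c_lower t ht x)
  have hχ : ∀ lam ∈ co.Λ₁, ∀ t ∈ Icc 0 T, ∀ x, 0 ≤ (co.q lam t x + h * co.p lam t x) / h ^ 2 :=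
    fun l hl t ht x => div_nonneg (hS.chi l hl t ht x) (sq_nonneg h)
  have key := nonpos_of_jump_inequality co.Λ₁ (T := T) (κ := (1 + θ) * κ) (A := A - D)
    (a := fun lam t x => (co.q lam t x + h * co.p lam t x) / h ^ 2) (fun lam x => x + h • lam)
    (c := fun t x => θ * co.c t x) (V := fun t x => V t x - D) (w := w) hχ
    (fun t ht x => mul_nonneg hθ (hc t ht x))
    (fun t ht x => by
      have h1 := hκ t ht x
      have h2 := Finset.sum_nonneg fun l hl => hχ l hl t ht x
      have h3 := hc t ht x
      have h4 := mul_le_mul_of_nonneg_left h1 hθ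
      have h5 := mul_nonneg hθ h2
      linarith)
    (fun t ht x => by linarith [hA t ht x]) hw
    (fun t ht x => by rw [hV t ht x]; ring) (fun x => by linarith [h0 x])
    (fun t ht x => by
      refine (hle t ht x).trans (le_of_eq ?_)
      unfold Coeffs.jump
      simp only [sub_sub_sub_cancel_right]
      ring)
  intro t ht x
  linarith [key t ht x]

/-- The sup-norm estimate for bounded solutions of the scheme. -/
theorem Coeffs.Stable.bound {c₀ E A : ℝ} (hS : co.Stable c₀ h T) (hc₀ : 0 < c₀) (hh : 0 < h)
    {w e : ℝ → Eu d → ℝ} {w₀ : Eu d → ℝ} (hT : 0 ≤ T)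
    (hA : ∀ t ∈ Icc 0 T, ∀ x, |w t x| ≤ A)
    (hint : ∀ x, IntervalIntegrable (fun t => co.Lh h t (w t) x + e t x) volume 0 T)
    (heq : ∀ t ∈ Icc 0 T, ∀ x, w t x = w₀ x + ∫ s in 0..t, (co.Lh h s (w s) x + e s x))
    (h0 : ∀ x, |w₀ x| ≤ E) (he : ∀ t ∈ Icc 0 T, ∀ x, |e t x| ≤ c₀ * E) :
    ∀ t ∈ Icc 0 T, ∀ x, |w t x| ≤ E := by
  have hw0 : ∀ x, w 0 x = w₀ x := fun x => by
    rw [heq 0 ⟨le_rfl, hT⟩ x, intervalIntegral.integral_same, add_zero]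
  have hE : 0 ≤ E := (abs_nonneg _).trans (h0 0)
  intro t ht x
  -- Since `c ≥ c₀`, the constant `E` is a supersolution and `-E` a subsolution. This is why the
  -- bound does not grow with time.
  have hcE : ∀ t ∈ Icc 0 T, ∀ x, c₀ * E ≤ co.c t x * E := fun t ht x =>
    mul_le_mul_of_nonneg_right (hS.c_lower t ht x) hE
  have up := hS.le_of_inequality hc₀.le zero_le_one (V := w) (D := E) (A := A)
    (w := fun t x => co.Lh h t (w t) x + e t x) (fun t ht x => (abs_le.1 (hA t ht x)).2) hint
    (fun t ht x => by rw [hw0, heq t ht x]) (fun x => by rw [hw0]; exact (abs_le.1 (h0 x)).2)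
    (fun t ht x => by
      rw [Lh_eq_jump hh.ne']
      linarith [(abs_le.1 (he t ht x)).2, hcE t ht x]) t ht x
  have lo := hS.le_of_inequality hc₀.le zero_le_one (V := fun t x => -w t x) (D := E) (A := A)
    (w := fun t x => -(co.Lh h t (w t) x + e t x))
    (fun t ht x => by linarith [(abs_le.1 (hA t ht x)).1]) (fun x => (hint x).neg)
    (fun t ht x => by rw [intervalIntegral.integral_neg, hw0, heq t ht x]; ring)
    (fun x => by rw [hw0]; linarith [(abs_le.1 (h0 x)).1])
    (fun t ht x => by
      have e1 : co.jump h t (fun y => -w t y) x = -co.jump h t (w t) x := by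
        unfold Coeffs.jump
        rw [← Finset.sum_neg_distrib]
        exact Finset.sum_congr rfl fun l _ => by ring
      rw [Lh_eq_jump hh.ne', e1]
      linarith [(abs_le.1 (he t ht x)).1, hcE t ht x]) t ht x
  exact abs_le.2 ⟨by linarith, up⟩

end Stability

/-! ### Smooth solutions of the scheme -/

section Smooth
variable {d : ℕ} {co : Coeffs d} {τ : Eu d → ℝ} {τ₀ h h₀ T : ℝ} {P : Prm}

/-- A smooth solution of the scheme with smooth data. -/
structure SSol (co : Coeffs d) (T h : ℝ) (f : ℝ → Eu d → ℝ) (g : Eu d → ℝ) (u : ℝ → Eu d → ℝ) :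
    Prop where
  f_sb : SB f
  g_smb : Smb g
  u_sb : SB u
  eqn : ∀ t ∈ Icc 0 T, ∀ x, u t x = g x + ∫ s in 0..t, (co.Lh h s (u s) x + f s x)

lemma Good.sb_Lh (hG : Good P h₀ co τ) (h : ℝ) {u : ℝ → Eu d → ℝ} (hu : SB u) :
    SB fun t => co.Lh h t (u t) := by
  have h1 : SB fun t x => ∑ lam ∈ co.Λ₁, co.q lam t x * Richardson.fdiff h lam (u t) x :=
    SB.sum _ fun l hl => (hG.q_sb l hl).mul (hu.fdiff h l)
  have h2 : SB fun t x => ∑ lam ∈ co.Λ₁, co.p lam t x * Richardson.fdiff h lam (u t) x :=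
    SB.sum _ fun l hl => (hG.p_sb l hl).mul (hu.fdiff h l)
  exact ((h1.const_mul (1 / h)).add h2).sub (hG.c_sb.mul hu)

lemma Good.stable (hG : Good P h₀ co τ) (hh : h ∈ Ioc 0 h₀) : co.Stable P.c₀ h T where
  chi l hl t _ x := hG.chi_nonneg h hh l hl t x
  c_lower t _ x := hG.c_lower t x
  bdd := by
    have h1 : SB fun t x => ∑ lam ∈ co.Λ₁, (1 / h ^ 2) * (co.q lam t x + h * co.p lam t x) :=
      SB.sum _ fun l hl => ((hG.q_sb l hl).add ((hG.p_sb l hl).const_mul h)).const_mul _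
    obtain ⟨κ, hκ⟩ := (h1.add hG.c_sb).usmooth.bounded
    refine ⟨κ, fun t _ x => le_trans (le_of_eq ?_) (le_of_abs_le (hκ t x))⟩
    congr 1
    exact Finset.sum_congr rfl fun l _ => by ring

lemma dl_integral {φ : ℝ → Eu d → ℝ} (hφ : SB φ) (a b : ℝ) (l : List co.Idx) :
    dl co τ τ₀ h l (fun x => ∫ s in a..b, φ s x) = fun x => ∫ s in a..b, dl co τ τ₀ h l (φ s) x := by
  induction l with
  | nil => rfl
  | cons μ l ih =>
    rw [dl_cons, ih]
    have hl : SB fun t => dl co τ τ₀ h l (φ t) := hφ.dl l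
    rcases μ with k | i
    · funext x
      simp only [dl_cons, Coeffs.dbar]
      rw [intervalIntegral.integral_const_mul, intervalIntegral.integral_sub
        (hl.intervalIntegrable _ _ _) (hl.intervalIntegrable _ _ _)]
    · funext x
      simp only [dl_cons, Coeffs.dbar]
      rw [intervalIntegral.integral_const_mul, hl.pd_integral]

lemma SSol.dl_eq {f : ℝ → Eu d → ℝ} {g : Eu d → ℝ} {u : ℝ → Eu d → ℝ} (hG : Good P h₀ co τ)
    (hu : SSol co T h f g u) (l : List co.Idx) {t : ℝ} (ht : t ∈ Icc 0 T) (x : Eu d) :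
    dl co τ τ₀ h l (u t) x = dl co τ τ₀ h l g x +
      ∫ s in 0..t, (dl co τ τ₀ h l (co.Lh h s (u s)) x + dl co τ τ₀ h l (f s) x) := by
  have hL := hG.sb_Lh h hu.u_sb
  have hR := hL.add hu.f_sb
  have e : u t = fun x => g x + ∫ s in 0..t, (co.Lh h s (u s) x + f s x) := funext (hu.eqn t ht)
  rw [e, dl_add hu.g_smb.smooth (hR.contDiff_integral 0 t), dl_integral hR]
  refine congrArg _ (intervalIntegral.integral_congr fun s _ => ?_)
  rw [dl_add (hL.usmooth.smooth s) (hu.f_sb.usmooth.smooth s)]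

/-- The coefficients are only measurable in time, so the evolution of the squares is recorded in
integrated form, via the product rule for indefinite integrals. -/
lemma SSol.W_eq {f : ℝ → Eu d → ℝ} {g : Eu d → ℝ} {u : ℝ → Eu d → ℝ} (hG : Good P h₀ co τ)
    (hu : SSol co T h f g u) (n : ℕ) (x : Eu d) (hT : 0 ≤ T) :
    IntervalIntegrable (fun s => 2 * lsum n fun l => dl co τ τ₀ h l (u s) x *
      (dl co τ τ₀ h l (co.Lh h s (u s)) x + dl co τ τ₀ h l (f s) x)) volume 0 T ∧
    ∀ t ∈ Icc 0 T, co.W τ τ₀ h n (u t) x = co.W τ τ₀ h n (u 0) x +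
      ∫ s in 0..t, 2 * lsum n fun l => dl co τ τ₀ h l (u s) x *
        (dl co τ τ₀ h l (co.Lh h s (u s)) x + dl co τ τ₀ h l (f s) x) := by
  have hX : ∀ l : List co.Idx, SB fun t => dl co τ τ₀ h l (u t) := fun l => hu.u_sb.dl l
  have hY : ∀ l : List co.Idx, SB fun t x => dl co τ τ₀ h l (co.Lh h t (u t)) x +
      dl co τ τ₀ h l (f t) x := fun l => ((hG.sb_Lh h hu.u_sb).dl l).add (hu.f_sb.dl l)
  have key : ∀ (l : List co.Idx), ∀ t ∈ Icc 0 T, dl co τ τ₀ h l (u t) x ^ 2 =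
      dl co τ τ₀ h l (u 0) x ^ 2 + ∫ s in 0..t, 2 * (dl co τ τ₀ h l (u s) x *
        (dl co τ τ₀ h l (co.Lh h s (u s)) x + dl co τ τ₀ h l (f s) x)) := by
    intro l t ht
    have hi := (hY l).intervalIntegrable x 0 t
    have he : ∀ r ∈ Icc 0 t, dl co τ τ₀ h l (u r) x = dl co τ τ₀ h l (u 0) x + ∫ s in 0..r,
        (dl co τ τ₀ h l (co.Lh h s (u s)) x + dl co τ τ₀ h l (f s) x) := fun r hr => by
      rw [hu.dl_eq hG l ⟨le_rfl, hT⟩, hu.dl_eq hG l ⟨hr.1, hr.2.trans ht.2⟩,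
        intervalIntegral.integral_same, add_zero]
    have := (mul_eq_integral ht.1 hi hi he he).2
    rw [sq, sq, this]
    congr 1
    exact intervalIntegral.integral_congr fun s _ => by ring
  have hint : ∀ (l : List co.Idx) t, IntervalIntegrable (fun s => 2 * (dl co τ τ₀ h l (u s) x *
      (dl co τ τ₀ h l (co.Lh h s (u s)) x + dl co τ τ₀ h l (f s) x))) volume 0 t :=
    fun l t => (((hX l).mul (hY l)).const_mul 2).intervalIntegrable x 0 t
  have hsum : ∀ s, 2 * lsum n (fun l => dl co τ τ₀ h l (u s) x *
        (dl co τ τ₀ h l (co.Lh h s (u s)) x + dl co τ τ₀ h l (f s) x)) =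
      ∑ v : Fin n → co.Idx, 2 * (dl co τ τ₀ h (List.ofFn v) (u s) x *
        (dl co τ τ₀ h (List.ofFn v) (co.Lh h s (u s)) x +
          dl co τ τ₀ h (List.ofFn v) (f s) x)) := fun s => by
    rw [lsum_eq_sum, Finset.mul_sum]
  simp_rw [hsum]
  refine ⟨?_, fun t ht => ?_⟩
  · have := IntervalIntegrable.sum (μ := volume) (a := 0) (b := T)
      (Finset.univ : Finset (Fin n → co.Idx)) fun v _ => hint (List.ofFn v) T
    simpa only [Finset.sum_fn] using this
  · rw [intervalIntegral.integral_finsetSum fun v _ => hint (List.ofFn v) t]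
    unfold Coeffs.W
    rw [lsum_eq_sum, lsum_eq_sum, ← Finset.sum_add_distrib]
    exact Finset.sum_congr rfl fun v _ => key _ t ht

end Smooth
end Richardson

namespace Richardson

/-! ### A priori estimates for the derivatives -/

section APriori
variable {d : ℕ}

/-- The qualitative bound `A` guarantees that the supremum is finite, so that `θ` times it may be
absorbed on the left; `A` does not enter the conclusion. -/
lemma le_of_sup_contraction {ι : Type*} [Nonempty ι] {w : ι → ℝ} {θ R A : ℝ} (hθ : θ < 1)
    (hA : ∀ i, w i ≤ A) (h : ∀ B, (∀ i, w i ≤ B) → ∀ i, w i ≤ θ * B + R) (i : ι) :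
    w i ≤ R / (1 - θ) := by
  have hb : BddAbove (range w) := ⟨A, by rintro _ ⟨i, rfl⟩; exact hA i⟩
  have h1 : (⨆ i, w i) ≤ θ * (⨆ i, w i) + R := ciSup_le (h _ fun i => le_ciSup hb i)
  rw [le_div_iff₀ (by linarith)]
  have h2 := mul_le_mul_of_nonneg_right (le_ciSup hb i) (sub_nonneg.2 hθ.le)
  linarith

lemma jump_sum {co : Coeffs d} {h t : ℝ} {κ : Type*} (s : Finset κ) (a : κ → ℝ)
    (f : κ → Eu d → ℝ) (x : Eu d) : co.jump h t (fun y => ∑ k ∈ s, a k * f k y) x =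
      ∑ k ∈ s, a k * co.jump h t (f k) x := by
  unfold Coeffs.jump
  simp_rw [Finset.mul_sum]
  rw [Finset.sum_comm]
  refine Finset.sum_congr rfl fun l _ => ?_
  rw [← Finset.sum_sub_distrib, Finset.mul_sum]
  exact Finset.sum_congr rfl fun k _ => by ring

/-- With the weights `(K/δ)^{n-j}`, the term `K Z_j` produced at level `j + 1` cancels exactly the
dissipation `δ Z_j` of level `j`. Only `-δ Z_n` is left. -/
lemma telescope_nonpos (n : ℕ) {δ K : ℝ} (hδ : 0 < δ) (Z : ℕ → ℝ) (hZ : 0 ≤ Z n) :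
    ∑ j ∈ Finset.range (n + 1), (K / δ) ^ (n - j) *
      (-(δ * Z j) + K * (if j = 0 then 0 else Z (j - 1))) ≤ 0 := by
  suffices h : ∀ n : ℕ, ∑ j ∈ Finset.range (n + 1), (K / δ) ^ (n - j) *
      (-(δ * Z j) + K * (if j = 0 then 0 else Z (j - 1))) = -(δ * Z n) by
    rw [h]; nlinarith
  intro n
  induction n with
  | zero => simp
  | succ n ih =>
    rw [Finset.sum_range_succ]
    have e : ∀ j ∈ Finset.range (n + 1), (K / δ) ^ (n + 1 - j) *
        (-(δ * Z j) + K * (if j = 0 then 0 else Z (j - 1))) =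
        K / δ * ((K / δ) ^ (n - j) * (-(δ * Z j) + K * (if j = 0 then 0 else Z (j - 1)))) := by
      intro j hj
      rw [Nat.sub_add_comm (by have := Finset.mem_range.1 hj; omega), pow_succ]; ring
    rw [Finset.sum_congr rfl e, ← Finset.mul_sum, ih]
    simp
    field_simp
    ring

variable {co : Coeffs d} {τ : Eu d → ℝ} {h h₀ T : ℝ} {P : Prm}

/-- The bound for the derivatives of the next order in terms of those of lower orders. -/
lemma Good.next_level (n : ℕ) (P : Prm) (d : ℕ) (hn : n ≤ P.m) (N : ℝ) (hN : 0 ≤ N) :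
    ∃ N' : ℝ, 0 ≤ N' ∧ ∀ (h₀ : ℝ) (co : Coeffs d) (τ : Eu d → ℝ) (h T : ℝ) (f : ℝ → Eu d → ℝ)
      (g : Eu d → ℝ) (u : ℝ → Eu d → ℝ) (F : ℝ), Good P h₀ co τ → h ∈ Ioc 0 h₀ →
      SSol co T h f g u → (∀ t ∈ Icc 0 T, Bd n F (f t)) → Bd n F g →
      (∀ t ∈ Icc 0 T, ∀ j < n, Lv j (N * F) (u t)) → ∀ t ∈ Icc 0 T, Lv n (N' * F) (u t) := by
  set w : ℝ := d ^ 2 * P.Lτ ^ 2 + d * P.τ₀ ^ 2 with hw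
  set Mx : ℝ := P.M * (1 + d * P.L + (d * P.L) ^ 2) with hMx
  set a : ℕ → ℝ := fun j => (P.K / P.δ) ^ (n - j) with ha
  -- Chosen so that `(2 ^ n + 1) η / (2 c₀) = δ / 2`: the Young terms use up half of the margin `δ`.
  set η : ℝ := P.δ * P.c₀ / (2 ^ n + 1) with hη
  set R : ℝ := ∑ j ∈ Finset.range (n + 1), a j * w ^ j
    + (1 - P.δ) * ∑ j ∈ Finset.range n, a j * (w ^ j * N ^ 2)
    + (∑ j ∈ Finset.range (n + 1), a j * (P.K * (w ^ (j - 1) * N ^ 2)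
        + η⁻¹ * (2 ^ j * (w ^ j * (Mx * N) ^ 2) + w ^ j))
      + ∑ j ∈ Finset.range n, a j * ((2 ^ j + 1) * η * (w ^ j * N ^ 2))) / (2 * P.c₀) with hR
  -- The contraction factor is `1 - δ/2`, and `τ₀ ^ n` converts differences along labels into
  -- derivatives. The absolute value is there because `τ₀ > 0` is not yet available.
  refine ⟨Real.sqrt (R / (1 - (1 - P.δ / 2))) / |P.τ₀| ^ n, by positivity, ?_⟩
  intro h₀ co τ h T f g u F hG hh hu hf hg hlow t ht
  have hδ := hG.δ_pos
  have hδ1 := hG.δ_le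
  have hK := hG.K_one
  have hτ₀ := hG.τ₀_pos
  have hc₀ := hG.c₀_pos
  have hT : 0 ≤ T := ht.1.trans ht.2
  have hF : 0 ≤ F := hg.nonneg
  have hη0 : 0 < η := by positivity
  have ha0 : ∀ j, 0 ≤ a j := fun j => by positivity
  have hw0 : 0 ≤ ∑ μ, co.wt τ P.τ₀ μ ^ 2 := Finset.sum_nonneg fun _ _ => sq_nonneg _
  have hwle : ∑ μ, co.wt τ P.τ₀ μ ^ 2 ≤ w := hG.wt_le
  have hwj : ∀ (j : ℕ) (C : ℝ) (φ : Eu d → ℝ), ContDiff ℝ ∞ φ → Lv j C φ → ∀ x,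
      co.W τ P.τ₀ h j φ x ≤ w ^ j * C ^ 2 := fun j C φ hφ hb x =>
    (W_le hh.1 hτ₀.le hφ hb x).trans
      (mul_le_mul_of_nonneg_right (pow_le_pow_left₀ hw0 hwle j) (sq_nonneg C))
  have hus : ∀ t, ContDiff ℝ ∞ (u t) := hu.u_sb.usmooth.smooth
  -- the contraction estimate
  have key : ∀ B, (∀ z : Icc (0 : ℝ) T × Eu d, co.W τ P.τ₀ h n (u z.1) z.2 ≤ B) →
      ∀ z : Icc (0 : ℝ) T × Eu d, co.W τ P.τ₀ h n (u z.1) z.2 ≤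
        (1 - P.δ / 2) * B + R * F ^ 2 := by
    intro B hB
    -- At the top level `B` is an arbitrary upper bound, to be improved; below it the bounds come
    -- from the orders already estimated.
    set Bj : ℕ → ℝ := fun j => if j = n then B else w ^ j * (N * F) ^ 2 with hBj
    have hWB : ∀ j ≤ n, ∀ t ∈ Icc 0 T, ∀ x, co.W τ P.τ₀ h j (u t) x ≤ Bj j := by
      intro j hj t ht x
      simp only [hBj]
      split_ifs with e
      · subst e; exact hB (⟨t, ht⟩, x)
      · exact hwj j _ _ (hus t) (hlow t ht j (by omega)) x
    set E : ℝ := ∑ j ∈ Finset.range (n + 1), a j * (P.K * (w ^ (j - 1) * (N * F) ^ 2)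
      + (2 ^ j + 1) * η * Bj j + η⁻¹ * (2 ^ j * (w ^ j * (Mx * (N * F)) ^ 2) + w ^ j * F ^ 2))
      with hE
    -- A constant supersolution for the weighted sum of the `W_j`: it dominates the initial values,
    -- the share `(1 - δ) B_j` left by the structural inequalities, and the remaining free terms
    -- divided by the least damping `2 c₀`.
    set D : ℝ := ∑ j ∈ Finset.range (n + 1), a j * (w ^ j * F ^ 2) +
      (1 - P.δ) * ∑ j ∈ Finset.range (n + 1), a j * Bj j + E / (2 * P.c₀) with hD
    have hV : ∀ t ∈ Icc 0 T, ∀ x,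
        ∑ j ∈ Finset.range (n + 1), a j * co.W τ P.τ₀ h j (u t) x ≤ D := by
      have hBj0 : ∀ j ≤ n, 0 ≤ Bj j := fun j hj =>
        (lsum_nonneg fun _ _ => sq_nonneg _).trans (hWB j hj t ht 0)
      have hwpos : 0 ≤ w := hw0.trans hwle
      have hE0 : 0 ≤ E := Finset.sum_nonneg fun j hj => by
        have := hBj0 j (by have := Finset.mem_range.1 hj; omega)
        have := ha0 j
        positivity
      have hE1 : 0 ≤ E / (2 * P.c₀) := by positivity
      have hS0 : 0 ≤ (1 - P.δ) * ∑ j ∈ Finset.range (n + 1), a j * Bj j :=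
        mul_nonneg (by linarith) (Finset.sum_nonneg fun j hj => mul_nonneg (ha0 j)
          (hBj0 j (by have := Finset.mem_range.1 hj; omega)))
      have hW := fun (j : ℕ) x => hu.W_eq (τ := τ) (τ₀ := P.τ₀) hG j x hT
      -- The comparison is made with zeroth-order coefficient `2c`, since squares of solutions are
      -- damped at twice the rate.
      refine (hG.stable hh).le_of_inequality hc₀.le zero_le_two
        (w := fun t x => ∑ j ∈ Finset.range (n + 1), a j * (2 * lsum j fun l =>
          dl co τ P.τ₀ h l (u t) x * (dl co τ P.τ₀ h l (co.Lh h t (u t)) x +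
            dl co τ P.τ₀ h l (f t) x)))
        (A := ∑ j ∈ Finset.range (n + 1), a j * Bj j)
        (fun t ht x => Finset.sum_le_sum fun j hj => mul_le_mul_of_nonneg_left
          (hWB j (by have := Finset.mem_range.1 hj; omega) t ht x) (ha0 j))
        (fun x => ?_) (fun t ht x => ?_) (fun x => ?_) (fun t ht x => ?_)
      · have := IntervalIntegrable.sum (μ := volume) (a := 0) (b := T) (Finset.range (n + 1))
          fun j _ => (hW j x).1.const_mul (a j)
        simpa only [Finset.sum_fn] using this
      · rw [intervalIntegral.integral_finsetSum fun j _ =>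
          (((hW j x).1.mono_set (by
            rw [uIcc_of_le hT, uIcc_of_le ht.1]; exact Icc_subset_Icc le_rfl ht.2)).const_mul (a j)),
          ← Finset.sum_add_distrib]
        refine Finset.sum_congr rfl fun j _ => ?_
        rw [(hW j x).2 t ht, intervalIntegral.integral_const_mul (a j), mul_add]
      · have hu0 : u 0 = g := funext fun x => by
          rw [hu.eqn 0 ⟨le_rfl, hT⟩, intervalIntegral.integral_same, add_zero]
        rw [hu0]
        have : ∑ j ∈ Finset.range (n + 1), a j * co.W τ P.τ₀ h j g x ≤
            ∑ j ∈ Finset.range (n + 1), a j * (w ^ j * F ^ 2) :=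
          Finset.sum_le_sum fun j hj => mul_le_mul_of_nonneg_left
            (hwj j F g hu.g_smb.smooth (fun I hI x => hg I (by
              have := Finset.mem_range.1 hj; omega) x) x) (ha0 j)
        linarith
      · have hχ : ∀ lam ∈ co.Λ₁, ∀ x, 0 ≤ co.q lam t x + h * co.p lam t x :=
          fun l hl x => hG.chi_nonneg h hh l hl t x
        have hj : ∀ j ∈ Finset.range (n + 1), a j * (2 * lsum j fun l =>
            dl co τ P.τ₀ h l (u t) x * (dl co τ P.τ₀ h l (co.Lh h t (u t)) x +
              dl co τ P.τ₀ h l (f t) x)) ≤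
            a j * co.jump h t (co.W τ P.τ₀ h j (u t)) x
            - 2 * co.c t x * (a j * co.W τ P.τ₀ h j (u t) x)
            + a j * (-(P.δ * co.Z τ P.τ₀ h t j (u t) x) +
                P.K * (if j = 0 then 0 else co.Z τ P.τ₀ h t (j - 1) (u t) x))
            + 2 * (1 - P.δ) * co.c t x * (a j * Bj j)
            + a j * (P.K * (w ^ (j - 1) * (N * F) ^ 2)
              + (2 ^ j + 1) * η * Bj j
              + η⁻¹ * (2 ^ j * (w ^ j * (Mx * (N * F)) ^ 2) + w ^ j * F ^ 2)) := by
          intro j hjm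
          have hjn : j ≤ n := by have := Finset.mem_range.1 hjm; omega
          have hbern := hG.bernstein (t := t) hh (hu.u_sb.usmooth.smb t) j (hjn.trans hn)
            (hWB j hjn t ht) (mul_nonneg hN hF) (fun i hi => hlow t ht i (by omega)) hη0 x
          have hWf : co.W τ P.τ₀ h j (f t) x ≤ w ^ j * F ^ 2 :=
            hwj j F _ (hu.f_sb.usmooth.smooth t) (fun I hI x => hf t ht I (by omega) x) x
          have hcross : 2 * lsum j (fun l => dl co τ P.τ₀ h l (u t) x * dl co τ P.τ₀ h l (f t) x) ≤
              η * co.W τ P.τ₀ h j (u t) x + η⁻¹ * co.W τ P.τ₀ h j (f t) x := by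
            unfold Coeffs.W
            rw [← lsum_mul_left, ← lsum_mul_left, ← lsum_mul_left, ← lsum_add]
            refine lsum_mono fun l _ => ?_
            generalize dl co τ P.τ₀ h l (u t) x = X, dl co τ P.τ₀ h l (f t) x = Y
            have h0 : η * X ^ 2 + η⁻¹ * Y ^ 2 - 2 * (X * Y) = η⁻¹ * (η * X - Y) ^ 2 := by
              field_simp; ring
            have := mul_nonneg (inv_nonneg.2 hη0.le) (sq_nonneg (η * X - Y))
            linarith
          have hWfη := mul_le_mul_of_nonneg_left hWf (inv_nonneg.2 hη0.le)
          have hWη := mul_le_mul_of_nonneg_left (hWB j hjn t ht x)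
            (show 0 ≤ (2 ^ j + 1) * η by positivity)
          have hsplit : 2 * lsum j (fun l => dl co τ P.τ₀ h l (u t) x *
              (dl co τ P.τ₀ h l (co.Lh h t (u t)) x + dl co τ P.τ₀ h l (f t) x)) =
              2 * lsum j (fun l => dl co τ P.τ₀ h l (u t) x *
                dl co τ P.τ₀ h l (co.Lh h t (u t)) x) +
              2 * lsum j (fun l => dl co τ P.τ₀ h l (u t) x * dl co τ P.τ₀ h l (f t) x) := by
            simp_rw [mul_add, lsum_add]
            ring
          rw [hsplit]
          have := mul_le_mul_of_nonneg_left (add_le_add hbern hcross) (ha0 j)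
          refine this.trans ?_
          have h5 : P.M * (1 + d * P.L + (d * P.L) ^ 2) * (N * F) = Mx * (N * F) := by rw [hMx]
          rw [h5]
          have h6 := mul_le_mul_of_nonneg_left (add_le_add hWfη hWη) (ha0 j)
          linarith
        have hsum := Finset.sum_le_sum hj
        simp only [Finset.sum_add_distrib, Finset.sum_sub_distrib, ← Finset.mul_sum] at hsum
        have htel := telescope_nonpos n hδ (K := P.K) (fun j => co.Z τ P.τ₀ h t j (u t) x)
          (lsum_nonneg fun _ _ => quad_nonneg hχ x)
        rw [jump_sum]
        have hcE : E ≤ 2 * co.c t x * (E / (2 * P.c₀)) := by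
          have := mul_le_mul_of_nonneg_right (hG.c_lower t x) hE1
          calc E = 2 * (P.c₀ * (E / (2 * P.c₀))) := by field_simp
            _ ≤ _ := by linarith
        have hD' : 2 * co.c t x * (∑ j ∈ Finset.range (n + 1), a j * (w ^ j * F ^ 2)) ≥ 0 := by
          have := hc₀.le.trans (hG.c_lower t x)
          have := Finset.sum_nonneg (s := Finset.range (n + 1)) (f := fun j => a j * (w ^ j * F ^ 2))
            fun j _ => by have := ha0 j; positivity
          positivity
        rw [hD]
        linarith
    intro z
    have h1 := hV z.1 z.1.2 z.2
    rw [Finset.sum_range_succ] at h1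
    have h2 : 0 ≤ ∑ j ∈ Finset.range n, a j * co.W τ P.τ₀ h j (u z.1) z.2 :=
      Finset.sum_nonneg fun j _ => mul_nonneg (ha0 j) (lsum_nonneg fun _ _ => sq_nonneg _)
    have h3 : a n = 1 := by simp [ha]
    have h4 : D = (1 - P.δ / 2) * B + R * F ^ 2 := by
      have s1 : ∑ j ∈ Finset.range (n + 1), a j * (w ^ j * F ^ 2) =
          (∑ j ∈ Finset.range (n + 1), a j * w ^ j) * F ^ 2 := by
        rw [Finset.sum_mul]; exact Finset.sum_congr rfl fun j _ => by ring
      have s2 : ∑ j ∈ Finset.range (n + 1), a j * Bj j =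
          (∑ j ∈ Finset.range n, a j * (w ^ j * N ^ 2)) * F ^ 2 + B := by
        rw [Finset.sum_range_succ, h3, Finset.sum_mul, one_mul]
        simp only [hBj, if_true]
        congr 1
        refine Finset.sum_congr rfl fun j hj => ?_
        rw [if_neg (by have := Finset.mem_range.1 hj; omega)]; ring
      have s3 : E = (∑ j ∈ Finset.range (n + 1), a j * (P.K * (w ^ (j - 1) * N ^ 2)
          + η⁻¹ * (2 ^ j * (w ^ j * (Mx * N) ^ 2) + w ^ j))
          + ∑ j ∈ Finset.range n, a j * ((2 ^ j + 1) * η * (w ^ j * N ^ 2))) * F ^ 2 +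
          (2 ^ n + 1) * η * B := by
        have e1 : ∑ j ∈ Finset.range (n + 1), a j * ((2 ^ j + 1) * η * Bj j) =
            (∑ j ∈ Finset.range n, a j * ((2 ^ j + 1) * η * (w ^ j * N ^ 2))) * F ^ 2 +
            (2 ^ n + 1) * η * B := by
          rw [Finset.sum_range_succ, h3, Finset.sum_mul, one_mul]
          simp only [hBj, if_true]
          congr 1
          refine Finset.sum_congr rfl fun j hj => ?_
          rw [if_neg (by have := Finset.mem_range.1 hj; omega)]; ring
        rw [add_mul, add_assoc, ← e1, Finset.sum_mul, ← Finset.sum_add_distrib, hE]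
        exact Finset.sum_congr rfl fun j _ => by ring
      have s4 : (2 ^ n + 1) * η = P.δ * P.c₀ := by rw [hη]; field_simp
      have s5 : ∀ X : ℝ, (X * F ^ 2 + P.δ * P.c₀ * B) / (2 * P.c₀) =
          X / (2 * P.c₀) * F ^ 2 + P.δ / 2 * B := fun X => by field_simp
      rw [hD, hR, s1, s2, s3, s4, s5]
      ring
    rw [h3, one_mul] at h1
    linarith
  have hbound : ∃ A, ∀ z : Icc (0 : ℝ) T × Eu d, co.W τ P.τ₀ h n (u z.1) z.2 ≤ A := by
    obtain ⟨C, hC⟩ := hu.u_sb.usmooth.bdd n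
    exact ⟨w ^ n * C ^ 2, fun z => hwj n C _ (hus z.1) (fun I hI x => hC z.1 I hI.le x) z.2⟩
  obtain ⟨A, hA⟩ := hbound
  have : Nonempty (Icc (0 : ℝ) T × Eu d) := ⟨(⟨t, ht⟩, 0)⟩
  intro I hI x
  have h1 := le_of_sup_contraction (by linarith) hA key (⟨t, ht⟩, x)
  refine (abs_pdl_le_W (co := co) (τ := τ) (h := h) hτ₀ (hus t) I x).trans ?_
  rw [hI, div_mul_eq_mul_div, abs_of_pos hτ₀]
  refine div_le_div_of_nonneg_right ?_ (by positivity)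
  nth_rewrite 1 [← Real.sqrt_sq hF]
  rw [← Real.sqrt_mul' _ (sq_nonneg F), div_mul_eq_mul_div]
  exact Real.sqrt_le_sqrt h1

/-- A priori estimates for smooth solutions of the scheme, uniform in the step. -/
theorem Good.apriori (P : Prm) (d n : ℕ) (hn : n ≤ P.m) :
    ∃ N : ℝ, 0 ≤ N ∧ ∀ (h₀ : ℝ) (co : Coeffs d) (τ : Eu d → ℝ) (h T : ℝ) (f : ℝ → Eu d → ℝ)
      (g : Eu d → ℝ) (u : ℝ → Eu d → ℝ) (F : ℝ), Good P h₀ co τ → h ∈ Ioc 0 h₀ →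
      SSol co T h f g u → (∀ t ∈ Icc 0 T, Bd n F (f t)) → Bd n F g →
      ∀ t ∈ Icc 0 T, Bd n (N * F) (u t) := by
  -- Induction on the number `k` of orders already estimated, starting from none.
  suffices H : ∀ k ≤ n + 1, ∃ N : ℝ, 0 ≤ N ∧ ∀ (h₀ : ℝ) (co : Coeffs d) (τ : Eu d → ℝ) (h T : ℝ)
      (f : ℝ → Eu d → ℝ) (g : Eu d → ℝ) (u : ℝ → Eu d → ℝ) (F : ℝ), Good P h₀ co τ →
      h ∈ Ioc 0 h₀ → SSol co T h f g u → (∀ t ∈ Icc 0 T, Bd n F (f t)) → Bd n F g →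
      ∀ t ∈ Icc 0 T, ∀ j < k, Lv j (N * F) (u t) by
    obtain ⟨N, hN, h⟩ := H (n + 1) le_rfl
    refine ⟨N, hN, fun h₀ co τ h' T f g u F hG hh hu hf hg t ht I hI x => ?_⟩
    exact h h₀ co τ h' T f g u F hG hh hu hf hg t ht I.length (by omega) I rfl x
  intro k
  induction k with
  | zero => exact fun _ => ⟨0, le_rfl, fun _ _ _ _ _ _ _ _ _ _ _ _ _ _ _ _ j hj => by omega⟩
  | succ k ih =>
    intro hk
    obtain ⟨N, hN, h1⟩ := ih (by omega)
    obtain ⟨N', hN', h2⟩ := Good.next_level k P d (by omega) N hN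
    refine ⟨max N N', le_max_of_le_left hN, fun h₀ co τ h T f g u F hG hh hu hf hg => ?_⟩
    have hF := hg.nonneg
    have h1' := h1 h₀ co τ h T f g u F hG hh hu hf hg
    have h2' := h2 h₀ co τ h T f g u F hG hh hu (fun t ht => (hf t ht).mono (by omega) le_rfl)
      (hg.mono (by omega) le_rfl) h1'
    intro t ht j hj I hI x
    rcases Nat.lt_succ_iff_lt_or_eq.1 hj with hj | hj
    · exact (h1' t ht j hj I hI x).trans (mul_le_mul_of_nonneg_right (le_max_left _ _) hF)
    · subst hj
      exact (h2' t ht I hI x).trans (mul_le_mul_of_nonneg_right (le_max_right _ _) hF)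

end APriori
end Richardson

namespace Richardson

/-! ### Existence of smooth solutions of the scheme -/

section Existence
open Filter Topology
variable {d : ℕ} {co : Coeffs d} {τ : Eu d → ℝ} {h h₀ T : ℝ} {P : Prm}

/-- For a fixed step, `L_h` is a bounded operator in every norm of derivatives. The constant depends
on `h` and is used only to construct solutions. -/
lemma Good.bd_Lh (hG : Good P h₀ co τ) (h : ℝ) (n : ℕ) : ∃ κ : ℝ, 0 < κ ∧ ∀ t (φ : Eu d → ℝ) C,
    ContDiff ℝ ∞ φ → Bd n C φ → Bd n (κ * C) (co.Lh h t φ) := by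
  have h1 : ∀ lam ∈ co.Λ₁, ∃ Q, ∀ t, Bd n Q fun x => (1 / h) * co.q lam t x + co.p lam t x :=
    fun l hl => (((hG.q_sb l hl).const_mul (1 / h)).add (hG.p_sb l hl)).usmooth.bdd n
  choose! Q hQ using h1
  obtain ⟨Qc, hQc⟩ := hG.c_sb.usmooth.bdd n
  have hQc0 := (hQc 0).nonneg
  have hQ0 : 0 ≤ ∑ lam ∈ co.Λ₁, 2 ^ n * (Q lam * (|1 / h| * 2)) := Finset.sum_nonneg fun l hl => by
    have := (hQ l hl 0).nonneg
    positivity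
  refine ⟨(∑ lam ∈ co.Λ₁, 2 ^ n * (Q lam * (|1 / h| * 2))) + 2 ^ n * Qc + 1, by positivity,
    fun t φ C hφ hb => ?_⟩
  have e : co.Lh h t φ = fun x => (∑ lam ∈ co.Λ₁, ((1 / h) * co.q lam t x + co.p lam t x) *
      fdiff h lam φ x) - co.c t x * φ x := by
    funext x
    unfold Coeffs.Lh
    rw [Finset.mul_sum, ← Finset.sum_add_distrib]
    congr 1
    exact Finset.sum_congr rfl fun l _ => by ring
  have hs : ∀ l ∈ co.Λ₁, ContDiff ℝ ∞ fun x => (1 / h) * co.q l t x + co.p l t x := fun l hl =>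
    (((hG.q_sb l hl).const_mul (1 / h)).add (hG.p_sb l hl)).usmooth.smooth t
  have hfd : ∀ l : Eu d, Bd n (|1 / h| * (C + C)) (fdiff h l φ) := fun l =>
    Bd.const_mul _ ((smooth_comp_add hφ _).sub hφ) (Bd.sub (smooth_comp_add hφ _) hφ
      (hb.comp_add _) hb)
  rw [e]
  refine (Bd.sub (ContDiff.sum fun l hl => (hs l hl).mul (smooth_fdiff hφ h l))
    ((hG.c_sb.usmooth.smooth t).mul hφ)
    (Bd.sum co.Λ₁ (fun l hl => (hs l hl).mul (smooth_fdiff hφ h l))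
      fun l hl => Bd.mul (hs l hl) (smooth_fdiff hφ h l) (hQ l hl t) (hfd l))
    (Bd.mul (hG.c_sb.usmooth.smooth t) hφ (hQc t) hb)).mono le_rfl ?_
  have hC := hb.nonneg
  have : ∑ lam ∈ co.Λ₁, 2 ^ n * (Q lam * (|1 / h| * (C + C))) =
      (∑ lam ∈ co.Λ₁, 2 ^ n * (Q lam * (|1 / h| * 2))) * C := by
    rw [Finset.sum_mul]; exact Finset.sum_congr rfl fun l _ => by ring
  rw [this]
  linarith

lemma Lh_sum (h t : ℝ) {κ : Type*} (s : Finset κ) (f : κ → Eu d → ℝ) (x : Eu d) :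
    co.Lh h t (fun y => ∑ k ∈ s, f k y) x = ∑ k ∈ s, co.Lh h t (f k) x := by
  have e : ∀ φ : Eu d → ℝ, co.Lh h t φ x = ∑ lam ∈ co.Λ₁, ((1 / h) * co.q lam t x + co.p lam t x) *
      (1 / h * (φ (x + h • lam) - φ x)) - co.c t x * φ x := by
    intro φ
    unfold Coeffs.Lh
    rw [Finset.mul_sum, ← Finset.sum_add_distrib]
    congr 1
    exact Finset.sum_congr rfl fun l _ => by unfold fdiff; ring
  simp_rw [e, Finset.sum_sub_distrib, Finset.mul_sum]
  congr 1
  rw [Finset.sum_comm]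
  refine Finset.sum_congr rfl fun l _ => ?_
  rw [← Finset.sum_sub_distrib, Finset.mul_sum, Finset.mul_sum]

/-- The terms of the Picard series. -/
noncomputable def Coeffs.picard (co : Coeffs d) (T h : ℝ) (f : ℝ → Eu d → ℝ) (g : Eu d → ℝ) :
    ℕ → ℝ → Eu d → ℝ
  | 0 => fun t x => g x + ∫ s in 0..clamp T t, f s x
  | k + 1 => fun t x => ∫ s in 0..clamp T t, co.Lh h s (co.picard T h f g k s) x

variable {f : ℝ → Eu d → ℝ} {g : Eu d → ℝ}

lemma Good.picard_sb (hG : Good P h₀ co τ) (hT : 0 ≤ T) (hf : SB f) (hg : Smb g) (k : ℕ) :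
    SB (co.picard T h f g k) := by
  induction k with
  | zero => exact (SB.const hg).add (hf.integral_clamp hT)
  | succ k ih => exact (hG.sb_Lh h ih).integral_clamp hT

/-- In the norm weighted by `exp (-2κt)` the Picard map contracts by `1/2`, because `κ` times the
integral of `exp (2κs)` over `[0, t]` is `(exp (2κt) - 1) / 2`. Hence the Picard series converges
with all its derivatives on the whole of `[0, T]`. -/
lemma Good.picard_bd (hG : Good P h₀ co τ) (hT : 0 ≤ T) (hf : SB f) (hg : Smb g) (n : ℕ) :
    ∃ C, ∀ k t, Bd n (C * (1 / 2) ^ k) (co.picard T h f g k t) := by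
  obtain ⟨κ, hκ, hL⟩ := hG.bd_Lh h n
  obtain ⟨C, hC⟩ := (hG.picard_sb (h := h) hT hf hg 0).usmooth.bdd n
  have hC0 := (hC 0).nonneg
  have key : ∀ k t, Bd n (C * (1 / 2) ^ k * Real.exp (2 * κ * clamp T t))
      (co.picard T h f g k t) := by
    intro k
    induction k with
    | zero =>
      intro t
      refine (hC t).mono le_rfl ?_
      rw [pow_zero, mul_one]
      refine le_mul_of_one_le_right hC0 (Real.one_le_exp ?_)
      have := (clamp_mem hT t).1
      positivity
    | succ k ih =>
      intro t I hI x
      have hsb := hG.sb_Lh h (hG.picard_sb (h := h) hT hf hg k)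
      change |pdl I (fun x => ∫ s in 0..clamp T t, co.Lh h s (co.picard T h f g k s) x) x| ≤ _
      have ht := clamp_mem hT t
      rw [hsb.pdl_integral]
      have hb : ∀ s ∈ Ioc 0 (clamp T t), ‖pdl I (co.Lh h s (co.picard T h f g k s)) x‖ ≤
          κ * (C * (1 / 2) ^ k) * Real.exp (2 * κ * s) := by
        intro s hs
        have h1 := hL s _ _ ((hG.picard_sb (h := h) hT hf hg k).usmooth.smooth s) (ih s) I hI x
        rw [clamp_eq ⟨hs.1.le, hs.2.trans ht.2⟩] at h1
        rw [Real.norm_eq_abs, mul_assoc]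
        exact h1
      have := intervalIntegral.norm_integral_le_of_norm_le (μ := volume) ht.1
        (Filter.Eventually.of_forall hb)
        (Continuous.intervalIntegrable (by fun_prop) _ _)
      rw [← Real.norm_eq_abs]
      refine this.trans ?_
      rw [intervalIntegral.integral_const_mul, intervalIntegral.integral_comp_mul_left _
        (by positivity : (2 * κ) ≠ 0), integral_exp, mul_zero, Real.exp_zero, smul_eq_mul]
      have e : κ * (C * (1 / 2) ^ k) * ((2 * κ)⁻¹ * (Real.exp (2 * κ * clamp T t) - 1)) =
          C * (1 / 2) ^ (k + 1) * (Real.exp (2 * κ * clamp T t) - 1) := by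
        field_simp
        ring
      rw [e]
      exact mul_le_mul_of_nonneg_left (by linarith) (by positivity)
  refine ⟨C * Real.exp (2 * κ * T), fun k t => (key k t).mono le_rfl ?_⟩
  rw [mul_right_comm]
  refine mul_le_mul_of_nonneg_right (mul_le_mul_of_nonneg_left (Real.exp_le_exp.2 ?_) hC0)
    (by positivity)
  exact mul_le_mul_of_nonneg_left (clamp_mem hT t).2 (by positivity)

/-- Existence of smooth solutions of the scheme. -/
theorem Good.exists_ssol (hG : Good P h₀ co τ) (hT : 0 ≤ T) (hf : SB f) (hg : Smb g) :
    ∃ u, SSol co T h f g u := by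
  set D := co.picard T h f g with hD
  have hDs : ∀ k, SB (D k) := hG.picard_sb hT hf hg
  have hDsm : ∀ k t, ContDiff ℝ ∞ (D k t) := fun k t => (hDs k).usmooth.smooth t
  set S : ℕ → ℝ → Eu d → ℝ := fun N t x => ∑ k ∈ Finset.range N, D k t x with hS
  have hSs : ∀ N, SB (S N) := fun N => SB.sum _ fun k _ => hDs k
  have hsumm : ∀ C : ℝ, Summable fun k : ℕ => C * (1 / 2 : ℝ) ^ k := fun C =>
    (summable_geometric_two).mul_left C
  have hpS : ∀ N t (I : List (Fin d)), pdl I (S N t) =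
      fun x => ∑ k ∈ Finset.range N, pdl I (D k t) x := fun N t I =>
    pdl_sum _ _ (fun k _ => hDsm k t) I
  have hbS : ∀ n, ∃ C, ∀ N t, Bd n C (S N t) := by
    intro n
    obtain ⟨C, hC⟩ := hG.picard_bd (h := h) hT hf hg n
    have hC0 : 0 ≤ C := by simpa using (hC 0 0).nonneg
    refine ⟨∑' k, C * (1 / 2 : ℝ) ^ k, fun N t I hI x => ?_⟩
    rw [hpS]
    refine (Finset.abs_sum_le_sum_abs _ _).trans ?_
    refine (Finset.sum_le_sum fun k _ => hC k t I hI x).trans ?_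
    exact (hsumm C).sum_le_tsum _ fun k _ => by positivity
  set u : ℝ → Eu d → ℝ := fun t x => ∑' k, D k t x with hu
  have hunif : ∀ t (I : List (Fin d)), TendstoUniformly (fun N => pdl I (S N t))
      (fun x => ∑' k, pdl I (D k t) x) atTop := by
    intro t I
    obtain ⟨C, hC⟩ := hG.picard_bd (h := h) hT hf hg I.length
    simp_rw [hpS]
    exact tendstoUniformly_tsum_nat (hsumm C) fun k x => hC k t I le_rfl x
  have hlim : ∀ t x, Tendsto (fun N => S N t x) atTop (𝓝 (u t x)) := fun t x =>
    (hunif t []).tendsto_at x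
  have hcd : ∀ t (n : ℕ), ContDiff ℝ n (u t) ∧ ∀ I : List (Fin d), I.length ≤ n →
      TendstoUniformly (fun j => pdl I (S j t)) (pdl I (u t)) atTop := fun t n =>
    contDiff_of_uniformCauchy n (fun j => S j t) (u t) (fun j => (hSs j).usmooth.smooth t)
      (fun I _ => (tendstoUniformlyOn_univ.2 (hunif t I)).uniformCauchySeqOn) (hlim t)
  have husb : SB u := by
    refine ⟨⟨fun t => contDiff_infty.2 fun n => (hcd t n).1, fun n => ?_⟩, fun x => ?_⟩
    · obtain ⟨C, hC⟩ := hbS n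
      exact ⟨C, fun t I hI x => le_of_tendsto (((hcd t n).2 I hI).tendsto_at x).abs
        (Filter.Eventually.of_forall fun N => hC N t I hI x)⟩
    · exact measurable_of_tendsto_metrizable (fun N => (hSs N).meas x)
        (tendsto_pi_nhds.2 fun t => hlim t x)
  refine ⟨u, hf, hg, husb, fun t ht x => ?_⟩
  -- By linearity the partial sums are the Picard iterates, so the equation follows by dominated
  -- convergence.
  have hrec : ∀ N, S (N + 1) t x = g x + ∫ s in 0..t, (co.Lh h s (S N s) x + f s x) := by
    intro N
    rw [hS]
    simp only
    rw [Finset.sum_range_succ']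
    simp_rw [Lh_sum]
    have hi : ∀ k ∈ Finset.range N, IntervalIntegrable (fun s => co.Lh h s (D k s) x) volume 0 t :=
      fun k _ => (hG.sb_Lh h (hDs k)).intervalIntegrable x 0 t
    have hsi := IntervalIntegrable.sum (μ := volume) (Finset.range N) hi
    simp only [Finset.sum_fn] at hsi
    rw [intervalIntegral.integral_add hsi (hf.intervalIntegrable x 0 t),
      intervalIntegral.integral_finsetSum hi, ← add_assoc, add_comm (g x), add_assoc]
    simp only [hD, Coeffs.picard, clamp_eq ht]
  have hl1 := (hlim t x).comp (tendsto_add_atTop_nat 1)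
  refine tendsto_nhds_unique hl1 ?_
  simp only [Function.comp_def, hrec]
  refine Tendsto.const_add _ ?_
  obtain ⟨C, hC⟩ := hbS 0
  obtain ⟨κ, hκ, hL⟩ := hG.bd_Lh h 0
  obtain ⟨Cf, hCf⟩ := hf.usmooth.bounded
  refine intervalIntegral.tendsto_integral_filter_of_dominated_convergence
    (fun _ => κ * C + Cf) (Filter.Eventually.of_forall fun N =>
      (((hG.sb_Lh h (hSs N)).add hf).meas x).aestronglyMeasurable)
    (Filter.Eventually.of_forall fun N => Filter.Eventually.of_forall fun s _ => ?_)
    (by simp) (Filter.Eventually.of_forall fun s _ => ?_)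
  · exact (abs_add_le _ _).trans (add_le_add
      ((hL s _ _ ((hSs N).usmooth.smooth s) (hC N s)).abs_le x) (hCf s x))
  · refine Tendsto.add_const _ ?_
    unfold Coeffs.Lh fdiff
    refine Tendsto.sub (Tendsto.add (Tendsto.const_mul _ (tendsto_finsetSum _ fun l _ => ?_))
      (tendsto_finsetSum _ fun l _ => ?_)) ((hlim s x).const_mul _)
    · exact (((hlim s _).sub (hlim s x)).const_mul _).const_mul _
    · exact (((hlim s _).sub (hlim s x)).const_mul _).const_mul _

end Existence
end Richardson

namespace Richardson

/-! ### The Taylor expansion of the scheme in the step -/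

section Expansion
variable {d : ℕ} {co : Coeffs d} {τ : Eu d → ℝ} {h h₀ T t C : ℝ} {P : Prm} {φ : Eu d → ℝ} {n : ℕ}

/-- The coefficients of the formal expansion `L_h = ∑_i h^i 𝓛_i`. -/
noncomputable def Coeffs.Lx (co : Coeffs d) (i : ℕ) (t : ℝ) (φ : Eu d → ℝ) (x : Eu d) : ℝ :=
  ∑ lam ∈ co.Λ₁, co.q lam t x * ((1 / (i + 2).factorial) * (dd lam)^[i + 2] φ x)
    + ∑ lam ∈ co.Λ₁, co.p lam t x * ((1 / (i + 1).factorial) * (dd lam)^[i + 1] φ x)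
    - (if i = 0 then co.c t x * φ x else 0)

/-- Symmetry for all times. -/
def Coeffs.Sym (co : Coeffs d) : Prop :=
  ∀ lam ∈ co.Λ₁, -lam ∈ co.Λ₁ ∧ ∀ t x, co.q (-lam) t x = co.q lam t x

/-- Antisymmetry for all times. -/
def Coeffs.Asym (co : Coeffs d) : Prop := ∀ lam ∈ co.Λ₁, ∀ t x, co.p (-lam) t x = -co.p lam t x

lemma Good.sb_Lx (hG : Good P h₀ co τ) (i : ℕ) {u : ℝ → Eu d → ℝ} (hu : SB u) :
    SB fun t => co.Lx i t (u t) := by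
  have h1 : SB fun t x => ∑ lam ∈ co.Λ₁, co.q lam t x *
      ((1 / ((i + 2).factorial : ℝ)) * (dd lam)^[i + 2] (u t) x) :=
    SB.sum _ fun l hl => (hG.q_sb l hl).mul ((hu.dd_iter l (i + 2)).const_mul _)
  have h2 : SB fun t x => ∑ lam ∈ co.Λ₁, co.p lam t x *
      ((1 / ((i + 1).factorial : ℝ)) * (dd lam)^[i + 1] (u t) x) :=
    SB.sum _ fun l hl => (hG.p_sb l hl).mul ((hu.dd_iter l (i + 1)).const_mul _)
  have h3 : SB fun t x => if i = 0 then co.c t x * u t x else 0 := by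
    split_ifs
    · exact hG.c_sb.mul hu
    · exact SB.zero
  exact (h1.add h2).sub h3

/-- One factor `‖λ‖` is kept for the `ℓ²` sum and the others are replaced by their bound `L`. With
`s = 0` the cardinality of `Λ₁` would appear. -/
lemma Good.sum_norm_pow_le (hG : Good P h₀ co τ) {s : ℕ} (hs : 1 ≤ s) {B : ℝ} :
    ∑ lam ∈ co.Λ₁, ((d * ‖lam‖) ^ s * B) ^ 2 ≤ ((d * P.L) ^ s * B) ^ 2 := by
  obtain ⟨s, rfl⟩ := Nat.exists_eq_add_of_le' hs
  have hL := hG.L_nonneg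
  have h1 : ∀ lam ∈ co.Λ₁, ‖lam‖ ≤ P.L := fun l hl => by
    refine abs_le_of_sq_le_sq' ?_ hL |>.2
    exact (Finset.single_le_sum (f := fun lam : Eu d => ‖lam‖ ^ 2) (fun _ _ => sq_nonneg _) hl).trans
      hG.L_le
  calc ∑ lam ∈ co.Λ₁, ((d * ‖lam‖) ^ (s + 1) * B) ^ 2
      ≤ ∑ lam ∈ co.Λ₁, ((d * P.L) ^ s * d * B) ^ 2 * ‖lam‖ ^ 2 :=
        Finset.sum_le_sum fun l hl => by
          have h2 : ((d * ‖l‖) ^ s) ^ 2 ≤ ((d * P.L) ^ s) ^ 2 :=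
            pow_le_pow_left₀ (by positivity) (pow_le_pow_left₀ (by positivity)
              (mul_le_mul_of_nonneg_left (h1 l hl) (Nat.cast_nonneg _)) _) _
          have := mul_le_mul_of_nonneg_right h2
            (show 0 ≤ (d : ℝ) ^ 2 * ‖l‖ ^ 2 * B ^ 2 by positivity)
          calc ((d * ‖l‖) ^ (s + 1) * B) ^ 2 =
                ((d * ‖l‖) ^ s) ^ 2 * ((d : ℝ) ^ 2 * ‖l‖ ^ 2 * B ^ 2) := by ring
            _ ≤ _ := this
            _ = _ := by ring
    _ ≤ ((d * P.L) ^ s * d * B) ^ 2 * P.L ^ 2 := by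
        rw [← Finset.mul_sum]
        exact mul_le_mul_of_nonneg_left hG.L_le (sq_nonneg _)
    _ = _ := by ring

lemma Good.bd_q_sum (hG : Good P h₀ co τ) (hn : n ≤ P.m) {s : ℕ} (hs : 1 ≤ s) {B : ℝ} (hB : 0 ≤ B)
    {g : Eu d → Eu d → ℝ} (hgs : ∀ lam, ContDiff ℝ ∞ (g lam))
    (hg : ∀ lam, Bd n ((d * ‖lam‖) ^ s * B) (g lam)) :
    Bd n (2 ^ n * (P.M * ((d * P.L) ^ s * B))) fun x => ∑ lam ∈ co.Λ₁, co.q lam t x * g lam x := by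
  have := hG.L_nonneg
  exact bd_sum_mul co.Λ₁ (fun l hl => (hG.q_sb l hl).usmooth.smooth t) (fun l _ => hgs l)
    hG.M_nonneg (by positivity) (fun I hI x => hG.q_bd I (hI.trans hn) t x) (fun l _ => hg l)
    (hG.sum_norm_pow_le hs)

lemma Good.bd_p_sum (hG : Good P h₀ co τ) (hn : n ≤ P.m) {s : ℕ} (hs : 1 ≤ s) {B : ℝ} (hB : 0 ≤ B)
    {g : Eu d → Eu d → ℝ} (hgs : ∀ lam, ContDiff ℝ ∞ (g lam))
    (hg : ∀ lam, Bd n ((d * ‖lam‖) ^ s * B) (g lam)) :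
    Bd n (2 ^ n * (P.M * ((d * P.L) ^ s * B))) fun x => ∑ lam ∈ co.Λ₁, co.p lam t x * g lam x := by
  have := hG.L_nonneg
  exact bd_sum_mul co.Λ₁ (fun l hl => (hG.p_sb l hl).usmooth.smooth t) (fun l _ => hgs l)
    hG.M_nonneg (by positivity) (fun I hI x => hG.p_bd I (hI.trans hn) t x) (fun l _ => hg l)
    (hG.sum_norm_pow_le hs)

lemma Bd.inv_factorial_mul (k : ℕ) (hφ : ContDiff ℝ ∞ φ) (hb : Bd n C φ) :
    Bd n C fun x => (1 / (k.factorial : ℝ)) * φ x := by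
  refine (Bd.const_mul _ hφ hb).mono le_rfl (mul_le_of_le_one_left hb.nonneg ?_)
  rw [abs_of_nonneg (by positivity), div_le_one (by positivity)]
  exact_mod_cast Nat.factorial_pos k

lemma dd_neg (v : Eu d) : dd (-v) φ = fun x => -dd v φ x := by
  funext x; simp [dd]

lemma dd_iter_neg (v : Eu d) (hφ : ContDiff ℝ ∞ φ) (s : ℕ) :
    (dd (-v))^[s] φ = fun x => (-1) ^ s * (dd v)^[s] φ x := by
  induction s with
  | zero => simp
  | succ s ih =>
    rw [Function.iterate_succ_apply', ih, dd_neg, Function.iterate_succ_apply']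
    funext x
    simp only [dd]
    rw [← Finset.sum_neg_distrib, Finset.mul_sum]
    refine Finset.sum_congr rfl fun i _ => ?_
    rw [pd_const_mul _ (smooth_differentiable (smooth_dd_iter v hφ s))]
    ring

lemma sum_eq_zero_of_neg {s : Finset (Eu d)} {F : Eu d → ℝ} (hs : ∀ v ∈ s, -v ∈ s)
    (hF : ∀ v ∈ s, F (-v) = -F v) : ∑ v ∈ s, F v = 0 := by
  have h1 : ∑ v ∈ s, F v = ∑ v ∈ s, F (-v) :=
    Finset.sum_nbij' (fun v => -v) (fun v => -v) hs hs (fun _ _ => neg_neg _) (fun _ _ => neg_neg _)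
      (fun v _ => by rw [neg_neg])
  rw [Finset.sum_congr rfl hF, Finset.sum_neg_distrib] at h1
  linarith

/-- Under `λ ↦ -λ` a directional derivative of odd order changes sign while `q_λ` does not, so the
terms cancel in pairs. -/
lemma Coeffs.Sym.q_sum_eq_zero (hS : co.Sym) (hφ : ContDiff ℝ ∞ φ) {s : ℕ} (hs : Odd s) (a : ℝ)
    (t : ℝ) (x : Eu d) : ∑ lam ∈ co.Λ₁, co.q lam t x * (a * (dd lam)^[s] φ x) = 0 :=
  sum_eq_zero_of_neg (fun v hv => (hS v hv).1) fun v hv => by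
    rw [(hS v hv).2, dd_iter_neg v hφ, hs.neg_one_pow]; ring

lemma Coeffs.Asym.p_sum_eq_zero (hS : co.Sym) (hA : co.Asym) (hφ : ContDiff ℝ ∞ φ) {s : ℕ}
    (hs : Even s) (a : ℝ) (t : ℝ) (x : Eu d) :
    ∑ lam ∈ co.Λ₁, co.p lam t x * (a * (dd lam)^[s] φ x) = 0 :=
  sum_eq_zero_of_neg (fun v hv => (hS v hv).1) fun v hv => by
    rw [hA v hv, dd_iter_neg v hφ, hs.neg_one_pow]; ring

/-- For odd `i` the symmetric `q` meets the odd order `i + 2` and the antisymmetric `p` the even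
order `i + 1`, so both sums cancel in pairs. -/
lemma Coeffs.Asym.Lx_odd (hS : co.Sym) (hA : co.Asym) (hφ : ContDiff ℝ ∞ φ) {i : ℕ} (hi : Odd i)
    (t : ℝ) : co.Lx i t φ = fun _ => 0 := by
  funext x
  unfold Coeffs.Lx
  rw [hS.q_sum_eq_zero hφ (hi.add_even even_two),
    Coeffs.Asym.p_sum_eq_zero hS hA hφ (hi.add_one), if_neg (by rintro rfl; simp at hi)]
  ring

/-- The number of derivatives lost by `𝓛_i`, `i ≥ 1`, is `ρ i` with `ρ = 3` in general and `ρ = 2`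
in the symmetric case. -/
def Coeffs.Loss (co : Coeffs d) (ρ : ℕ) : Prop := ρ = 3 ∨ ρ = 2 ∧ co.Sym

/-- The operator `𝓛_i` has order `i + 2`, which is at most `3i`; the linear form `ρ i` is what makes
the losses add up along the recursion. It is at most `2i` except for `i = 1`. -/
lemma Good.bd_Lx (P : Prm) (d ρ i n : ℕ) (hn : n ≤ P.m) (hi : 1 ≤ i) :
    ∃ N : ℝ, 0 ≤ N ∧ ∀ (h₀ : ℝ) (co : Coeffs d) (τ : Eu d → ℝ), Good P h₀ co τ → co.Loss ρ →
      ∀ t (φ : Eu d → ℝ) C, ContDiff ℝ ∞ φ → Bd (n + ρ * i) C φ → Bd n (N * C) (co.Lx i t φ) := by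
  refine ⟨2 ^ n * (|P.M| * (d * |P.L|) ^ (i + 2)) + 2 ^ n * (|P.M| * (d * |P.L|) ^ (i + 1)),
    by positivity, fun h₀ co τ hG hρ t φ C hφ hb => ?_⟩
  rw [abs_of_nonneg hG.M_nonneg, abs_of_nonneg hG.L_nonneg]
  have hM := hG.M_nonneg
  have hL := hG.L_nonneg
  have hC := hb.nonneg
  have hρ2 : 2 ≤ ρ := by rcases hρ with h | h <;> omega
  have hmul : 2 * i ≤ ρ * i := Nat.mul_le_mul_right i hρ2
  have hsm : ∀ (s : ℕ) (l : Eu d), ContDiff ℝ ∞ fun x => (1 / (s.factorial : ℝ)) * (dd l)^[s] φ x :=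
    fun s l => contDiff_const.mul (smooth_dd_iter l hφ s)
  have hbs : ∀ s, n + s ≤ n + ρ * i → ∀ l : Eu d, Bd n ((d * ‖l‖) ^ s * C)
      fun x => (1 / (s.factorial : ℝ)) * (dd l)^[s] φ x := fun s hs l =>
    Bd.inv_factorial_mul s (smooth_dd_iter l hφ s) (Bd.dd_iter l hφ s (hb.mono hs le_rfl))
  have hq : Bd n (2 ^ n * (P.M * ((d * P.L) ^ (i + 2) * C))) fun x => ∑ lam ∈ co.Λ₁,
      co.q lam t x * ((1 / ((i + 2).factorial : ℝ)) * (dd lam)^[i + 2] φ x) := by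
    by_cases hle : i + 2 ≤ ρ * i
    · exact hG.bd_q_sum hn (by omega) hC (hsm (i + 2)) (hbs _ (by omega))
    · rcases hρ with h3 | ⟨h2, hS⟩
      · subst h3; omega
      · have : i = 1 := by subst h2; omega
        subst this
        have e : (fun x => ∑ lam ∈ co.Λ₁, co.q lam t x *
            ((1 / ((1 + 2).factorial : ℝ)) * (dd lam)^[1 + 2] φ x)) = fun _ => 0 :=
          funext fun x => hS.q_sum_eq_zero hφ (by decide) _ t x
        rw [e]
        intro I _ x
        rw [pdl_zero, abs_zero]
        positivity
  have hp := hG.bd_p_sum (t := t) hn (by omega) hC (hsm (i + 1)) (hbs _ (by omega))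
  have e : co.Lx i t φ = fun x => (∑ lam ∈ co.Λ₁,
      co.q lam t x * ((1 / ((i + 2).factorial : ℝ)) * (dd lam)^[i + 2] φ x)) +
      ∑ lam ∈ co.Λ₁, co.p lam t x * ((1 / ((i + 1).factorial : ℝ)) * (dd lam)^[i + 1] φ x) := by
    funext x
    unfold Coeffs.Lx
    rw [if_neg (by omega), sub_zero]
  rw [e]
  refine (Bd.add (ContDiff.sum fun l hl => ((hG.q_sb l hl).usmooth.smooth t).mul (hsm _ l))
    (ContDiff.sum fun l hl => ((hG.p_sb l hl).usmooth.smooth t).mul (hsm _ l)) hq hp).mono le_rfl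
    (le_of_eq (by ring))

/-- The condition `∑ λ q_λ = 0` removes the term of order `h⁻¹`. The Taylor orders `r + 3` for `q`
and `r + 2` for `p` are chosen so that both remainders are `O(h^{r+1})` after division by `h²` and
`h`. -/
lemma Good.Lh_sub_expansion (hG : Good P h₀ co τ) (hh : 0 < h) (r : ℕ)
    (x : Eu d) : co.Lh h t φ x - ∑ i ∈ Finset.range (r + 1), h ^ i * co.Lx i t φ x =
      ∑ lam ∈ co.Λ₁, co.q lam t x * (1 / h ^ 2 * taylorRem h lam (r + 3) φ x) +
      ∑ lam ∈ co.Λ₁, co.p lam t x * (1 / h * taylorRem h lam (r + 2) φ x) := by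
  have hne := hh.ne'
  have hbal : ∑ lam ∈ co.Λ₁, co.q lam t x * dd lam φ x = 0 := by
    simp only [dd, Finset.mul_sum]
    rw [Finset.sum_comm]
    refine Finset.sum_eq_zero fun i _ => ?_
    have hz : ∑ lam ∈ co.Λ₁, co.q lam t x * lam i = 0 := by
      have := congrArg (fun v : Eu d => v i) (hG.balanced t x)
      simpa [WithLp.ofLp_sum, Finset.sum_apply] using this
    simp_rw [← mul_assoc]
    rw [← Finset.sum_mul, hz, zero_mul]
  have h1 : ∀ lam, 1 / h * fdiff h lam φ x = 1 / h * dd lam φ x +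
      ∑ i ∈ Finset.range (r + 1), h ^ i * (1 / ((i + 2).factorial : ℝ) * (dd lam)^[i + 2] φ x) +
      1 / h ^ 2 * taylorRem h lam (r + 3) φ x := by
    intro lam
    simp only [taylorRem, fdiff, Finset.sum_range_succ' _ (r + 2), Finset.sum_range_succ' _ (r + 1)]
    simp only [Function.iterate_succ_apply, Function.iterate_zero, id, mul_sub, mul_add,
      Finset.mul_sum]
    have e : ∑ i ∈ Finset.range (r + 1), 1 / h ^ 2 *
        (h ^ (i + 1 + 1) / ((i + 1 + 1).factorial : ℝ) * (dd lam)^[i] (dd lam (dd lam φ)) x) =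
        ∑ i ∈ Finset.range (r + 1), h ^ i * (1 / ((i + 2).factorial : ℝ) *
          (dd lam)^[i] (dd lam (dd lam φ)) x) :=
      Finset.sum_congr rfl fun i _ => by field_simp; ring
    rw [e]
    simp
    field_simp
    ring
  have h2 : ∀ lam, fdiff h lam φ x =
      ∑ i ∈ Finset.range (r + 1), h ^ i * (1 / ((i + 1).factorial : ℝ) * (dd lam)^[i + 1] φ x) +
      1 / h * taylorRem h lam (r + 2) φ x := by
    intro lam
    simp only [taylorRem, fdiff, Finset.sum_range_succ' _ (r + 1)]
    simp only [Function.iterate_succ_apply, Function.iterate_zero, id, mul_sub, mul_add,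
      Finset.mul_sum]
    have e : ∑ i ∈ Finset.range (r + 1), 1 / h *
        (h ^ (i + 1) / ((i + 1).factorial : ℝ) * (dd lam)^[i] (dd lam φ) x) =
        ∑ i ∈ Finset.range (r + 1), h ^ i * (1 / ((i + 1).factorial : ℝ) *
          (dd lam)^[i] (dd lam φ) x) :=
      Finset.sum_congr rfl fun i _ => by field_simp; ring
    rw [e]
    simp only [pow_zero, Nat.factorial_zero, Nat.cast_one, div_one, one_mul]
    ring
  have e1 : 1 / h * ∑ lam ∈ co.Λ₁, co.q lam t x * fdiff h lam φ x =
      ∑ i ∈ Finset.range (r + 1), h ^ i * ∑ lam ∈ co.Λ₁, co.q lam t x *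
        (1 / ((i + 2).factorial : ℝ) * (dd lam)^[i + 2] φ x) +
      ∑ lam ∈ co.Λ₁, co.q lam t x * (1 / h ^ 2 * taylorRem h lam (r + 3) φ x) := by
    have : ∀ lam ∈ co.Λ₁, 1 / h * (co.q lam t x * fdiff h lam φ x) =
        1 / h * (co.q lam t x * dd lam φ x) +
        (∑ i ∈ Finset.range (r + 1), h ^ i * (co.q lam t x *
          (1 / ((i + 2).factorial : ℝ) * (dd lam)^[i + 2] φ x)) +
        co.q lam t x * (1 / h ^ 2 * taylorRem h lam (r + 3) φ x)) := fun lam _ => by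
      rw [mul_left_comm, h1, mul_add, mul_add, Finset.mul_sum, add_assoc, mul_left_comm]
      congr 2
      exact Finset.sum_congr rfl fun i _ => by ring
    rw [Finset.mul_sum, Finset.sum_congr rfl this, Finset.sum_add_distrib, ← Finset.mul_sum, hbal,
      mul_zero, zero_add, Finset.sum_add_distrib, Finset.sum_comm]
    simp_rw [Finset.mul_sum]
  have e2 : ∑ lam ∈ co.Λ₁, co.p lam t x * fdiff h lam φ x =
      ∑ i ∈ Finset.range (r + 1), h ^ i * ∑ lam ∈ co.Λ₁, co.p lam t x *
        (1 / ((i + 1).factorial : ℝ) * (dd lam)^[i + 1] φ x) +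
      ∑ lam ∈ co.Λ₁, co.p lam t x * (1 / h * taylorRem h lam (r + 2) φ x) := by
    have : ∀ lam ∈ co.Λ₁, co.p lam t x * fdiff h lam φ x =
        (∑ i ∈ Finset.range (r + 1), h ^ i * (co.p lam t x *
          (1 / ((i + 1).factorial : ℝ) * (dd lam)^[i + 1] φ x)) +
        co.p lam t x * (1 / h * taylorRem h lam (r + 2) φ x)) := fun lam _ => by
      rw [h2, mul_add, Finset.mul_sum]
      congr 1
      exact Finset.sum_congr rfl fun i _ => by ring
    rw [Finset.sum_congr rfl this, Finset.sum_add_distrib, Finset.sum_comm]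
    simp_rw [Finset.mul_sum]
  have e3 : ∑ i ∈ Finset.range (r + 1), h ^ i * (if i = 0 then co.c t x * φ x else 0) =
      co.c t x * φ x := by
    rw [Finset.sum_range_succ']; simp
  unfold Coeffs.Lh Coeffs.Lx
  simp_rw [mul_sub, mul_add, Finset.sum_sub_distrib, Finset.sum_add_distrib]
  rw [e1, e2, e3]
  ring

lemma Good.bd_remainder (P : Prm) (d r n : ℕ) (hn : n ≤ P.m) :
    ∃ N : ℝ, 0 ≤ N ∧ ∀ (h₀ : ℝ) (co : Coeffs d) (τ : Eu d → ℝ), Good P h₀ co τ → ∀ h, 0 < h →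
      ∀ t (φ : Eu d → ℝ) C, ContDiff ℝ ∞ φ → Bd (n + r + 3) C φ →
      Bd n (N * h ^ (r + 1) * C) fun x => co.Lh h t φ x -
        ∑ i ∈ Finset.range (r + 1), h ^ i * co.Lx i t φ x := by
  refine ⟨2 ^ n * (|P.M| * (d * |P.L|) ^ (r + 3)) + 2 ^ n * (|P.M| * (d * |P.L|) ^ (r + 2)),
    by positivity, fun h₀ co τ hG h hh t φ C hφ hb => ?_⟩
  rw [abs_of_nonneg hG.M_nonneg, abs_of_nonneg hG.L_nonneg]
  have hC := hb.nonneg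
  have e : (fun x => co.Lh h t φ x - ∑ i ∈ Finset.range (r + 1), h ^ i * co.Lx i t φ x) =
      fun x => (∑ lam ∈ co.Λ₁, co.q lam t x * (1 / h ^ 2 * taylorRem h lam (r + 3) φ x)) +
      ∑ lam ∈ co.Λ₁, co.p lam t x * (1 / h * taylorRem h lam (r + 2) φ x) :=
    funext fun x => hG.Lh_sub_expansion hh r x
  have hs1 : ∀ (l : Eu d), ContDiff ℝ ∞ fun x => 1 / h ^ 2 * taylorRem h l (r + 3) φ x :=
    fun l => contDiff_const.mul (smooth_taylorRem h l _ hφ)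
  have hs2 : ∀ (l : Eu d), ContDiff ℝ ∞ fun x => 1 / h * taylorRem h l (r + 2) φ x :=
    fun l => contDiff_const.mul (smooth_taylorRem h l _ hφ)
  have hq := hG.bd_q_sum (t := t) hn (s := r + 3) (by omega)
    (show 0 ≤ h ^ (r + 1) * C by positivity) hs1 (fun l => by
      refine (Bd.const_mul (1 / h ^ 2) (smooth_taylorRem h l _ hφ)
        (Bd.taylorRem hh.le l (r + 3) hφ (hb.mono (by omega) le_rfl))).mono le_rfl (le_of_eq ?_)
      rw [abs_of_pos (by positivity)]
      field_simp
      ring)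
  have hp := hG.bd_p_sum (t := t) hn (s := r + 2) (by omega)
    (show 0 ≤ h ^ (r + 1) * C by positivity) hs2 (fun l => by
      refine (Bd.const_mul (1 / h) (smooth_taylorRem h l _ hφ)
        (Bd.taylorRem hh.le l (r + 2) hφ (hb.mono (by omega) le_rfl))).mono le_rfl (le_of_eq ?_)
      rw [abs_of_pos (by positivity)]
      field_simp
      ring)
  rw [e]
  exact (Bd.add (ContDiff.sum fun l hl => ((hG.q_sb l hl).usmooth.smooth t).mul (hs1 l))
    (ContDiff.sum fun l hl => ((hG.p_sb l hl).usmooth.smooth t).mul (hs2 l)) hq hp).mono le_rfl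
    (le_of_eq (by ring))

end Expansion
end Richardson

namespace Richardson

/-! ### The asymptotic expansion of the solutions of the scheme -/

section Asymptotics
variable {d : ℕ} {co : Coeffs d} {τ : Eu d → ℝ} {h h' h₀ T t C : ℝ} {P : Prm}
  {f : ℝ → Eu d → ℝ} {g : Eu d → ℝ} {v₀ : ℝ → Eu d → ℝ}

lemma Lh_eq_sum (φ : Eu d → ℝ) (x : Eu d) : co.Lh h t φ x =
    ∑ lam ∈ co.Λ₁, ((1 / h) * co.q lam t x + co.p lam t x) *
      (1 / h * (φ (x + h • lam) - φ x)) - co.c t x * φ x := by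
  unfold Coeffs.Lh
  rw [Finset.mul_sum, ← Finset.sum_add_distrib]
  congr 1
  exact Finset.sum_congr rfl fun l _ => by unfold fdiff; ring

lemma Lh_const_mul (a : ℝ) (φ : Eu d → ℝ) (x : Eu d) :
    co.Lh h t (fun y => a * φ y) x = a * co.Lh h t φ x := by
  simp_rw [Lh_eq_sum, mul_sub a, Finset.mul_sum]
  congr 1
  · exact Finset.sum_congr rfl fun l _ => by ring
  · ring

lemma Lh_sub (φ ψ : Eu d → ℝ) (x : Eu d) :
    co.Lh h t (fun y => φ y - ψ y) x = co.Lh h t φ x - co.Lh h t ψ x := by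
  simp_rw [Lh_eq_sum]
  rw [sub_sub_sub_comm, ← Finset.sum_sub_distrib]
  congr 1
  · exact Finset.sum_congr rfl fun l _ => by ring
  · ring

lemma Lh_zero (x : Eu d) : co.Lh h t (fun _ => 0) x = 0 := by simp [Lh_eq_sum]

lemma dd_iter_zero (v : Eu d) (s : ℕ) : (dd v)^[s] (fun _ => (0 : ℝ)) = fun _ => 0 := by
  induction s with
  | zero => rfl
  | succ s ih =>
    rw [Function.iterate_succ_apply', ih]
    funext x
    have : ∀ i : Fin d, pd i (fun _ : Eu d => (0 : ℝ)) x = 0 := fun i => by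
      have := congrFun (pdl_zero (d := d) [i]) x
      simpa using this
    simp [dd, this]

lemma Lx_zero (i : ℕ) (x : Eu d) : co.Lx i t (fun _ => 0) x = 0 := by
  simp [Coeffs.Lx, dd_iter_zero]

/-- Some smooth solution of the scheme. -/
noncomputable def Coeffs.sol (co : Coeffs d) (T h : ℝ) (f : ℝ → Eu d → ℝ) (g : Eu d → ℝ) :
    ℝ → Eu d → ℝ := Classical.epsilon (SSol co T h f g)

lemma Good.ssol_sol (hG : Good P h₀ co τ) (hT : 0 ≤ T) (hf : SB f) (hg : Smb g) :
    SSol co T h f g (co.sol T h f g) := Classical.epsilon_spec (hG.exists_ssol hT hf hg)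

/-- The coefficients of the expansion, as solutions of the scheme of a smaller step. -/
noncomputable def Coeffs.vseq (co : Coeffs d) (T h : ℝ) (v₀ : ℝ → Eu d → ℝ) : ℕ → ℝ → Eu d → ℝ
  | 0 => v₀
  | j + 1 => co.sol T h
      (fun t x => ∑ i : Fin (j + 1), co.Lx (j - i + 1) t (co.vseq T h v₀ i t) x) fun _ => 0

/-- The free terms in the equations for `Coeffs.vseq`. -/
noncomputable def Coeffs.vfree (co : Coeffs d) (T h : ℝ) (f v₀ : ℝ → Eu d → ℝ) :
    ℕ → ℝ → Eu d → ℝ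
  | 0 => f
  | j + 1 => fun t x => ∑ i ∈ Finset.range (j + 1), co.Lx (j - i + 1) t (co.vseq T h v₀ i t) x

lemma smb_zero : Smb fun _ : Eu d => (0 : ℝ) := USmooth.zero

lemma Good.ssol_vseq (hG : Good P h₀ co τ) (hT : 0 ≤ T) (hv : SSol co T h f g v₀) (j : ℕ) :
    SSol co T h (co.vfree T h f v₀ j) (if j = 0 then g else fun _ => 0) (co.vseq T h v₀ j) := by
  induction j using Nat.strong_induction_on with
  | _ j ih =>
    rcases j with _ | j
    · rw [Coeffs.vseq]; exact hv
    · have hs : SB (co.vfree T h f v₀ (j + 1)) := SB.sum _ fun i hi =>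
        hG.sb_Lx _ (ih i (Finset.mem_range.1 hi)).u_sb
      have e : co.vfree T h f v₀ (j + 1) = fun t x => ∑ i : Fin (j + 1),
          co.Lx (j - i + 1) t (co.vseq T h v₀ i t) x := by
        funext t x
        exact Finset.sum_range fun i => co.Lx (j - i + 1) t (co.vseq T h v₀ i t) x
      rw [Coeffs.vseq, ← e]
      exact hG.ssol_sol hT hs smb_zero

/-- Since `𝓛_{j-i+1}` costs `ρ (j-i+1)` derivatives and `v_i` has already lost `ρ i`, every summand
of the free term for `v_{j+1}` has lost exactly `ρ (j+1)`, whatever `i` is. The a priori estimate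
loses nothing more. -/
lemma Good.vseq_bd (P : Prm) (d ρ J : ℕ) : ∃ N : ℝ, 0 ≤ N ∧
    ∀ (h₀ : ℝ) (co : Coeffs d) (τ : Eu d → ℝ) (h T : ℝ) (f : ℝ → Eu d → ℝ)
      (g : Eu d → ℝ) (v₀ : ℝ → Eu d → ℝ) (F : ℝ), Good P h₀ co τ → co.Loss ρ → h ∈ Ioc 0 h₀ →
      SSol co T h f g v₀ → (∀ t ∈ Icc 0 T, Bd P.m F (f t)) → Bd P.m F g →
      ∀ j ≤ J, ρ * j ≤ P.m → ∀ t ∈ Icc 0 T, Bd (P.m - ρ * j) (N * F) (co.vseq T h v₀ j t) := by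
  induction J with
  | zero =>
    obtain ⟨N, hN, h1⟩ := Good.apriori P d P.m le_rfl
    refine ⟨N, hN, fun h₀ co τ h T f g v₀ F hG _ hh hv hf hg j hj _ t ht => ?_⟩
    obtain rfl : j = 0 := by omega
    rw [Coeffs.vseq]
    exact h1 h₀ co τ h T f g v₀ F hG hh hv hf hg t ht
  | succ J ih =>
    -- If too few derivatives are left for the index `J + 1`, nothing is claimed about it and the
    -- previous constant serves.
    by_cases hJ : ρ * (J + 1) ≤ P.m
    swap
    · obtain ⟨N, hN, h1⟩ := ih
      refine ⟨N, hN, fun h₀ co τ h T f g v₀ F hG hρ hh hv hf hg j hj hjm => ?_⟩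
      refine h1 h₀ co τ h T f g v₀ F hG hρ hh hv hf hg j ?_ hjm
      by_contra hc
      obtain rfl : j = J + 1 := by omega
      exact hJ hjm
    · obtain ⟨N, hN, h1⟩ := ih
      obtain ⟨Na, hNa, h2⟩ := Good.apriori P d (P.m - ρ * (J + 1)) (Nat.sub_le _ _)
      have h3 := fun i : ℕ => Good.bd_Lx P d ρ (i + 1) (P.m - ρ * (J + 1)) (Nat.sub_le _ _)
        (by omega)
      choose Nx hNx h3 using h3
      set S := ∑ i ∈ Finset.range (J + 1), Nx (J - i) * N with hS
      have hS0 : 0 ≤ S := Finset.sum_nonneg fun i _ => mul_nonneg (hNx _) hN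
      refine ⟨max N (Na * S), le_max_of_le_left hN,
        fun h₀ co τ h T f g v₀ F hG hρ hh hv hf hg j hj hjm t ht => ?_⟩
      have hF := hg.nonneg
      have h1' := h1 h₀ co τ h T f g v₀ F hG hρ hh hv hf hg
      by_cases hjJ : j ≤ J
      · exact (h1' j hjJ hjm t ht).mono le_rfl (mul_le_mul_of_nonneg_right (le_max_left _ _) hF)
      obtain rfl : j = J + 1 := by omega
      have hT : 0 ≤ T := ht.1.trans ht.2
      have hsol := hG.ssol_vseq hT hv (J + 1)
      rw [if_neg (by omega)] at hsol
      refine (h2 h₀ co τ h T _ _ _ (S * F) hG hh hsol (fun t ht => ?_) (fun I _ x => ?_) t ht).mono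
        le_rfl ?_
      · have hvs := fun i => (hG.ssol_vseq hT hv i).u_sb.usmooth.smooth t
        refine (Bd.sum (Finset.range (J + 1)) (b := fun i => Nx (J - i) * (N * F))
          (fun i _ => (hG.sb_Lx (J - i + 1) (hG.ssol_vseq hT hv i).u_sb).usmooth.smooth t)
          (fun i hi => ?_)).mono le_rfl (le_of_eq ?_)
        · have hiJ : i ≤ J := by have := Finset.mem_range.1 hi; omega
          have hmul : ρ * (J + 1) = ρ * i + ρ * (J - i + 1) := by
            rw [← mul_add]; congr 1; omega
          refine h3 (J - i) h₀ co τ hG hρ t _ _ (hvs i) ?_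
          exact (h1' i hiJ (by omega) t ht).mono (by omega) le_rfl
        · rw [hS, Finset.sum_mul]
          exact Finset.sum_congr rfl fun i _ => by ring
      · rw [pdl_zero, abs_zero]; positivity
      · rw [← mul_assoc]
        exact mul_le_mul_of_nonneg_right (le_max_right _ _) hF

/-- In the free term for an odd index, each summand has either an odd operator, which vanishes, or
an odd earlier coefficient, which vanishes by induction. Zero data then force a zero solution by the
a priori estimate. -/
lemma Good.vseq_odd (hG : Good P h₀ co τ) (hS : co.Sym) (hA : co.Asym) (hh : h ∈ Ioc 0 h₀)
    (hv : SSol co T h f g v₀) (j : ℕ) (hj : Odd j) :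
    ∀ t ∈ Icc 0 T, co.vseq T h v₀ j t = fun _ => 0 := by
  induction j using Nat.strong_induction_on with
  | _ j ih =>
    intro t ht
    have hT : 0 ≤ T := ht.1.trans ht.2
    rcases j with _ | j
    · simp at hj
    obtain ⟨N, hN, h2⟩ := Good.apriori P d 0 (Nat.zero_le _)
    have hsol := hG.ssol_vseq hT hv (j + 1)
    rw [if_neg (by omega)] at hsol
    have hz := h2 h₀ co τ h T _ _ _ 0 hG hh hsol (fun t ht => ?_) (fun I _ x => by
      rw [pdl_zero, abs_zero]) t ht
    · funext x
      have := hz.abs_le x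
      rw [mul_zero] at this
      exact abs_nonpos_iff.1 this
    · have e : co.vfree T h f v₀ (j + 1) t = fun _ => 0 := by
        funext x
        refine Finset.sum_eq_zero fun i hi => ?_
        have hij : i < j + 1 := Finset.mem_range.1 hi
        rcases Nat.even_or_odd i with he | ho
        · have hodd : Odd (j - i + 1) := by
            rw [Nat.odd_iff] at *
            rw [Nat.even_iff] at he
            omega
          rw [Coeffs.Asym.Lx_odd hS hA ((hG.ssol_vseq hT hv i).u_sb.usmooth.smooth t) hodd]
        · rw [ih i hij ho t ht, Lx_zero]
      rw [e]
      intro I _ x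
      rw [pdl_zero, abs_zero]

/-- The expansion of the solution of the scheme in powers of the step. -/
theorem Good.expansion (P : Prm) (d k l ρ : ℕ) (hl : l ≤ P.m) (hρ : 1 ≤ ρ) : ∃ N : ℝ, 0 ≤ N ∧
    ∀ (h₀ : ℝ) (co : Coeffs d) (τ : Eu d → ℝ) (h h' T : ℝ) (f : ℝ → Eu d → ℝ)
      (g : Eu d → ℝ) (u v₀ : ℝ → Eu d → ℝ) (F : ℝ), Good P h₀ co τ → co.Loss ρ → h ∈ Ioc 0 h₀ →
      h' ∈ Ioc 0 h₀ → SSol co T h f g u →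
      SSol co T h' f g v₀ → (∀ t ∈ Icc 0 T, Bd P.m F (f t)) → Bd P.m F g →
      (∀ j ≤ k, l + k + 3 + ρ * j ≤ P.m + j ∨
        ∀ t ∈ Icc 0 T, co.vseq T h' v₀ j t = fun _ => 0) →
      ∀ t ∈ Icc 0 T, Bd l (N * (h ^ (k + 1) + (1 + h) ^ k * h') * F)
        fun x => u t x - ∑ j ∈ Finset.range (k + 1), h ^ j * co.vseq T h' v₀ j t x := by
  obtain ⟨Na, hNa, h2⟩ := Good.apriori P d l hl
  obtain ⟨Nv, hNv, hvbd⟩ := Good.vseq_bd P d ρ k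
  have h3 := fun r : ℕ => Good.bd_remainder P d r l hl
  choose Nr hNr h3 using h3
  set S := ∑ j ∈ Finset.range (k + 1), (Nr (k - j) * Nv + Nr 0 * Nv) with hS
  have hS0 : 0 ≤ S := Finset.sum_nonneg fun j _ =>
    add_nonneg (mul_nonneg (hNr _) hNv) (mul_nonneg (hNr _) hNv)
  refine ⟨Na * S, mul_nonneg hNa hS0,
    fun h₀ co τ h h' T f g u v₀ F hG hloss hh hh' hu hv hf hg hk t ht => ?_⟩
  have hF := hg.nonneg
  have hT : 0 ≤ T := ht.1.trans ht.2
  have hh1 := hh.1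
  have hh1' := hh'.1
  set v := co.vseq T h' v₀ with hvdef
  have hvs : ∀ j, SB (v j) := fun j => (hG.ssol_vseq hT hv j).u_sb
  -- The defect caused by `v_j`: the first bracket is the consistency error of `L_h` after `k - j +
  -- 1` terms, of size `h^{k-j+1}`; the second, of size `h'`, is the price for letting `v_j` solve
  -- the scheme of step `h'` instead of the limiting equation.
  set E : ℕ → ℝ → Eu d → ℝ := fun j t x =>
    (co.Lh h t (v j t) x - ∑ i ∈ Finset.range (k - j + 1), h ^ i * co.Lx i t (v j t) x) -
    (co.Lh h' t (v j t) x - ∑ i ∈ Finset.range (0 + 1), h' ^ i * co.Lx i t (v j t) x) with hE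
  have hEsb : ∀ j, SB (E j) := fun j =>
    ((hG.sb_Lh h (hvs j)).sub (SB.sum _ fun i _ => (hG.sb_Lx i (hvs j)).const_mul _)).sub
    ((hG.sb_Lh h' (hvs j)).sub (SB.sum _ fun i _ => (hG.sb_Lx i (hvs j)).const_mul _))
  have hEbd : ∀ j ∈ Finset.range (k + 1), ∀ t ∈ Icc 0 T,
      Bd l (Nr (k - j) * h ^ (k - j + 1) * (Nv * F) + Nr 0 * h' ^ (0 + 1) * (Nv * F)) (E j t) := by
    intro j hj t ht
    have hjk : j ≤ k := by have := Finset.mem_range.1 hj; omega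
    rcases hk j hjk with hj1 | hj0
    -- The remainder needs `l + (k - j) + 3` derivatives of `v_j`, which has `m - ρ j` of them; this
    -- is the first alternative of the hypothesis.
    · have hmul : j ≤ ρ * j := Nat.le_mul_of_pos_left j hρ
      have hb := hvbd h₀ co τ h' T f g v₀ F hG hloss hh' hv hf hg j hjk (by omega) t ht
      refine Bd.sub ?_ ?_ (h3 (k - j) h₀ co τ hG h hh.1 t _ _ ((hvs j).usmooth.smooth t)
        (hb.mono (by omega) le_rfl)) (h3 0 h₀ co τ hG h' hh'.1 t _ _ ((hvs j).usmooth.smooth t)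
        (hb.mono (by omega) le_rfl))
      · exact ((hG.sb_Lh h (hvs j)).sub
          (SB.sum _ fun i _ => (hG.sb_Lx i (hvs j)).const_mul _)).usmooth.smooth t
      · exact ((hG.sb_Lh h' (hvs j)).sub
          (SB.sum _ fun i _ => (hG.sb_Lx i (hvs j)).const_mul _)).usmooth.smooth t
    · have e : E j t = fun _ => 0 := by
        funext x
        simp only [hE]
        rw [hj0 t ht]
        simp [Lh_zero, Lx_zero]
      rw [e]
      intro I _ x
      rw [pdl_zero, abs_zero]
      have := hNr (k - j)
      have := hNr 0
      positivity
  have hrsol : SSol co T h (fun t x => ∑ j ∈ Finset.range (k + 1), h ^ j * E j t x) (fun _ => 0)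
      (fun t x => u t x - ∑ j ∈ Finset.range (k + 1), h ^ j * v j t x) := by
    refine ⟨SB.sum _ fun j _ => (hEsb j).const_mul _, smb_zero,
      hu.u_sb.sub (SB.sum _ fun j _ => (hvs j).const_mul _), fun t ht x => ?_⟩
    have hvj : ∀ j ∈ Finset.range (k + 1), h ^ j * v j t x =
        (if j = 0 then g x else 0) + ∫ s in 0..t, h ^ j * (co.Lh h' s (v j s) x +
          co.vfree T h' f v₀ j s x) := by
      intro j _
      rw [hvdef, (hG.ssol_vseq hT hv j).eqn t ht x, intervalIntegral.integral_const_mul, mul_add]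
      congr 1
      split_ifs with h0
      · rw [h0, pow_zero, one_mul]
      · rw [mul_zero]
    have hint : ∀ j ∈ Finset.range (k + 1), IntervalIntegrable (fun s => h ^ j *
        (co.Lh h' s (v j s) x + co.vfree T h' f v₀ j s x)) volume 0 t := fun j _ =>
      (((hG.sb_Lh h' (hvs j)).add (hG.ssol_vseq hT hv j).f_sb).const_mul _).intervalIntegrable x 0 t
    rw [hu.eqn t ht x, Finset.sum_congr rfl hvj, Finset.sum_add_distrib,
      ← intervalIntegral.integral_finsetSum hint, add_sub_add_comm,
      ← intervalIntegral.integral_sub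
        (((hG.sb_Lh h hu.u_sb).add hu.f_sb).intervalIntegrable x 0 t)
        (by have := IntervalIntegrable.sum (μ := volume) _ hint; simpa only [Finset.sum_fn] using this)]
    congr 1
    · rw [Finset.sum_ite_eq' (Finset.range (k + 1)) 0 fun _ => g x, if_pos (by simp), sub_self]
    refine intervalIntegral.integral_congr fun s _ => ?_
    rw [Lh_sub, Lh_sum]
    simp_rw [Lh_const_mul]
    -- Summation along diagonals: the free terms of `v_1, …, v_k`, weighted by powers of `h`, are
    -- regrouped according to the coefficient on which the operators act.
    have hfree : ∑ j ∈ Finset.range (k + 1), h ^ j * co.vfree T h' f v₀ j s x = f s x +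
        ∑ j ∈ Finset.range (k + 1), h ^ j * ∑ i ∈ Finset.range (k - j),
          h ^ (i + 1) * co.Lx (i + 1) s (v j s) x := by
      rw [Finset.sum_range_succ', pow_zero, one_mul, add_comm]
      congr 1
      rw [Finset.sum_range_succ, Nat.sub_self, Finset.range_zero, Finset.sum_empty, mul_zero,
        add_zero]
      have := Finset.sum_range_diag_flip k fun i r => h ^ (i + r + 1) * co.Lx (r + 1) s (v i s) x
      simp_rw [Finset.mul_sum, Coeffs.vfree]
      simp_rw [Finset.mul_sum]
      refine Eq.trans ?_ (this.trans ?_)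
      · refine Finset.sum_congr rfl fun j _ => Finset.sum_congr rfl fun i hi => ?_
        have : i + (j - i) + 1 = j + 1 := by have := Finset.mem_range.1 hi; omega
        rw [this]
      · refine Finset.sum_congr rfl fun j _ => Finset.sum_congr rfl fun i hi => ?_
        ring
    have hEsum : ∑ j ∈ Finset.range (k + 1), h ^ j * E j s x =
        ∑ j ∈ Finset.range (k + 1), h ^ j * co.Lh h s (v j s) x
        - ∑ j ∈ Finset.range (k + 1), h ^ j * co.Lh h' s (v j s) x
        - ∑ j ∈ Finset.range (k + 1), h ^ j * ∑ i ∈ Finset.range (k - j),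
          h ^ (i + 1) * co.Lx (i + 1) s (v j s) x := by
      rw [← Finset.sum_sub_distrib, ← Finset.sum_sub_distrib]
      refine Finset.sum_congr rfl fun j _ => ?_
      simp only [hE]
      rw [Finset.sum_range_succ']
      simp
      ring
    simp_rw [mul_add, Finset.sum_add_distrib]
    rw [hfree, hEsum]
    ring
  refine (h2 h₀ co τ h T _ _ _ (S * (h ^ (k + 1) + (1 + h) ^ k * h') * F) hG hh hrsol
    (fun t ht => ?_) (fun I _ x => ?_) t ht).mono le_rfl (le_of_eq (by ring))
  · refine (Bd.sum (Finset.range (k + 1)) (fun j _ => contDiff_const.mul ((hEsb j).usmooth.smooth t))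
      fun j hj => Bd.const_mul (h ^ j) ((hEsb j).usmooth.smooth t) (hEbd j hj t ht)).mono le_rfl ?_
    rw [hS, Finset.sum_mul, Finset.sum_mul]
    refine Finset.sum_le_sum fun j hj => ?_
    have hjk : j ≤ k := by have := Finset.mem_range.1 hj; omega
    have e1 : h ^ j * h ^ (k - j + 1) = h ^ (k + 1) := by rw [← pow_add]; congr 1; omega
    -- No bound on `h₀` is available, so `(1 + h) ^ k` dominates all the powers for small and large
    -- `h` alike. It only multiplies `h'`, which tends to zero later.
    have e2 : h ^ j ≤ (1 + h) ^ k := (pow_le_pow_left₀ hh1.le (by linarith) j).trans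
      (pow_le_pow_right₀ (by linarith) hjk)
    have hr1 := mul_nonneg (mul_nonneg (hNr (k - j)) hNv) hF
    have hr0 := mul_nonneg (mul_nonneg (hNr 0) hNv) hF
    rw [abs_of_nonneg (by positivity)]
    calc h ^ j * (Nr (k - j) * h ^ (k - j + 1) * (Nv * F) + Nr 0 * h' ^ (0 + 1) * (Nv * F))
        = Nr (k - j) * Nv * F * (h ^ j * h ^ (k - j + 1)) + Nr 0 * Nv * F * (h ^ j * h') := by ring
      _ ≤ Nr (k - j) * Nv * F * h ^ (k + 1) + Nr 0 * Nv * F * ((1 + h) ^ k * h') := by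
          rw [e1]
          exact add_le_add le_rfl (mul_le_mul_of_nonneg_left
            (mul_le_mul_of_nonneg_right e2 hh1'.le) hr0)
      _ ≤ _ := by
          have a1 := mul_nonneg hr1 (show 0 ≤ (1 + h) ^ k * h' by positivity)
          have a2 := mul_nonneg hr0 (show 0 ≤ h ^ (k + 1) by positivity)
          linarith
  · rw [pdl_zero, abs_zero]; positivity

end Asymptotics
end Richardson

namespace Richardson

/-! ### The Richardson combinations of smooth solutions -/

lemma vander_eq (a : ℝ) (n : ℕ) :
    vander a n = Matrix.vandermonde fun i : Fin (n + 1) => (a ^ (i : ℕ))⁻¹ := by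
  ext i j
  simp [vander, Matrix.vandermonde, pow_mul]

/-- The matrix is a Vandermonde matrix with the distinct nodes `a^{-j}`, hence invertible. The claim
is the defining relation of the weights read off column by column. -/
lemma sum_weights {a : ℝ} (ha : 1 < a) (n i : ℕ) (hi : i ≤ n) :
    ∑ j : Fin (n + 1), weights a n j * (a ^ ((j : ℕ) * i))⁻¹ = if i = 0 then 1 else 0 := by
  have hdet : IsUnit (vander a n).det := by
    rw [isUnit_iff_ne_zero, vander_eq, Matrix.det_vandermonde_ne_zero_iff]
    intro i j hij
    exact Fin.ext ((pow_right_injective₀ (by linarith) ha.ne') (inv_injective hij))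
  have h := congrFun (show Matrix.vecMul (weights a n) (vander a n) = Pi.single 0 1 by
    rw [weights, Matrix.vecMul_vecMul, Matrix.nonsing_inv_mul _ hdet, Matrix.vecMul_one])
    ⟨i, by omega⟩
  rw [Matrix.vecMul, dotProduct] at h
  simp only [vander, Matrix.of_apply] at h
  rw [h, Pi.single_apply]
  simp [Fin.ext_iff]

section Combination
variable {d : ℕ}

/-- The weights are arbitrary so that both combinations are covered: each power `h^i` is either
treated correctly by the weights or absent from the expansion because `v_i = 0`. All steps `h / 2^j`
share the same coefficients `v_i`, which depend on `h'` only. -/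
lemma Good.combination (P : Prm) (d k l ρ n : ℕ) (hl : l ≤ P.m) (hρ : 1 ≤ ρ)
    (b : Fin (n + 1) → ℝ) : ∃ N : ℝ, 0 ≤ N ∧
    ∀ (h₀ : ℝ) (co : Coeffs d) (τ : Eu d → ℝ) (h h' T : ℝ) (f : ℝ → Eu d → ℝ)
      (g : Eu d → ℝ) (u : ℝ → ℝ → Eu d → ℝ) (F : ℝ), Good P h₀ co τ → co.Loss ρ → h ∈ Ioc 0 h₀ →
      h' ∈ Ioc 0 h₀ → (∀ h ∈ Ioc 0 h₀, SSol co T h f g (u h)) →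
      (∀ t ∈ Icc 0 T, Bd P.m F (f t)) → Bd P.m F g →
      (∀ j ≤ k, l + k + 3 + ρ * j ≤ P.m + j ∨ Odd j ∧ co.Sym ∧ co.Asym) →
      (∀ i ≤ k, ∑ j, b j * ((2 : ℝ) ^ ((j : ℕ) * i))⁻¹ = (if i = 0 then 1 else 0) ∨
        Odd i ∧ co.Sym ∧ co.Asym) →
      ∀ t ∈ Icc 0 T, Bd l (N * (h ^ (k + 1) + (1 + h) ^ k * h') * F)
        fun x => ∑ j, b j * u (h / 2 ^ (j : ℕ)) t x - u h' t x := by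
  obtain ⟨N, hN, hexp⟩ := Good.expansion P d k l ρ hl hρ
  refine ⟨(∑ j, |b j|) * N, mul_nonneg (Finset.sum_nonneg fun _ _ => abs_nonneg _) hN,
    fun h₀ co τ h h' T f g u F hG hloss hh hh' hu hf hg hk hb t ht => ?_⟩
  have hF := hg.nonneg
  have hh1 := hh.1
  have hh1' := hh'.1
  have hT : 0 ≤ T := ht.1.trans ht.2
  set v := co.vseq T h' (u h') with hv
  have hvs : ∀ j, SB (v j) := fun j => (hG.ssol_vseq hT (hu h' hh') j).u_sb
  have hodd : ∀ j, Odd j ∧ co.Sym ∧ co.Asym → ∀ t ∈ Icc 0 T, v j t = fun _ => 0 :=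
    fun j hj t ht => hG.vseq_odd hj.2.1 hj.2.2 hh' (hu h' hh') j hj.1 t ht
  have hle : ∀ j : ℕ, h / 2 ^ j ≤ h := fun j => div_le_self hh1.le (one_le_pow₀ one_le_two)
  have hmem : ∀ j : ℕ, h / 2 ^ j ∈ Ioc 0 h₀ := fun j => ⟨by positivity, (hle j).trans hh.2⟩
  have hr : ∀ j : ℕ, Bd l (N * (h ^ (k + 1) + (1 + h) ^ k * h') * F)
      fun x => u (h / 2 ^ j) t x - ∑ i ∈ Finset.range (k + 1), (h / 2 ^ j) ^ i * v i t x := by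
    intro j
    refine (hexp h₀ co τ (h / 2 ^ j) h' T f g (u (h / 2 ^ j)) (u h') F hG hloss (hmem j) hh'
      (hu _ (hmem j)) (hu h' hh') hf hg (fun i hi => (hk i hi).imp id (hodd i)) t ht).mono le_rfl ?_
    refine mul_le_mul_of_nonneg_right (mul_le_mul_of_nonneg_left (add_le_add
      (pow_le_pow_left₀ (hmem j).1.le (hle j) _) (mul_le_mul_of_nonneg_right
      (pow_le_pow_left₀ (by have := (hmem j).1; positivity) (by linarith [hle j]) _) hh1'.le)) hN) hF
  have e : (fun x => ∑ j, b j * u (h / 2 ^ (j : ℕ)) t x - u h' t x) = fun x =>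
      ∑ j : Fin (n + 1), b j * (u (h / 2 ^ (j : ℕ)) t x -
        ∑ i ∈ Finset.range (k + 1), (h / 2 ^ (j : ℕ)) ^ i * v i t x) := by
    funext x
    simp_rw [mul_sub, Finset.sum_sub_distrib]
    congr 1
    simp_rw [Finset.mul_sum]
    rw [Finset.sum_comm]
    have : ∀ i ∈ Finset.range (k + 1), ∑ j : Fin (n + 1), b j * ((h / 2 ^ (j : ℕ)) ^ i * v i t x) =
        if i = 0 then u h' t x else 0 := by
      intro i hi
      have hik : i ≤ k := by have := Finset.mem_range.1 hi; omega
      have e1 : ∑ j : Fin (n + 1), b j * ((h / 2 ^ (j : ℕ)) ^ i * v i t x) =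
          (∑ j, b j * ((2 : ℝ) ^ ((j : ℕ) * i))⁻¹) * (h ^ i * v i t x) := by
        rw [Finset.sum_mul]
        refine Finset.sum_congr rfl fun j _ => ?_
        rw [div_pow, pow_mul]
        ring
      rw [e1]
      rcases hb i hik with h1 | h1
      · rw [h1]
        split_ifs with h0
        · rw [h0, hv, Coeffs.vseq]; ring
        · ring
      · rw [hodd i h1 t ht, if_neg (by rintro rfl; simp at h1)]; ring
    rw [Finset.sum_congr rfl this, Finset.sum_ite_eq' (Finset.range (k + 1)) 0 fun _ => u h' t x,
      if_pos (by simp)]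
  have hsm : ∀ j : ℕ, ContDiff ℝ ∞ fun x => u (h / 2 ^ j) t x -
      ∑ i ∈ Finset.range (k + 1), (h / 2 ^ j) ^ i * v i t x := fun j =>
    ((hu _ (hmem j)).u_sb.sub (SB.sum _ fun i _ => (hvs i).const_mul _)).usmooth.smooth t
  rw [e]
  refine (Bd.sum Finset.univ (fun (j : Fin (n + 1)) _ => contDiff_const.mul (hsm j))
    fun j _ => Bd.const_mul (b j) (hsm j) (hr j)).mono le_rfl (le_of_eq ?_)
  rw [← Finset.sum_mul]
  ring

/-- The cases of the theorem for smooth coefficients. -/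
def Coeffs.SCase (co : Coeffs d) (m k l : ℕ) : Prop :=
  3 * k + 3 + l ≤ m ∨ 2 * k + 3 + l ≤ m ∧ co.Sym ∨ Odd k ∧ 2 * k + 2 + l ≤ m ∧ co.Sym ∧ co.Asym

/-- The reference is the solution `u h'` of an auxiliary step rather than the limit, which is not
yet constructed. The loss per coefficient is `3` in general and `2` under symmetry. -/
theorem Good.richardson (P : Prm) (d k l : ℕ) (hl : l ≤ P.m) : ∃ N : ℝ, 0 ≤ N ∧
    ∀ (h₀ : ℝ) (co : Coeffs d) (τ : Eu d → ℝ) (h h' T : ℝ) (f : ℝ → Eu d → ℝ)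
      (g : Eu d → ℝ) (u : ℝ → ℝ → Eu d → ℝ) (F : ℝ), Good P h₀ co τ → h ∈ Ioc 0 h₀ →
      h' ∈ Ioc 0 h₀ → (∀ h ∈ Ioc 0 h₀, SSol co T h f g (u h)) →
      (∀ t ∈ Icc 0 T, Bd P.m F (f t)) → Bd P.m F g → co.SCase P.m k l →
      ∀ t ∈ Icc 0 T, Bd l (N * (h ^ (k + 1) + (1 + h) ^ k * h') * F)
          (fun x => ubar k u h t x - u h' t x) ∧
        (Odd k ∧ 2 * k + 2 + l ≤ P.m ∧ co.Sym ∧ co.Asym →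
          Bd l (N * (h ^ (k + 1) + (1 + h) ^ k * h') * F)
          (fun x => utilde k u h t x - u h' t x)) := by
  obtain ⟨N₁, hN₁, H₁⟩ := Good.combination P d k l 3 k hl (by norm_num) (weights 2 k)
  obtain ⟨N₂, hN₂, H₂⟩ := Good.combination P d k l 2 k hl (by norm_num) (weights 2 k)
  obtain ⟨N₃, hN₃, H₃⟩ := Good.combination P d k l 2 ((k - 1) / 2) hl (by norm_num)
    (weights 4 ((k - 1) / 2))
  refine ⟨N₁ + N₂ + N₃, by positivity,
    fun h₀ co τ h h' T f g u F hG hh hh' hu hf hg hcase t ht => ?_⟩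
  have hF := hg.nonneg
  have hh1 := hh.1
  have hh1' := hh'.1
  have hX : 0 ≤ h ^ (k + 1) + (1 + h) ^ k * h' := by positivity
  have hw : ∀ i ≤ k, ∑ j, weights 2 k j * ((2 : ℝ) ^ ((j : ℕ) * i))⁻¹ = (if i = 0 then 1 else 0) ∨
        Odd i ∧ co.Sym ∧ co.Asym := fun i hi => Or.inl (sum_weights one_lt_two k i hi)
  -- Only `j = k` may lack a derivative when `m = 2k + 2 + l`, and `v_k = 0` because `k` is odd.
  have hodd : Odd k ∧ 2 * k + 2 + l ≤ P.m ∧ co.Sym ∧ co.Asym →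
      ∀ j ≤ k, l + k + 3 + 2 * j ≤ P.m + j ∨ Odd j ∧ co.Sym ∧ co.Asym := by
    rintro ⟨ho, hm, hS, hA⟩ j hj
    by_cases hjk : j = k
    · subst hjk; exact Or.inr ⟨ho, hS, hA⟩
    · left; omega
  have hmono : ∀ {N : ℝ} {φ : Eu d → ℝ}, N ≤ N₁ + N₂ + N₃ →
      Bd l (N * (h ^ (k + 1) + (1 + h) ^ k * h') * F) φ →
      Bd l ((N₁ + N₂ + N₃) * (h ^ (k + 1) + (1 + h) ^ k * h') * F) φ := fun hN hb =>
    hb.mono le_rfl (mul_le_mul_of_nonneg_right (mul_le_mul_of_nonneg_right hN hX) hF)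
  refine ⟨?_, fun hc => ?_⟩
  · rcases hcase with hc | ⟨hc, hS⟩ | hc
    · exact hmono (by linarith) (H₁ h₀ co τ h h' T f g u F hG (Or.inl rfl) hh hh' hu hf hg
        (fun j hj => Or.inl (by omega)) hw t ht)
    · exact hmono (by linarith) (H₂ h₀ co τ h h' T f g u F hG (Or.inr ⟨rfl, hS⟩) hh hh' hu hf hg
        (fun j hj => Or.inl (by omega)) hw t ht)
    · exact hmono (by linarith) (H₂ h₀ co τ h h' T f g u F hG (Or.inr ⟨rfl, hc.2.2.1⟩) hh hh' hu hf
        hg (hodd hc) hw t ht)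
  · refine hmono (by linarith) (H₃ h₀ co τ h h' T f g u F hG (Or.inr ⟨rfl, hc.2.2.1⟩) hh hh' hu hf
      hg (hodd hc) (fun i hi => ?_) t ht)
    -- For `i = 2s` one has `2^{-ji} = 4^{-js}` with `s ≤ (k-1)/2`, within the range handled by the
    -- weights to base `4`; the odd powers are absent.
    rcases Nat.even_or_odd i with ⟨s, hs⟩ | ho
    · left
      have hs' : s ≤ (k - 1) / 2 := by
        have := Nat.odd_iff.1 hc.1
        omega
      have := sum_weights (a := 4) (by norm_num) ((k - 1) / 2) s hs'
      have e : ∀ j : ℕ, (2 : ℝ) ^ (j * i) = 4 ^ (j * s) := fun j => by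
        rw [hs, show (4 : ℝ) = 2 ^ 2 by norm_num, ← pow_mul]; congr 1; ring
      simp_rw [e]
      rw [this]
      split_ifs <;> first | rfl | omega
    · exact Or.inr ⟨ho, hc.2.2.1, hc.2.2.2⟩

end Combination
end Richardson

namespace Richardson

/-! ### Multi-indices, test functions and generalized derivatives -/

section MultiIndex
variable {d : ℕ}

/-- The list of coordinates along which `D^α` differentiates. -/
def idx (α : Fin d → ℕ) : List (Fin d) :=
  (List.finRange d).flatMap fun i => List.replicate (α i) i

lemma pdl_replicate (n : ℕ) (i : Fin d) (φ : Eu d → ℝ) :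
    pdl (List.replicate n i) φ = (pd i)^[n] φ := by
  induction n with
  | zero => rfl
  | succ n ih => rw [List.replicate_succ, pdl_cons, ih, Function.iterate_succ_apply']

lemma mderiv_eq_pdl (α : Fin d → ℕ) (φ : Eu d → ℝ) : mderiv α φ = pdl (idx α) φ := by
  unfold mderiv idx
  induction List.finRange d with
  | nil => rfl
  | cons i L ih => rw [List.foldr_cons, List.flatMap_cons, pdl_append, ← ih, pdl_replicate]

lemma length_idx (α : Fin d → ℕ) : (idx α).length = order α := by
  unfold idx order
  rw [List.length_flatMap, Fin.sum_univ_def]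
  simp

/-- The dictionary between lists of coordinates and multi-indices, valid up to the order of
differentiation. -/
lemma idx_count_perm (I : List (Fin d)) : (idx fun i => I.count i).Perm I := by
  rw [List.perm_iff_count]
  intro a
  unfold idx
  rw [List.count_flatMap, ← Fin.sum_univ_def]
  simp [List.count_replicate]

lemma order_count (I : List (Fin d)) : (order fun i => I.count i) = I.length := by
  rw [← length_idx, (idx_count_perm I).length_eq]

end MultiIndex

/-! ### Test functions and integration by parts. -/

section TestFunctions
variable {d : ℕ} {η φ ψ : Eu d → ℝ}

/-- Test functions. -/
structure TF {d : ℕ} (η : Eu d → ℝ) : Prop where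
  smooth : ContDiff ℝ ∞ η
  supp : HasCompactSupport η

lemma TF.pd (h : TF η) (i : Fin d) : TF (pd i η) :=
  ⟨smooth_pd h.smooth, by
    rw [pd_eq (smooth_differentiable h.smooth)]; exact h.supp.fderiv_apply ℝ _⟩

lemma TF.pdl (h : TF η) (I : List (Fin d)) : TF (pdl I η) := by
  induction I with
  | nil => exact h
  | cons i I ih => exact ih.pd i

lemma TF.comp_add (h : TF η) (v : Eu d) : TF fun x => η (x + v) :=
  ⟨smooth_comp_add h.smooth v, h.supp.comp_homeomorph (Homeomorph.addRight v)⟩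

lemma TF.comp_sub (h : TF η) (v : Eu d) : TF fun x => η (x - v) := by
  simpa only [sub_eq_add_neg] using h.comp_add (-v)

lemma TF.mul (h : TF η) (hφ : ContDiff ℝ ∞ φ) : TF fun x => η x * φ x :=
  ⟨h.smooth.mul hφ, h.supp.mul_right⟩

lemma TF.integrable_mul (h : TF η) (hφ : LocallyIntegrable φ) :
    Integrable fun x => η x * φ x := by
  simpa using hφ.integrable_smul_left_of_hasCompactSupport h.smooth.continuous h.supp

lemma TF.integrable (h : TF η) : Integrable η :=
  h.smooth.continuous.integrable_of_hasCompactSupport h.supp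

lemma TF.bounded (h : TF η) : ∃ C, ∀ x, |η x| ≤ C :=
  h.supp.exists_bound_of_continuous h.smooth.continuous

lemma TF.integral_mul_pd (h : TF η) (hφ : Differentiable ℝ φ) (i : Fin d)
    (hφ' : LocallyIntegrable (Richardson.pd i φ)) :
    ∫ x, φ x * Richardson.pd i η x = -∫ x, Richardson.pd i φ x * η x := by
  have hl : ∀ {f : Eu d → ℝ}, Differentiable ℝ f → ∀ x, HasLineDerivAt ℝ f (Richardson.pd i f x) x
      (EuclideanSpace.single i 1) := fun hf x => (hf x).lineDifferentiableAt.hasLineDerivAt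
  have := integral_bilinear_hasLineDerivAt_right_eq_neg_left_of_integrable
    (μ := (volume : Measure (Eu d))) (B := ContinuousLinearMap.mul ℝ ℝ)
    (f := φ) (f' := Richardson.pd i φ) (g := η) (g' := Richardson.pd i η)
    (v := EuclideanSpace.single i 1)
    (by simpa [mul_comm] using h.integrable_mul hφ')
    (by simpa [mul_comm] using (h.pd i).integrable_mul hφ.continuous.locallyIntegrable)
    (by simpa [mul_comm] using h.integrable_mul hφ.continuous.locallyIntegrable)
    (fun x _ => hl hφ x) (fun x _ => hl (smooth_differentiable h.smooth) x)
  simpa using this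

lemma locallyIntegrable_of_bdd {C : ℝ} (hφ : AEStronglyMeasurable φ) (hC : ∀ᵐ x, |φ x| ≤ C) :
    LocallyIntegrable φ :=
  (locallyIntegrable_const C).mono hφ (hC.mono fun x hx => by
    rw [Real.norm_eq_abs, Real.norm_eq_abs]; exact hx.trans (le_abs_self C))

end TestFunctions

/-! ### Boundedly differentiable functions of finite order. -/

section CB
variable {d : ℕ} {φ ψ : Eu d → ℝ}

/-- Functions that are `n` times differentiable with bounded derivatives. -/
def CB {d : ℕ} : ℕ → (Eu d → ℝ) → Prop
  | 0, φ => Continuous φ ∧ ∃ C, ∀ x, |φ x| ≤ C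
  | n + 1, φ => Differentiable ℝ φ ∧ (∃ C, ∀ x, |φ x| ≤ C) ∧ ∀ i, CB n (pd i φ)

lemma CB.continuous {n : ℕ} (h : CB n φ) : Continuous φ := by
  cases n with
  | zero => exact h.1
  | succ n => exact h.1.continuous

lemma CB.bounded {n : ℕ} (h : CB n φ) : ∃ C, ∀ x, |φ x| ≤ C := by
  cases n with
  | zero => exact h.2
  | succ n => exact h.2.1

lemma CB.of_succ {n : ℕ} (h : CB (n + 1) φ) : CB n φ := by
  induction n generalizing φ with
  | zero => exact ⟨h.1.continuous, h.2.1⟩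
  | succ n ih => exact ⟨h.1, h.2.1, fun i => ih (h.2.2 i)⟩

lemma CB.of_le {n k : ℕ} (h : CB n φ) (hk : k ≤ n) : CB k φ := by
  induction n with
  | zero => rwa [Nat.le_zero.1 hk]
  | succ n ih =>
    rcases hk.lt_or_eq with hk | rfl
    · exact ih h.of_succ (Nat.lt_succ_iff.1 hk)
    · exact h

lemma CB.locallyIntegrable {n : ℕ} (h : CB n φ) : LocallyIntegrable φ :=
  h.continuous.locallyIntegrable

lemma CB.add {n : ℕ} (h : CB n φ) (h' : CB n ψ) : CB n fun x => φ x + ψ x := by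
  have hb : ∃ C, ∀ x, |φ x + ψ x| ≤ C := by
    obtain ⟨C, hC⟩ := h.bounded
    obtain ⟨C', hC'⟩ := h'.bounded
    exact ⟨C + C', fun x => (abs_add_le _ _).trans (add_le_add (hC x) (hC' x))⟩
  induction n generalizing φ ψ with
  | zero => exact ⟨h.1.add h'.1, hb⟩
  | succ n ih =>
    refine ⟨h.1.fun_add h'.1, hb, fun i => ?_⟩
    rw [pd_add h.1 h'.1]
    obtain ⟨C, hC⟩ := (h.2.2 i).bounded
    obtain ⟨C', hC'⟩ := (h'.2.2 i).bounded
    exact ih (h.2.2 i) (h'.2.2 i)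
      ⟨C + C', fun x => (abs_add_le _ _).trans (add_le_add (hC x) (hC' x))⟩

lemma CB.const_mul {n : ℕ} (a : ℝ) (h : CB n φ) : CB n fun x => a * φ x := by
  induction n generalizing φ with
  | zero =>
    obtain ⟨C, hC⟩ := h.bounded
    exact ⟨continuous_const.mul h.1, |a| * C, fun x => by
      rw [abs_mul]; exact mul_le_mul_of_nonneg_left (hC x) (abs_nonneg a)⟩
  | succ n ih =>
    obtain ⟨C, hC⟩ := h.bounded
    refine ⟨h.1.const_mul a, ⟨|a| * C, fun x => by
      rw [abs_mul]; exact mul_le_mul_of_nonneg_left (hC x) (abs_nonneg a)⟩, fun i => ?_⟩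
    rw [pd_const_mul a h.1]
    exact ih (h.2.2 i)

lemma CB.comp_add {n : ℕ} (h : CB n φ) (v : Eu d) : CB n fun x => φ (x + v) := by
  induction n generalizing φ with
  | zero =>
    obtain ⟨C, hC⟩ := h.bounded
    exact ⟨h.1.comp (continuous_add_const v), C, fun x => hC _⟩
  | succ n ih =>
    obtain ⟨C, hC⟩ := h.bounded
    refine ⟨h.1.comp (differentiable_id.add_const v), ⟨C, fun x => hC _⟩, fun i => ?_⟩
    rw [pd_comp_add]
    exact ih (h.2.2 i)

lemma CB.sub {n : ℕ} (h : CB n φ) (h' : CB n ψ) : CB n fun x => φ x - ψ x := by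
  have := h.add (h'.const_mul (-1))
  simpa [sub_eq_add_neg] using this

lemma CB.dbar {n : ℕ} {co : Coeffs d} {τ : Eu d → ℝ} {τ₀ h : ℝ} (hφ : CB (n + 1) φ) (μ : co.Idx) :
    CB n (co.dbar τ τ₀ h μ φ) := by
  rcases μ with l | i
  · exact ((hφ.of_succ.comp_add _).sub hφ.of_succ).const_mul _
  · exact (hφ.2.2 i).const_mul _

lemma cb_of_contDiff {n : ℕ} (hφ : ContDiff ℝ n φ)
    (hb : ∃ C, ∀ I : List (Fin d), I.length ≤ n → ∀ x, |pdl I φ x| ≤ C) : CB n φ := by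
  induction n generalizing φ with
  | zero =>
    obtain ⟨C, hC⟩ := hb
    exact ⟨hφ.continuous, C, fun x => hC [] (by simp) x⟩
  | succ n ih =>
    obtain ⟨C, hC⟩ := hb
    refine ⟨hφ.differentiable (by simp), ⟨C, fun x => hC [] (by simp) x⟩, fun i => ?_⟩
    refine ih (contDiff_pd (n := n) (by exact_mod_cast hφ)) ⟨C, fun I hI x => ?_⟩
    rw [← pdl_concat]
    exact hC _ (by simpa using hI) x

lemma Smb.cb (h : Smb φ) (n : ℕ) : CB n φ := by
  obtain ⟨C, hC⟩ := h.bdd n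
  exact cb_of_contDiff (contDiff_infty.1 h.smooth n) ⟨C, hC ()⟩

lemma CB.pdl {n : ℕ} (I : List (Fin d)) (h : CB (n + I.length) φ) : CB n (pdl I φ) := by
  induction I using List.reverseRecOn generalizing φ with
  | nil => exact h
  | append_singleton I i ih =>
    rw [pdl_concat]
    rw [List.length_append, List.length_singleton, ← add_assoc] at h
    exact ih (h.2.2 i)

end CB

/-! ### Generalized derivatives versus classical ones. -/

section Weak
variable {d : ℕ} {φ v w : Eu d → ℝ} {α : Fin d → ℕ}

lemma TF.integral_mul_pdl {η : Eu d → ℝ} (h : TF η) (I : List (Fin d)) (hφ : CB I.length φ) :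
    ∫ x, φ x * Richardson.pdl I η x = (-1) ^ I.length * ∫ x, Richardson.pdl I φ x * η x := by
  induction I generalizing η with
  | nil => simp
  | cons i I ih =>
    have h1 : CB I.length φ := hφ.of_succ
    have h2 : CB 1 (Richardson.pdl I φ) := CB.pdl I (by rw [add_comm]; exact hφ)
    rw [pdl_cons, ← pdl_pd h.smooth, ih (h.pd i) h1,
      h.integral_mul_pd h2.1 i (h2.2.2 i).locallyIntegrable, List.length_cons, pow_succ]
    simp only [pdl_cons]
    ring

lemma CB.isWeakDeriv (hφ : CB (order α) φ) : IsWeakDeriv α φ (mderiv α φ) := by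
  rw [← length_idx] at hφ
  refine ⟨hφ.locallyIntegrable, ?_, fun η h1 h2 => ?_⟩
  · rw [mderiv_eq_pdl]
    exact (CB.pdl (n := 0) (idx α) (by rwa [zero_add])).locallyIntegrable
  · rw [mderiv_eq_pdl, mderiv_eq_pdl, ← length_idx]
    exact TF.integral_mul_pdl ⟨h1, h2⟩ _ hφ

lemma IsWeakDeriv.ae_eq (h : IsWeakDeriv α v φ) (h' : IsWeakDeriv α v w) : φ =ᵐ[volume] w := by
  refine ae_eq_of_integral_contDiff_smul_eq h.2.1 h'.2.1 fun η h1 h2 => ?_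
  have e := (h.2.2 η h1 h2).symm.trans (h'.2.2 η h1 h2)
  have := mul_left_cancel₀ (pow_ne_zero _ (by norm_num)) e
  simpa [mul_comm] using this

lemma weakDeriv_spec (h : ∃ w, IsWeakDeriv α v w) : IsWeakDeriv α v (weakDeriv α v) := by
  unfold weakDeriv
  rw [dif_pos h]
  exact h.choose_spec

lemma IsWeakDeriv.weakDeriv_ae (h : IsWeakDeriv α v w) : weakDeriv α v =ᵐ[volume] w :=
  (weakDeriv_spec ⟨w, h⟩).ae_eq h

end Weak
end Richardson

namespace Richardson

/-! ### Mollification -/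

section Mollifier
variable {d : ℕ} {κ φ ψ w : Eu d → ℝ} {r : ℝ}

/-- Mollification kernels of radius `r`. -/
structure Ker {d : ℕ} (κ : Eu d → ℝ) (r : ℝ) : Prop where
  tf : TF κ
  nonneg : ∀ y, 0 ≤ κ y
  integral : ∫ y, κ y = 1
  supp : ∀ y, r < ‖y‖ → κ y = 0

lemma exists_ker (d : ℕ) {r : ℝ} (hr : 0 < r) : ∃ κ : Eu d → ℝ, Ker κ r := by
  let b : ContDiffBump (0 : Eu d) := ⟨r / 2, r, by positivity, by linarith⟩
  refine ⟨b.normed volume, ⟨b.contDiff_normed, b.hasCompactSupport_normed⟩, b.nonneg_normed,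
    b.integral_normed, fun y hy => ?_⟩
  have : y ∉ Function.support (b.normed volume) := by
    rw [b.support_normed_eq]
    simp [Metric.mem_ball, b, hy.le]
  simpa using this

/-- `moll κ φ (x) = ∫ κ(z - x) φ(z) dz`. -/
noncomputable def moll (κ φ : Eu d → ℝ) (x : Eu d) : ℝ := ∫ z, κ (z - x) * φ z

lemma moll_eq_add (κ φ : Eu d → ℝ) (x : Eu d) : moll κ φ x = ∫ y, κ y * φ (x + y) := by
  unfold moll
  rw [← integral_add_right_eq_self _ x]
  simp [add_comm]

lemma moll_eq_convolution (κ φ : Eu d → ℝ) : moll κ φ =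
    convolution φ (fun y => κ (-y)) (ContinuousLinearMap.mul ℝ ℝ) volume := by
  funext x
  unfold moll convolution
  simp [mul_comm]

lemma TF.comp_neg (h : TF κ) : TF fun y => κ (-y) :=
  ⟨h.smooth.comp contDiff_neg, h.supp.comp_homeomorph (Homeomorph.neg (Eu d))⟩

lemma TF.smooth_moll (h : TF κ) (hφ : LocallyIntegrable φ) : ContDiff ℝ ∞ (moll κ φ) := by
  rw [moll_eq_convolution]
  exact h.comp_neg.supp.contDiff_convolution_right _ hφ h.comp_neg.smooth

lemma pd_comp_neg (hκ : Differentiable ℝ κ) (i : Fin d) (x : Eu d) :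
    pd i (fun y => κ (-y)) x = -pd i κ (-x) := by
  have h := (hκ (-x)).hasFDerivAt.comp x (hasFDerivAt_id x).neg
  have e : fderiv ℝ (fun y => κ (-y)) x = _ := h.fderiv
  rw [pd_apply (φ := fun y => κ (-y)) ((hκ.comp differentiable_id.neg) x), pd_apply (hκ _), e]
  simp

lemma TF.pd_moll (h : TF κ) (hφ : LocallyIntegrable φ) (i : Fin d) :
    Richardson.pd i (moll κ φ) = fun x => -moll (Richardson.pd i κ) φ x := by
  funext x
  have hk := h.comp_neg
  have hd := hk.supp.hasFDerivAt_convolution_right (ContinuousLinearMap.mul ℝ ℝ) hφ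
    (hk.smooth.of_le (by simp)) x
  rw [pd_apply (smooth_differentiable (h.smooth_moll hφ) x), moll_eq_convolution, hd.fderiv,
    convolution_precompR_apply _ hφ (hk.supp.fderiv ℝ)
      (hk.smooth.continuous_fderiv (by simp))]
  unfold convolution moll
  rw [← integral_neg]
  congr 1
  funext z
  have := pd_comp_neg (smooth_differentiable h.smooth) i (x - z)
  rw [pd_apply (smooth_differentiable hk.smooth _)] at this
  simp only [ContinuousLinearMap.mul_apply']
  rw [this]
  simp only [neg_sub]
  ring

lemma locallyIntegrable_const_mul (a : ℝ) (hφ : LocallyIntegrable φ) :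
    LocallyIntegrable fun x => a * φ x := hφ.smul a

lemma TF.pdl_moll (h : TF κ) (hφ : LocallyIntegrable φ) (I : List (Fin d)) :
    Richardson.pdl I (moll κ φ) = fun x => (-1) ^ I.length * moll (Richardson.pdl I κ) φ x := by
  induction I with
  | nil => simp
  | cons i I ih =>
    rw [pdl_cons, ih, pd_const_mul _ (smooth_differentiable ((h.pdl I).smooth_moll hφ)),
      (h.pdl I).pd_moll hφ]
    funext x
    simp [pow_succ]

/-- Here `κ(· - x)` is itself the test function. The sign from differentiating in `x` instead of `z`
cancels the sign in the definition of the generalized derivative. -/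
lemma TF.pdl_moll_weak {α : Fin d → ℕ} (h : TF κ) (hw : IsWeakDeriv α φ w) {I : List (Fin d)}
    (hI : (idx α).Perm I) : Richardson.pdl I (moll κ φ) = moll κ w := by
  funext x
  rw [h.pdl_moll hw.1]
  have h1 := hw.2.2 (fun z => κ (z - x)) (h.comp_sub x).smooth (h.comp_sub x).supp
  have h2 : mderiv α (fun z => κ (z - x)) = fun z => Richardson.pdl I κ (z - x) := by
    rw [mderiv_eq_pdl, pdl_perm (h.comp_sub x).smooth hI]
    simp only [sub_eq_add_neg, pdl_comp_add]
  have h3 : order α = I.length := by rw [← length_idx, hI.length_eq]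
  rw [h2, h3] at h1
  unfold moll
  simp_rw [mul_comm (Richardson.pdl I κ _), mul_comm (κ _)]
  rw [h1, ← mul_assoc, ← pow_add, Even.neg_one_pow ⟨_, rfl⟩, one_mul]

lemma TF.pd_moll_cb (h : TF κ) (hφ : CB 1 φ) (i : Fin d) :
    Richardson.pd i (moll κ φ) = moll κ (Richardson.pd i φ) := by
  have h1 : order (fun k => [i].count k) = 1 := order_count [i]
  have h2 := CB.isWeakDeriv (α := fun k => [i].count k) (by rw [h1]; exact hφ)
  have h3 := h.pdl_moll_weak h2 (idx_count_perm [i])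
  have h4 : idx (fun k => [i].count k) = [i] := List.perm_singleton.1 (idx_count_perm [i])
  rw [mderiv_eq_pdl, h4] at h3
  exact h3

lemma TF.abs_moll_le (h : TF κ) {C : ℝ} (hφ : AEStronglyMeasurable φ) (hC : ∀ᵐ x, |φ x| ≤ C)
    (x : Eu d) : |moll κ φ x| ≤ (∫ y, |κ y|) * C := by
  unfold moll
  have hi := (h.comp_sub x).integrable_mul (locallyIntegrable_of_bdd hφ hC)
  refine (abs_integral_le_integral_abs).trans ?_
  have e : (∫ y, |κ y|) = ∫ z, |κ (z - x)| := (integral_sub_right_eq_self (fun y => |κ y|) x).symm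
  rw [e, ← integral_mul_const]
  refine integral_mono_ae hi.abs ((h.comp_sub x).integrable.abs.mul_const C) ?_
  filter_upwards [hC] with z hz
  rw [abs_mul]
  exact mul_le_mul_of_nonneg_left hz (abs_nonneg _)

lemma Ker.integral_comp_sub (h : Ker κ r) (x : Eu d) : ∫ z, κ (z - x) = 1 := by
  rw [integral_sub_right_eq_self (fun y => κ y) x, h.integral]

lemma Ker.moll_const (h : Ker κ r) (a : ℝ) (x : Eu d) : moll κ (fun _ => a) x = a := by
  unfold moll
  rw [integral_mul_const, h.integral_comp_sub, one_mul]

lemma Ker.moll_mono (h : Ker κ r) (hφ : LocallyIntegrable φ) (hψ : LocallyIntegrable ψ)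
    (hle : ∀ᵐ z, φ z ≤ ψ z) (x : Eu d) : moll κ φ x ≤ moll κ ψ x := by
  refine integral_mono_ae ((h.tf.comp_sub x).integrable_mul hφ)
    ((h.tf.comp_sub x).integrable_mul hψ) ?_
  filter_upwards [hle] with z hz
  exact mul_le_mul_of_nonneg_left hz (h.nonneg _)

lemma Ker.moll_le (h : Ker κ r) (hφ : LocallyIntegrable φ) {a : ℝ} (hle : ∀ᵐ z, φ z ≤ a)
    (x : Eu d) : moll κ φ x ≤ a :=
  (h.moll_mono hφ (locallyIntegrable_const a) hle x).trans_eq (h.moll_const a x)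

lemma Ker.le_moll (h : Ker κ r) (hφ : LocallyIntegrable φ) {a : ℝ} (hle : ∀ᵐ z, a ≤ φ z)
    (x : Eu d) : a ≤ moll κ φ x :=
  (h.moll_const a x).symm.trans_le (h.moll_mono (locallyIntegrable_const a) hφ hle x)

lemma TF.moll_sum (h : TF κ) {ι : Type*} (s : Finset ι) {f : ι → Eu d → ℝ}
    (hf : ∀ k ∈ s, LocallyIntegrable (f k)) (x : Eu d) :
    moll κ (fun z => ∑ k ∈ s, f k z) x = ∑ k ∈ s, moll κ (f k) x := by
  unfold moll
  simp_rw [Finset.mul_sum]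
  exact integral_finsetSum _ fun k hk => (h.comp_sub x).integrable_mul (hf k hk)

lemma TF.moll_add (h : TF κ) (hφ : LocallyIntegrable φ) (hψ : LocallyIntegrable ψ) (x : Eu d) :
    moll κ (fun z => φ z + ψ z) x = moll κ φ x + moll κ ψ x := by
  unfold moll
  simp_rw [mul_add]
  exact integral_add ((h.comp_sub x).integrable_mul hφ) ((h.comp_sub x).integrable_mul hψ)

lemma moll_const_mul (a : ℝ) (κ φ : Eu d → ℝ) (x : Eu d) :
    moll κ (fun z => a * φ z) x = a * moll κ φ x := by
  unfold moll
  rw [← integral_const_mul]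
  congr 1
  funext z
  ring

lemma moll_comp_add (κ φ : Eu d → ℝ) (v x : Eu d) :
    moll κ (fun z => φ (z + v)) x = moll κ φ (x + v) := by
  rw [moll_eq_add, moll_eq_add]
  congr 1
  funext y
  rw [add_right_comm]

/-- Jensen's inequality, by averaging `2aφ - a² ≤ φ²` with `a` the mean of `φ`. It keeps the `ℓ²`
bounds on the coefficients with the same constants. -/
lemma Ker.moll_sq_le (h : Ker κ r) {C : ℝ} (hφ : AEStronglyMeasurable φ) (hC : ∀ᵐ x, |φ x| ≤ C)
    (x : Eu d) : moll κ φ x ^ 2 ≤ moll κ (fun z => φ z ^ 2) x := by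
  set a := moll κ φ x with ha
  have hl := locallyIntegrable_of_bdd hφ hC
  have hl2 : LocallyIntegrable fun z => φ z ^ 2 :=
    locallyIntegrable_of_bdd (hφ.pow 2) (C := C ^ 2) (hC.mono fun z hz => by
      rw [abs_pow]; exact pow_le_pow_left₀ (abs_nonneg _) hz 2)
  have h1 := h.moll_mono (φ := fun z => 2 * a * φ z + -(a ^ 2)) (ψ := fun z => φ z ^ 2)
    ((locallyIntegrable_const_mul (2 * a) hl).add (locallyIntegrable_const _)) hl2
    (Filter.Eventually.of_forall fun z => by nlinarith [sq_nonneg (φ z - a)]) x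
  rw [h.tf.moll_add (locallyIntegrable_const_mul (2 * a) hl) (locallyIntegrable_const _), moll_const_mul,
    h.moll_const] at h1
  rw [← ha] at h1
  linarith

lemma Ker.abs_moll_sub_le (h : Ker κ r) (hφ : LocallyIntegrable φ) {ε a : ℝ} {x : Eu d}
    (hε : ∀ y, ‖y‖ ≤ r → |φ (x + y) - a| ≤ ε) : |moll κ φ x - a| ≤ ε := by
  have e : moll κ φ x - a = ∫ z, κ (z - x) * (φ z - a) := by
    simp_rw [mul_sub]
    rw [integral_sub ((h.tf.comp_sub x).integrable_mul hφ)
      ((h.tf.comp_sub x).integrable.mul_const a), integral_mul_const, h.integral_comp_sub, one_mul]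
    rfl
  have hi := (h.tf.comp_sub x).integrable_mul (hφ.sub (locallyIntegrable_const a))
  rw [e]
  refine (abs_integral_le_integral_abs).trans ?_
  calc ∫ z, |κ (z - x) * (φ z - a)| ≤ ∫ z, κ (z - x) * ε := by
        refine integral_mono_ae hi.abs ((h.tf.comp_sub x).integrable.mul_const ε)
          (Filter.Eventually.of_forall fun z => ?_)
        simp only
        rw [abs_mul, abs_of_nonneg (h.nonneg _)]
        by_cases hz : ‖z - x‖ ≤ r
        · have := hε (z - x) hz
          rw [add_sub_cancel] at this
          exact mul_le_mul_of_nonneg_left this (h.nonneg _)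
        · rw [h.supp _ (not_le.1 hz)]; simp
    _ = ε := by rw [integral_mul_const, h.integral_comp_sub, one_mul]

lemma TF.dbar_moll (h : TF κ) {co : Coeffs d} {τ : Eu d → ℝ} {τ₀ s : ℝ} (hφ : CB 1 φ)
    (μ : co.Idx) : co.dbar τ τ₀ s μ (moll κ φ) = moll κ (co.dbar τ τ₀ s μ φ) := by
  rcases μ with l | i
  · funext x
    simp only [Coeffs.dbar]
    have e : (fun z => φ (z + s • l.1) - φ z) = fun z => φ (z + s • l.1) + -1 * φ z := by
      funext z; ring
    rw [moll_const_mul, e, h.moll_add (hφ.comp_add _).locallyIntegrable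
      (hφ.const_mul _).locallyIntegrable, moll_comp_add, moll_const_mul]
    ring
  · funext x
    simp only [Coeffs.dbar]
    rw [moll_const_mul, h.pd_moll_cb hφ]

/-- Mollification of bounded Borel functions depending on a parameter. -/
lemma TF.sb_moll (h : TF κ) {φ : ℝ → Eu d → ℝ} (hm : Measurable (Function.uncurry φ))
    {C : ℝ} (hC : ∀ t x, |φ t x| ≤ C) : SB fun t => moll κ (φ t) := by
  have hmt : ∀ t, AEStronglyMeasurable (φ t) := fun t =>
    (hm.comp measurable_prodMk_left).aestronglyMeasurable
  have hl : ∀ t, LocallyIntegrable (φ t) := fun t =>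
    locallyIntegrable_of_bdd (hmt t) (Filter.Eventually.of_forall (hC t))
  have hC0 : 0 ≤ C := (abs_nonneg _).trans (hC 0 0)
  refine ⟨⟨fun t => h.smooth_moll (hl t), fun n => ?_⟩, fun x => ?_⟩
  · have hfin : ∀ n : ℕ, ∃ A : ℝ, ∀ I : List (Fin d), I.length ≤ n →
        (∫ y, |Richardson.pdl I κ y|) ≤ A := by
      intro n
      obtain ⟨A, hA⟩ := ((List.finite_length_le (Fin d) n).image
        fun I => ∫ y, |Richardson.pdl I κ y|).bddAbove
      exact ⟨A, fun I hI => hA ⟨I, hI, rfl⟩⟩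
    obtain ⟨A, hA⟩ := hfin n
    refine ⟨A * C, fun t I hI x => ?_⟩
    rw [h.pdl_moll (hl t), abs_mul, abs_pow, abs_neg, abs_one, one_pow, one_mul]
    exact ((h.pdl I).abs_moll_le (hmt t) (Filter.Eventually.of_forall (hC t)) x).trans
      (mul_le_mul_of_nonneg_right (hA I hI) hC0)
  · have : Measurable (Function.uncurry fun (t : ℝ) (z : Eu d) => κ (z - x) * φ t z) :=
      ((h.smooth.continuous.measurable.comp (measurable_snd.sub_const x))).mul hm
    exact this.stronglyMeasurable.integral_prod_right.measurable

end Mollifier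
end Richardson

namespace Richardson

/-! ### The spaces `𝔅^m` -/

section Bounded
open Filter Topology
variable {d m : ℕ} {C : ℝ} {v : Eu d → ℝ}

/-- Continuous functions with generalized derivatives up to order `m` bounded by `C`. -/
structure WB {d : ℕ} (m : ℕ) (C : ℝ) (v : Eu d → ℝ) : Prop where
  continuous : Continuous v
  weak : ∀ α : Fin d → ℕ, order α ≤ m → ∃ w, IsWeakDeriv α v w ∧ ∀ᵐ x, |w x| ≤ C

lemma Ker.abs_moll_le {κ φ : Eu d → ℝ} {r : ℝ} (h : Ker κ r) (hφ : AEStronglyMeasurable φ)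
    (hC : ∀ᵐ x, |φ x| ≤ C) (x : Eu d) : |moll κ φ x| ≤ C := by
  refine (h.tf.abs_moll_le hφ hC x).trans_eq ?_
  simp_rw [abs_of_nonneg (h.nonneg _)]
  rw [h.integral, one_mul]

lemma WB.bd_moll (h : WB m C v) {κ : Eu d → ℝ} {r : ℝ} (hκ : Ker κ r) : Bd m C (moll κ v) := by
  intro I hI x
  obtain ⟨w, hw, hb⟩ := h.weak (fun i => I.count i) (by rw [order_count]; exact hI)
  rw [hκ.tf.pdl_moll_weak hw (idx_count_perm I)]
  exact hκ.abs_moll_le hw.2.1.aestronglyMeasurable hb x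

lemma WB.smooth_moll (h : WB m C v) {κ : Eu d → ℝ} {r : ℝ} (hκ : Ker κ r) :
    ContDiff ℝ ∞ (moll κ v) := hκ.tf.smooth_moll h.continuous.locallyIntegrable

/-- A sequence of kernels of radius `1 / (j + 1)`. -/
noncomputable def kerSeq (d : ℕ) (j : ℕ) : Eu d → ℝ :=
  (exists_ker d (r := 1 / ((j : ℝ) + 1)) (by positivity)).choose

lemma ker_kerSeq (d j : ℕ) : Ker (kerSeq d j) (1 / ((j : ℝ) + 1)) :=
  (exists_ker d (r := 1 / ((j : ℝ) + 1)) (by positivity)).choose_spec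

lemma tendsto_moll_kerSeq (hv : Continuous v) (x : Eu d) :
    Tendsto (fun j => moll (kerSeq d j) v x) atTop (𝓝 (v x)) := by
  rw [Metric.tendsto_atTop]
  intro ε hε
  obtain ⟨s, hs, hv'⟩ := Metric.continuousAt_iff.1 hv.continuousAt (ε / 2) (half_pos hε)
  obtain ⟨J, hJ⟩ := exists_nat_one_div_lt hs
  refine ⟨J, fun j hj => ?_⟩
  rw [Real.dist_eq]
  refine lt_of_le_of_lt ((ker_kerSeq d j).abs_moll_sub_le hv.locallyIntegrable (ε := ε / 2)
    fun y hy => ?_) (half_lt_self hε)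
  rw [← Real.dist_eq]
  refine (hv' ?_).le
  rw [dist_self_add_left]
  refine (hy.trans ?_).trans_lt hJ
  exact one_div_le_one_div_of_le (by positivity) (by exact_mod_cast Nat.succ_le_succ hj)

/-- The mollifications satisfy the bound with the same constant and converge pointwise, as `v` is
continuous. -/
lemma WB.lipschitz (h : WB m C v) (hm : 1 ≤ m) (x y : Eu d) :
    |v y - v x| ≤ d * C * ‖y - x‖ := by
  refine le_of_tendsto (((tendsto_moll_kerSeq h.continuous y).sub
    (tendsto_moll_kerSeq h.continuous x)).abs) (Eventually.of_forall fun j => ?_)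
  exact abs_sub_le_of_pd (smooth_differentiable (h.smooth_moll (ker_kerSeq d j)))
    (fun i z => h.bd_moll (ker_kerSeq d j) [i] (by simpa using hm) z) x y

lemma WB.nonneg (h : WB m C v) : 0 ≤ C := (h.bd_moll (ker_kerSeq d 0)).nonneg

lemma WB.abs_moll_sub_le (h : WB m C v) (hm : 1 ≤ m) {κ : Eu d → ℝ} {r : ℝ} (hκ : Ker κ r)
    (x : Eu d) : |moll κ v x - v x| ≤ d * C * r := by
  refine hκ.abs_moll_sub_le h.continuous.locallyIntegrable fun y hy => ?_
  refine (h.lipschitz hm x (x + y)).trans ?_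
  rw [add_sub_cancel_left]
  exact mul_le_mul_of_nonneg_left hy (mul_nonneg (Nat.cast_nonneg d) h.nonneg)

lemma WB.tendstoUniformly (h : WB m C v) (hm : 1 ≤ m) :
    TendstoUniformly (fun j => moll (kerSeq d j) v) v atTop := by
  rw [Metric.tendstoUniformly_iff]
  intro ε hε
  have h1 : Tendsto (fun j : ℕ => d * C * (1 / ((j : ℝ) + 1))) atTop (𝓝 0) := by
    simpa using (tendsto_one_div_add_atTop_nhds_zero_nat (𝕜 := ℝ)).const_mul (d * C)
  filter_upwards [h1.eventually_lt_const hε] with j hj x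
  rw [dist_comm, Real.dist_eq]
  exact (h.abs_moll_sub_le hm (ker_kerSeq d j) x).trans_lt hj

/-- One order is lost: bounded derivatives of order `n + 1` give, by interpolation, uniform
convergence of the mollified derivatives up to order `n`. -/
lemma WB.contDiff {n : ℕ} (h : WB m C v) (hn : n + 1 ≤ m) : ContDiff ℝ n v ∧ Bd n C v := by
  have h1 := contDiff_of_bd (n := n) (fun j => h.smooth_moll (ker_kerSeq d j))
    (fun j => (h.bd_moll (ker_kerSeq d j)).mono hn le_rfl) (h.tendstoUniformly (by omega))
  refine ⟨h1.1, fun I hI x => ?_⟩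
  exact le_of_tendsto ((h1.2 I hI).tendsto_at x).abs (Eventually.of_forall fun j =>
    h.bd_moll (ker_kerSeq d j) I (by omega) x)

lemma WB.cb {n : ℕ} (h : WB m C v) (hn : n + 1 ≤ m) : CB n v :=
  cb_of_contDiff (h.contDiff hn).1 ⟨C, (h.contDiff hn).2⟩

lemma WB.mono {m' : ℕ} {C' : ℝ} (h : WB m C v) (hm : m' ≤ m) (hC : C ≤ C') : WB m' C' v :=
  ⟨h.continuous, fun α hα => (h.weak α (hα.trans hm)).imp fun _ hw =>
    ⟨hw.1, hw.2.mono fun _ hx => hx.trans hC⟩⟩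

end Bounded

/-! ### The norm of `𝔅^m` and mollification in time-dependent form. -/

section InB
open Filter Topology
variable {d m : ℕ} {T : ℝ} {ψ : ℝ → Eu d → ℝ}

lemma mem_multiIndices (α : Fin d → ℕ) : α ∈ multiIndices d (order α) := by
  simp [multiIndices, order]

lemma sq_weakDeriv_le_weakSq (α : Fin d → ℕ) (v : Eu d → ℝ) (x : Eu d) :
    weakDeriv α v x ^ 2 ≤ weakSq (order α) v x :=
  Finset.single_le_sum (f := fun α => weakDeriv α v x ^ 2) (fun _ _ => sq_nonneg _)
    (mem_multiIndices α)

lemma weakSq_nonneg (k : ℕ) (v : Eu d → ℝ) (x : Eu d) : 0 ≤ weakSq k v x :=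
  Finset.sum_nonneg fun _ _ => sq_nonneg _

lemma InB.exists_sq_le (h : InB T m ψ) : ∃ C : ℝ, 0 ≤ C ∧ ∀ t ∈ Icc 0 T, ∀ᵐ x,
    ∑ k ∈ Finset.range (m + 1), weakSq k (ψ t) x ≤ C ^ 2 := by
  obtain ⟨C, hC⟩ := h.derivs
  refine ⟨Real.sqrt (∑ k ∈ Finset.range (m + 1), ∑ _α ∈ multiIndices d k, C ^ 2),
    Real.sqrt_nonneg _, fun t ht => ?_⟩
  rw [Real.sq_sqrt (Finset.sum_nonneg fun _ _ => Finset.sum_nonneg fun _ _ => sq_nonneg _)]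
  have h1 : ∀ᵐ x, ∀ k ∈ Finset.range (m + 1), ∀ α ∈ multiIndices d k,
      |weakDeriv α (ψ t) x| ≤ C := by
    refine (ae_ball_iff (Finset.countable_toSet _)).2 fun k hk => ?_
    refine (ae_ball_iff (Finset.countable_toSet _)).2 fun α hα => ?_
    refine (hC t ht α ?_).2
    have : order α = k := by simpa [multiIndices, order] using hα
    rw [this]
    exact Nat.lt_succ_iff.1 (Finset.mem_range.1 hk)
  filter_upwards [h1] with x hx
  refine Finset.sum_le_sum fun k hk => Finset.sum_le_sum fun α hα => ?_
  rw [← sq_abs]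
  exact pow_le_pow_left₀ (abs_nonneg _) (hx k hk α hα) 2

/-- The infimum in the norm is attained: for each time, countably many admissible bounds approaching
it hold off a common null set. -/
lemma InB.normB_spec (h : InB T m ψ) : 0 ≤ normB T m ψ ∧ ∀ t ∈ Icc 0 T, ∀ᵐ x,
    ∑ k ∈ Finset.range (m + 1), weakSq k (ψ t) x ≤ normB T m ψ ^ 2 := by
  refine ⟨Real.sInf_nonneg fun C hC => hC.1, fun t ht => ?_⟩
  have hne : {C : ℝ | 0 ≤ C ∧ ∀ t ∈ Icc 0 T, ∀ᵐ x,
    ∑ k ∈ Finset.range (m + 1), weakSq k (ψ t) x ≤ C ^ 2}.Nonempty := h.exists_sq_le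
  have h1 : ∀ j : ℕ, ∀ᵐ x, ∑ k ∈ Finset.range (m + 1), weakSq k (ψ t) x ≤
      (normB T m ψ + 1 / ((j : ℝ) + 1)) ^ 2 := by
    intro j
    obtain ⟨C, hC, hlt⟩ := exists_lt_of_csInf_lt hne
      (lt_add_of_pos_right (normB T m ψ) (show 0 < 1 / ((j : ℝ) + 1) by positivity))
    filter_upwards [hC.2 t ht] with x hx
    exact hx.trans (pow_le_pow_left₀ hC.1 hlt.le 2)
  filter_upwards [ae_all_iff.2 h1] with x hx
  refine ge_of_tendsto' (x := atTop) (f := fun j : ℕ => (normB T m ψ + 1 / ((j : ℝ) + 1)) ^ 2)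
    ?_ hx
  simpa using ((tendsto_one_div_add_atTop_nhds_zero_nat (𝕜 := ℝ)).const_add (normB T m ψ)).pow 2

lemma InB.wb (h : InB T m ψ) {t : ℝ} (ht : t ∈ Icc 0 T) : WB m (normB T m ψ) (ψ t) := by
  refine ⟨h.continuous t ht, fun α hα => ?_⟩
  obtain ⟨C, hC⟩ := h.derivs
  refine ⟨_, weakDeriv_spec (hC t ht α hα).1, ?_⟩
  filter_upwards [h.normB_spec.2 t ht] with x hx
  refine abs_le_of_sq_le_sq ((sq_weakDeriv_le_weakSq α (ψ t) x).trans (le_trans ?_ hx))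
    h.normB_spec.1
  exact Finset.single_le_sum (f := fun k => weakSq k (ψ t) x) (fun _ _ => weakSq_nonneg _ _ _)
    (Finset.mem_range.2 (Nat.lt_succ_of_le hα))

lemma InB.measurable_clamp (h : InB T m ψ) (hT : 0 ≤ T) :
    Measurable (Function.uncurry fun t => ψ (clamp T t)) := by
  have h1 : Measurable fun z : ℝ × Eu d => ((⟨clamp T z.1, clamp_mem hT _⟩ : Icc (0 : ℝ) T), z.2) :=
    (((continuous_clamp T).measurable.comp measurable_fst).subtype_mk).prodMk measurable_snd
  exact h.measurable.comp h1

lemma InB.sb_moll (h : InB T m ψ) (hT : 0 ≤ T) {κ : Eu d → ℝ} (hκ : TF κ) :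
    SB fun t => moll κ (ψ (clamp T t)) := by
  obtain ⟨C, hC⟩ := h.bounded
  exact hκ.sb_moll (h.measurable_clamp hT) fun t x => hC _ (clamp_mem hT t) x

/-- Mollification does not increase square sums of generalized derivatives. -/
lemma Ker.sum_sq_pdl_moll_le {κ : Eu d → ℝ} {r M : ℝ} (hκ : Ker κ r) {ι : Type*} (s : Finset ι)
    {v : ι → Eu d → ℝ} {C : ι → ℝ} (hv : ∀ l ∈ s, WB m (C l) (v l)) {I : List (Fin d)}
    (hI : I.length ≤ m) (hM : ∀ᵐ x, ∑ l ∈ s, weakSq I.length (v l) x ≤ M) (x : Eu d) :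
    ∑ l ∈ s, pdl I (moll κ (v l)) x ^ 2 ≤ M := by
  set α : Fin d → ℕ := fun i => I.count i with hα
  have ho : order α = I.length := order_count I
  have hw : ∀ l ∈ s, IsWeakDeriv α (v l) (weakDeriv α (v l)) ∧
      ∀ᵐ x, |weakDeriv α (v l) x| ≤ C l := by
    intro l hl
    obtain ⟨w, hw, hb⟩ := (hv l hl).weak α (by rw [ho]; exact hI)
    refine ⟨weakDeriv_spec ⟨w, hw⟩, ?_⟩
    filter_upwards [hw.weakDeriv_ae, hb] with x h1 h2
    rwa [h1]
  have hli : ∀ l ∈ s, LocallyIntegrable fun z => weakDeriv α (v l) z ^ 2 := fun l hl =>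
    locallyIntegrable_of_bdd ((hw l hl).1.2.1.aestronglyMeasurable.pow 2) (C := C l ^ 2)
      ((hw l hl).2.mono fun z hz => by
        rw [abs_pow]; exact pow_le_pow_left₀ (abs_nonneg _) hz 2)
  calc ∑ l ∈ s, pdl I (moll κ (v l)) x ^ 2
      ≤ ∑ l ∈ s, moll κ (fun z => weakDeriv α (v l) z ^ 2) x := Finset.sum_le_sum fun l hl => by
        rw [hκ.tf.pdl_moll_weak (hw l hl).1 (idx_count_perm I)]
        exact hκ.moll_sq_le (hw l hl).1.2.1.aestronglyMeasurable (hw l hl).2 x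
    _ = moll κ (fun z => ∑ l ∈ s, weakDeriv α (v l) z ^ 2) x := (hκ.tf.moll_sum s hli x).symm
    _ ≤ M := by
        refine hκ.moll_le ?_ ?_ x
        · exact locallyIntegrable_finsetSum s hli
        · filter_upwards [hM] with z hz
          refine le_trans (Finset.sum_le_sum fun l _ => ?_) hz
          rw [← ho]
          exact sq_weakDeriv_le_weakSq α (v l) z

end InB
end Richardson

namespace Richardson

/-! ### The structural assumptions for mollified coefficients -/

section SmoothBounded
variable {d : ℕ} {φ : Eu d → ℝ}

lemma Smb.pd (h : Smb φ) (i : Fin d) : Smb (Richardson.pd i φ) := USmooth.pd h i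

lemma Smb.isSmoothBounded (h : Smb φ) : IsSmoothBounded φ := by
  refine ⟨h.smooth, fun n => ?_⟩
  induction n generalizing φ with
  | zero =>
    obtain ⟨C, hC⟩ := h.bounded
    exact ⟨C, fun x => by rw [norm_iteratedFDeriv_zero]; exact hC () x⟩
  | succ n ih =>
    choose C hC using fun i => ih (h.pd i)
    have e : fderiv ℝ φ = fun x => ∑ i,
        (ContinuousLinearMap.id ℝ ℝ).smulRight (EuclideanSpace.proj i : Eu d →L[ℝ] ℝ)
          (Richardson.pd i φ x) := by
      funext x
      ext v
      rw [fderiv_eq_sum v (smooth_differentiable h.smooth x)]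
      simp [mul_comm]
    refine ⟨∑ i, ‖(ContinuousLinearMap.id ℝ ℝ).smulRight
      (EuclideanSpace.proj i : Eu d →L[ℝ] ℝ)‖ * C i, fun x => ?_⟩
    rw [← norm_iteratedFDeriv_fderiv, e, iteratedFDeriv_fun_sum_apply]
    · refine (norm_sum_le _ _).trans (Finset.sum_le_sum fun i _ => ?_)
      refine (ContinuousLinearMap.norm_iteratedFDeriv_comp_left _
        ((smooth_pd h.smooth).contDiffAt (n := ∞)) (by exact_mod_cast le_top)).trans ?_
      exact mul_le_mul_of_nonneg_left (hC i x) (norm_nonneg _)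
    · intro i _
      exact ((ContinuousLinearMap.contDiff _).comp
        ((smooth_pd h.smooth).of_le (by exact_mod_cast le_top))).contDiffAt

lemma Smb.comp_add (h : Smb φ) (v : Eu d) : Smb fun x => φ (x + v) := USmooth.comp_add h v

end SmoothBounded

/-! ### Operators of the class `𝔎`. -/

section SubMarkov
variable {d : ℕ} {𝒦 : (Eu d → ℝ) → Eu d → ℝ}

lemma CB.isBoundedBorel {n : ℕ} {φ : Eu d → ℝ} (h : CB n φ) : IsBoundedBorel φ :=
  ⟨h.continuous.measurable, h.bounded⟩

/-- Positivity applied to `B - F` gives `𝒦 F ≤ B 𝒦 1 ≤ B`, where the last step uses `B ≥ 0`. -/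
lemma IsSubMarkov.le (h : IsSubMarkov 𝒦) {F : Eu d → ℝ} {B : ℝ} (hF : IsBoundedBorel F)
    (h0 : ∀ x, 0 ≤ F x) (hB : ∀ x, F x ≤ B) (x : Eu d) : 𝒦 F x ≤ B := by
  have hB0 : 0 ≤ B := (h0 0).trans (hB 0)
  have h1 : IsBoundedBorel fun _ : Eu d => (1 : ℝ) := ⟨measurable_const, 1, fun _ => by simp⟩
  have hB1 : IsBoundedBorel (B • fun _ : Eu d => (1 : ℝ)) :=
    ⟨measurable_const.const_smul B, |B|, fun _ => by simp⟩
  have hF1 : IsBoundedBorel ((-1 : ℝ) • F) := ⟨hF.1.const_smul _, by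
    obtain ⟨C, hC⟩ := hF.2
    exact ⟨C, fun x => by simpa using hC x⟩⟩
  have h2 := h.nonneg (B • (fun _ : Eu d => (1 : ℝ)) + (-1 : ℝ) • F) (by
    refine ⟨hB1.1.add hF1.1, ?_⟩
    obtain ⟨C, hC⟩ := hB1.2
    obtain ⟨C', hC'⟩ := hF1.2
    exact ⟨C + C', fun x => (abs_add_le _ _).trans (add_le_add (hC x) (hC' x))⟩)
    (fun x => by simpa using hB x) x
  rw [h.map_add _ _ hB1 hF1, h.map_smul _ _ h1, h.map_smul _ _ hF] at h2
  simp only [Pi.add_apply, Pi.smul_apply, smul_eq_mul] at h2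
  nlinarith [mul_le_mul_of_nonneg_left (h.one_le x) hB0]

lemma IsSubMarkov.map_sum (h : IsSubMarkov 𝒦) {ι : Type*} (s : Finset ι) {F : ι → Eu d → ℝ}
    (hF : ∀ k ∈ s, IsBoundedBorel (F k)) :
    IsBoundedBorel (∑ k ∈ s, F k) ∧ 𝒦 (∑ k ∈ s, F k) = ∑ k ∈ s, 𝒦 (F k) := by
  classical
  induction s using Finset.induction_on with
  | empty =>
    have h0 : IsBoundedBorel (0 : Eu d → ℝ) := ⟨measurable_const, 0, fun _ => by simp⟩
    refine ⟨by simpa using h0, ?_⟩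
    have := h.map_smul 0 0 h0
    simpa using this
  | insert a s ha ih =>
    obtain ⟨h1, h2⟩ := ih fun k hk => hF k (Finset.mem_insert_of_mem hk)
    have h3 := hF a (Finset.mem_insert_self a s)
    rw [Finset.sum_insert ha, Finset.sum_insert ha, ← h2]
    refine ⟨⟨h3.1.add h1.1, ?_⟩, h.map_add _ _ h3 h1⟩
    obtain ⟨C, hC⟩ := h1.2
    obtain ⟨C', hC'⟩ := h3.2
    exact ⟨C' + C, fun x => (abs_add_le _ _).trans (add_le_add (hC' x) (hC x))⟩

end SubMarkov

/-! ### Elimination of `𝒦` from the structural inequalities. -/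

section Reduction
variable {d : ℕ} {co : Coeffs d} {τ : Eu d → ℝ} {τ₀ δ K h h₀ T t c₀ : ℝ} {m n : ℕ}

lemma isBoundedBorel_sum_sq {ι : Type*} (s : Finset ι) {F : ι → Eu d → ℝ}
    (hF : ∀ k ∈ s, Smb (F k)) : IsBoundedBorel fun y => ∑ k ∈ s, |F k y| ^ 2 := by
  simp_rw [sq_abs, pow_two]
  exact (Smb.cb (USmooth.sum s fun k hk => USmooth.mul (hF k hk) (hF k hk)) 0).isBoundedBorel

lemma Smb.dbar {φ : Eu d → ℝ} (h : Smb φ) {s : ℝ} (μ : co.Idx) : Smb (co.dbar τ τ₀ s μ φ) := by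
  rcases μ with l | i
  · exact USmooth.const_mul _ (USmooth.sub (h.comp_add _) h)
  · exact USmooth.const_mul _ (h.pd i)

/-- Replacing `𝒦` by a constant upper bound makes the inequality linear in the coefficients and
invariant under translation of `φ`, as the averaging below requires. The maximum principle needs no
more than this. -/
lemma Coeffs.Structural1.red1 (hS : co.Structural1 τ τ₀ δ K h₀ T m) (hδ : δ ≤ 1)
    (hc : ∀ x, 0 ≤ co.c t x) (hh : h ∈ Ioc 0 h₀) (ht : t ∈ Icc 0 T) :
    co.Red1 τ τ₀ δ K m h t := by
  obtain ⟨𝒦, h1, h2⟩ := hS h hh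
  intro φ hφ B hB x
  refine (h2 t ht φ hφ.isSmoothBounded x).trans (add_le_add_right ?_ _)
  refine mul_le_mul_of_nonneg_left ?_ (mul_nonneg (by linarith) (hc x))
  exact (h1 t ht).le (isBoundedBorel_sum_sq _ fun μ _ => hφ.dbar μ)
    (fun y => Finset.sum_nonneg fun _ _ => by positivity)
    (fun y => by simpa only [sq_abs] using hB y) x

/-- Families are treated together because `𝒦` is linear: it acts on the total sum of squares, whose
supremum is what the estimate must contain, and not the sum of separate suprema. -/
lemma Coeffs.Structural2.red2 (hS : co.Structural2 τ τ₀ δ K h₀ T m) (hδ : δ ≤ 1) (hK : 0 ≤ K)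
    (hc : ∀ x, 0 ≤ co.c t x) (hh : h ∈ Ioc 0 h₀) (hn : n ∈ Finset.Icc 1 m) (ht : t ∈ Icc 0 T) :
    co.Red2 τ τ₀ δ K n h t := by
  obtain ⟨𝒦, h1, h2⟩ := hS h hh n hn
  intro ι _ φ hφ B₂ B₁ hB₂ hB₁ x
  have key := Finset.sum_le_sum fun (k : ι) (_ : k ∈ Finset.univ) =>
    h2 t ht (φ k) (hφ k).isSmoothBounded x
  simp only [Finset.sum_add_distrib, ← Finset.mul_sum] at key
  refine key.trans (add_le_add (add_le_add_right ?_ _) ?_)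
  · refine mul_le_mul_of_nonneg_left ?_ (mul_nonneg (by linarith) (hc x))
    have hF : ∀ k ∈ (Finset.univ : Finset ι), IsBoundedBorel fun y => ∑ μ : co.Idx, ∑ ν : co.Idx,
        |co.dbar τ τ₀ h μ (co.dbar τ τ₀ h ν (φ k)) y| ^ 2 := by
      intro k _
      simp_rw [← Finset.sum_product']
      exact isBoundedBorel_sum_sq (Finset.univ ×ˢ Finset.univ) (F := fun p : co.Idx × co.Idx =>
        co.dbar τ τ₀ h p.1 (co.dbar τ τ₀ h p.2 (φ k))) fun p _ => ((hφ k).dbar p.2).dbar p.1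
    have := (h1 t ht).map_sum _ hF
    rw [← Finset.sum_apply, ← this.2]
    refine (h1 t ht).le this.1 (fun y => ?_) (fun y => ?_) x
    · rw [Finset.sum_apply]; positivity
    · rw [Finset.sum_apply]; simpa only [sq_abs] using hB₂ y
  · refine mul_le_mul_of_nonneg_left ?_ hK
    have hF : ∀ k ∈ (Finset.univ : Finset ι), IsBoundedBorel fun y => ∑ μ : co.Idx,
        |co.dbar τ τ₀ h μ (φ k) y| ^ 2 := fun k _ =>
      isBoundedBorel_sum_sq _ fun μ _ => (hφ k).dbar μ
    have := (h1 t ht).map_sum _ hF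
    rw [← Finset.sum_apply, ← this.2]
    refine (h1 t ht).le this.1 (fun y => ?_) (fun y => ?_) x
    · rw [Finset.sum_apply]; positivity
    · rw [Finset.sum_apply]; simpa only [sq_abs] using hB₁ y

end Reduction

/-! ### Averages with respect to a kernel. -/

section Average
variable {d : ℕ} {κ : Eu d → ℝ} {x : Eu d} {F G : Eu d → ℝ} {r v w a : ℝ}

/-- `v` is the average of `F` with respect to the kernel `κ` centred at `x`. -/
structure Avg {d : ℕ} (κ : Eu d → ℝ) (x : Eu d) (F : Eu d → ℝ) (v : ℝ) : Prop where
  li : LocallyIntegrable F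
  eq : moll κ F x = v

lemma Ker.avg_add (hκ : Ker κ r) (hF : Avg κ x F v) (hG : Avg κ x G w) :
    Avg κ x (fun z => F z + G z) (v + w) :=
  ⟨hF.li.add hG.li, by rw [hκ.tf.moll_add hF.li hG.li, hF.eq, hG.eq]⟩

lemma Avg.const_mul (hF : Avg κ x F v) (a : ℝ) : Avg κ x (fun z => a * F z) (a * v) :=
  ⟨locallyIntegrable_const_mul a hF.li, by rw [moll_const_mul, hF.eq]⟩

lemma Avg.mul_const (hF : Avg κ x F v) (a : ℝ) : Avg κ x (fun z => F z * a) (v * a) := by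
  simpa only [mul_comm] using hF.const_mul a

lemma Ker.avg_const (hκ : Ker κ r) (a : ℝ) : Avg κ x (fun _ => a) a :=
  ⟨locallyIntegrable_const a, hκ.moll_const a x⟩

lemma Ker.avg_sum (hκ : Ker κ r) {ι : Type*} (s : Finset ι) {F : ι → Eu d → ℝ} {v : ι → ℝ}
    (hF : ∀ k ∈ s, Avg κ x (F k) (v k)) : Avg κ x (fun z => ∑ k ∈ s, F k z) (∑ k ∈ s, v k) :=
  ⟨locallyIntegrable_finsetSum s fun k hk => (hF k hk).li, by
    rw [hκ.tf.moll_sum s fun k hk => (hF k hk).li]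
    exact Finset.sum_congr rfl fun k hk => (hF k hk).eq⟩

lemma Ker.avg_le (hκ : Ker κ r) (hF : Avg κ x F v) (hG : Avg κ x G w) (h : ∀ z, F z ≤ G z) :
    v ≤ w := by
  rw [← hF.eq, ← hG.eq]
  exact hκ.moll_mono hF.li hG.li (Filter.Eventually.of_forall h) x

lemma Avg.of_cb {n : ℕ} {f : Eu d → ℝ} (hf : CB n f) : Avg κ x f (moll κ f x) :=
  ⟨hf.locallyIntegrable, rfl⟩

end Average

/-! ### Structural inequalities for mollified coefficients. -/

section Mollified
variable {d : ℕ} {co : Coeffs d} {τ : Eu d → ℝ} {τ₀ δ K h h₀ T t c₀ r : ℝ} {m n : ℕ}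
  {κ φ : Eu d → ℝ} {x : Eu d}

/-- The scheme with mollified coefficients, extended to all times. -/
noncomputable abbrev Coeffs.mollify (co : Coeffs d) (T : ℝ) (κ : Eu d → ℝ) : Coeffs d where
  Λ₁ := co.Λ₁
  q l t := moll κ (co.q l (clamp T t))
  p l t := moll κ (co.p l (clamp T t))
  c t := moll κ (co.c (clamp T t))

lemma dbar_mollify : (co.mollify T κ).dbar τ τ₀ h = co.dbar τ τ₀ h := by
  funext μ φ
  rcases μ with l | i <;> rfl

lemma shift_mollify : (co.mollify T κ).shift h = co.shift h := by
  funext μ φ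
  rcases μ with l | i <;> rfl

/-- The coefficients at a given time are twice boundedly differentiable. -/
structure Coeffs.CBAt (co : Coeffs d) (t : ℝ) : Prop where
  q : ∀ l ∈ co.Λ₁, CB 2 (co.q l t)
  p : ∀ l ∈ co.Λ₁, CB 2 (co.p l t)
  c : CB 0 (co.c t)

/-- The differences at `z` of the translate `φ(· + x - z)` are those of `φ` at `x`, independent of
`z`. Only the coefficients vary under the average, and they become the mollified ones. -/
lemma Ker.avg_quad (hκ : Ker κ r) (hco : co.CBAt (clamp T t)) :
    Avg κ x (fun z => co.quad h (clamp T t) (fun y => φ (y + (x - z))) z)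
      ((co.mollify T κ).quad h t φ x) := by
  unfold Coeffs.quad
  simp_rw [fdiff_comp_add, add_sub_cancel]
  refine hκ.avg_sum _ fun l hl => Avg.mul_const (hκ.avg_add (Avg.of_cb (hco.q l hl)) ?_) _
  exact (Avg.of_cb (hco.p l hl)).const_mul h

lemma shift_comp_add (v : Eu d) (μ : co.Idx) :
    co.shift h μ (fun x => φ (x + v)) = fun x => co.shift h μ φ (x + v) := by
  rcases μ with l | i
  · funext x; simp only [Coeffs.shift, add_right_comm]
  · rfl

lemma Ker.avg_Qop (hκ : Ker κ r) {dμ : (Eu d → ℝ) → Eu d → ℝ}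
    (hd : ∀ l ∈ co.Λ₁, Avg κ x (dμ (co.q l (clamp T t))) (dμ (moll κ (co.q l (clamp T t))) x)) :
    Avg κ x (fun z => co.Qop h (clamp T t) dμ (fun y => φ (y + (x - z))) z)
      ((co.mollify T κ).Qop h t dμ φ x) := by
  unfold Coeffs.Qop
  simp_rw [fdiff_comp_add, add_sub_cancel]
  exact (hκ.avg_sum _ fun l hl => (hd l hl).mul_const _).const_mul _

lemma Ker.avg_dbar (hκ : Ker κ r) {f : Eu d → ℝ} {n : ℕ} (hf : CB (n + 1) f) (μ : co.Idx) :
    Avg κ x (co.dbar τ τ₀ h μ f) (co.dbar τ τ₀ h μ (moll κ f) x) := by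
  rw [hκ.tf.dbar_moll (CB.of_le hf (by omega))]
  exact Avg.of_cb (hf.dbar μ)

lemma Ker.avg_dbar_dbar (hκ : Ker κ r) {f : Eu d → ℝ} (hf : CB 2 f) (μ ν : co.Idx) :
    Avg κ x (co.dbar τ τ₀ h μ (co.dbar τ τ₀ h ν f))
      (co.dbar τ τ₀ h μ (co.dbar τ τ₀ h ν (moll κ f)) x) := by
  rw [hκ.tf.dbar_moll hf.of_succ]
  exact hκ.avg_dbar (hf.dbar ν) μ

lemma Ker.avg_Aop (hκ : Ker κ r) (hco : co.CBAt (clamp T t)) :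
    Avg κ x (fun z => co.Aop τ τ₀ h (clamp T t) (fun y => φ (y + (x - z))) z)
      ((co.mollify T κ).Aop τ τ₀ h t φ x) := by
  unfold Coeffs.Aop
  rw [dbar_mollify, shift_mollify]
  simp_rw [dbar_comp_add, shift_comp_add, add_sub_cancel]
  refine (hκ.avg_sum _ fun μ _ => Avg.const_mul ?_ _).const_mul 2
  unfold Coeffs.L0op
  refine hκ.avg_add (hκ.avg_Qop fun l hl => hκ.avg_dbar (hco.q l hl) μ) ?_
  simp_rw [fdiff_comp_add, add_sub_cancel]
  exact hκ.avg_sum _ fun l hl => (hκ.avg_dbar (hco.p l hl) μ).mul_const _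

/-- The inequality is used at every `z` for the translate `φ(· + x - z)`, which has the same bound
`B`, and then averaged over `z`. -/
lemma Coeffs.Red1.mollify (hκ : Ker κ r) (hco : co.CBAt (clamp T t))
    (hR : co.Red1 τ τ₀ δ K m h (clamp T t)) : (co.mollify T κ).Red1 τ τ₀ δ K m h t := by
  intro φ hφ B hB x
  rw [dbar_mollify] at hB ⊢
  refine hκ.avg_le ((hκ.avg_Aop (φ := φ) (x := x) hco).const_mul _) (hκ.avg_add (hκ.avg_add
    ((hκ.avg_sum _ fun μ _ => hκ.avg_quad (φ := co.dbar τ τ₀ h μ φ) (x := x) hco).const_mul _)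
    ((hκ.avg_quad (φ := φ) (x := x) hco).const_mul _))
    (((Avg.of_cb hco.c).const_mul _).mul_const _)) fun z => ?_
  have := hR (fun y => φ (y + (x - z))) (hφ.comp_add _) B
    (fun y => by simp_rw [dbar_comp_add]; exact hB _) z
  simp_rw [dbar_comp_add] at this
  exact this

lemma Coeffs.Red2.mollify (hκ : Ker κ r) (hco : co.CBAt (clamp T t))
    (hR : co.Red2 τ τ₀ δ K n h (clamp T t)) : (co.mollify T κ).Red2 τ τ₀ δ K n h t := by
  intro ι _ φ hφ B₂ B₁ hB₂ hB₁ x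
  rw [dbar_mollify] at hB₂ hB₁ ⊢
  rw [shift_mollify]
  refine hκ.avg_le (hκ.avg_add
    ((hκ.avg_sum _ fun k _ => hκ.avg_sum _ fun ν _ =>
      hκ.avg_Aop (φ := co.dbar τ τ₀ h ν (φ k)) (x := x) hco).const_mul _)
    ((hκ.avg_sum _ fun k _ => hκ.avg_sum _ fun μ _ => hκ.avg_sum _ fun ν _ =>
      (hκ.avg_Qop (φ := co.shift h μ (co.shift h ν (φ k))) fun l hl =>
        hκ.avg_dbar_dbar (hco.q l hl) μ ν).const_mul _).const_mul _))
    (hκ.avg_add (hκ.avg_add (hκ.avg_add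
      ((hκ.avg_sum _ fun k _ => hκ.avg_sum _ fun μ _ => hκ.avg_sum _ fun ν _ =>
        hκ.avg_quad (φ := co.dbar τ τ₀ h μ (co.dbar τ τ₀ h ν (φ k))) (x := x) hco).const_mul _)
      ((hκ.avg_sum _ fun k _ => hκ.avg_sum _ fun μ _ =>
        hκ.avg_quad (φ := co.dbar τ τ₀ h μ (φ k)) (x := x) hco).const_mul _))
      (((Avg.of_cb hco.c).const_mul _).mul_const _)) (hκ.avg_const _)) fun z => ?_
  have := hR ι (fun k y => φ k (y + (x - z))) (fun k => (hφ k).comp_add _) B₂ B₁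
    (fun y => by simp_rw [dbar_comp_add]; exact hB₂ _)
    (fun y => by simp_rw [dbar_comp_add]; exact hB₁ _) z
  simp_rw [dbar_comp_add, shift_comp_add, add_sub_cancel] at this
  exact this

end Mollified

/-! ### Mollified admissible coefficients are good. -/

section Admissible
variable {d : ℕ} {co : Coeffs d} {τ : Eu d → ℝ} {τ₀ δ K h h₀ T t c₀ r : ℝ} {m : ℕ}
  {M : Fin (m + 1) → ℝ} {κ : Eu d → ℝ}

/-- The parameters on which the constants of the estimates depend. -/
noncomputable def prmOf (δ K τ₀ c₀ L Lτ : ℝ) {m : ℕ} (M : Fin (m + 1) → ℝ) : Prm :=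
  ⟨m, δ, K, τ₀, c₀, L, Lτ, ∑ k, |M k|⟩

lemma prmOf_M_nonneg (δ K τ₀ c₀ L Lτ : ℝ) {m : ℕ} (M : Fin (m + 1) → ℝ) :
    0 ≤ (prmOf δ K τ₀ c₀ L Lτ M).M := by
  simp only [prmOf]
  positivity

lemma Coeffs.Symmetric.mollify (h : co.Symmetric T) (hT : 0 ≤ T) : (co.mollify T κ).Sym :=
  fun l hl => ⟨(h l hl).1, fun t x => by
    change moll κ (co.q (-l) (clamp T t)) x = moll κ (co.q l (clamp T t)) x
    rw [funext ((h l hl).2 _ (clamp_mem hT t))]⟩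

lemma Coeffs.Antisymmetric.mollify (h : co.Antisymmetric T) (hT : 0 ≤ T) :
    (co.mollify T κ).Asym := fun l hl t x => by
  have e : co.p (-l) (clamp T t) = fun x => -1 * co.p l (clamp T t) x := funext fun x => by
    rw [h l hl _ (clamp_mem hT t)]; ring
  change moll κ (co.p (-l) (clamp T t)) x = -moll κ (co.p l (clamp T t)) x
  rw [e, moll_const_mul]
  ring

lemma Coeffs.Admissible.cbAt (hA : co.Admissible τ τ₀ δ K c₀ h₀ T m M) (hm : 3 ≤ m)
    (ht : t ∈ Icc 0 T) : co.CBAt t where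
  q l hl := ((hA.smooth.1 l hl).1.wb ht).cb hm
  p l hl := ((hA.smooth.1 l hl).2.wb ht).cb hm
  c := (hA.smooth.2.1.wb ht).cb (by omega)

lemma Coeffs.Admissible.weakSq_le (hA : co.Admissible τ τ₀ δ K c₀ h₀ T m M)
    (ht : t ∈ Icc 0 T) {k : ℕ} (hk : k ≤ m) : ∀ᵐ x,
    ∑ lam ∈ co.Λ₁, (weakSq k (co.q lam t) x + weakSq k (co.p lam t) x)
      + weakSq k (co.c t) x ≤ (∑ k, |M k|) ^ 2 := by
  filter_upwards [hA.smooth.2.2 ⟨k, Nat.lt_succ_of_le hk⟩ t ht] with x hx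
  refine hx.trans ?_
  rw [← sq_abs]
  exact pow_le_pow_left₀ (abs_nonneg _) (Finset.single_le_sum (f := fun k => |M k|)
    (fun _ _ => abs_nonneg _) (Finset.mem_univ _)) 2

/-- The one-sided conditions and the balance relation are linear in the coefficients and the
derivative bounds are quadratic, so all survive averaging with parameters independent of the kernel.
Freezing time outside `[0, T]` makes them hold for all times. -/
lemma Coeffs.Admissible.good (hA : co.Admissible τ τ₀ δ K c₀ h₀ T m M) (hm : 3 ≤ m)
    (hδ : δ ∈ Ioc (0 : ℝ) 1) (hK : 1 ≤ K) (hτ₀ : 0 < τ₀) (hc₀ : 0 < c₀) (hT : 0 ≤ T)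
    (hκ : Ker κ r) :
    Good (prmOf δ K τ₀ c₀ (Real.sqrt (∑ lam ∈ co.Λ₁, ‖lam‖ ^ 2))
      (Real.sqrt (∑ lam ∈ co.Λ₁, ‖τ lam • lam‖ ^ 2)) M) h₀ (co.mollify T κ) τ where
  δ_pos := hδ.1
  δ_le := hδ.2
  K_one := hK
  τ₀_pos := hτ₀
  c₀_pos := hc₀
  L_nonneg := Real.sqrt_nonneg _
  M_nonneg := prmOf_M_nonneg _ _ _ _ _ _ M
  m_pos := by simp only [prmOf]; omega
  q_sb l hl := (hA.smooth.1 l hl).1.sb_moll hT hκ.tf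
  p_sb l hl := (hA.smooth.1 l hl).2.sb_moll hT hκ.tf
  c_sb := hA.smooth.2.1.sb_moll hT hκ.tf
  q_bd I hI t x := by
    refine hκ.sum_sq_pdl_moll_le co.Λ₁
      (fun l hl => (hA.smooth.1 l hl).1.wb (clamp_mem hT t)) hI ?_ x
    filter_upwards [hA.weakSq_le (clamp_mem hT t) hI] with z hz
    refine le_trans (le_trans (Finset.sum_le_sum fun l _ => ?_)
      (le_add_of_nonneg_right (weakSq_nonneg _ _ _))) hz
    exact le_add_of_nonneg_right (weakSq_nonneg _ _ _)
  p_bd I hI t x := by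
    refine hκ.sum_sq_pdl_moll_le co.Λ₁
      (fun l hl => (hA.smooth.1 l hl).2.wb (clamp_mem hT t)) hI ?_ x
    filter_upwards [hA.weakSq_le (clamp_mem hT t) hI] with z hz
    refine le_trans (le_trans (Finset.sum_le_sum fun l _ => ?_)
      (le_add_of_nonneg_right (weakSq_nonneg _ _ _))) hz
    exact le_add_of_nonneg_left (weakSq_nonneg _ _ _)
  c_bd t I hI x := by
    refine abs_le_of_sq_le_sq ?_ (prmOf_M_nonneg _ _ _ _ _ _ M)
    have := hκ.sum_sq_pdl_moll_le (Finset.univ : Finset Unit) (v := fun _ => co.c (clamp T t))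
      (fun _ _ => hA.smooth.2.1.wb (clamp_mem hT t)) hI (M := (∑ k, |M k|) ^ 2) ?_ x
    · simpa [prmOf] using this
    filter_upwards [hA.weakSq_le (clamp_mem hT t) hI] with z hz
    refine le_trans ?_ hz
    simp only [Finset.univ_unique, Finset.sum_singleton]
    exact le_add_of_nonneg_left (Finset.sum_nonneg fun _ _ =>
      add_nonneg (weakSq_nonneg _ _ _) (weakSq_nonneg _ _ _))
  chi_nonneg h hh l hl t x := by
    have hco := hA.cbAt hm (clamp_mem hT t)
    exact hκ.avg_le (hκ.avg_const 0) (hκ.avg_add (Avg.of_cb (hco.q l hl))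
      ((Avg.of_cb (hco.p l hl)).const_mul h)) fun z =>
        hA.chi_nonneg _ (clamp_mem hT t) z h hh l hl
  balanced t x := by
    have hco := hA.cbAt hm (clamp_mem hT t)
    ext i
    have h1 := hκ.avg_sum (x := x) co.Λ₁ fun l hl => (Avg.of_cb (hco.q l hl)).mul_const (l i)
    have h2 : ∀ z, ∑ l ∈ co.Λ₁, co.q l (clamp T t) z * l i = 0 := fun z => by
      have := congrArg (fun v : Eu d => v i) (hA.balanced _ (clamp_mem hT t) z)
      simpa using this
    simp_rw [h2] at h1
    have h3 := h1.eq
    rw [hκ.moll_const] at h3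
    simpa using h3.symm
  c_lower t x := hκ.le_moll (hA.cbAt hm (clamp_mem hT t)).c.locallyIntegrable
    (Filter.Eventually.of_forall fun z => hA.c_lower _ (clamp_mem hT t) z) x
  L_le := by
    simp only [prmOf]
    rw [Real.sq_sqrt (Finset.sum_nonneg fun _ _ => sq_nonneg _)]
  Lτ_le := by
    simp only [prmOf]
    rw [Real.sq_sqrt (Finset.sum_nonneg fun _ _ => sq_nonneg _)]
  red1 h hh t := (hA.structural1.red1 hδ.2 (fun x => hc₀.le.trans
    (hA.c_lower _ (clamp_mem hT t) x)) hh (clamp_mem hT t)).mollify hκ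
      (hA.cbAt hm (clamp_mem hT t))
  red2 h hh n hn t := (hA.structural2.red2 hδ.2 (by linarith) (fun x => hc₀.le.trans
    (hA.c_lower _ (clamp_mem hT t) x)) hh hn (clamp_mem hT t)).mollify hκ
      (hA.cbAt hm (clamp_mem hT t))

end Admissible
end Richardson

namespace Richardson

/-! ### Solutions of the scheme with rough coefficients -/

section Bounds
variable {d : ℕ} {co co' : Coeffs d} {T h t a S : ℝ} {φ : Eu d → ℝ} {x : Eu d}

/-- The norm of `L_h` as a bounded operator for coefficients of size one. -/
noncomputable def Coeffs.opNorm (co : Coeffs d) (h : ℝ) : ℝ :=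
  co.Λ₁.card * ((1 / h + 1) * (2 / h)) + 1

lemma opNorm_pos (hh : 0 < h) : 0 < co.opNorm h := by
  unfold Coeffs.opNorm
  positivity

lemma abs_Lh_le (hh : 0 < h) (hq : ∀ l ∈ co.Λ₁, |co.q l t x| ≤ a)
    (hp : ∀ l ∈ co.Λ₁, |co.p l t x| ≤ a) (hc : |co.c t x| ≤ a) (hφ : ∀ y, |φ y| ≤ S) :
    |co.Lh h t φ x| ≤ a * (co.opNorm h * S) := by
  have hS : 0 ≤ S := (abs_nonneg _).trans (hφ 0)
  have ha : 0 ≤ a := (abs_nonneg _).trans hc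
  rw [Lh_eq_sum]
  have h1 : ∀ l ∈ co.Λ₁, |((1 / h) * co.q l t x + co.p l t x) * (1 / h * (φ (x + h • l) - φ x))| ≤
      a * ((1 / h + 1) * (2 / h)) * S := by
    intro l hl
    rw [abs_mul, abs_mul, abs_of_pos (show 0 < 1 / h by positivity)]
    have h2 : |(1 / h) * co.q l t x + co.p l t x| ≤ (1 / h + 1) * a := by
      refine (abs_add_le _ _).trans ?_
      rw [abs_mul, abs_of_pos (show 0 < 1 / h by positivity), add_mul, one_mul]
      exact add_le_add (mul_le_mul_of_nonneg_left (hq l hl) (by positivity)) (hp l hl)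
    have h3 : |φ (x + h • l) - φ x| ≤ 2 * S := by
      refine (abs_sub _ _).trans ?_
      linarith [hφ (x + h • l), hφ x]
    calc _ ≤ (1 / h + 1) * a * (1 / h * (2 * S)) := by gcongr
      _ = _ := by ring
  have h4 : |co.c t x * φ x| ≤ a * S := by
    rw [abs_mul]
    exact mul_le_mul hc (hφ x) (abs_nonneg _) ha
  calc _ ≤ ∑ _l ∈ co.Λ₁, a * ((1 / h + 1) * (2 / h)) * S + a * S :=
        (abs_sub _ _).trans (add_le_add ((Finset.abs_sum_le_sum_abs _ _).trans
          (Finset.sum_le_sum h1)) h4)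
    _ = _ := by
        rw [Finset.sum_const, nsmul_eq_mul]
        unfold Coeffs.opNorm
        ring

lemma abs_Lh_sub_le {q p q' p' : Eu d → ℝ → Eu d → ℝ} {c c' : ℝ → Eu d → ℝ} {Λ : Finset (Eu d)}
    (hh : 0 < h) (hq : ∀ l ∈ Λ, |q l t x - q' l t x| ≤ a)
    (hp : ∀ l ∈ Λ, |p l t x - p' l t x| ≤ a) (hc : |c t x - c' t x| ≤ a) (hφ : ∀ y, |φ y| ≤ S) :
    |(⟨Λ, q, p, c⟩ : Coeffs d).Lh h t φ x - (⟨Λ, q', p', c'⟩ : Coeffs d).Lh h t φ x| ≤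
      a * ((⟨Λ, q, p, c⟩ : Coeffs d).opNorm h * S) := by
  have e : (⟨Λ, q, p, c⟩ : Coeffs d).Lh h t φ x - (⟨Λ, q', p', c'⟩ : Coeffs d).Lh h t φ x =
      (⟨Λ, fun l t x => q l t x - q' l t x, fun l t x => p l t x - p' l t x,
        fun t x => c t x - c' t x⟩ : Coeffs d).Lh h t φ x := by
    rw [Lh_eq_sum, Lh_eq_sum, Lh_eq_sum, sub_sub_sub_comm, ← Finset.sum_sub_distrib]
    congr 1
    · exact Finset.sum_congr rfl fun l _ => by ring
    · ring
  rw [e]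
  exact abs_Lh_le hh hq hp hc hφ

lemma intervalIntegrable_of_clamp {φ : ℝ → ℝ} {C s : ℝ} (hm : Measurable fun t => φ (clamp T t))
    (hC : ∀ t ∈ Icc 0 T, |φ t| ≤ C) (hs : s ∈ Icc 0 T) :
    IntervalIntegrable φ volume 0 s := by
  refine (intervalIntegrable_of_bdd hm (fun t => hC _ (clamp_mem (hs.1.trans hs.2) t)) 0 s).congr
    fun t ht => ?_
  rw [uIoc_of_le hs.1] at ht
  rw [clamp_eq ⟨ht.1.le, ht.2.trans hs.2⟩]

lemma measurable_clamp_of_Icc (hT : 0 ≤ T) {u : ℝ → Eu d → ℝ}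
    (hu : Measurable fun z : Icc (0 : ℝ) T × Eu d => u z.1 z.2) :
    Measurable (Function.uncurry fun t => u (clamp T t)) := by
  have h1 : Measurable fun z : ℝ × Eu d => ((⟨clamp T z.1, clamp_mem hT _⟩ : Icc (0 : ℝ) T), z.2) :=
    (((continuous_clamp T).measurable.comp measurable_fst).subtype_mk).prodMk measurable_snd
  exact hu.comp h1

end Bounds

/-! ### The problem with rough data and its mollifications. -/

section Problem
open Filter Topology
variable {d : ℕ} {P : Prm} {h₀ T h t : ℝ} {co : Coeffs d} {τ : Eu d → ℝ} {f : ℝ → Eu d → ℝ}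
  {g : Eu d → ℝ} {u w : ℝ → Eu d → ℝ} {x : Eu d}

/-- A problem whose coefficients can be mollified within the class of good schemes. -/
structure Problem (P : Prm) (h₀ T : ℝ) (co : Coeffs d) (τ : Eu d → ℝ) (f : ℝ → Eu d → ℝ)
    (g : Eu d → ℝ) : Prop where
  T_nonneg : 0 ≤ T
  m_le : 3 ≤ P.m
  h₀_pos : 0 < h₀
  good : ∀ κ r, Ker κ r → Good P h₀ (co.mollify T κ) τ
  q : ∀ l ∈ co.Λ₁, InB T P.m (co.q l)
  p : ∀ l ∈ co.Λ₁, InB T P.m (co.p l)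
  c : InB T P.m co.c
  f : InB T P.m f
  g : InB T P.m fun _ => g

/-- The mollified coefficients. -/
noncomputable abbrev Coeffs.approx (co : Coeffs d) (T : ℝ) (j : ℕ) : Coeffs d :=
  co.mollify T (kerSeq d j)

/-- The solutions of the scheme with mollified coefficients and data. -/
noncomputable def Coeffs.approxSol (co : Coeffs d) (T : ℝ) (f : ℝ → Eu d → ℝ) (g : Eu d → ℝ)
    (j : ℕ) (h : ℝ) : ℝ → Eu d → ℝ :=
  (co.approx T j).sol T h (fun t => moll (kerSeq d j) (f (clamp T t))) (moll (kerSeq d j) g)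

/-- A common bound for the coefficients. -/
noncomputable def Coeffs.size (co : Coeffs d) (T : ℝ) (m : ℕ) : ℝ :=
  ∑ l ∈ co.Λ₁, (normB T m (co.q l) + normB T m (co.p l)) + normB T m co.c

namespace Problem

lemma zero_mem (hP : Problem P h₀ T co τ f g) : (0 : ℝ) ∈ Icc 0 T := ⟨le_rfl, hP.T_nonneg⟩

lemma normB_nonneg (hP : Problem P h₀ T co τ f g) :
    0 ≤ normB T P.m f + normB T P.m fun _ => g := add_nonneg hP.f.normB_spec.1 hP.g.normB_spec.1

lemma sb_f (hP : Problem P h₀ T co τ f g) {κ : Eu d → ℝ} {r : ℝ} (hκ : Ker κ r) :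
    SB fun t => moll κ (f (clamp T t)) := hP.f.sb_moll hP.T_nonneg hκ.tf

lemma smb_g (hP : Problem P h₀ T co τ f g) {κ : Eu d → ℝ} {r : ℝ} (hκ : Ker κ r) :
    Smb (moll κ g) := (hP.g.sb_moll hP.T_nonneg hκ.tf).usmooth.smb 0

lemma wb_f (hP : Problem P h₀ T co τ f g) (ht : t ∈ Icc 0 T) :
    WB P.m (normB T P.m f + normB T P.m fun _ => g) (f t) :=
  (hP.f.wb ht).mono le_rfl (le_add_of_nonneg_right hP.g.normB_spec.1)

lemma wb_g (hP : Problem P h₀ T co τ f g) :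
    WB P.m (normB T P.m f + normB T P.m fun _ => g) g :=
  (hP.g.wb hP.zero_mem).mono le_rfl (le_add_of_nonneg_left hP.f.normB_spec.1)

lemma ssol (hP : Problem P h₀ T co τ f g) (j : ℕ) (h : ℝ) :
    SSol (co.approx T j) T h (fun t => moll (kerSeq d j) (f (clamp T t))) (moll (kerSeq d j) g)
      (co.approxSol T f g j h) :=
  (hP.good _ _ (ker_kerSeq d j)).ssol_sol hP.T_nonneg (hP.sb_f (ker_kerSeq d j))
    (hP.smb_g (ker_kerSeq d j))

lemma le_size (hP : Problem P h₀ T co τ f g) : 0 ≤ co.size T P.m ∧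
    (∀ l ∈ co.Λ₁, normB T P.m (co.q l) ≤ co.size T P.m) ∧
    (∀ l ∈ co.Λ₁, normB T P.m (co.p l) ≤ co.size T P.m) ∧ normB T P.m co.c ≤ co.size T P.m := by
  have h0 : ∀ l ∈ co.Λ₁, 0 ≤ normB T P.m (co.q l) + normB T P.m (co.p l) := fun l hl =>
    add_nonneg (hP.q l hl).normB_spec.1 (hP.p l hl).normB_spec.1
  have hc := hP.c.normB_spec.1
  have hs := Finset.sum_nonneg h0
  unfold Coeffs.size
  refine ⟨add_nonneg hs hc, fun l hl => ?_, fun l hl => ?_, le_add_of_nonneg_left hs⟩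
  · have := Finset.single_le_sum h0 hl
    linarith [(hP.p l hl).normB_spec.1]
  · have := Finset.single_le_sum h0 hl
    linarith [(hP.q l hl).normB_spec.1]

lemma wb_q (hP : Problem P h₀ T co τ f g) (ht : t ∈ Icc 0 T) :
    ∀ l ∈ co.Λ₁, WB P.m (co.size T P.m) (co.q l t) :=
  fun l hl => ((hP.q l hl).wb ht).mono le_rfl (hP.le_size.2.1 l hl)

lemma wb_p (hP : Problem P h₀ T co τ f g) (ht : t ∈ Icc 0 T) :
    ∀ l ∈ co.Λ₁, WB P.m (co.size T P.m) (co.p l t) :=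
  fun l hl => ((hP.p l hl).wb ht).mono le_rfl (hP.le_size.2.2.1 l hl)

lemma wb_c (hP : Problem P h₀ T co τ f g) (ht : t ∈ Icc 0 T) :
    WB P.m (co.size T P.m) (co.c t) := (hP.c.wb ht).mono le_rfl hP.le_size.2.2.2

lemma _root_.Richardson.WB.abs_le {m : ℕ} {C : ℝ} {v : Eu d → ℝ} (h : WB m C v) (hm : 1 ≤ m)
    (x : Eu d) : |v x| ≤ C := (h.contDiff (n := 0) hm).2 [] (by simp) x

/-- The operator of the mollified scheme is close to that of the scheme. -/
lemma abs_Lh_approx_sub_le (hP : Problem P h₀ T co τ f g) (hh : 0 < h) (ht : t ∈ Icc 0 T) (j : ℕ)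
    {φ : Eu d → ℝ} {S : ℝ} (hφ : ∀ y, |φ y| ≤ S) (x : Eu d) :
    |(co.approx T j).Lh h t φ x - co.Lh h t φ x| ≤
      d * co.size T P.m * (1 / ((j : ℝ) + 1)) * (co.opNorm h * S) := by
  have hm : 1 ≤ P.m := by have := hP.m_le; omega
  refine abs_Lh_sub_le (q' := co.q) (p' := co.p) (c' := co.c) hh (fun l hl => ?_) (fun l hl => ?_)
    ?_ hφ
  · rw [clamp_eq ht]
    exact (hP.wb_q ht l hl).abs_moll_sub_le hm (ker_kerSeq d j) x
  · rw [clamp_eq ht]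
    exact (hP.wb_p ht l hl).abs_moll_sub_le hm (ker_kerSeq d j) x
  · rw [clamp_eq ht]
    exact (hP.wb_c ht).abs_moll_sub_le hm (ker_kerSeq d j) x

lemma abs_Lh_le (hP : Problem P h₀ T co τ f g) (hh : 0 < h) (ht : t ∈ Icc 0 T)
    {φ : Eu d → ℝ} {S : ℝ} (hφ : ∀ y, |φ y| ≤ S) (x : Eu d) :
    |co.Lh h t φ x| ≤ co.size T P.m * (co.opNorm h * S) := by
  have hm : 1 ≤ P.m := by have := hP.m_le; omega
  exact Richardson.abs_Lh_le hh (fun l hl => (hP.wb_q ht l hl).abs_le hm x)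
    (fun l hl => (hP.wb_p ht l hl).abs_le hm x) ((hP.wb_c ht).abs_le hm x) hφ

lemma measurable_Lh (hP : Problem P h₀ T co τ f g)
    (hu : Measurable (Function.uncurry fun t => u (clamp T t))) (h : ℝ) :
    Measurable (Function.uncurry fun t => co.Lh h (clamp T t) (u (clamp T t))) := by
  have hs : ∀ v : Eu d, Measurable fun z : ℝ × Eu d => u (clamp T z.1) (z.2 + v) := fun v =>
    hu.comp (measurable_fst.prodMk (measurable_snd.add_const v))
  have e : (Function.uncurry fun t => co.Lh h (clamp T t) (u (clamp T t))) = fun z : ℝ × Eu d =>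
      ∑ lam ∈ co.Λ₁, ((1 / h) * co.q lam (clamp T z.1) z.2 + co.p lam (clamp T z.1) z.2) *
      (1 / h * (u (clamp T z.1) (z.2 + h • lam) - u (clamp T z.1) z.2))
        - co.c (clamp T z.1) z.2 * u (clamp T z.1) z.2 := by
    funext z
    exact Lh_eq_sum _ _
  rw [e]
  refine Measurable.sub (Finset.measurable_sum _ fun l hl => ?_)
    ((hP.c.measurable_clamp hP.T_nonneg).mul hu)
  refine Measurable.mul ?_ (((hs _).sub hu).const_mul _)
  exact (((hP.q l hl).measurable_clamp hP.T_nonneg).const_mul _).add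
    ((hP.p l hl).measurable_clamp hP.T_nonneg)

/-- A limit of the corresponding property of the mollified schemes. -/
lemma chi_nonneg (hP : Problem P h₀ T co τ f g) (hh : h ∈ Ioc 0 h₀) {l : Eu d} (hl : l ∈ co.Λ₁)
    (ht : t ∈ Icc 0 T) (x : Eu d) : 0 ≤ co.q l t x + h * co.p l t x := by
  refine ge_of_tendsto' (x := atTop) (((tendsto_moll_kerSeq (hP.wb_q ht l hl).continuous x).add
    ((tendsto_moll_kerSeq (hP.wb_p ht l hl).continuous x).const_mul h))) fun j => ?_
  have := (hP.good _ _ (ker_kerSeq d j)).chi_nonneg h hh l hl t x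
  simpa only [clamp_eq ht] using this

lemma c_lower (hP : Problem P h₀ T co τ f g) (ht : t ∈ Icc 0 T) (x : Eu d) :
    P.c₀ ≤ co.c t x := by
  refine ge_of_tendsto' (x := atTop) (tendsto_moll_kerSeq (hP.wb_c ht).continuous x) fun j => ?_
  have := (hP.good _ _ (ker_kerSeq d j)).c_lower t x
  simpa only [clamp_eq ht] using this

lemma stable (hP : Problem P h₀ T co τ f g) (hh : h ∈ Ioc 0 h₀) : co.Stable P.c₀ h T where
  chi l hl t ht x := hP.chi_nonneg hh hl ht x
  c_lower t ht x := hP.c_lower ht x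
  bdd := by
    have hm : 1 ≤ P.m := by have := hP.m_le; omega
    have hh0 := hh.1
    refine ⟨∑ _l ∈ co.Λ₁, (co.size T P.m + h * co.size T P.m) / h ^ 2 + co.size T P.m,
      fun t ht x => add_le_add (Finset.sum_le_sum fun l hl => ?_)
        ((le_abs_self _).trans ((hP.wb_c ht).abs_le hm x))⟩
    gcongr
    · exact (le_abs_self _).trans ((hP.wb_q ht l hl).abs_le hm x)
    · exact (le_abs_self _).trans ((hP.wb_p ht l hl).abs_le hm x)

lemma c₀_pos (hP : Problem P h₀ T co τ f g) : 0 < P.c₀ := (hP.good _ _ (ker_kerSeq d 0)).c₀_pos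

end Problem
end Problem
end Richardson

namespace Richardson

/-! ### Removing the mollification at a fixed step. -/

section Limits
open Filter Topology
variable {d : ℕ} {P : Prm} {h₀ T h t : ℝ} {co : Coeffs d} {τ : Eu d → ℝ} {f : ℝ → Eu d → ℝ}
  {g : Eu d → ℝ} {u w : ℝ → Eu d → ℝ} {x : Eu d}

lemma SB.measurable_uncurry {φ : ℝ → Eu d → ℝ} (hφ : SB φ) : Measurable (Function.uncurry φ) :=
  (measurable_uncurry_of_continuous_of_measurable (u := fun x t => φ t x)
    (fun t => (hφ.usmooth.smooth t).continuous) hφ.meas).comp measurable_swap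

namespace Problem

lemma one_le_m (hP : Problem P h₀ T co τ f g) : 1 ≤ P.m := by have := hP.m_le; omega

/-- Mollification changes neither the parameters nor the bounds on the data, so the a priori
constant serves for all kernels, steps and times. -/
lemma exists_bd_approxSol (P : Prm) (d : ℕ) : ∃ N : ℝ, 0 ≤ N ∧ ∀ (h₀ T : ℝ) (co : Coeffs d)
    (τ : Eu d → ℝ) (f : ℝ → Eu d → ℝ) (g : Eu d → ℝ), Problem P h₀ T co τ f g →
    ∀ h ∈ Ioc 0 h₀, ∀ j, ∀ t ∈ Icc 0 T,
      Bd P.m (N * (normB T P.m f + normB T P.m fun _ => g)) (co.approxSol T f g j h t) := by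
  obtain ⟨N, hN, H⟩ := Good.apriori P d P.m le_rfl
  refine ⟨N, hN, fun h₀ T co τ f g hP h hh j t ht => ?_⟩
  exact H h₀ _ τ h T _ _ _ _ (hP.good _ _ (ker_kerSeq d j)) hh (hP.ssol j h)
    (fun s _ => (hP.wb_f (clamp_mem hP.T_nonneg s)).bd_moll (ker_kerSeq d j))
    (hP.wb_g.bd_moll (ker_kerSeq d j)) t ht

lemma abs_moll_f_sub_le (hP : Problem P h₀ T co τ f g) (j : ℕ) (ht : t ∈ Icc 0 T) (x : Eu d) :
    |moll (kerSeq d j) (f (clamp T t)) x - f t x| ≤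
      d * (normB T P.m f + normB T P.m fun _ => g) * (1 / ((j : ℝ) + 1)) := by
  rw [clamp_eq ht]
  exact (hP.wb_f ht).abs_moll_sub_le hP.one_le_m (ker_kerSeq d j) x

lemma abs_moll_g_sub_le (hP : Problem P h₀ T co τ f g) (j : ℕ) (x : Eu d) :
    |moll (kerSeq d j) g x - g x| ≤
      d * (normB T P.m f + normB T P.m fun _ => g) * (1 / ((j : ℝ) + 1)) :=
  hP.wb_g.abs_moll_sub_le hP.one_le_m (ker_kerSeq d j) x

lemma ssol_intervalIntegrable (hP : Problem P h₀ T co τ f g) (j : ℕ) (h : ℝ) (x : Eu d)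
    (a b : ℝ) : IntervalIntegrable (fun s => (co.approx T j).Lh h s (co.approxSol T f g j h s) x +
      moll (kerSeq d j) (f (clamp T s)) x) volume a b :=
  (((hP.good _ _ (ker_kerSeq d j)).sb_Lh h (hP.ssol j h).u_sb).add
    (hP.ssol j h).f_sb).intervalIntegrable x a b

/-- The difference solves the `i`-th scheme with a free term made of differences of coefficients and
data, all of the size of the kernel radii. The factor `co.opNorm h` is not uniform in `h`, which is
harmless because the mollification is removed at a fixed step. -/
lemma abs_approxSol_sub_le (hP : Problem P h₀ T co τ f g) (hh : h ∈ Ioc 0 h₀) {S : ℝ}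
    (hS : ∀ j, ∀ t ∈ Icc 0 T, Bd P.m S (co.approxSol T f g j h t)) (i j : ℕ)
    (ht : t ∈ Icc 0 T) (x : Eu d) :
    |co.approxSol T f g i h t x - co.approxSol T f g j h t x| ≤
      (d * (normB T P.m f + normB T P.m fun _ => g) + d * (co.size T P.m * (co.opNorm h * S) +
        (normB T P.m f + normB T P.m fun _ => g)) / P.c₀) *
        (1 / ((i : ℝ) + 1) + 1 / ((j : ℝ) + 1)) := by
  set F := normB T P.m f + normB T P.m fun _ => g with hF
  set A := co.size T P.m
  set ui := co.approxSol T f g i h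
  set uj := co.approxSol T f g j h
  have hF0 : 0 ≤ F := hP.normB_nonneg
  have hA0 : 0 ≤ A := hP.le_size.1
  have hS0 : 0 ≤ S := (hS 0 0 hP.zero_mem).nonneg
  have hB0 : 0 < co.opNorm h := opNorm_pos hh.1
  have hc₀ := hP.c₀_pos
  set ei : ℝ := 1 / ((i : ℝ) + 1)
  set ej : ℝ := 1 / ((j : ℝ) + 1)
  have hei : 0 ≤ ei := by positivity
  have hej : 0 ≤ ej := by positivity
  have hGi := hP.good _ _ (ker_kerSeq d i)
  refine (hGi.stable (T := T) hh).bound hc₀ hh.1 (w := fun t x => ui t x - uj t x)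
    (e := fun t x => ((co.approx T i).Lh h t (uj t) x - (co.approx T j).Lh h t (uj t) x) +
      (moll (kerSeq d i) (f (clamp T t)) x - moll (kerSeq d j) (f (clamp T t)) x))
    (w₀ := fun x => moll (kerSeq d i) g x - moll (kerSeq d j) g x) hP.T_nonneg (A := S + S)
    ?_ ?_ ?_ ?_ ?_ t ht x
  · intro t ht x
    exact (abs_sub _ _).trans (add_le_add ((hS i t ht).abs_le x) ((hS j t ht).abs_le x))
  · intro x
    refine ((hP.ssol_intervalIntegrable i h x 0 T).sub
      (hP.ssol_intervalIntegrable j h x 0 T)).congr fun s _ => ?_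
    rw [Lh_sub]
    ring
  · intro t ht x
    have e1 : ui t x = _ := (hP.ssol i h).eqn t ht x
    have e2 : uj t x = _ := (hP.ssol j h).eqn t ht x
    rw [e1, e2, add_sub_add_comm,
      ← intervalIntegral.integral_sub (hP.ssol_intervalIntegrable i h x 0 t)
        (hP.ssol_intervalIntegrable j h x 0 t)]
    congr 1
    refine intervalIntegral.integral_congr fun s _ => ?_
    rw [Lh_sub]
    ring
  · intro x
    have h1 := hP.abs_moll_g_sub_le i x
    have h2 := hP.abs_moll_g_sub_le j x
    have h3 : |moll (kerSeq d i) g x - moll (kerSeq d j) g x| ≤ d * F * (ei + ej) := by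
      refine (abs_sub_le _ (g x) _).trans ?_
      rw [abs_sub_comm (g x)]
      rw [mul_add]
      exact add_le_add h1 h2
    refine h3.trans (mul_le_mul_of_nonneg_right (le_add_of_nonneg_right ?_) (by positivity))
    positivity
  · intro t ht x
    have h1 := hP.abs_Lh_approx_sub_le hh.1 ht i (hS j t ht).abs_le x
    have h2 := hP.abs_Lh_approx_sub_le hh.1 ht j (hS j t ht).abs_le x
    have h3 := hP.abs_moll_f_sub_le i ht x
    have h4 := hP.abs_moll_f_sub_le j ht x
    have h5 : |(co.approx T i).Lh h t (uj t) x - (co.approx T j).Lh h t (uj t) x| ≤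
        d * A * ei * (co.opNorm h * S) + d * A * ej * (co.opNorm h * S) := by
      refine (abs_sub_le _ (co.Lh h t (uj t) x) _).trans ?_
      rw [abs_sub_comm (co.Lh h t (uj t) x)]
      exact add_le_add h1 h2
    have h6 : |moll (kerSeq d i) (f (clamp T t)) x - moll (kerSeq d j) (f (clamp T t)) x| ≤
        d * F * ei + d * F * ej := by
      refine (abs_sub_le _ (f t x) _).trans ?_
      rw [abs_sub_comm (f t x)]
      exact add_le_add h3 h4
    refine (abs_add_le _ _).trans ((add_le_add h5 h6).trans ?_)
    have e : P.c₀ * ((d * F + d * (A * (co.opNorm h * S) + F) / P.c₀) * (ei + ej)) =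
        P.c₀ * (d * F) * (ei + ej) + d * (A * (co.opNorm h * S) + F) * (ei + ej) := by
      field_simp
    rw [e]
    have : 0 ≤ P.c₀ * (d * F) * (ei + ej) := by positivity
    linarith

lemma tendsto_Lh_approx (hP : Problem P h₀ T co τ f g) (ht : t ∈ Icc 0 T)
    {φ : ℕ → Eu d → ℝ} {ψ : Eu d → ℝ} (hφ : ∀ y, Tendsto (fun j => φ j y) atTop (𝓝 (ψ y)))
    (x : Eu d) : Tendsto (fun j => (co.approx T j).Lh h t (φ j) x) atTop (𝓝 (co.Lh h t ψ x)) := by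
  simp_rw [Lh_eq_sum, clamp_eq ht]
  refine Tendsto.sub (tendsto_finsetSum _ fun l hl => Tendsto.mul ?_ ?_) ?_
  · exact ((tendsto_moll_kerSeq (hP.wb_q ht l hl).continuous x).const_mul _).add
      (tendsto_moll_kerSeq (hP.wb_p ht l hl).continuous x)
  · exact ((hφ _).sub (hφ _)).const_mul _
  · exact (tendsto_moll_kerSeq (hP.wb_c ht).continuous x).mul (hφ _)

/-- The scheme is solvable, and its solution is a limit of smooth solutions. -/
theorem exists_schemeSol (hP : Problem P h₀ T co τ f g) (hh : h ∈ Ioc 0 h₀) :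
    ∃ u, IsSchemeSol co T h f g u ∧ ∃ R : ℝ, 0 ≤ R ∧ ∀ j : ℕ, ∀ t ∈ Icc 0 T, ∀ x,
      |co.approxSol T f g j h t x - u t x| ≤ R * (1 / ((j : ℝ) + 1)) := by
  obtain ⟨N, hN, HN⟩ := exists_bd_approxSol P d
  have hS := HN h₀ T co τ f g hP h hh
  set F := normB T P.m f + normB T P.m fun _ => g with hF
  set S := N * F
  have hcau := fun i j t ht x => hP.abs_approxSol_sub_le hh hS i j (t := t) ht x
  set R := d * F + d * (co.size T P.m * (co.opNorm h * S) + F) / P.c₀ with hR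
  have hF0 : 0 ≤ F := hP.normB_nonneg
  have hA0 := hP.le_size.1
  have hS0 : 0 ≤ S := mul_nonneg hN hF0
  have hB0 : 0 < co.opNorm h := opNorm_pos hh.1
  have hc₀ := hP.c₀_pos
  have hR0 : 0 ≤ R := by positivity
  have hlim : Tendsto (fun j : ℕ => 1 / ((j : ℝ) + 1)) atTop (𝓝 0) :=
    tendsto_one_div_add_atTop_nhds_zero_nat
  have hex : ∀ t x, ∃ l, Tendsto (fun j => co.approxSol T f g j h (clamp T t) x) atTop (𝓝 l) := by
    intro t x
    refine cauchySeq_tendsto_of_complete ?_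
    rw [Metric.cauchySeq_iff']
    intro ε hε
    have h2 : Tendsto (fun j : ℕ => R * (1 / ((j : ℝ) + 1) + 1 / ((j : ℝ) + 1))) atTop (𝓝 0) := by
      simpa using (hlim.add hlim).const_mul R
    obtain ⟨J, hJ⟩ := (h2.eventually_lt_const hε).exists
    refine ⟨J, fun n hn => ?_⟩
    rw [Real.dist_eq]
    refine (hcau n J _ (clamp_mem hP.T_nonneg t) x).trans_lt (lt_of_le_of_lt ?_ hJ)
    gcongr
  choose u hu using hex
  have hu' : ∀ t ∈ Icc 0 T, ∀ x, Tendsto (fun j => co.approxSol T f g j h t x) atTop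
      (𝓝 (u t x)) := fun t ht x => by
    have := hu t x
    rwa [clamp_eq ht] at this
  have hrate : ∀ j : ℕ, ∀ t ∈ Icc 0 T, ∀ x,
      |co.approxSol T f g j h t x - u t x| ≤ R * (1 / ((j : ℝ) + 1)) := by
    intro j t ht x
    have h1 : Tendsto (fun i : ℕ => R * (1 / ((j : ℝ) + 1) + 1 / ((i : ℝ) + 1))) atTop
        (𝓝 (R * (1 / ((j : ℝ) + 1) + 0))) := (hlim.const_add _).const_mul R
    rw [add_zero] at h1
    exact le_of_tendsto_of_tendsto' ((hu' t ht x).const_sub _).abs h1 fun i => hcau j i t ht x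
  have hb : ∀ t ∈ Icc 0 T, ∀ x, |u t x| ≤ S := fun t ht x =>
    le_of_tendsto' (hu' t ht x).abs fun j => (hS j t ht).abs_le x
  refine ⟨u, ⟨?_, ⟨S, hb⟩, ?_⟩, R, hR0, hrate⟩
  · have hm : Measurable (Function.uncurry u) := by
      refine measurable_of_tendsto_metrizable (fun j => ?_)
        (tendsto_pi_nhds.2 fun z => hu z.1 z.2)
      have hsb := (hP.ssol j h).u_sb.comp_measurable (continuous_clamp T).measurable
      exact hsb.measurable_uncurry
    exact hm.comp ((measurable_subtype_coe.comp measurable_fst).prodMk measurable_snd)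
  · intro t ht x
    refine tendsto_nhds_unique (hu' t ht x) ?_
    simp_rw [fun j => (hP.ssol j h).eqn t ht x]
    refine (tendsto_moll_kerSeq hP.wb_g.continuous x).add ?_
    -- The dominating constant bounds the mollified operator by the original one plus their
    -- difference, using that the kernel radii are at most `1`.
    refine intervalIntegral.tendsto_integral_filter_of_dominated_convergence
      (fun _ => (co.size T P.m + d * co.size T P.m) * (co.opNorm h * S) + F) ?_ ?_ ?_ ?_
    · exact Eventually.of_forall fun j =>
        (intervalIntegrable_iff.1 (hP.ssol_intervalIntegrable j h x 0 t)).aestronglyMeasurable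
    · refine Eventually.of_forall fun j => Eventually.of_forall fun s hs => ?_
      rw [uIoc_of_le ht.1] at hs
      have hs' : s ∈ Icc 0 T := ⟨hs.1.le, hs.2.trans ht.2⟩
      rw [Real.norm_eq_abs]
      have h1 := hP.abs_Lh_approx_sub_le hh.1 hs' j (hS j s hs').abs_le x
      have h2 := hP.abs_Lh_le hh.1 hs' (hS j s hs').abs_le x
      have h3 : |moll (kerSeq d j) (f (clamp T s)) x| ≤ F :=
        ((hP.wb_f (clamp_mem hP.T_nonneg s)).bd_moll (ker_kerSeq d j)).abs_le x
      have h4 : d * co.size T P.m * (1 / ((j : ℝ) + 1)) * (co.opNorm h * S) ≤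
          d * co.size T P.m * (co.opNorm h * S) := by
        have : 1 / ((j : ℝ) + 1) ≤ 1 := by
          rw [div_le_one (by positivity)]
          linarith [(Nat.cast_nonneg j : (0 : ℝ) ≤ j)]
        have h5 := mul_le_mul_of_nonneg_left this (show 0 ≤ d * co.size T P.m by positivity)
        rw [mul_one] at h5
        exact mul_le_mul_of_nonneg_right h5 (by positivity)
      refine (abs_add_le _ _).trans (add_le_add ?_ h3)
      have h6 := abs_add_le ((co.approx T j).Lh h s (co.approxSol T f g j h s) x -
        co.Lh h s (co.approxSol T f g j h s) x) (co.Lh h s (co.approxSol T f g j h s) x)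
      rw [sub_add_cancel] at h6
      linarith
    · exact intervalIntegrable_const
    · refine Eventually.of_forall fun s hs => ?_
      rw [uIoc_of_le ht.1] at hs
      have hs' : s ∈ Icc 0 T := ⟨hs.1.le, hs.2.trans ht.2⟩
      refine (hP.tendsto_Lh_approx hs' (hu' s hs') x).add ?_
      rw [clamp_eq hs']
      exact tendsto_moll_kerSeq (hP.wb_f hs').continuous x

lemma schemeSol_intervalIntegrable (hP : Problem P h₀ T co τ f g) (hh : h ∈ Ioc 0 h₀)
    (hu : IsSchemeSol co T h f g u) (x : Eu d) (ht : t ∈ Icc 0 T) :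
    IntervalIntegrable (fun s => co.Lh h s (u s) x + f s x) volume 0 t := by
  obtain ⟨C, hC⟩ := hu.bounded
  have hmu := hP.measurable_Lh (measurable_clamp_of_Icc hP.T_nonneg hu.measurable) h
  refine intervalIntegrable_of_clamp (T := T) (C := co.size T P.m * (co.opNorm h * C) +
    (normB T P.m f + normB T P.m fun _ => g)) ?_ (fun s hs => ?_) ht
  · exact ((hmu.add (hP.f.measurable_clamp hP.T_nonneg)).comp measurable_prodMk_right :)
  · exact (abs_add_le _ _).trans (add_le_add (hP.abs_Lh_le hh.1 hs (hC s hs) x)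
      ((hP.wb_f hs).abs_le hP.one_le_m x))

theorem schemeSol_unique (hP : Problem P h₀ T co τ f g) (hh : h ∈ Ioc 0 h₀)
    (hu : IsSchemeSol co T h f g u) (hw : IsSchemeSol co T h f g w) (ht : t ∈ Icc 0 T) :
    w t = u t := by
  obtain ⟨C, hC⟩ := hu.bounded
  obtain ⟨C', hC'⟩ := hw.bounded
  funext x
  have := (hP.stable hh).bound hP.c₀_pos hh.1 (w := fun t x => w t x - u t x)
    (e := fun _ _ => 0) (w₀ := fun _ => 0) hP.T_nonneg (A := C' + C) (E := 0)
    (fun t ht x => (abs_sub _ _).trans (add_le_add (hC' t ht x) (hC t ht x)))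
    (fun x => ((hP.schemeSol_intervalIntegrable hh hw x ⟨hP.T_nonneg, le_rfl⟩).sub
      (hP.schemeSol_intervalIntegrable hh hu x ⟨hP.T_nonneg, le_rfl⟩)).congr fun s _ => by
        simp only [Lh_sub]; ring)
    (fun t ht x => by
      rw [hu.eqn t ht x, hw.eqn t ht x, add_sub_add_comm, sub_self,
        ← intervalIntegral.integral_sub (hP.schemeSol_intervalIntegrable hh hw x ht)
          (hP.schemeSol_intervalIntegrable hh hu x ht)]
      congr 1
      refine intervalIntegral.integral_congr fun s _ => ?_
      simp only [Lh_sub]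
      ring) (fun x => by simp) (fun t ht x => by simp) t ht x
  exact sub_eq_zero.1 (abs_nonpos_iff.1 this)

end Problem
end Limits
end Richardson

namespace Richardson

/-! ### The limit of the solutions of the scheme -/

section Limit
open Filter Topology
variable {d : ℕ} {P : Prm} {h₀ T h t : ℝ} {co : Coeffs d} {τ : Eu d → ℝ} {f : ℝ → Eu d → ℝ}
  {g : Eu d → ℝ} {u v : ℝ → Eu d → ℝ} {x : Eu d}

lemma tendstoUniformly_of_abs_le {φ : ℕ → Eu d → ℝ} {ψ : Eu d → ℝ} {ρ : ℕ → ℝ}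
    (hρ : Tendsto ρ atTop (𝓝 0)) (h : ∀ n x, |φ n x - ψ x| ≤ ρ n) :
    TendstoUniformly φ ψ atTop := by
  rw [Metric.tendstoUniformly_iff]
  intro ε hε
  filter_upwards [hρ.eventually_lt_const hε] with n hn x
  rw [dist_comm, Real.dist_eq]
  exact (h n x).trans_lt hn

lemma ubar_zero (u : ℝ → ℝ → Eu d → ℝ) (h t : ℝ) : ubar 0 u h t = u h t := by
  funext x
  have := sum_weights one_lt_two 0 0 le_rfl
  simp only [Nat.reduceAdd, Finset.univ_unique, Fin.default_eq_zero, Fin.isValue,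
    Finset.sum_singleton] at this
  simp only [ubar, Nat.reduceAdd, Finset.univ_unique, Fin.default_eq_zero, Fin.isValue,
    Finset.sum_singleton]
  have h2 : weights 2 0 0 = 1 := by simpa using this
  rw [h2]
  simp

/-- `v` is the limit of solutions of the scheme with mollified coefficients along some sequence
of steps tending to zero. -/
def Coeffs.IsLimit (co : Coeffs d) (h₀ T : ℝ) (f : ℝ → Eu d → ℝ) (g : Eu d → ℝ)
    (v : ℝ → Eu d → ℝ) : Prop :=
  ∃ (J : ℕ → ℕ) (ρ : ℕ → ℝ), Tendsto J atTop atTop ∧ Tendsto ρ atTop (𝓝 0) ∧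
    ∀ n : ℕ, ∀ t ∈ Icc 0 T, ∀ x,
      |co.approxSol T f g (J n) (h₀ / ((n : ℝ) + 1)) t x - v t x| ≤ ρ n

namespace Problem

lemma div_mem (hP : Problem P h₀ T co τ f g) (n : ℕ) : h₀ / ((n : ℝ) + 1) ∈ Ioc 0 h₀ := by
  have := hP.h₀_pos
  refine ⟨by positivity, div_le_self this.le ?_⟩
  linarith [(Nat.cast_nonneg n : (0 : ℝ) ≤ n)]

lemma exists_rate (hP : Problem P h₀ T co τ f g) (hh : h ∈ Ioc 0 h₀)
    (hu : IsSchemeSol co T h f g u) : ∃ R : ℝ, 0 ≤ R ∧ ∀ j : ℕ, ∀ t ∈ Icc 0 T, ∀ x,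
      |co.approxSol T f g j h t x - u t x| ≤ R * (1 / ((j : ℝ) + 1)) := by
  obtain ⟨u', hu', R, hR, H⟩ := hP.exists_schemeSol hh
  refine ⟨R, hR, fun j t ht x => ?_⟩
  rw [hP.schemeSol_unique hh hu' hu ht]
  exact H j t ht x

lemma tendsto_rate (R : ℝ) : Tendsto (fun j : ℕ => R * (1 / ((j : ℝ) + 1))) atTop (𝓝 0) := by
  simpa using (tendsto_one_div_add_atTop_nhds_zero_nat (𝕜 := ℝ)).const_mul R

/-- The case `k = l = 0` of `Good.richardson` reads `|u_h - u_{h'}| ≤ R (h + h')` and needs only `m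
≥ 3`; hence the solutions are uniformly Cauchy as the step tends to zero. -/
theorem exists_limit (hP : Problem P h₀ T co τ f g) : ∃ v, co.IsLimit h₀ T f g v ∧
    ∃ R : ℝ, ∀ h ∈ Ioc 0 h₀, ∀ u, IsSchemeSol co T h f g u → ∀ t ∈ Icc 0 T, ∀ x,
      |u t x - v t x| ≤ R * h := by
  obtain ⟨N, hN, H⟩ := Good.richardson P d 0 0 (Nat.zero_le _)
  have hex := fun h (hh : h ∈ Ioc 0 h₀) => hP.exists_schemeSol hh
  choose! u hu R' hR' hrate using hex
  set R := N * (normB T P.m f + normB T P.m fun _ => g) with hR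
  have hR0 : 0 ≤ R := mul_nonneg hN hP.normB_nonneg
  have hlim : ∀ h ∈ Ioc 0 h₀, ∀ t ∈ Icc 0 T, ∀ x,
      Tendsto (fun j => co.approxSol T f g j h t x) atTop (𝓝 (u h t x)) := fun h hh t ht x =>
    (tendstoUniformly_of_abs_le (tendsto_rate (R' h)) fun j => hrate h hh j t ht).tendsto_at x
  have hcau : ∀ h ∈ Ioc 0 h₀, ∀ h' ∈ Ioc 0 h₀, ∀ t ∈ Icc 0 T, ∀ x,
      |u h t x - u h' t x| ≤ R * (h + h') := by
    intro h hh h' hh' t ht x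
    refine le_of_tendsto' ((hlim h hh t ht x).sub (hlim h' hh' t ht x)).abs fun j => ?_
    have := ((H h₀ (co.approx T j) τ h h' T _ _ (fun h => co.approxSol T f g j h) _
      (hP.good _ _ (ker_kerSeq d j)) hh hh' (fun h _ => hP.ssol j h)
      (fun s _ => (hP.wb_f (clamp_mem hP.T_nonneg s)).bd_moll (ker_kerSeq d j))
      (hP.wb_g.bd_moll (ker_kerSeq d j)) (Or.inl (by simpa using hP.m_le)) t ht).1).abs_le x
    simp only [ubar_zero, zero_add, pow_one, pow_zero, one_mul] at this
    exact this.trans_eq (by rw [hR]; ring)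
  have hs : Tendsto (fun n : ℕ => h₀ / ((n : ℝ) + 1)) atTop (𝓝 0) := by
    simpa [div_eq_mul_inv] using tendsto_rate h₀
  have hv : ∀ t x, ∃ l, Tendsto (fun n : ℕ => u (h₀ / ((n : ℝ) + 1)) (clamp T t) x) atTop
      (𝓝 l) := by
    intro t x
    refine cauchySeq_tendsto_of_complete ?_
    rw [Metric.cauchySeq_iff']
    intro ε hε
    have h2 : Tendsto (fun n : ℕ => R * (h₀ / ((n : ℝ) + 1) + h₀ / ((n : ℝ) + 1))) atTop
        (𝓝 0) := by simpa using (hs.add hs).const_mul R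
    obtain ⟨J, hJ⟩ := (h2.eventually_lt_const hε).exists
    refine ⟨J, fun n hn => ?_⟩
    rw [Real.dist_eq]
    refine (hcau _ (hP.div_mem n) _ (hP.div_mem J) _ (clamp_mem hP.T_nonneg t) x).trans_lt
      (lt_of_le_of_lt ?_ hJ)
    have := hP.h₀_pos
    gcongr
  choose v hv using hv
  have hb : ∀ h ∈ Ioc 0 h₀, ∀ t ∈ Icc 0 T, ∀ x, |u h t x - v t x| ≤ R * h := by
    intro h hh t ht x
    have h1 := hv t x
    rw [clamp_eq ht] at h1
    have h2 : Tendsto (fun n : ℕ => R * (h + h₀ / ((n : ℝ) + 1))) atTop (𝓝 (R * (h + 0))) :=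
      (hs.const_add h).const_mul R
    rw [add_zero] at h2
    exact le_of_tendsto_of_tendsto' (h1.const_sub _).abs h2 fun n =>
      hcau h hh _ (hP.div_mem n) t ht x
  -- The rate `R' h` of the mollification is not controlled as `h → 0`, so the kernel is chosen
  -- after the step, fine enough to leave an error of at most `1 / (n + 1)`.
  have hJ : ∀ n : ℕ, ∃ j : ℕ, n ≤ j ∧ R' (h₀ / ((n : ℝ) + 1)) * (1 / ((j : ℝ) + 1)) ≤
      1 / ((n : ℝ) + 1) := fun n =>
    ((eventually_ge_atTop n).and ((tendsto_rate (R' (h₀ / ((n : ℝ) + 1)))).eventually_le_const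
      (show 0 < 1 / ((n : ℝ) + 1) by positivity))).exists
  choose J hJn hJ using hJ
  refine ⟨v, ⟨J, fun n => 1 / ((n : ℝ) + 1) + R * (h₀ / ((n : ℝ) + 1)),
    tendsto_atTop_mono hJn tendsto_id, ?_, fun n t ht x => ?_⟩, R, fun h hh w hw t ht x => ?_⟩
  · simpa using (tendsto_one_div_add_atTop_nhds_zero_nat (𝕜 := ℝ)).add (hs.const_mul R)
  · refine (abs_sub_le _ (u (h₀ / ((n : ℝ) + 1)) t x) _).trans (add_le_add ?_
      (hb _ (hP.div_mem n) t ht x))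
    exact (hrate _ (hP.div_mem n) (J n) t ht x).trans (hJ n)
  · rw [hP.schemeSol_unique hh (hu h hh) hw ht]
    exact hb h hh t ht x

lemma smooth_approxSol (hP : Problem P h₀ T co τ f g) (j : ℕ) (h t : ℝ) :
    ContDiff ℝ ∞ (co.approxSol T f g j h t) := (hP.ssol j h).u_sb.usmooth.smooth t

/-- Derivatives of linear combinations of solutions of the scheme. -/
lemma comb_limit (hP : Problem P h₀ T co τ f g) {ι : Type*} [Fintype ι] (a s : ι → ℝ)
    (hs : ∀ i, s i ∈ Ioc 0 h₀) {u : ℝ → ℝ → Eu d → ℝ}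
    (hu : ∀ h ∈ Ioc 0 h₀, IsSchemeSol co T h f g (u h)) (ht : t ∈ Icc 0 T) {l : ℕ}
    (hl : l + 1 ≤ P.m) : ContDiff ℝ l (fun x => ∑ i, a i * u (s i) t x) ∧
      ∀ I : List (Fin d), I.length ≤ l →
      TendstoUniformly (fun j => pdl I fun x => ∑ i, a i * co.approxSol T f g j (s i) t x)
        (pdl I fun x => ∑ i, a i * u (s i) t x) atTop := by
  obtain ⟨N, hN, H⟩ := exists_bd_approxSol P d
  have hb := fun i j => H h₀ T co τ f g hP (s i) (hs i) j t ht
  choose R hR hrate using fun i => hP.exists_rate (hs i) (hu _ (hs i))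
  have hsm : ∀ i j, ContDiff ℝ ∞ fun x => a i * co.approxSol T f g j (s i) t x := fun i j =>
    contDiff_const.mul (hP.smooth_approxSol j (s i) t)
  refine contDiff_of_bd (fun j => ContDiff.sum fun i _ => hsm i j)
    (fun j => (Bd.sum Finset.univ (fun i _ => hsm i j)
      fun i _ => (hb i j).const_mul (a i) (hP.smooth_approxSol j (s i) t)).mono hl le_rfl) ?_
  refine tendstoUniformly_of_abs_le (tendsto_rate (∑ i, |a i| * R i)) fun j x => ?_
  rw [← Finset.sum_sub_distrib, Finset.sum_mul]
  refine (Finset.abs_sum_le_sum_abs _ _).trans (Finset.sum_le_sum fun i _ => ?_)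
  rw [← mul_sub, abs_mul, mul_assoc]
  exact mul_le_mul_of_nonneg_left (hrate i j t ht x) (abs_nonneg _)

lemma limit_derivs (hP : Problem P h₀ T co τ f g) {J : ℕ → ℕ} {ρ : ℕ → ℝ}
    (hρ : Tendsto ρ atTop (𝓝 0)) (hv : ∀ n : ℕ, ∀ t ∈ Icc 0 T, ∀ x,
      |co.approxSol T f g (J n) (h₀ / ((n : ℝ) + 1)) t x - v t x| ≤ ρ n) (ht : t ∈ Icc 0 T)
    {l : ℕ} (hl : l + 1 ≤ P.m) : ContDiff ℝ l (v t) ∧ ∀ I : List (Fin d), I.length ≤ l →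
      TendstoUniformly (fun n : ℕ => pdl I (co.approxSol T f g (J n) (h₀ / ((n : ℝ) + 1)) t))
        (pdl I (v t)) atTop := by
  obtain ⟨N, hN, H⟩ := exists_bd_approxSol P d
  exact contDiff_of_bd (fun n => hP.smooth_approxSol _ _ t)
    (fun n => (H h₀ T co τ f g hP _ (hP.div_mem n) (J n) t ht).mono hl le_rfl)
    (tendstoUniformly_of_abs_le hρ fun n => hv n t ht)

/-- Along the diagonal sequence defining `v`, the auxiliary step `h'` and the kernel radius vanish
together. The derivatives converge on both sides, and the term with `(1 + h)^k h'` disappears. -/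
lemma comb_estimate (hP : Problem P h₀ T co τ f g) {ι : Type*} [Fintype ι] (a s : ι → ℝ)
    (hs : ∀ i, s i ∈ Ioc 0 h₀) {u : ℝ → ℝ → Eu d → ℝ}
    (hu : ∀ h ∈ Ioc 0 h₀, IsSchemeSol co T h f g (u h)) (ht : t ∈ Icc 0 T) {k l : ℕ}
    (hl : l + 1 ≤ P.m) (hv : co.IsLimit h₀ T f g v) {N F : ℝ}
    (H : ∀ j, ∀ h' ∈ Ioc 0 h₀, Bd l (N * (h ^ (k + 1) + (1 + h) ^ k * h') * F)
      (fun x => ∑ i, a i * co.approxSol T f g j (s i) t x - co.approxSol T f g j h' t x))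
    {I : List (Fin d)} (hI : I.length ≤ l) (x : Eu d) :
    |pdl I (fun x => ∑ i, a i * u (s i) t x) x - pdl I (v t) x| ≤ N * h ^ (k + 1) * F := by
  obtain ⟨J, ρ, hJ, hρ, hv⟩ := hv
  have h1 := (((hP.comb_limit a s hs hu ht hl).2 I hI).tendsto_at x).comp hJ
  have h2 := ((hP.limit_derivs hρ hv ht hl).2 I hI).tendsto_at x
  have h3 : Tendsto (fun n : ℕ => N * (h ^ (k + 1) + (1 + h) ^ k * (h₀ / ((n : ℝ) + 1))) * F)
      atTop (𝓝 (N * (h ^ (k + 1) + (1 + h) ^ k * 0) * F)) := by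
    have h4 : Tendsto (fun n : ℕ => h₀ / ((n : ℝ) + 1)) atTop (𝓝 0) := by
      simpa [div_eq_mul_inv] using tendsto_rate h₀
    exact (((h4.const_mul _).const_add _).const_mul _).mul_const _
  rw [mul_zero, add_zero] at h3
  refine le_of_tendsto_of_tendsto' (h1.sub h2).abs h3 fun n => ?_
  have h5 := H (J n) _ (hP.div_mem n) I hI x
  rw [pdl_sub (ContDiff.sum fun i _ => contDiff_const.mul (hP.smooth_approxSol _ _ t))
    (hP.smooth_approxSol _ _ t)] at h5
  exact h5

lemma div_pow_mem (hh : h ∈ Ioc 0 h₀) (j : ℕ) : h / 2 ^ j ∈ Ioc 0 h₀ :=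
  ⟨div_pos hh.1 (by positivity), (div_le_self hh.1.le (one_le_pow₀ one_le_two)).trans hh.2⟩

/-- The error estimate for Richardson's combinations in terms of the limit of the scheme. -/
theorem estimate (P : Prm) (d k l : ℕ) (hl : l + 1 ≤ P.m) : ∃ N : ℝ, 0 ≤ N ∧
    ∀ (h₀ T : ℝ) (co : Coeffs d) (τ : Eu d → ℝ) (f : ℝ → Eu d → ℝ) (g : Eu d → ℝ)
      (u : ℝ → ℝ → Eu d → ℝ) (v : ℝ → Eu d → ℝ), Problem P h₀ T co τ f g →
      (∀ h ∈ Ioc 0 h₀, IsSchemeSol co T h f g (u h)) → co.IsLimit h₀ T f g v →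
      (∀ j, (co.approx T j).SCase P.m k l) → ∀ I : List (Fin d), I.length ≤ l →
      ∀ h ∈ Ioc 0 h₀, ∀ t ∈ Icc 0 T, ∀ x,
        |pdl I (ubar k u h t) x - pdl I (v t) x| ≤
            N * h ^ (k + 1) * (normB T P.m f + normB T P.m fun _ => g) ∧
        ((∀ j, Odd k ∧ 2 * k + 2 + l ≤ P.m ∧ (co.approx T j).Sym ∧ (co.approx T j).Asym) →
          |pdl I (utilde k u h t) x - pdl I (v t) x| ≤
            N * h ^ (k + 1) * (normB T P.m f + normB T P.m fun _ => g)) := by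
  obtain ⟨N, hN, H⟩ := Good.richardson P d k l (by omega)
  refine ⟨N, hN, fun h₀ T co τ f g u v hP hu hv hc I hI h hh t ht x => ?_⟩
  have key := fun j h' (hh' : h' ∈ Ioc 0 h₀) => H h₀ (co.approx T j) τ h h' T _ _
    (fun h => co.approxSol T f g j h) _
    (hP.good _ _ (ker_kerSeq d j)) hh hh' (fun h _ => hP.ssol j h)
    (fun s _ => (hP.wb_f (clamp_mem hP.T_nonneg s)).bd_moll (ker_kerSeq d j))
    (hP.wb_g.bd_moll (ker_kerSeq d j)) (hc j) t ht
  exact ⟨hP.comb_estimate (weights 2 k) (fun j => h / 2 ^ (j : ℕ)) (fun j => div_pow_mem hh j) hu ht hl hv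
    (fun j h' hh' => (key j h' hh').1) hI x,
    fun ho => hP.comb_estimate (weights 4 ((k - 1) / 2)) (fun j => h / 2 ^ (j : ℕ))
    (fun j => div_pow_mem hh j) hu ht hl hv
    (fun j h' hh' => (key j h' hh').2 (ho j)) hI x⟩

end Problem
end Limit
end Richardson

namespace Richardson

/-! ### Existence for the limiting equation -/

section Generator
open Filter Topology
variable {d : ℕ} {co : Coeffs d} {t a S : ℝ} {φ : Eu d → ℝ} {x : Eu d}

lemma dd_dd (hφ : ∀ j, Differentiable ℝ (pd j φ)) (l x : Eu d) :
    (dd l)^[2] φ x = ∑ i, ∑ j, l i * l j * pdl [i, j] φ x := by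
  have e : (dd l)^[2] φ = dd l (dd l φ) := rfl
  rw [e]
  refine Finset.sum_congr rfl fun i _ => ?_
  have e2 : dd l φ = fun x => ∑ j, l j * pd j φ x := rfl
  rw [e2, pd_sum _ _ fun j _ => (hφ j).const_mul _, Finset.mul_sum]
  refine Finset.sum_congr rfl fun j _ => ?_
  simp only [pd_const_mul _ (hφ j)]
  rw [← mul_assoc]
  rfl

lemma Lx_zero_eq (hφ : ∀ j, Differentiable ℝ (pd j φ)) (x : Eu d) : co.Lx 0 t φ x =
    ∑ l ∈ co.Λ₁, co.q l t x * (1 / 2 * ∑ i, ∑ j, l i * l j * pdl [i, j] φ x) +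
      ∑ l ∈ co.Λ₁, co.p l t x * ∑ i, l i * pdl [i] φ x - co.c t x * φ x := by
  unfold Coeffs.Lx
  have e2 : ∀ l : Eu d, dd l φ x = ∑ j, l j * pdl [j] φ x := fun _ => rfl
  simp only [zero_add, Function.iterate_one, if_true, dd_dd hφ, e2]
  norm_num

/-- The norm of the limiting operator for coefficients of size one. -/
noncomputable def Coeffs.lxNorm (co : Coeffs d) : ℝ :=
  ∑ l ∈ co.Λ₁, ((d * ‖l‖) ^ 2 + d * ‖l‖) + 1

lemma lxNorm_pos : 0 < co.lxNorm := by
  unfold Coeffs.lxNorm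
  positivity

lemma abs_Lx_zero_le (hφ : ∀ j, Differentiable ℝ (pd j φ)) (hb : Bd 2 S φ)
    (hq : ∀ l ∈ co.Λ₁, |co.q l t x| ≤ a) (hp : ∀ l ∈ co.Λ₁, |co.p l t x| ≤ a)
    (hc : |co.c t x| ≤ a) : |co.Lx 0 t φ x| ≤ a * (co.lxNorm * S) := by
  have hS : 0 ≤ S := hb.nonneg
  have ha : 0 ≤ a := (abs_nonneg _).trans hc
  rw [Lx_zero_eq hφ]
  have h1 : ∀ l : Eu d, |1 / 2 * ∑ i, ∑ j, l i * l j * pdl [i, j] φ x| ≤ (d * ‖l‖) ^ 2 * S := by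
    intro l
    have : |∑ i, ∑ j, l i * l j * pdl [i, j] φ x| ≤ ∑ _i : Fin d, ∑ _j : Fin d, ‖l‖ * ‖l‖ * S := by
      refine (Finset.abs_sum_le_sum_abs _ _).trans (Finset.sum_le_sum fun i _ => ?_)
      refine (Finset.abs_sum_le_sum_abs _ _).trans (Finset.sum_le_sum fun j _ => ?_)
      rw [abs_mul, abs_mul]
      have := abs_coord_le l i
      have := abs_coord_le l j
      have := hb [i, j] (by simp) x
      gcongr
    rw [abs_mul, abs_of_pos (by norm_num : (0 : ℝ) < 1 / 2)]
    simp only [Finset.sum_const, Finset.card_univ, Fintype.card_fin, nsmul_eq_mul] at this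
    have h0 : 0 ≤ |∑ i, ∑ j, l i * l j * pdl [i, j] φ x| := abs_nonneg _
    nlinarith
  have h2 : ∀ l : Eu d, |∑ i, l i * pdl [i] φ x| ≤ d * ‖l‖ * S := by
    intro l
    have : |∑ i, l i * pdl [i] φ x| ≤ ∑ _i : Fin d, ‖l‖ * S := by
      refine (Finset.abs_sum_le_sum_abs _ _).trans (Finset.sum_le_sum fun i _ => ?_)
      rw [abs_mul]
      have := abs_coord_le l i
      have := hb [i] (by simp) x
      gcongr
    simp only [Finset.sum_const, Finset.card_univ, Fintype.card_fin, nsmul_eq_mul] at this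
    linarith
  have h3 : |∑ l ∈ co.Λ₁, co.q l t x * (1 / 2 * ∑ i, ∑ j, l i * l j * pdl [i, j] φ x)| ≤
      ∑ l ∈ co.Λ₁, a * ((d * ‖l‖) ^ 2 * S) :=
    (Finset.abs_sum_le_sum_abs _ _).trans (Finset.sum_le_sum fun l hl => by
      rw [abs_mul]
      exact mul_le_mul (hq l hl) (h1 l) (abs_nonneg _) ha)
  have h4 : |∑ l ∈ co.Λ₁, co.p l t x * ∑ i, l i * pdl [i] φ x| ≤
      ∑ l ∈ co.Λ₁, a * (d * ‖l‖ * S) :=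
    (Finset.abs_sum_le_sum_abs _ _).trans (Finset.sum_le_sum fun l hl => by
      rw [abs_mul]
      exact mul_le_mul (hp l hl) (h2 l) (abs_nonneg _) ha)
  have h5 : |co.c t x * φ x| ≤ a * S := by
    rw [abs_mul]
    exact mul_le_mul hc (hb.abs_le x) (abs_nonneg _) ha
  calc _ ≤ _ := (abs_sub _ _).trans (add_le_add ((abs_add_le _ _).trans (add_le_add h3 h4)) h5)
    _ = _ := by
      unfold Coeffs.lxNorm
      rw [← Finset.mul_sum, ← Finset.mul_sum, ← Finset.sum_mul, ← Finset.sum_mul,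
        Finset.sum_add_distrib]
      ring

end Generator

/-! ### The limit of the scheme satisfies the limiting equation pointwise. -/

section Existence
open Filter Topology
variable {d : ℕ} {P : Prm} {h₀ T h t : ℝ} {co : Coeffs d} {τ : Eu d → ℝ} {f : ℝ → Eu d → ℝ}
  {g : Eu d → ℝ} {u v : ℝ → Eu d → ℝ} {x : Eu d}

lemma contDiff_two_pd {φ : Eu d → ℝ} (hφ : ContDiff ℝ (2 : ℕ) φ) (j : Fin d) :
    Differentiable ℝ (pd j φ) :=
  (contDiff_pd (n := 1) (by exact_mod_cast hφ)).differentiable (by simp)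

lemma smooth_pd_differentiable {φ : Eu d → ℝ} (hφ : ContDiff ℝ ∞ φ) (j : Fin d) :
    Differentiable ℝ (pd j φ) := smooth_differentiable (smooth_pd hφ)

namespace Problem

lemma tendsto_Lx_approx (hP : Problem P h₀ T co τ f g) (ht : t ∈ Icc 0 T) {J : ℕ → ℕ}
    (hJ : Tendsto J atTop atTop) {φ : ℕ → Eu d → ℝ} {ψ : Eu d → ℝ}
    (hφ : ∀ n j, Differentiable ℝ (pd j (φ n))) (hψ : ∀ j, Differentiable ℝ (pd j ψ))
    (hl : ∀ I : List (Fin d), I.length ≤ 2 → Tendsto (fun n => pdl I (φ n) x) atTop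
      (𝓝 (pdl I ψ x))) :
    Tendsto (fun n => (co.approx T (J n)).Lx 0 t (φ n) x) atTop (𝓝 (co.Lx 0 t ψ x)) := by
  simp_rw [fun n => Lx_zero_eq (co := co.approx T (J n)) (t := t) (hφ n) x, Lx_zero_eq hψ,
    clamp_eq ht]
  refine Tendsto.sub (Tendsto.add (tendsto_finsetSum _ fun l hl' => Tendsto.mul ?_ ?_)
    (tendsto_finsetSum _ fun l hl' => Tendsto.mul ?_ ?_)) (Tendsto.mul ?_ ?_)
  · exact (tendsto_moll_kerSeq (hP.wb_q ht l hl').continuous x).comp hJ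
  · exact (tendsto_finsetSum _ fun i _ => tendsto_finsetSum _ fun j _ =>
      (hl [i, j] (by simp)).const_mul _).const_mul _
  · exact (tendsto_moll_kerSeq (hP.wb_p ht l hl').continuous x).comp hJ
  · exact tendsto_finsetSum _ fun i _ => (hl [i] (by simp)).const_mul _
  · exact (tendsto_moll_kerSeq (hP.wb_c ht).continuous x).comp hJ
  · exact hl [] (by simp)

lemma abs_Lx_approx_le (hP : Problem P h₀ T co τ f g) (j : ℕ) (t : ℝ) {φ : Eu d → ℝ} {S : ℝ}
    (hφ : ContDiff ℝ ∞ φ) (hb : Bd 2 S φ) (x : Eu d) :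
    |(co.approx T j).Lx 0 t φ x| ≤ co.size T P.m * (co.lxNorm * S) :=
  abs_Lx_zero_le (co := co.approx T j) (smooth_pd_differentiable hφ) hb
    (fun l hl => ((hP.wb_q (clamp_mem hP.T_nonneg t) l hl).bd_moll (ker_kerSeq d j)).abs_le x)
    (fun l hl => ((hP.wb_p (clamp_mem hP.T_nonneg t) l hl).bd_moll (ker_kerSeq d j)).abs_le x)
    (((hP.wb_c (clamp_mem hP.T_nonneg t)).bd_moll (ker_kerSeq d j)).abs_le x)

lemma abs_Lx_le (hP : Problem P h₀ T co τ f g) (ht : t ∈ Icc 0 T) {φ : Eu d → ℝ} {S : ℝ}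
    (hφ : ∀ j, Differentiable ℝ (pd j φ)) (hb : Bd 2 S φ) (x : Eu d) :
    |co.Lx 0 t φ x| ≤ co.size T P.m * (co.lxNorm * S) :=
  abs_Lx_zero_le hφ hb (fun l hl => (hP.wb_q ht l hl).abs_le hP.one_le_m x)
    (fun l hl => (hP.wb_p ht l hl).abs_le hP.one_le_m x) ((hP.wb_c ht).abs_le hP.one_le_m x)

/-- First-order consistency, uniform in the kernel: three bounded derivatives suffice, which is what
`m ≥ 3` provides. -/
lemma exists_remainder_approx (hP : Problem P h₀ T co τ f g) : ∃ N : ℝ, 0 ≤ N ∧ ∀ j h, 0 < h →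
    ∀ t (φ : Eu d → ℝ) C, ContDiff ℝ ∞ φ → Bd 3 C φ → ∀ x,
      |(co.approx T j).Lh h t φ x - (co.approx T j).Lx 0 t φ x| ≤ N * h * C := by
  obtain ⟨N, hN, H⟩ := Good.bd_remainder P d 0 0 (Nat.zero_le _)
  refine ⟨N, hN, fun j h hh t φ C hφ hb x => ?_⟩
  have := (H h₀ (co.approx T j) τ (hP.good _ _ (ker_kerSeq d j)) h hh t φ C hφ hb).abs_le x
  simpa using this

lemma exists_remainder (hP : Problem P h₀ T co τ f g) : ∃ N : ℝ, 0 ≤ N ∧ ∀ h, 0 < h →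
    ∀ t ∈ Icc 0 T, ∀ (φ : Eu d → ℝ) C, ContDiff ℝ ∞ φ → Bd 3 C φ → ∀ x,
      |co.Lh h t φ x - co.Lx 0 t φ x| ≤ N * h * C := by
  obtain ⟨N, hN, H⟩ := hP.exists_remainder_approx
  refine ⟨N, hN, fun h hh t ht φ C hφ hb x => ?_⟩
  have h1 := hP.tendsto_Lh_approx (h := h) ht (φ := fun _ => φ) (ψ := φ)
    (fun y => tendsto_const_nhds) x
  have h2 := hP.tendsto_Lx_approx (x := x) ht tendsto_id (φ := fun _ => φ) (ψ := φ)
    (fun _ => smooth_pd_differentiable hφ) (smooth_pd_differentiable hφ)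
    (fun I _ => tendsto_const_nhds)
  exact le_of_tendsto' (h1.sub h2).abs fun j => H j h hh t φ C hφ hb x

/-- Regularity of the limit and the equation which it satisfies. -/
theorem limit_spec (hP : Problem P h₀ T co τ f g) (hv : co.IsLimit h₀ T f g v) :
    ∃ S C : ℝ, 0 ≤ C ∧ (∀ t ∈ Icc 0 T, ContDiff ℝ (2 : ℕ) (v t) ∧ Bd 2 S (v t)) ∧
      (∀ t ∈ Icc 0 T, ∀ i j, pdl [i, j] (v t) = pdl [j, i] (v t)) ∧
      (∀ t ∈ Icc 0 T, ∀ x, |co.Lx 0 t (v t) x + f t x| ≤ C) ∧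
      Measurable (Function.uncurry fun t x => co.Lx 0 (clamp T t) (v (clamp T t)) x +
        f (clamp T t) x) ∧
      ∀ t ∈ Icc 0 T, ∀ x, v t x = g x + ∫ s in 0..t, (co.Lx 0 s (v s) x + f s x) := by
  obtain ⟨J, ρ, hJ, hρ, hv⟩ := hv
  obtain ⟨N, hN, HN⟩ := exists_bd_approxSol P d
  obtain ⟨Nr, hNr, HR⟩ := hP.exists_remainder_approx
  have h2m : 2 + 1 ≤ P.m := hP.m_le
  set F := normB T P.m f + normB T P.m fun _ => g with hF
  set S := N * F with hSdef
  set s : ℕ → ℝ := fun n => h₀ / ((n : ℝ) + 1) with hs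
  set U : ℕ → ℝ → Eu d → ℝ := fun n => co.approxSol T f g (J n) (s n) with hU
  have hUs : ∀ n t, ContDiff ℝ ∞ (U n t) := fun n t => hP.smooth_approxSol _ _ t
  have hUb : ∀ n, ∀ t ∈ Icc 0 T, Bd P.m S (U n t) := fun n t ht =>
    HN h₀ T co τ f g hP _ (hP.div_mem n) (J n) t ht
  have hd := fun t (ht : t ∈ Icc 0 T) => hP.limit_derivs hρ hv ht h2m
  have hvb : ∀ t ∈ Icc 0 T, Bd 2 S (v t) := fun t ht I hI x =>
    le_of_tendsto' (((hd t ht).2 I hI).tendsto_at x).abs fun n => hUb n t ht I (by omega) x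
  have hs0 : Tendsto s atTop (𝓝 0) := by simpa [hs, div_eq_mul_inv] using tendsto_rate h₀
  have hLx : ∀ t ∈ Icc 0 T, ∀ x, Tendsto (fun n => (co.approx T (J n)).Lx 0 t (U n t) x) atTop
      (𝓝 (co.Lx 0 t (v t) x)) := fun t ht x => hP.tendsto_Lx_approx ht hJ
    (fun n => smooth_pd_differentiable (hUs n t)) (contDiff_two_pd (hd t ht).1)
    fun I hI => ((hd t ht).2 I hI).tendsto_at x
  have hrem : ∀ n, ∀ t ∈ Icc 0 T, ∀ x, |(co.approx T (J n)).Lh (s n) t (U n t) x -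
      (co.approx T (J n)).Lx 0 t (U n t) x| ≤ Nr * s n * S := fun n t ht x =>
    HR (J n) (s n) (hP.div_mem n).1 t (U n t) S (hUs n t) ((hUb n t ht).mono h2m le_rfl) x
  have hLh : ∀ t ∈ Icc 0 T, ∀ x, Tendsto (fun n => (co.approx T (J n)).Lh (s n) t (U n t) x +
      moll (kerSeq d (J n)) (f (clamp T t)) x) atTop (𝓝 (co.Lx 0 t (v t) x + f t x)) := by
    intro t ht x
    have h1 : Tendsto (fun n => (co.approx T (J n)).Lh (s n) t (U n t) x -
        (co.approx T (J n)).Lx 0 t (U n t) x) atTop (𝓝 0) := by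
      refine squeeze_zero_norm (fun n => hrem n t ht x) ?_
      simpa using (hs0.const_mul Nr).mul_const S
    have h2 := h1.add (hLx t ht x)
    simp only [sub_add_cancel, zero_add] at h2
    refine h2.add ?_
    rw [clamp_eq ht]
    exact (tendsto_moll_kerSeq (hP.wb_f ht).continuous x).comp hJ
  have hS0 : 0 ≤ S := (hUb 0 0 hP.zero_mem).nonneg
  have hF0 : 0 ≤ F := hP.normB_nonneg
  set C := Nr * h₀ * S + co.size T P.m * (co.lxNorm * S) + F with hC
  have hC0 : 0 ≤ C := by
    have := hP.h₀_pos
    have := hP.le_size.1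
    have := lxNorm_pos (co := co)
    positivity
  have hbd : ∀ n, ∀ t ∈ Icc 0 T, ∀ x, |(co.approx T (J n)).Lh (s n) t (U n t) x +
      moll (kerSeq d (J n)) (f (clamp T t)) x| ≤ C := by
    intro n t ht x
    have h1 := hrem n t ht x
    have h2 := hP.abs_Lx_approx_le (J n) t (hUs n t) ((hUb n t ht).mono (by omega) le_rfl) x
    have h3 : |moll (kerSeq d (J n)) (f (clamp T t)) x| ≤ F :=
      ((hP.wb_f (clamp_mem hP.T_nonneg t)).bd_moll (ker_kerSeq d (J n))).abs_le x
    have h4 : Nr * s n * S ≤ Nr * h₀ * S :=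
      mul_le_mul_of_nonneg_right (mul_le_mul_of_nonneg_left (hP.div_mem n).2 hNr) hS0
    have h5 := abs_add_le ((co.approx T (J n)).Lh (s n) t (U n t) x -
      (co.approx T (J n)).Lx 0 t (U n t) x) ((co.approx T (J n)).Lx 0 t (U n t) x)
    rw [sub_add_cancel] at h5
    refine (abs_add_le _ _).trans (add_le_add ?_ h3)
    linarith
  refine ⟨S, C, hC0, fun t ht => ⟨(hd t ht).1, hvb t ht⟩, fun t ht i j => ?_, fun t ht x =>
    le_of_tendsto' (hLh t ht x).abs fun n => hbd n t ht x, ?_, fun t ht x => ?_⟩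
  -- The limit is only known to be of class `C²`; the symmetry of its second derivatives is
  -- inherited from the smooth approximations.
  · funext x
    refine tendsto_nhds_unique (((hd t ht).2 [i, j] (by simp)).tendsto_at x) ?_
    have := ((hd t ht).2 [j, i] (by simp)).tendsto_at x
    exact this.congr fun n => by rw [pdl_perm (hUs n t) (List.Perm.swap i j [])]
  · refine measurable_of_tendsto_metrizable (fun n => ?_) (tendsto_pi_nhds.2 fun z =>
      hLh _ (clamp_mem hP.T_nonneg z.1) z.2)
    exact ((((hP.good _ _ (ker_kerSeq d (J n))).sb_Lh (s n) (hP.ssol (J n) (s n)).u_sb).add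
      (hP.ssol (J n) (s n)).f_sb).comp_measurable
        (continuous_clamp T).measurable).measurable_uncurry
  · refine tendsto_nhds_unique (f := fun n => U n t x)
      (((hd t ht).2 [] (by simp)).tendsto_at x) ?_
    rw [funext fun n => show U n t x = _ from (hP.ssol (J n) (s n)).eqn t ht x]
    refine ((tendsto_moll_kerSeq hP.wb_g.continuous x).comp hJ).add ?_
    refine intervalIntegral.tendsto_integral_filter_of_dominated_convergence
      (fun _ => C) ?_ ?_ intervalIntegrable_const ?_
    · exact Eventually.of_forall fun n => (intervalIntegrable_iff.1
        (hP.ssol_intervalIntegrable (J n) (s n) x 0 t)).aestronglyMeasurable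
    · refine Eventually.of_forall fun n => Eventually.of_forall fun r hr => ?_
      rw [uIoc_of_le ht.1] at hr
      exact hbd n r ⟨hr.1.le, hr.2.trans ht.2⟩ x
    · refine Eventually.of_forall fun r hr => ?_
      rw [uIoc_of_le ht.1] at hr
      exact hLh r ⟨hr.1.le, hr.2.trans ht.2⟩ x

end Problem
end Existence
end Richardson

namespace Richardson

/-! ### Multi-indices of order one and two. -/

section PairIndex
variable {d : ℕ} {co : Coeffs d} {t S : ℝ} {φ : Eu d → ℝ}

lemma idx_pair_perm (i j : Fin d) :
    (idx (Pi.single i 1 + Pi.single j 1 : Fin d → ℕ)).Perm [i, j] := by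
  have e : (fun k => [i, j].count k) = (Pi.single i 1 + Pi.single j 1 : Fin d → ℕ) := by
    funext k
    simp only [List.count_cons, List.count_nil, Pi.add_apply, Pi.single_apply, beq_iff_eq]
    simp only [eq_comm (a := k)]
    omega
  rw [← e]
  exact idx_count_perm [i, j]

lemma idx_pair (i j : Fin d) : idx (Pi.single i 1 + Pi.single j 1 : Fin d → ℕ) = [i, j] ∨
    idx (Pi.single i 1 + Pi.single j 1 : Fin d → ℕ) = [j, i] := by
  have h := idx_pair_perm i j
  obtain ⟨a, b, hab⟩ := List.length_eq_two.1 h.length_eq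
  rw [hab] at h ⊢
  have ha : a ∈ [i, j] := h.subset (by simp)
  rcases List.mem_pair.1 ha with rfl | rfl
  · left
    rw [List.perm_singleton.1 h.cons_inv]
  · right
    rw [List.perm_singleton.1 (h.trans (List.Perm.swap _ _ _)).cons_inv]

lemma idx_single (i : Fin d) : idx (Pi.single i 1 : Fin d → ℕ) = [i] := by
  have e : (fun k => [i].count k) = (Pi.single i 1 : Fin d → ℕ) := by
    funext k
    simp only [List.count_cons, List.count_nil, Pi.single_apply, beq_iff_eq]
    simp only [eq_comm (a := k)]
    omega
  rw [← e]
  exact List.perm_singleton.1 (idx_count_perm [i])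

lemma order_pair (i j : Fin d) : order (Pi.single i 1 + Pi.single j 1 : Fin d → ℕ) = 2 := by
  rw [← length_idx, (idx_pair_perm i j).length_eq]
  rfl

lemma order_single (i : Fin d) : order (Pi.single i 1 : Fin d → ℕ) = 1 := by
  rw [← length_idx, idx_single]
  rfl

/-- On smooth functions the limiting operator may be computed with classical derivatives. -/
lemma calL_ae_eq (hφ : CB 2 φ) (hs : ∀ i j, pdl [i, j] φ = pdl [j, i] φ) :
    ∀ᵐ x, co.calL t φ x = co.Lx 0 t φ x := by
  have h1 : ∀ᵐ x, ∀ i j, weakDeriv (Pi.single i 1 + Pi.single j 1) φ x = pdl [i, j] φ x := by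
    refine ae_all_iff.2 fun i => ae_all_iff.2 fun j => ?_
    have h := (CB.isWeakDeriv (by rw [order_pair i j]; exact hφ)).weakDeriv_ae
    rw [mderiv_eq_pdl] at h
    -- The multi-index fixes its own order of differentiation, which may be the reverse of `[i, j]`;
    -- the symmetry hypothesis covers that case.
    rcases idx_pair i j with e | e
    · rwa [e] at h
    · rwa [e, hs j i] at h
  have h2 : ∀ᵐ x, ∀ i, weakDeriv (Pi.single i 1) φ x = pdl [i] φ x := by
    refine ae_all_iff.2 fun i => ?_
    have h := (CB.isWeakDeriv (by rw [order_single i]; exact hφ.of_succ)).weakDeriv_ae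
    rwa [mderiv_eq_pdl, idx_single] at h
  filter_upwards [h1, h2] with x h1 h2
  rw [Lx_zero_eq fun j => (hφ.2.2 j).1]
  unfold Coeffs.calL
  simp_rw [h1, h2, Finset.mul_sum]
  congr 2
  · refine Finset.sum_congr rfl fun l _ => Finset.sum_congr rfl fun i _ =>
      Finset.sum_congr rfl fun j _ => by ring
  · refine Finset.sum_congr rfl fun l _ => Finset.sum_congr rfl fun i _ => by ring

end PairIndex

/-! ### Existence for the limiting equation. -/

section PDE
open Filter Topology
variable {d : ℕ} {P : Prm} {h₀ T t : ℝ} {co : Coeffs d} {τ : Eu d → ℝ} {f : ℝ → Eu d → ℝ}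
  {g : Eu d → ℝ} {v : ℝ → Eu d → ℝ}

/-- The limit satisfies the equation pointwise in integrated form with bounded right-hand side. This
gives the Lipschitz bound in time, hence joint continuity, and Fubini's theorem gives the equation
tested against `η`. -/
theorem Problem.isPDESol (hP : Problem P h₀ T co τ f g) (hv : co.IsLimit h₀ T f g v) :
    IsPDESol co T f g v := by
  obtain ⟨S, C, hC, hreg, hsym, hbd, hmeas, heq⟩ := hP.limit_spec hv
  have hcb : ∀ t ∈ Icc 0 T, CB 2 (v t) := fun t ht =>
    cb_of_contDiff (hreg t ht).1 ⟨S, (hreg t ht).2⟩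
  set Ψ : ℝ → Eu d → ℝ := fun t x => co.Lx 0 (clamp T t) (v (clamp T t)) x + f (clamp T t) x
  have hΨ : ∀ t ∈ Icc 0 T, ∀ x, co.Lx 0 t (v t) x + f t x = Ψ t x := fun t ht x => by
    simp only [Ψ, clamp_eq ht]
  have hΨb : ∀ t x, |Ψ t x| ≤ C := fun t x => hbd _ (clamp_mem hP.T_nonneg t) x
  have hΨi : ∀ x a b, IntervalIntegrable (fun s => Ψ s x) volume a b := fun x a b =>
    intervalIntegrable_of_bdd (hmeas.comp measurable_prodMk_right :) (fun s => hΨb s x) a b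
  have hvΨ : ∀ t ∈ Icc 0 T, ∀ x, v t x = g x + ∫ s in 0..t, Ψ s x := by
    intro t ht x
    rw [heq t ht x]
    congr 1
    refine intervalIntegral.integral_congr fun s hs => ?_
    rw [uIcc_of_le ht.1] at hs
    exact hΨ s ⟨hs.1, hs.2.trans ht.2⟩ x
  have hlip : ∀ t ∈ Icc 0 T, ∀ s ∈ Icc 0 T, ∀ x y,
      |v t x - v s y| ≤ C * |t - s| + d * S * ‖x - y‖ := by
    intro t ht s hs x y
    refine (abs_sub_le _ (v s x) _).trans (add_le_add ?_ ?_)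
    · rw [hvΨ t ht x, hvΨ s hs x, add_sub_add_left_eq_sub,
        intervalIntegral.integral_interval_sub_left (hΨi x 0 t) (hΨi x 0 s)]
      exact intervalIntegral.norm_integral_le_of_norm_le_const (f := fun r => Ψ r x)
        fun r _ => hΨb r x
    · exact abs_sub_le_of_pd (hcb s hs).1 (fun i z => (hreg s hs).2 [i] (by simp) z) y x
  have hcont : ContinuousOn (fun z : ℝ × Eu d => v z.1 z.2) (Icc 0 T ×ˢ univ) := by
    intro z₀ hz₀
    refine tendsto_iff_dist_tendsto_zero.2 (squeeze_zero' (Eventually.of_forall fun _ =>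
      dist_nonneg) (eventually_nhdsWithin_of_forall fun z hz => hlip z.1 hz.1 z₀.1 hz₀.1 z.2 z₀.2)
      ?_)
    have : Continuous fun z : ℝ × Eu d => C * |z.1 - z₀.1| + d * S * ‖z.2 - z₀.2‖ := by fun_prop
    exact (this.tendsto' z₀ 0 (by simp)).mono_left nhdsWithin_le_nhds
  refine ⟨hcont, ⟨?_, ⟨S, fun t ht => (hreg t ht).2.abs_le⟩, fun t ht => (hcb t ht).continuous,
    ⟨S, fun t ht α hα => ?_⟩⟩, fun t ht η hη1 hη2 => ?_⟩
  · exact (hcont.comp_continuous (f := fun z : Icc (0 : ℝ) T × Eu d => ((z.1 : ℝ), z.2))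
      (by fun_prop) fun z => ⟨z.1.2, mem_univ _⟩).measurable
  · have hw := ((hcb t ht).of_le hα).isWeakDeriv
    refine ⟨⟨_, hw⟩, ?_⟩
    filter_upwards [hw.weakDeriv_ae] with x hx
    rw [hx, mderiv_eq_pdl]
    exact (hreg t ht).2 _ (by rw [length_idx]; exact hα) x
  · have hη : TF η := ⟨hη1, hη2⟩
    have hsub : (fun x => ∫ s in 0..t, Ψ s x) = fun x => v t x - g x := by
      funext x
      rw [hvΨ t ht x]
      ring
    have hli : LocallyIntegrable fun x => ∫ s in 0..t, Ψ s x := by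
      rw [hsub]
      exact ((hcb t ht).continuous.sub hP.wb_g.continuous).locallyIntegrable
    simp_rw [hvΨ t ht, mul_add]
    rw [integral_add (hη.integrable_mul hP.wb_g.continuous.locallyIntegrable)
      (hη.integrable_mul hli)]
    congr 1
    simp_rw [← intervalIntegral.integral_const_mul, intervalIntegral.integral_of_le ht.1]
    -- After the swap, for each time, generalized and classical derivatives agree almost everywhere
    -- in `x`, which is all the inner integral sees.
    rw [integral_integral_swap]
    · refine setIntegral_congr_fun measurableSet_Ioc fun s hs => ?_
      have hs' : s ∈ Icc 0 T := ⟨hs.1.le, hs.2.trans ht.2⟩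
      refine integral_congr_ae ?_
      filter_upwards [calL_ae_eq (co := co) (t := s) (hcb s hs') (hsym s hs')] with x hx
      rw [hx, ← hΨ s hs' x, mul_add]
    · refine Integrable.mono' (g := fun z : Eu d × ℝ => |η z.1| * C)
        (hη.integrable.abs.mul_prod (integrable_const C)) ?_
        (Eventually.of_forall fun z => ?_)
      · exact ((hη.smooth.continuous.measurable.comp measurable_fst).mul
          (hmeas.comp measurable_swap)).aestronglyMeasurable
      · simp only [Function.uncurry, norm_mul, Real.norm_eq_abs]
        exact mul_le_mul_of_nonneg_left (hΨb _ _) (abs_nonneg _)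

end PDE
end Richardson

namespace Richardson

/-! ### Uniqueness for the limiting equation -/

section Commutator
open Filter Topology
variable {d m : ℕ} {T r W A : ℝ} {κ q b : Eu d → ℝ} {x : Eu d}

lemma TF.smb (h : TF κ) : Smb κ := by
  refine ⟨fun _ => h.smooth, fun n => ?_⟩
  choose C hC using fun I : List (Fin d) => (h.pdl I).bounded
  obtain ⟨A, hA⟩ := ((List.finite_length_le (Fin d) n).image C).bddAbove
  exact ⟨A, fun _ I hI x => (hC I x).trans (hA ⟨I, hI, rfl⟩)⟩

/-- Mollification almost commutes with the multiplication by Lipschitz functions. -/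
lemma Ker.abs_moll_mul_sub_le (h : Ker κ r) (hq : Continuous q)
    (hL : ∀ y, |q y - q x| ≤ A * ‖y - x‖) (hA : 0 ≤ A) (hb : AEStronglyMeasurable b)
    (hW : ∀ᵐ z, |b z| ≤ W) : |moll κ (fun z => q z * b z) x - q x * moll κ b x| ≤ A * r * W := by
  have hbl := locallyIntegrable_of_bdd hb hW
  have hqb : LocallyIntegrable fun z => q z * b z := by
    rw [← locallyIntegrableOn_univ] at hbl ⊢
    exact hbl.continuousOn_mul hq.continuousOn isOpen_univ.isLocallyClosed
  have hi1 := (h.tf.comp_sub x).integrable_mul hqb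
  have hi2 := (h.tf.comp_sub x).integrable_mul hbl
  have e : moll κ (fun z => q z * b z) x - q x * moll κ b x =
      ∫ z, κ (z - x) * ((q z - q x) * b z) := by
    unfold moll
    rw [← integral_const_mul, ← integral_sub hi1 (hi2.const_mul _)]
    congr 1
    funext z
    ring
  rw [e]
  refine (abs_integral_le_integral_abs).trans ?_
  have h3 : ∫ z, κ (z - x) * (A * r * W) = A * r * W := by
    rw [integral_mul_const, h.integral_comp_sub, one_mul]
  rw [← h3]
  refine integral_mono_of_nonneg (Eventually.of_forall fun _ => abs_nonneg _)
    ((h.tf.comp_sub x).integrable.mul_const _) ?_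
  filter_upwards [hW] with z hz
  rw [abs_mul, abs_of_nonneg (h.nonneg _)]
  by_cases hzr : ‖z - x‖ ≤ r
  · refine mul_le_mul_of_nonneg_left ?_ (h.nonneg _)
    rw [abs_mul]
    exact mul_le_mul ((hL z).trans (mul_le_mul_of_nonneg_left hzr hA)) hz (abs_nonneg _)
      (mul_nonneg hA ((norm_nonneg _).trans hzr))
  · rw [h.supp _ (not_le.1 hzr)]
    simp

lemma WB.avg_mul {C : ℝ} (hq : WB m C q) {α : Fin d → ℕ} {v : Eu d → ℝ} (hv : WB 2 W v)
    (hα : order α ≤ 2) : Avg κ x (fun z => q z * weakDeriv α v z)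
      (moll κ (fun z => q z * weakDeriv α v z) x) := by
  obtain ⟨w, hw, -⟩ := hv.weak α hα
  refine ⟨?_, rfl⟩
  rw [← locallyIntegrableOn_univ]
  exact (locallyIntegrableOn_univ.2 (weakDeriv_spec ⟨w, hw⟩).2.1).continuousOn_mul
    hq.continuous.continuousOn isOpen_univ.isLocallyClosed

lemma WB.weakDeriv_spec {v : Eu d → ℝ} (hv : WB m W v) {α : Fin d → ℕ} (hα : order α ≤ m) :
    IsWeakDeriv α v (weakDeriv α v) ∧ ∀ᵐ z, |weakDeriv α v z| ≤ W := by
  obtain ⟨w, hw, hb⟩ := hv.weak α hα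
  refine ⟨Richardson.weakDeriv_spec ⟨w, hw⟩, ?_⟩
  filter_upwards [hw.weakDeriv_ae, hb] with z h1 h2
  rwa [h1]

/-- The generalized derivative is an arbitrary representative at each time, so measurability in `s`
is not evident. With `q` mollified, the derivative can be moved onto the smooth factor, leaving an
integral of the measurable `w`; then the mollification of `q` is removed. -/
lemma measurable_moll_mul_weakDeriv (hT : 0 ≤ T) (hκ : Ker κ r) (x : Eu d)
    {q w : ℝ → Eu d → ℝ} (hq : InB T m q) (hw : InB T 2 w) {α : Fin d → ℕ}
    (hα : order α ≤ 2) : Measurable fun s =>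
      moll κ (fun z => q (clamp T s) z * weakDeriv α (w (clamp T s)) z) x := by
  have hlim : ∀ s, Tendsto (fun n => moll κ (fun z => moll (kerSeq d n) (q (clamp T s)) z *
      weakDeriv α (w (clamp T s)) z) x) atTop
      (𝓝 (moll κ (fun z => q (clamp T s) z * weakDeriv α (w (clamp T s)) z) x)) := by
    intro s
    have hs := clamp_mem hT s
    have hq' := hq.wb hs
    have hD := (hw.wb hs).weakDeriv_spec hα
    refine tendsto_integral_of_dominated_convergence (fun z => κ (z - x) *
      (normB T m q * normB T 2 w)) (fun n => ?_) ((hκ.tf.comp_sub x).integrable.mul_const _)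
      (fun n => ?_) (Eventually.of_forall fun z => ?_)
    · exact (hκ.tf.comp_sub x).smooth.continuous.aestronglyMeasurable.mul
        ((hq'.smooth_moll (ker_kerSeq d n)).continuous.aestronglyMeasurable.mul
          hD.1.2.1.aestronglyMeasurable)
    · filter_upwards [hD.2] with z hz
      rw [Real.norm_eq_abs, abs_mul, abs_of_nonneg (hκ.nonneg _), abs_mul]
      exact mul_le_mul_of_nonneg_left (mul_le_mul ((hq'.bd_moll (ker_kerSeq d n)).abs_le z) hz
        (abs_nonneg _) hq'.nonneg) (hκ.nonneg _)
    · exact ((tendsto_moll_kerSeq hq'.continuous z).mul_const _).const_mul _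
  refine measurable_of_tendsto_metrizable (fun n => ?_) (tendsto_pi_nhds.2 hlim)
  set η : ℝ → Eu d → ℝ := fun s z => κ (z - x) * moll (kerSeq d n) (q (clamp T s)) z with hη
  have hsb : SB η := (SB.const (hκ.tf.comp_sub x).smb).mul (hq.sb_moll hT (ker_kerSeq d n).tf)
  have e : (fun s => moll κ (fun z => moll (kerSeq d n) (q (clamp T s)) z *
      weakDeriv α (w (clamp T s)) z) x) = fun s => (-1) ^ order α *
        ∫ z, w (clamp T s) z * pdl (idx α) (η s) z := by
    funext s
    have hs := clamp_mem hT s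
    have hD := (hw.wb hs).weakDeriv_spec hα
    have hη' : TF (η s) := (hκ.tf.comp_sub x).mul ((hq.wb hs).smooth_moll (ker_kerSeq d n))
    have h1 := hD.1.2.2 (η s) hη'.smooth hη'.supp
    rw [← mderiv_eq_pdl, h1, ← mul_assoc, ← pow_add, Even.neg_one_pow ⟨_, rfl⟩, one_mul]
    unfold moll
    congr 1
    funext z
    simp only [hη]
    unfold moll
    ring
  rw [e]
  refine Measurable.const_mul ?_ _
  exact ((hw.measurable_clamp hT).mul
    (hsb.pdl (idx α)).measurable_uncurry).stronglyMeasurable.integral_prod_right.measurable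

end Commutator

/-! ### Consistency of mollified solutions of the limiting equation. -/

section Uniqueness
open Filter Topology
variable {d : ℕ} {P : Prm} {h₀ T h t W r : ℝ} {co : Coeffs d} {τ : Eu d → ℝ} {f : ℝ → Eu d → ℝ}
  {g : Eu d → ℝ} {v w : ℝ → Eu d → ℝ} {κ φ : Eu d → ℝ}

namespace Problem

/-- The mollified right-hand side of the limiting equation. -/
lemma avg_rhs (hP : Problem P h₀ T co τ f g) (hκ : Ker κ r) (ht : t ∈ Icc 0 T)
    (hφ : WB 2 W φ) (x : Eu d) : Avg κ x (fun z => co.calL t φ z + f t z)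
      (1 / 2 * ∑ l ∈ co.Λ₁, ∑ i, ∑ j, l i * l j *
        moll κ (fun z => co.q l t z * weakDeriv (Pi.single i 1 + Pi.single j 1) φ z) x +
      ∑ l ∈ co.Λ₁, ∑ i, l i * moll κ (fun z => co.p l t z * weakDeriv (Pi.single i 1) φ z) x +
      -1 * moll κ (fun z => co.c t z * φ z) x + moll κ (f t) x) := by
  have e : (fun z => co.calL t φ z + f t z) = fun z => 1 / 2 * ∑ l ∈ co.Λ₁, ∑ i, ∑ j, l i * l j *
        (co.q l t z * weakDeriv (Pi.single i 1 + Pi.single j 1) φ z) +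
      ∑ l ∈ co.Λ₁, ∑ i, l i * (co.p l t z * weakDeriv (Pi.single i 1) φ z) +
      -1 * (co.c t z * φ z) + f t z := by
    funext z
    unfold Coeffs.calL
    rw [sub_eq_add_neg, neg_one_mul]
    refine congrArg₂ (· + ·) (congrArg₂ (· + ·) (congrArg₂ (· + ·)
      (congrArg (1 / 2 * ·) ?_) ?_) rfl) rfl
    · exact Finset.sum_congr rfl fun l _ => Finset.sum_congr rfl fun i _ =>
        Finset.sum_congr rfl fun j _ => by ring
    · exact Finset.sum_congr rfl fun l _ => Finset.sum_congr rfl fun i _ => by ring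
  rw [e]
  refine hκ.avg_add (hκ.avg_add (hκ.avg_add ((hκ.avg_sum _ fun l hl => hκ.avg_sum _ fun i _ =>
    hκ.avg_sum _ fun j _ => Avg.const_mul ?_ _).const_mul _)
    (hκ.avg_sum _ fun l hl => hκ.avg_sum _ fun i _ => Avg.const_mul ?_ _)) (Avg.const_mul ?_ _))
    ⟨(hP.wb_f ht).continuous.locallyIntegrable, rfl⟩
  · exact (hP.wb_q ht l hl).avg_mul hφ (order_pair i j).le
  · exact (hP.wb_p ht l hl).avg_mul hφ ((order_single i).le.trans one_le_two)
  · exact ⟨((hP.wb_c ht).continuous.mul hφ.continuous).locallyIntegrable, rfl⟩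

lemma measurable_rhs (hP : Problem P h₀ T co τ f g) (hκ : Ker κ r) (hw : InB T 2 w) (x : Eu d) :
    Measurable fun s => moll κ (fun z => co.calL (clamp T s) (w (clamp T s)) z +
      f (clamp T s) z) x := by
  simp_rw [fun s => (hP.avg_rhs hκ (clamp_mem hP.T_nonneg s)
    (hw.wb (clamp_mem hP.T_nonneg s)) x).eq]
  have hmul : ∀ {a : ℝ → Eu d → ℝ}, Measurable (Function.uncurry fun s => a (clamp T s)) →
      Measurable fun s => moll κ (a (clamp T s)) x := by
    intro a ha
    have : Measurable (Function.uncurry fun (s : ℝ) (z : Eu d) => κ (z - x) * a (clamp T s) z) :=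
      ((hκ.tf.smooth.continuous.measurable.comp (measurable_snd.sub_const x))).mul ha
    exact this.stronglyMeasurable.integral_prod_right.measurable
  refine (((Measurable.const_mul (Finset.measurable_sum _ fun l hl => Finset.measurable_sum _
    fun i _ => Finset.measurable_sum _ fun j _ => Measurable.const_mul ?_ _) _).add
    (Finset.measurable_sum _ fun l hl => Finset.measurable_sum _ fun i _ =>
      Measurable.const_mul ?_ _)).add (Measurable.const_mul ?_ _)).add ?_
  · exact measurable_moll_mul_weakDeriv hP.T_nonneg hκ x (hP.q l hl) hw
      (order_pair i j).le
  · exact measurable_moll_mul_weakDeriv hP.T_nonneg hκ x (hP.p l hl) hw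
      ((order_single i).le.trans one_le_two)
  · exact hmul (a := fun s z => co.c s z * w s z) ((hP.c.measurable_clamp hP.T_nonneg).mul
      (hw.measurable_clamp hP.T_nonneg))
  · exact hmul (hP.f.measurable_clamp hP.T_nonneg)

/-- The mollification of a solution solves the equation up to a small error. -/
lemma abs_rhs_sub_le (hP : Problem P h₀ T co τ f g) (hκ : Ker κ r) (ht : t ∈ Icc 0 T)
    (hφ : WB 2 W φ) (x : Eu d) :
    |moll κ (fun z => co.calL t φ z + f t z) x - (co.Lx 0 t (moll κ φ) x + f t x)| ≤
      (co.lxNorm * (d * co.size T P.m * W) +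
        d * (normB T P.m f + normB T P.m fun _ => g)) * r := by
  set A := co.size T P.m with hA
  have hA0 : 0 ≤ A := hP.le_size.1
  have hW : 0 ≤ W := hφ.nonneg
  have hr : 0 ≤ r := by
    by_contra hr
    have h0 : ∀ y, κ y = 0 := fun y => hκ.supp y ((not_le.1 hr).trans_le (norm_nonneg y))
    have := hκ.integral
    simp [h0] at this
  -- The commutator of multiplication and mollification is of order `r`: the coefficients are
  -- Lipschitz and the derivatives of `φ` up to order two are bounded.
  have hcom : ∀ {q : Eu d → ℝ}, WB P.m A q → ∀ {b : Eu d → ℝ}, AEStronglyMeasurable b →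
      (∀ᵐ z, |b z| ≤ W) →
      |moll κ (fun z => q z * b z) x - q x * moll κ b x| ≤ d * A * r * W := fun hq b hb hbW =>
    hκ.abs_moll_mul_sub_le hq.continuous (fun y => hq.lipschitz hP.one_le_m x y)
      (by positivity) hb hbW
  have h2 : ∀ i j, pdl [i, j] (moll κ φ) =
      moll κ (weakDeriv (Pi.single i 1 + Pi.single j 1) φ) := fun i j =>
    hκ.tf.pdl_moll_weak (hφ.weakDeriv_spec (order_pair i j).le).1 (idx_pair_perm i j)
  have h1 : ∀ i, pdl [i] (moll κ φ) = moll κ (weakDeriv (Pi.single i 1) φ) := fun i =>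
    hκ.tf.pdl_moll_weak (hφ.weakDeriv_spec ((order_single i).le.trans one_le_two)).1
      (by rw [idx_single])
  rw [(hP.avg_rhs hκ ht hφ x).eq, Lx_zero_eq (smooth_pd_differentiable (hφ.smooth_moll hκ))]
  simp_rw [h1, h2]
  set X := d * A * r * W with hX
  have hX0 : 0 ≤ X := by positivity
  have e1 : |∑ l ∈ co.Λ₁, ∑ i, ∑ j, l i * l j *
        moll κ (fun z => co.q l t z * weakDeriv (Pi.single i 1 + Pi.single j 1) φ z) x -
      ∑ l ∈ co.Λ₁, ∑ i, ∑ j, l i * l j * (co.q l t x *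
        moll κ (weakDeriv (Pi.single i 1 + Pi.single j 1) φ) x)| ≤
      ∑ l ∈ co.Λ₁, (d * ‖l‖) ^ 2 * X := by
    simp_rw [← Finset.sum_sub_distrib, ← mul_sub]
    refine (Finset.abs_sum_le_sum_abs _ _).trans (Finset.sum_le_sum fun l hl => ?_)
    refine (Finset.abs_sum_le_sum_abs _ _).trans ((Finset.sum_le_sum fun i _ =>
      (Finset.abs_sum_le_sum_abs _ _).trans (Finset.sum_le_sum fun j _ =>
        show _ ≤ ‖l‖ * ‖l‖ * X from ?_)).trans_eq ?_)
    · rw [abs_mul, abs_mul]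
      have h3 := abs_coord_le l i
      have h4 := abs_coord_le l j
      have h5 := hφ.weakDeriv_spec (order_pair i j).le
      have h6 := hcom (hP.wb_q ht l hl) h5.1.2.1.aestronglyMeasurable h5.2
      gcongr
    · simp only [Finset.sum_const, Finset.card_univ, Fintype.card_fin, nsmul_eq_mul]
      ring
  have e2 : |∑ l ∈ co.Λ₁, ∑ i, l i *
        moll κ (fun z => co.p l t z * weakDeriv (Pi.single i 1) φ z) x -
      ∑ l ∈ co.Λ₁, ∑ i, l i * (co.p l t x * moll κ (weakDeriv (Pi.single i 1) φ) x)| ≤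
      ∑ l ∈ co.Λ₁, d * ‖l‖ * X := by
    simp_rw [← Finset.sum_sub_distrib, ← mul_sub]
    refine (Finset.abs_sum_le_sum_abs _ _).trans (Finset.sum_le_sum fun l hl => ?_)
    refine (Finset.abs_sum_le_sum_abs _ _).trans ((Finset.sum_le_sum fun i _ =>
        show _ ≤ ‖l‖ * X from ?_).trans_eq ?_)
    · rw [abs_mul]
      have h3 := abs_coord_le l i
      have h5 := hφ.weakDeriv_spec ((order_single i).le.trans one_le_two)
      have h6 := hcom (hP.wb_p ht l hl) h5.1.2.1.aestronglyMeasurable h5.2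
      gcongr
    · simp only [Finset.sum_const, Finset.card_univ, Fintype.card_fin, nsmul_eq_mul]
      ring
  have e3 := hcom (hP.wb_c ht) hφ.continuous.aestronglyMeasurable
    (Eventually.of_forall (hφ.abs_le one_le_two))
  have e4 : |moll κ (f t) x - f t x| ≤ _ := (hP.wb_f ht).abs_moll_sub_le hP.one_le_m hκ x
  have e5 : ∑ l ∈ co.Λ₁, co.q l t x * (1 / 2 * ∑ i, ∑ j, l i * l j *
      moll κ (weakDeriv (Pi.single i 1 + Pi.single j 1) φ) x) =
      1 / 2 * ∑ l ∈ co.Λ₁, ∑ i, ∑ j, l i * l j * (co.q l t x *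
        moll κ (weakDeriv (Pi.single i 1 + Pi.single j 1) φ) x) := by
    simp_rw [Finset.mul_sum]
    exact Finset.sum_congr rfl fun l _ => Finset.sum_congr rfl fun i _ =>
      Finset.sum_congr rfl fun j _ => by ring
  have e6 : ∑ l ∈ co.Λ₁, co.p l t x * ∑ i, l i * moll κ (weakDeriv (Pi.single i 1) φ) x =
      ∑ l ∈ co.Λ₁, ∑ i, l i * (co.p l t x * moll κ (weakDeriv (Pi.single i 1) φ) x) := by
    simp_rw [Finset.mul_sum]
    exact Finset.sum_congr rfl fun l _ => Finset.sum_congr rfl fun i _ => by ring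
  have e7 : co.lxNorm * (d * A * W) * r =
      ∑ l ∈ co.Λ₁, (d * ‖l‖) ^ 2 * X + ∑ l ∈ co.Λ₁, d * ‖l‖ * X + X := by
    unfold Coeffs.lxNorm
    rw [← Finset.sum_mul, ← Finset.sum_mul, Finset.sum_add_distrib, hX]
    ring
  have e8 : 0 ≤ ∑ l ∈ co.Λ₁, (d * ‖l‖) ^ 2 * X := Finset.sum_nonneg fun _ _ => by positivity
  rw [e5, e6, add_mul, e7]
  rw [abs_le] at *
  constructor <;> linarith [e1.1, e1.2, e2.1, e2.2, e3.1, e3.2, e4.1, e4.2]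

end Problem
end Uniqueness
end Richardson

namespace Richardson

/-! ### Uniqueness for the limiting equation. -/

section Uniqueness
open Filter Topology
variable {d : ℕ} {P : Prm} {h₀ T t : ℝ} {co : Coeffs d} {τ : Eu d → ℝ} {f : ℝ → Eu d → ℝ}
  {g : Eu d → ℝ} {v w : ℝ → Eu d → ℝ}

/-- No maximum principle for the degenerate equation is used. A mollification of `w` is compared
with the scheme's solution `u_h` by the stability of the scheme, and `u_h` with `v` by hypothesis;
first `h → 0`, then the kernel shrinks. -/
theorem Problem.pdeSol_unique (hP : Problem P h₀ T co τ f g) {R : ℝ}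
    (hv : ∀ h ∈ Ioc 0 h₀, ∀ u, IsSchemeSol co T h f g u → ∀ t ∈ Icc 0 T, ∀ x,
      |u t x - v t x| ≤ R * h) (hw : IsPDESol co T f g w) (ht : t ∈ Icc 0 T) : w t = v t := by
  obtain ⟨Nr, hNr, Hrem⟩ := hP.exists_remainder
  set F := normB T P.m f + normB T P.m fun _ => g with hF
  have hF0 : 0 ≤ F := hP.normB_nonneg
  have hc₀ := hP.c₀_pos
  have hwb := fun s (hs : s ∈ Icc 0 T) => hw.inB.wb hs
  set K := co.lxNorm * (d * co.size T P.m * normB T 2 w) + d * F with hK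
  have hK0 : 0 ≤ K := by
    have h1 := (hwb 0 hP.zero_mem).nonneg
    have h2 := hP.le_size.1
    have h3 := lxNorm_pos (co := co)
    positivity
  have key : ∀ (i : ℕ) (x : Eu d), |moll (kerSeq d i) (w t) x - v t x| ≤
      (d * F + K / P.c₀) * (1 / ((i : ℝ) + 1)) := by
    intro i x
    set κ := kerSeq d i
    have hκ := ker_kerSeq d i
    set ε : ℝ := 1 / ((i : ℝ) + 1)
    have hε : 0 ≤ ε := by positivity
    set U : ℝ → Eu d → ℝ := fun s => moll κ (w (clamp T s)) with hU
    have hUsb : SB U := hw.inB.sb_moll hP.T_nonneg hκ.tf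
    -- Third derivatives of the mollification are bounded, but `C` depends on the kernel since `w`
    -- has only two. It enters only multiplied by `h`.
    obtain ⟨C, hC⟩ := hUsb.usmooth.bdd 3
    have hC0 := (hC 0).nonneg
    set G : ℝ → Eu d → ℝ := fun s => moll κ fun z => co.calL s (w s) z + f s z with hG
    have hGd : ∀ s ∈ Icc 0 T, ∀ x, |G s x - (co.Lx 0 s (U s) x + f s x)| ≤ K * ε := by
      intro s hs x
      have := hP.abs_rhs_sub_le hκ hs (hwb s hs) x
      simpa only [hU, hG, clamp_eq hs] using this
    have hGb : ∀ s ∈ Icc 0 T, ∀ x, |G s x| ≤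
        K * ε + (co.size T P.m * (co.lxNorm * C) + F) := by
      intro s hs x
      have h1 := hP.abs_Lx_le hs (smooth_pd_differentiable (hUsb.usmooth.smooth s))
        ((hC s).mono (by omega) le_rfl) x
      have h2 := (hP.wb_f hs).abs_le hP.one_le_m x
      have h3 := abs_add_le (G s x - (co.Lx 0 s (U s) x + f s x)) (co.Lx 0 s (U s) x + f s x)
      rw [sub_add_cancel] at h3
      exact h3.trans (add_le_add (hGd s hs x) ((abs_add_le _ _).trans (add_le_add h1 h2)))
    have hGi : ∀ x, ∀ s ∈ Icc 0 T, IntervalIntegrable (fun r => G r x) volume 0 s :=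
      fun x s hs => intervalIntegrable_of_clamp (hP.measurable_rhs hκ hw.inB x)
        (fun r hr => hGb r hr x) hs
    have hUeq : ∀ s ∈ Icc 0 T, ∀ x, U s x = moll κ g x + ∫ r in 0..s, G r x := by
      intro s hs x
      -- Testing with `κ(· - x)` turns the equation in the sense of generalized functions into a
      -- pointwise one for the mollification.
      have := hw.eqn s hs (fun z => κ (z - x)) (hκ.tf.comp_sub x).smooth (hκ.tf.comp_sub x).supp
      simp only [hU, clamp_eq hs]
      exact this
    have hstep : ∀ h ∈ Ioc 0 h₀, |U t x - v t x| ≤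
        d * F * ε + (K * ε + Nr * h * C) / P.c₀ + R * h := by
      intro h hh
      obtain ⟨u, hu, -⟩ := hP.exists_schemeSol hh
      obtain ⟨B, hB⟩ := hu.bounded
      have hh0 := hh.1
      refine (abs_sub_le _ (u t x) _).trans (add_le_add ?_ (hv h hh u hu t ht x))
      refine (hP.stable hh).bound hc₀ hh.1 (w := fun s x => U s x - u s x)
        (e := fun s x => G s x - co.Lh h s (U s) x - f s x) (w₀ := fun x => moll κ g x - g x)
        hP.T_nonneg (A := C + B) ?_ ?_ ?_ ?_ ?_ t ht x
      · exact fun s hs x => (abs_sub _ _).trans (add_le_add ((hC s).abs_le x) (hB s hs x))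
      · intro x
        refine ((hGi x T ⟨hP.T_nonneg, le_rfl⟩).sub
          (hP.schemeSol_intervalIntegrable hh hu x ⟨hP.T_nonneg, le_rfl⟩)).congr fun s _ => ?_
        rw [Lh_sub]
        ring
      · intro s hs x
        rw [hUeq s hs x, hu.eqn s hs x, add_sub_add_comm, ← intervalIntegral.integral_sub
          (hGi x s hs) (hP.schemeSol_intervalIntegrable hh hu x hs)]
        congr 1
        refine intervalIntegral.integral_congr fun r _ => ?_
        rw [Lh_sub]
        ring
      · intro x
        refine (hP.abs_moll_g_sub_le i x).trans (le_add_of_nonneg_right ?_)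
        positivity
      · intro s hs x
        have h1 := hGd s hs x
        have h2 := Hrem h hh.1 s hs (U s) C (hUsb.usmooth.smooth s) (hC s) x
        rw [abs_sub_comm] at h2
        have e1 : G s x - co.Lh h s (U s) x - f s x = G s x - (co.Lx 0 s (U s) x + f s x) +
          (co.Lx 0 s (U s) x - co.Lh h s (U s) x) := by ring
        rw [e1]
        refine (abs_add_le _ _).trans ((add_le_add h1 h2).trans ?_)
        rw [mul_add, mul_div_cancel₀ _ hc₀.ne']
        refine le_add_of_nonneg_left ?_
        positivity
    have hlim : Tendsto (fun n : ℕ => d * F * ε + (K * ε + Nr * (h₀ / ((n : ℝ) + 1)) * C) / P.c₀ +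
        R * (h₀ / ((n : ℝ) + 1))) atTop
        (𝓝 (d * F * ε + (K * ε + Nr * 0 * C) / P.c₀ + R * 0)) := by
      have h4 : Tendsto (fun n : ℕ => h₀ / ((n : ℝ) + 1)) atTop (𝓝 0) := by
        simpa [div_eq_mul_inv] using tendsto_rate h₀
      exact (((((h4.const_mul Nr).mul_const C).const_add _).div_const _).const_add _).add
        (h4.const_mul R)
    -- The step tends to zero with the kernel fixed, leaving an error proportional to the kernel
    -- radius.
    have h5 := ge_of_tendsto' hlim fun n => hstep _ (hP.div_mem n)
    simp only [hU, clamp_eq ht] at h5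
    refine h5.trans_eq ?_
    ring
  funext x
  have h1 := tendsto_moll_kerSeq (hwb t ht).continuous x
  refine tendsto_nhds_unique h1 ?_
  rw [tendsto_iff_dist_tendsto_zero]
  refine squeeze_zero (fun _ => dist_nonneg) (fun i => ?_) (tendsto_rate (d * F + K / P.c₀))
  rw [Real.dist_eq]
  exact key i x

end Uniqueness

/-! ### Assembly of the corollary. -/

section Assembly
open Filter Topology
variable {d m k l : ℕ} {δ K τ₀ c₀ h₀ T L Lτ : ℝ} {M : Fin (m + 1) → ℝ} {co : Coeffs d}
  {τ : Eu d → ℝ} {f : ℝ → Eu d → ℝ} {g : Eu d → ℝ}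

lemma Coeffs.Admissible.problem (hA : co.Admissible τ τ₀ δ K c₀ h₀ T m M) (hm : 3 ≤ m)
    (hδ : δ ∈ Ioc (0 : ℝ) 1) (hK : 1 ≤ K) (hτ₀ : 0 < τ₀) (hc₀ : 0 < c₀) (hh₀ : 0 < h₀)
    (hT : 0 < T) (hL : Real.sqrt (∑ lam ∈ co.Λ₁, ‖lam‖ ^ 2) = L)
    (hLτ : Real.sqrt (∑ lam ∈ co.Λ₁, ‖τ lam • lam‖ ^ 2) = Lτ) (hf : InB T m f)
    (hg : InB T m fun _ => g) : Problem (prmOf δ K τ₀ c₀ L Lτ M) h₀ T co τ f g where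
  T_nonneg := hT.le
  m_le := hm
  h₀_pos := hh₀
  good κ r hκ := by
    rw [← hL, ← hLτ]
    exact hA.good hm hδ hK hτ₀ hc₀ hT.le hκ
  q l hl := (hA.smooth.1 l hl).1
  p l hl := (hA.smooth.1 l hl).2
  c := hA.smooth.2.1
  f := hf
  g := hg

lemma sCase_of_cases {κ : Eu d → ℝ} (hT : 0 ≤ T)
    (h : CaseI m k l ∨ CaseII co T m k l ∨ CaseIII co T m k l) :
    (co.mollify T κ).SCase m k l := by
  rcases h with h | h | h
  · exact Or.inl h
  · exact Or.inr (Or.inl ⟨h.1, h.2.mollify hT⟩)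
  · exact Or.inr (Or.inr ⟨h.1, h.2.1, h.2.2.1.mollify hT, h.2.2.2.mollify hT⟩)

/-- Only finitely many pairs `(k, l)` are possible for a given `m`, so one constant can be fixed in
advance for all of them. -/
lemma bounds_of_cases (h : CaseI m k l ∨ CaseII co T m k l ∨ CaseIII co T m k l) :
    k ≤ m ∧ l + 1 ≤ m := by
  rcases h with h | h | h
  · unfold CaseI at h; omega
  · have := h.1; omega
  · have := h.2.1; omega

end Assembly
end Richardson

theorem corollary10p25p11p08 (d m : ℕ) (hm : 3 ≤ m) (δ K τ₀ c₀ : ℝ)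
    (hδ : δ ∈ Set.Ioc (0 : ℝ) 1) (hK : 1 ≤ K) (hτ₀ : 0 < τ₀) (hc₀ : 0 < c₀)
    (normΛ normτΛ : ℝ) (M : Fin (m + 1) → ℝ) :
    ∃ N : ℝ, ∀ (h₀ T : ℝ), 0 < h₀ → 0 < T →
      ∀ (co : Richardson.Coeffs d) (τ : Richardson.Eu d → ℝ),
        Real.sqrt (∑ lam ∈ co.Λ₁, ‖lam‖ ^ 2) = normΛ →
        Real.sqrt (∑ lam ∈ co.Λ₁, ‖τ lam • lam‖ ^ 2) = normτΛ →
        co.Admissible τ τ₀ δ K c₀ h₀ T m M →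
      ∀ (f : ℝ → Richardson.Eu d → ℝ) (g : Richardson.Eu d → ℝ),
        Richardson.InB T m f → Richardson.InB T m (fun _ => g) →
      -- the scheme and the limiting equation are uniquely solvable
      (∀ h ∈ Set.Ioc 0 h₀, ∃ v, Richardson.IsSchemeSol co T h f g v ∧
        ∀ w, Richardson.IsSchemeSol co T h f g w → ∀ t ∈ Set.Icc 0 T, w t = v t) ∧
      (∃ v, Richardson.IsPDESol co T f g v ∧
        ∀ w, Richardson.IsPDESol co T f g w → ∀ t ∈ Set.Icc 0 T, w t = v t) ∧
      -- and the Richardson combinations of the solutions satisfy the estimates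
      ∀ (u : ℝ → ℝ → Richardson.Eu d → ℝ) (u0 : ℝ → Richardson.Eu d → ℝ),
        (∀ h ∈ Set.Ioc 0 h₀, Richardson.IsSchemeSol co T h f g (u h)) →
        Richardson.IsPDESol co T f g u0 →
      ∀ k l : ℕ,
        (Richardson.CaseI m k l ∨ Richardson.CaseII co T m k l ∨
          Richardson.CaseIII co T m k l) →
        (∀ t ∈ Set.Icc 0 T, ContDiff ℝ l (u0 t) ∧
          ∀ h ∈ Set.Ioc 0 h₀, ContDiff ℝ l (u h t)) ∧
        ∀ α : Fin d → ℕ, Richardson.order α ≤ l → ∀ h ∈ Set.Ioc 0 h₀,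
          (∀ t ∈ Set.Icc 0 T, ∀ x,
            |Richardson.mderiv α (Richardson.ubar k u h t) x - Richardson.mderiv α (u0 t) x|
              ≤ N * h ^ (k + 1)
                * (Richardson.normB T m f + Richardson.normB T m (fun _ => g))) ∧
          (Richardson.CaseIII co T m k l → ∀ t ∈ Set.Icc 0 T, ∀ x,
            |Richardson.mderiv α (Richardson.utilde k u h t) x - Richardson.mderiv α (u0 t) x|
              ≤ N * h ^ (k + 1)
                * (Richardson.normB T m f + Richardson.normB T m (fun _ => g))) := by
  have hex : ∀ k l : ℕ, ∃ N : ℝ, 0 ≤ N ∧ (l + 1 ≤ m → _) := fun k l => by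
    by_cases hl : l + 1 ≤ m
    · obtain ⟨N, hN, H⟩ := Richardson.Problem.estimate
        (Richardson.prmOf δ K τ₀ c₀ normΛ normτΛ M) d k l hl
      exact ⟨N, hN, fun _ => H⟩
    -- A default value for pairs that no case allows.
    · exact ⟨0, le_rfl, fun h => absurd h hl⟩
  choose N hN H using hex
  -- The constants are nonnegative, so their sum over all `k, l ≤ m` dominates each of them.
  refine ⟨∑ p ∈ Finset.range (m + 1) ×ˢ Finset.range (m + 1), N p.1 p.2,
    fun h₀ T hh₀ hT co τ hL hLτ hA f g hf hg => ?_⟩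
  have hP := hA.problem hm hδ hK hτ₀ hc₀ hh₀ hT hL hLτ hf hg
  obtain ⟨v, hv, R, hR⟩ := hP.exists_limit
  refine ⟨fun h hh => ?_, ⟨v, hP.isPDESol hv, fun w hw t ht => hP.pdeSol_unique hR hw ht⟩,
    fun u u0 hu hu0 k l hcase => ?_⟩
  · obtain ⟨u, hu, -⟩ := hP.exists_schemeSol hh
    exact ⟨u, hu, fun w hw t ht => hP.schemeSol_unique hh hu hw ht⟩
  · obtain ⟨hk, hl⟩ := Richardson.bounds_of_cases hcase
    have hle : N k l ≤ ∑ p ∈ Finset.range (m + 1) ×ˢ Finset.range (m + 1), N p.1 p.2 :=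
      Finset.single_le_sum (f := fun p : ℕ × ℕ => N p.1 p.2) (fun p _ => hN p.1 p.2)
        (a := (k, l)) (by simp; omega)
    have hmono : ∀ h ∈ Set.Ioc 0 h₀, N k l * h ^ (k + 1) *
        (Richardson.normB T m f + Richardson.normB T m fun _ => g) ≤
        (∑ p ∈ Finset.range (m + 1) ×ˢ Finset.range (m + 1), N p.1 p.2) * h ^ (k + 1) *
        (Richardson.normB T m f + Richardson.normB T m fun _ => g) := fun h hh =>
      mul_le_mul_of_nonneg_right (mul_le_mul_of_nonneg_right hle (pow_nonneg hh.1.le _))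
        hP.normB_nonneg
    have key := H k l hl h₀ T co τ f g u v hP hu hv
      fun j => Richardson.sCase_of_cases hT.le hcase
    refine ⟨fun t ht => ⟨?_, fun h hh => ?_⟩, fun α hα h hh =>
      ⟨fun t ht x => ?_, fun h3 t ht x => ?_⟩⟩
    · obtain ⟨J, ρ, -, hρ, hv'⟩ := hv
      rw [hP.pdeSol_unique hR hu0 ht]
      exact (hP.limit_derivs hρ hv' ht hl).1
    · simpa using (hP.comb_limit (ι := Unit) (fun _ => 1) (fun _ => h) (fun _ => hh) hu ht hl).1
    · rw [hP.pdeSol_unique hR hu0 ht, Richardson.mderiv_eq_pdl, Richardson.mderiv_eq_pdl]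
      exact ((key _ (by rwa [Richardson.length_idx]) h hh t ht x).1).trans (hmono h hh)
    · rw [hP.pdeSol_unique hR hu0 ht, Richardson.mderiv_eq_pdl, Richardson.mderiv_eq_pdl]
      exact ((key _ (by rwa [Richardson.length_idx]) h hh t ht x).2 fun j =>
        ⟨h3.1, h3.2.1, h3.2.2.1.mollify hT.le, h3.2.2.2.mollify hT.le⟩).trans (hmono h hh)
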